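/- Let $(\xi_k,\eta_k)_{k\ge 1}$ be i.i.d. random vectors in $\mathbb R^2$ ($\xi_k$ and $\eta_k$ may be dependent) with $\mathbb P[\xi_1=0]<1$, and put $S_n=\sum_{k\le n}\xi_k$, $C_n=\sum_{k\le n}\eta_k$. Assume that $(S_n,C_n)$ and $(-S_n,C_n)$ have the same law for every $n$. Let $\mathcal T=\min\{n>0: S_n>0\}$, let $\phi_{\eta_1}(s)=\mathbb E[e^{is\eta_1}]$, and let $$\Phi(z,s)=\exp\Big(\tfrac12\sum_{n\ge1}\tfrac{z^n}{n}\,\mathbb E\big[e^{isC_n};\,S_n=0\big]\Big).$$ A random variable $X$ is in the domain of attraction of an $\alpha$-stable law ($0<\alpha\le 2$) if, for i.i.d. copies $X_i$ of $X$ and suitable $a_n>0$, $b_n\in\mathbb R$, $(X_1+\dots+X_n-b_n)/a_n$ converges in distribution to a non-degenerate $\alpha$-stable law. Then $\mathcal T<\infty$ almost surely, $\sum_n \mathbb P[S_n=0]/n<\infty$, and $\Phi(1,0)$ is a positive real number. If $\xi_1\in\mathbb Z$ a.s., then $\Phi(1,0)=\exp\big(-\frac1{2\pi}\int_0^\pi\ln[1-\mathbb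 E e^{it\xi_1}]\,dt\big)$, with an integrable integrand; if $\xi_1$ has no atoms, then $\Phi(1,0)=1$. Moreover: **Domain of attraction.** Let $\eta_1$ be in the domain of attraction of a $\gamma$-stable law. If $0<\gamma<1$, then $C_{\mathcal T}$ is in the domain of attraction of a $\gamma/2$-stable law. If $\gamma=1$ and $(1-\phi_{\eta_1}(s))/|1-\phi_{\eta_1}(s)|$ has a limit as $s\to0^+$, then $C_{\mathcal T}$ is in the domain of attraction of a $1/2$-stable law. If $1<\gamma\le2$, then $\eta_1$ is integrable, and $C_{\mathcal T}$ is in the domain of attraction of a $1/2$-stable law if $\mathbb E\eta_1\ne0$, and of a $\gamma/2$-stable law if $\mathbb E\eta_1=0$. **Tails.** The following hold as $x\to+\infty$. (A) If $\phi_{\eta_1}(s)=1+i\nu s+o(s)$ as $s\to0^+$ with $\nu>0$, then $C_{\mathcal T}$ is in the domain of attraction of a $1/2$-stable law and $$\mathbb P[C_{\mathcal T}>x]\sim\sqrt{\tfrac{\nu}{\pi}}\,\Phi(1,0)\,x^{-1/2},\qquad \mathbb P[C_{\mathcal T}<-x]=o(x^{-1/2}).$$ If $\nu<0$, the same holds with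 the two tails exchanged and $\nu$ replaced by $|\nu|$. (B) If $\phi_{\eta_1}(s)=1-c_1s^\gamma+o(s^\gamma)$ as $s\to0^+$ with $\gamma\in(0,1]$, $c_1\in\mathbb C$, $\Re c_1>0$, then $C_{\mathcal T}$ is in the domain of attraction of a $\gamma/2$-stable law and $$\mathbb P[C_{\mathcal T}>x]\sim\frac{Cp_+}{\Gamma(1-\gamma/2)}x^{-\gamma/2},\qquad \mathbb P[C_{\mathcal T}<-x]\sim\frac{Cp_-}{\Gamma(1-\gamma/2)}x^{-\gamma/2},$$ where, with $\vartheta=\frac12\arctan(\Im c_1/\Re c_1)$, $$C=\frac{\Phi(1,0)}{\cos(\pi\gamma/4)}\big[(\Re c_1)^2+(\Im c_1)^2\big]^{1/4}\cos\vartheta,\qquad p_+=1-p_-=\frac12\Big(1-\frac{\sin\vartheta}{\cos\vartheta\,\tan(\pi\gamma/4)}\Big)\in[0,1];$$ if $p_\pm=0$ the corresponding relation is read as $o(x^{-\gamma/2})$. (C) If $\phi_{\eta_1}(s)=1+ic_2s\log(1/s)+o(s\log(1/s))$ as $s\to0^+$ with $c_2>0$, then $C_{\mathcal T}$ is in the domain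 of attraction of a $1/2$-stable law and $$\mathbb P[C_{\mathcal T}>x]\sim\sqrt{\tfrac{c_2\log x}{\pi}}\,\Phi(1,0)\,x^{-1/2},\qquad \mathbb P[C_{\mathcal T}<-x]=o\big(\sqrt{\log x}\;x^{-1/2}\big).$$ If $c_2<0$, the same holds with the two tails exchanged and $c_2$ replaced by $|c_2|$. (D) If $\phi_{\eta_1}(s)=1-c_3s^\gamma+o(s^\gamma)$ as $s\to0^+$ with $\gamma\in(1,2]$ and $c_3>0$, then $C_{\mathcal T}$ is in the domain of attraction of a $\gamma/2$-stable law and $$\mathbb P[C_{\mathcal T}>x]\sim\mathbb P[C_{\mathcal T}<-x]\sim\begin{cases}\dfrac{\Phi(1,0)\sqrt{c_3}}{2\cos(\pi\gamma/4)\,\Gamma(1-\gamma/2)}\,x^{-\gamma/2},&\gamma\in(1,2),\\[2mm]\dfrac{\Phi(1,0)\sqrt{c_3}}{\pi}\,x^{-1},&\gamma=2.\end{cases}$$ -/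

import Mathlib

open MeasureTheory ProbabilityTheory Filter Topology Asymptotics

namespace LadderCost

noncomputable section

/-- `ν` is a (non-degenerate) `α`-stable law on `ℝ`, `0 < α ≤ 2`: with scale `c > 0`, skewness
`β ∈ [-1, 1]` and location `δ`, its characteristic function is
`exp (i δ t - c |t|^α (1 - i β sgn(t) w))`, where `w = tan (π α / 2)` if `α ≠ 1` and
`w = -(2 / π) log |t|` if `α = 1`. -/
def IsStable (α : ℝ) (ν : Measure ℝ) : Prop :=
  0 < α ∧ α ≤ 2 ∧ ∃ c β δ : ℝ, 0 < c ∧ |β| ≤ 1 ∧ ∀ t : ℝ,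
    charFun ν t =
      Complex.exp (Complex.I * ((δ * t : ℝ) : ℂ)
        - ((c * |t| ^ α : ℝ) : ℂ) *
          (1 - Complex.I * ((β * SignType.sign t *
            (if α = 1 then -(2 / Real.pi) * Real.log |t|
              else Real.tan (Real.pi * α / 2)) : ℝ) : ℂ)))

/-- The random variable `X` on `(Ω, μ)` is in the domain (basin) of attraction of an `α`-stable
law: for i.i.d. copies `X_1, X_2, …` of `X` (realized on the product space `Ω^n`), suitable
scales `a n > 0` and centerings `b n`, the variables `(X_1 + ⋯ + X_n - b n) / a n` converge in
distribution to an `α`-stable law. -/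
def InDomainOfAttraction {Ω : Type*} [MeasurableSpace Ω] (μ : Measure Ω) [IsProbabilityMeasure μ]
    (X : Ω → ℝ) (α : ℝ) : Prop :=
  ∃ ν : ProbabilityMeasure ℝ, IsStable α (ν : Measure ℝ) ∧
    ∃ a b : ℕ → ℝ, (∀ n, 0 < a n) ∧
      TendstoInDistribution
        (fun (n : ℕ) (x : Fin n → Ω) => ((∑ i, X (x i)) - b n) / a n) atTop
        (id : ℝ → ℝ) (fun n => Measure.pi fun _ : Fin n => μ) (ν : Measure ℝ)

/-- Partial sums `X_1 + ⋯ + X_n` of a sequence; the increment `X_{k+1}` is `X k`. -/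
def partialSum {Ω : Type*} (X : ℕ → Ω → ℝ) (n : ℕ) (ω : Ω) : ℝ :=
  ∑ k ∈ Finset.range n, X k ω

/-- First-ladder time `min {n > 0 : S_n > 0}` of the walk with increments `ξ`
(with value `0` on the event that the walk never becomes positive). -/
def ladderTime {Ω : Type*} (ξ : ℕ → Ω → ℝ) (ω : Ω) : ℕ :=
  sInf {n : ℕ | 0 < n ∧ 0 < partialSum ξ n ω}

/-- First-ladder cost `C_T`: the cost process stopped at the first-ladder time. -/
def ladderCost {Ω : Type*} (ξ η : ℕ → Ω → ℝ) (ω : Ω) : ℝ :=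
  partialSum η (ladderTime ξ ω) ω

/-- `(S, C)` is symmetric under `S ↦ -S`: for every `n`, the pairs `(S_n, C_n)` and
`(-S_n, C_n)` have the same law. -/
def IsSymmetricPair {Ω : Type*} [MeasurableSpace Ω] (μ : Measure Ω) (ξ η : ℕ → Ω → ℝ) : Prop :=
  ∀ n : ℕ, μ.map (fun ω => (partialSum ξ n ω, partialSum η n ω)) =
    μ.map (fun ω => (-partialSum ξ n ω, partialSum η n ω))

/-- Joint characteristic function `φ(t, s) = E[exp (i (t X + s Y))]`. -/
def jointCharFun {Ω : Type*} [MeasurableSpace Ω] (μ : Measure Ω) (X Y : Ω → ℝ) (t s : ℝ) : ℂ :=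
  ∫ ω, Complex.exp (Complex.I * ((t * X ω + s * Y ω : ℝ) : ℂ)) ∂μ

/-- `Φ(z, s) = exp (½ ∑_{n ≥ 1} zⁿ / n · E[exp (i s C_n); S_n = 0])`, for a real-valued walk. -/
def Phi {Ω : Type*} [MeasurableSpace Ω] (μ : Measure Ω) (ξ η : ℕ → Ω → ℝ) (z s : ℝ) : ℂ :=
  Complex.exp ((1 / 2) * ∑' n : ℕ, ((z ^ (n + 1) / (n + 1) : ℝ) : ℂ) *
    ∫ ω in {ω | partialSum ξ (n + 1) ω = 0},
      Complex.exp (Complex.I * ((s * partialSum η (n + 1) ω : ℝ) : ℂ)) ∂μ)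

/-- The integral form `exp (-(1 / 2π) ∫_0^π log (1 - z φ(t, s)) dt)` of `Φ(z, s)`, relevant for
walks on `ℤ`. -/
def latticePhi {Ω : Type*} [MeasurableSpace Ω] (μ : Measure Ω) (ξ η : ℕ → Ω → ℝ) (z s : ℝ) : ℂ :=
  Complex.exp (-(1 / (2 * Real.pi)) *
    ∫ t in (0 : ℝ)..Real.pi, Complex.log (1 - z * jointCharFun μ (ξ 0) (η 0) t s))

/-- `x ↦ P[X > x]`. -/
def upperTail {Ω : Type*} [MeasurableSpace Ω] (μ : Measure Ω) (X : Ω → ℝ) (x : ℝ) : ℝ :=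
  μ.real {ω | x < X ω}

/-- `x ↦ P[X < -x]`. -/
def lowerTail {Ω : Type*} [MeasurableSpace Ω] (μ : Measure Ω) (X : Ω → ℝ) (x : ℝ) : ℝ :=
  μ.real {ω | X ω < -x}

/-- `f(x) ~ a g(x)` as `x → ∞`, read as `f(x) = o(g(x))` if `a = 0`. -/
def TailEquiv (f : ℝ → ℝ) (a : ℝ) (g : ℝ → ℝ) : Prop :=
  (a ≠ 0 → f ~[atTop] fun x => a * g x) ∧ (a = 0 → f =o[atTop] g)

/-- `½ arctan (Im c / Re c)`. -/
def halfAngle (c : ℂ) : ℝ := Real.arctan (c.im / c.re) / 2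

/-- The balance parameter `p₊` attached to `c` and `γ`. -/
def pPlus (c : ℂ) (γ : ℝ) : ℝ :=
  1 / 2 * (1 - Real.sin (halfAngle c) /
    (Real.cos (halfAngle c) * Real.tan (Real.pi * γ / 4)))

/-- The constant `κ / cos (πγ/4) · (Re(c)² + Im(c)²)^{1/4} · cos (½ arctan (Im c / Re c))`. -/
def tailConst (κ : ℝ) (c : ℂ) (γ : ℝ) : ℝ :=
  κ / Real.cos (Real.pi * γ / 4) * (c.re ^ 2 + c.im ^ 2) ^ (1 / 4 : ℝ) * Real.cos (halfAngle c)

end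

end LadderCost

/-! Write φ for the characteristic function of η₁. Everything rests on the identity 1 - E exp(i s
C_T) = Φ(1, s) (1 - φ(s))^{1/2}, which is `one_sub_charFun_ladderCost`.

It comes from a Wiener–Hopf argument for the planar walk (S, C). Let H be the generating function of
the Fourier transforms of the walk at its first entrance into x > 0, let G be that of the walk which
has not yet entered, and let L = 1 - H. Decomposing one step gives L = G (1 - zφ), with φ now the
joint transform. After taking logarithmic derivatives and splitting φ/(1 - zφ) according to the sign
of S, one side only involves measures on x > 0 and the other only measures on x ≤ 0. Injectivity of
the Fourier transform forces both sides to vanish, so L is the exponential of -∑ zⁿ/n E[exp(i s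
C_n); S_n > 0] (`succ_mul_ladderCoeff`, `one_sub_tsum_firstPos`). By symmetry the event S_n > 0
carries half of φⁿ minus the contribution of S_n = 0, and the series sums to the logarithm of a
square root times Φ. A Gaussian bound on the characteristic function near 0 gives P[S_n = 0] =
O(n^{-1/2}). Hence ∑ P[S_n = 0]/n converges, and z may tend to 1. At s = 0 the identity says that T
is almost surely finite.

Since Φ(1, s) tends to Φ(1, 0) > 0, the behaviour of the transform of C_T at 0+ is that of the
square root of 1 - φ. Two transfer results finish the proof. Regular variation of index at most one,
with a fixed phase, gives attraction to a stable law without centering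
(`inDomainOfAttraction_of_regVar`). Tails follow from a Tauberian theorem (`upperTail_of_charFun`):
rescaled laws multiplied by 1 - sinc become finite measures whose transforms converge. The limit is
identified as a tilted two-sided Lévy measure with weights p and q, and testing against ramps
recovers the tails.

For the attraction statements, regular variation of 1 - φ has to be extracted from the hypothesis on
η₁. Along n = 2^j the functions -2^j log φ(t/α_j) + i t D_j converge locally uniformly to a stable
exponent. Comparing consecutive scales gives α_j/α_{j+1} → 2^{-1/γ} and, for γ ≠ 1, a recursion for
the drift D_j with multiplier tending to 2^{1-1/γ}. For γ < 1 this contracts and the drift dies. For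
γ > 1 it expands, and mean zero singles out the solution tending to 0. For γ = 1 the limiting
multiplier would be one, and the assumed limit of the phase replaces the recursion. -/

namespace LadderCost

/-! ### Lévy continuity and domains of attraction through characteristic functions -/

/-- Lévy's continuity theorem, existence part. -/
theorem exists_charFun_eq_of_tendsto {P : ℕ → ProbabilityMeasure ℝ} {f : ℝ → ℂ}
    (hf : ContinuousAt f 0)
    (h : ∀ t, Tendsto (fun n => charFun (P n : Measure ℝ) t) atTop (𝓝 (f t))) :
    ∃ Q : ProbabilityMeasure ℝ, ∀ t, charFun (Q : Measure ℝ) t = f t := by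
  have htight : IsTightMeasureSet {((μ : ProbabilityMeasure ℝ) : Measure ℝ) | μ ∈ Set.range P} := by
    have := isTightMeasureSet_of_tendsto_charFun (μ := fun n => (P n : Measure ℝ)) hf h
    refine this.subset ?_
    rintro _ ⟨_, ⟨n, rfl⟩, rfl⟩
    exact ⟨n, rfl⟩
  have hcomp := isCompact_closure_of_isTightMeasureSet htight
  -- An ultrafilter finer than `atTop` replaces the extraction of a subsequence: compactness gives a
  -- limit law along it, and the pointwise limit f is unaffected.
  obtain ⟨Q, -, hQ : Tendsto _ _ _⟩ := hcomp.ultrafilter_le_nhds ((Ultrafilter.of atTop).map P)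
    (le_principal_iff.2 (mem_map.2 (Filter.univ_mem' fun n => subset_closure ⟨n, rfl⟩)))
  refine ⟨Q, fun t => ?_⟩
  have h1 : Tendsto (fun n => charFun (P n : Measure ℝ) t) (Ultrafilter.of (atTop : Filter ℕ))
      (𝓝 (charFun (Q : Measure ℝ) t)) := by
    have hQ' : Tendsto P (Ultrafilter.of (atTop : Filter ℕ)) (𝓝 Q) := hQ
    rw [ProbabilityMeasure.tendsto_iff_forall_integral_rclike_tendsto ℂ] at hQ'
    simp_rw [charFun_eq_integral_innerProbChar]
    exact hQ' _
  exact tendsto_nhds_unique h1 ((h t).mono_left (Ultrafilter.of_le _))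

variable {Ω : Type*} [MeasurableSpace Ω]

theorem charFun_map_normalized_sum (μ : Measure Ω) [IsProbabilityMeasure μ] {X : Ω → ℝ}
    (hX : Measurable X) (n : ℕ) (a b t : ℝ) :
    charFun ((Measure.pi fun _ : Fin n => μ).map (fun x => ((∑ i, X (x i)) - b) / a)) t =
      charFun (μ.map X) (t / a) ^ n * Complex.exp (-(Complex.I * (t * (b / a) : ℝ))) := by
  have h1 : charFun ((Measure.pi fun _ : Fin n => μ).map (fun x => ∑ i, X (x i))) =
      charFun (μ.map X) ^ n := by
    have hind : iIndepFun (fun (i : Fin n) (x : Fin n → Ω) => X (x i))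
        (Measure.pi fun _ : Fin n => μ) :=
      iIndepFun_pi (μ := fun _ : Fin n => μ) (X := fun _ => X) (fun _ => hX.aemeasurable)
    have hm : ∀ i : Fin n, AEMeasurable (fun x : Fin n → Ω => X (x i))
        (Measure.pi fun _ : Fin n => μ) := fun i => (hX.comp (measurable_pi_apply i)).aemeasurable
    rw [hind.charFun_map_fun_sum_eq_prod hm]
    have : ∀ i : Fin n, (Measure.pi fun _ : Fin n => μ).map (fun x => X (x i)) = μ.map X := by
      intro i
      have := (measurePreserving_eval (fun _ : Fin n => μ) i).map_eq
      conv_rhs => rw [← this, Measure.map_map hX (measurable_pi_apply i)]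
      rfl
    simp [this]
  have h2 : (Measure.pi fun _ : Fin n => μ).map (fun x => ((∑ i, X (x i)) - b) / a) =
      (((Measure.pi fun _ : Fin n => μ).map (fun x => ∑ i, X (x i))).map (fun y => a⁻¹ * y)).map
        (fun y => y + (-(b / a))) := by
    rw [Measure.map_map (by fun_prop) (by fun_prop), Measure.map_map (by fun_prop) (by fun_prop)]
    congr 1
    ext x
    simp only [Function.comp]
    ring
  rw [h2, charFun_map_add_const, charFun_map_mul, h1]
  simp only [Pi.pow_apply]
  congr 2
  · congr 1; ring
  · simp only [RCLike.inner_apply, conj_trivial]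
    push_cast
    ring

/-- Convergence in distribution is pointwise convergence of characteristic functions, and
independence turns the transform of a sum into a power. Attraction is only handled in this form
below. -/
theorem inDomainOfAttraction_iff (μ : Measure Ω) [IsProbabilityMeasure μ] {X : Ω → ℝ}
    (hX : Measurable X) (α : ℝ) :
    InDomainOfAttraction μ X α ↔ ∃ ν : ProbabilityMeasure ℝ, IsStable α (ν : Measure ℝ) ∧
      ∃ a b : ℕ → ℝ, (∀ n, 0 < a n) ∧ ∀ t, Tendsto
        (fun n => charFun (μ.map X) (t / a n) ^ n *
          Complex.exp (-(Complex.I * (t * (b n / a n) : ℝ)))) atTop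
        (𝓝 (charFun (ν : Measure ℝ) t)) := by
  have key : ∀ (ν : ProbabilityMeasure ℝ) (a b : ℕ → ℝ), TendstoInDistribution
        (fun (n : ℕ) (x : Fin n → Ω) => ((∑ i, X (x i)) - b n) / a n) atTop
        (id : ℝ → ℝ) (fun n => Measure.pi fun _ : Fin n => μ) (ν : Measure ℝ) ↔
        ∀ t, Tendsto (fun n => charFun (μ.map X) (t / a n) ^ n *
          Complex.exp (-(Complex.I * (t * (b n / a n) : ℝ)))) atTop
        (𝓝 (charFun (ν : Measure ℝ) t)) := by
    intro ν a b
    have hm : ∀ n, AEMeasurable (fun (x : Fin n → Ω) => ((∑ i, X (x i)) - b n) / a n)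
        (Measure.pi fun _ : Fin n => μ) := fun n => by
      have : ∀ i : Fin n, Measurable fun x : Fin n → Ω => X (x i) :=
        fun i => hX.comp (measurable_pi_apply i)
      exact (((Finset.measurable_sum _ fun i _ => this i).sub_const _).div_const _).aemeasurable
    have heq : (⟨(ν : Measure ℝ).map id, Measure.isProbabilityMeasure_map aemeasurable_id⟩ :
        ProbabilityMeasure ℝ) = ν := by
      ext1; simp
    let P : ℕ → ProbabilityMeasure ℝ := fun n => ⟨_, Measure.isProbabilityMeasure_map (hm n)⟩
    have hcf : ∀ t, (fun n => charFun (μ.map X) (t / a n) ^ n *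
          Complex.exp (-(Complex.I * (t * (b n / a n) : ℝ)))) = fun n =>
          charFun (P n : Measure ℝ) t := by
      intro t; ext n
      exact (charFun_map_normalized_sum μ hX n (a n) (b n) t).symm
    have hiff : Tendsto P atTop (𝓝 ν) ↔ ∀ t, Tendsto (fun n => charFun (P n : Measure ℝ) t)
      atTop (𝓝 (charFun (ν : Measure ℝ) t)) := ProbabilityMeasure.tendsto_iff_tendsto_charFun
    simp only [hcf]
    rw [← hiff]
    constructor
    · intro h
      have := h.tendsto
      rw [heq] at this
      exact this
    · intro h
      refine ⟨hm, aemeasurable_id, ?_⟩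
      rw [heq]
      exact h
  unfold InDomainOfAttraction
  simp only [key]

/-! ### Regular variation at 0+ and attraction to stable laws of index at most one -/

/-- `g` is regularly varying at `0+` with index `ρ`, with asymptotic phase `u`. -/
def RegVar (g : ℝ → ℂ) (ρ : ℝ) (u : ℂ) : Prop :=
  Tendsto (fun s => g s / (‖g s‖ : ℂ)) (𝓝[>] 0) (𝓝 u) ∧
    ∀ t : ℝ, 0 < t → Tendsto (fun s => ‖g (t * s)‖ / ‖g s‖) (𝓝[>] 0) (𝓝 (t ^ ρ))

/-- Division by zero gives 0, so the ratio condition at t = 1, whose limit is 1, already excludes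
zeros of g near 0+. -/
theorem RegVar.eventually_ne {g : ℝ → ℂ} {ρ : ℝ} {u : ℂ} (h : RegVar g ρ u) :
    ∀ᶠ s in 𝓝[>] 0, g s ≠ 0 := by
  have := h.2 1 one_pos
  simp only [Real.one_rpow] at this
  filter_upwards [this.eventually_ne one_ne_zero] with s hs h0
  simp [h0] at hs

theorem RegVar.norm_eq_one {g : ℝ → ℂ} {ρ : ℝ} {u : ℂ} (h : RegVar g ρ u) : ‖u‖ = 1 := by
  refine tendsto_nhds_unique h.1.norm (Tendsto.congr' ?_ tendsto_const_nhds)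
  filter_upwards [h.eventually_ne] with s hs
  simp [hs]

theorem tendsto_mul_nhdsGT_zero {t : ℝ} (ht : 0 < t) :
    Tendsto (fun s : ℝ => t * s) (𝓝[>] 0) (𝓝[>] 0) := by
  refine tendsto_nhdsWithin_iff.2 ⟨?_, ?_⟩
  · have : Tendsto (fun s : ℝ => t * s) (𝓝 0) (𝓝 (t * 0)) := (continuous_const_mul t).tendsto 0
    simpa using this.mono_left nhdsWithin_le_nhds
  · filter_upwards [self_mem_nhdsWithin] with s hs
    exact mul_pos ht hs

theorem regVar_of_tendsto_div {F : ℝ → ℂ} {g : ℝ → ℝ} {w : ℂ} {ρ : ℝ} (hw : w ≠ 0)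
    (hg : ∀ᶠ s in 𝓝[>] 0, 0 < g s) (hF : Tendsto (fun s => F s / (g s : ℂ)) (𝓝[>] 0) (𝓝 w))
    (hr : ∀ t : ℝ, 0 < t → Tendsto (fun s => g (t * s) / g s) (𝓝[>] 0) (𝓝 (t ^ ρ))) :
    RegVar F ρ (w / (‖w‖ : ℂ)) := by
  have hn : (‖w‖ : ℂ) ≠ 0 := by simpa using hw
  constructor
  · have hF' : Tendsto (fun s => ((‖F s / (g s : ℂ)‖ : ℝ) : ℂ)) (𝓝[>] 0) (𝓝 (‖w‖ : ℂ)) :=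
      (Complex.continuous_ofReal.tendsto _).comp hF.norm
    refine (hF.div hF' hn).congr' ?_
    filter_upwards [hg] with s hs
    have : (g s : ℂ) ≠ 0 := by exact_mod_cast hs.ne'
    simp only [Pi.div_apply]
    rw [norm_div, Complex.norm_real, Real.norm_of_nonneg hs.le]
    push_cast
    rw [div_div_div_cancel_right₀ this]
  · intro t ht
    have h1 := hF.norm
    have h2 := h1.comp (tendsto_mul_nhdsGT_zero ht)
    have h3 := (h2.div h1 (by simpa using hw)).mul (hr t ht)
    simp only [div_self (norm_ne_zero_iff.2 hw), one_mul] at h3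
    refine h3.congr' ?_
    filter_upwards [hg, (tendsto_mul_nhdsGT_zero ht).eventually hg] with s hs hts
    simp only [Function.comp, Pi.div_apply, norm_div, Complex.norm_real, Real.norm_of_nonneg hs.le,
      Real.norm_of_nonneg hts.le]
    field_simp

theorem RegVar.tendsto_div {g : ℝ → ℂ} {ρ : ℝ} {u : ℂ} (h : RegVar g ρ u) {t : ℝ} (ht : 0 < t) :
    Tendsto (fun s => g (t * s) / (‖g s‖ : ℂ)) (𝓝[>] 0) (𝓝 (u * (t ^ ρ : ℝ))) := by
  have h1 := h.1.comp (tendsto_mul_nhdsGT_zero ht)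
  have h2 := (Complex.continuous_ofReal.tendsto _).comp (h.2 t ht)
  refine (h1.mul h2).congr' ?_
  filter_upwards [(tendsto_mul_nhdsGT_zero ht).eventually h.eventually_ne] with s hs
  have : (‖g (t * s)‖ : ℂ) ≠ 0 := by simpa using hs
  simp only [Function.comp]
  push_cast
  field_simp

/-- A continuous function with `G 0 = 0` which does not vanish near `0+` takes the values `1 / n`
at points tending to zero. -/
theorem exists_seq_norm_eq_inv {G : ℝ → ℂ} (hG : Continuous G) (h0 : G 0 = 0)
    (hne : ∀ᶠ s in 𝓝[>] 0, G s ≠ 0) :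
    ∃ x : ℕ → ℝ, (∀ n, 0 < x n) ∧ Tendsto x atTop (𝓝[>] 0) ∧
      ∀ᶠ n : ℕ in atTop, ‖G (x n)‖ = 1 / n := by
  obtain ⟨δ, hδ, hδG⟩ := (mem_nhdsGT_iff_exists_Ioo_subset).1 hne
  have hδ : 0 < δ := hδ
  -- The value 1/n is attained on [0, δ/2] by the intermediate value theorem as soon as it is at
  -- most ‖G (δ/2)‖. The point δ/2 serves as default for the finitely many other n.
  have key : ∀ n : ℕ, ∃ x : ℝ, 0 < x ∧ x ≤ δ / 2 ∧ ((1 : ℝ) / n ≤ ‖G (δ / 2)‖ → 0 < n →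
      ‖G x‖ = 1 / n) := by
    intro n
    by_cases hc : (1 : ℝ) / n ≤ ‖G (δ / 2)‖ ∧ 0 < n
    · have hn : (0 : ℝ) < 1 / n := by have := hc.2; positivity
      obtain ⟨x, hx, hxe⟩ := intermediate_value_Icc (a := (0 : ℝ)) (b := δ / 2) (by positivity)
        (f := fun s => ‖G s‖) hG.norm.continuousOn
        (show (1 : ℝ) / n ∈ Set.Icc _ _ from ⟨by simp [h0], hc.1⟩)
      refine ⟨x, ?_, hx.2, fun _ _ => hxe⟩
      rcases hx.1.eq_or_lt with h | h
      · rw [← h] at hxe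
        simp only [h0, norm_zero] at hxe
        linarith
      · exact h
    · exact ⟨δ / 2, by positivity, le_rfl, fun h1 h2 => absurd ⟨h1, h2⟩ hc⟩
  choose x hx0 hxδ hx using key
  have hev : ∀ᶠ n : ℕ in atTop, ‖G (x n)‖ = 1 / n := by
    have hpos : 0 < ‖G (δ / 2)‖ := norm_pos_iff.2 (hδG ⟨by positivity, by linarith⟩)
    filter_upwards [tendsto_one_div_atTop_nhds_zero_nat.eventually (eventually_le_nhds hpos),
      eventually_gt_atTop 0] with n h1 h2 using hx n h1 h2
  refine ⟨x, hx0, tendsto_nhdsWithin_iff.2 ⟨?_, Eventually.of_forall fun n => hx0 n⟩, hev⟩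
  rw [Metric.tendsto_nhds]
  intro ε hε
  -- G is bounded away from 0 on [ε, δ/2], so a point with ‖G‖ = 1/n must lie below ε once n is
  -- large.
  have hmin : ∃ m > 0, ∀ s ∈ Set.Icc ε (δ / 2), m ≤ ‖G s‖ := by
    by_cases hεδ : ε ≤ δ / 2
    · obtain ⟨y, hy, hym⟩ := (isCompact_Icc (a := ε) (b := δ / 2)).exists_isMinOn
        ⟨ε, by constructor <;> linarith⟩ hG.norm.continuousOn
      refine ⟨‖G y‖, norm_pos_iff.2 (hδG ⟨hε.trans_le hy.1, by linarith [hy.2]⟩),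
        fun s hs => hym hs⟩
    · exact ⟨1, one_pos, fun s hs => absurd (hs.1.trans hs.2) hεδ⟩
  obtain ⟨m, hm, hmG⟩ := hmin
  filter_upwards [tendsto_one_div_atTop_nhds_zero_nat.eventually (eventually_lt_nhds hm), hev]
    with n h1 h2
  rw [Real.dist_eq, sub_zero, abs_of_pos (hx0 n)]
  by_contra! hlt
  have := hmG _ ⟨hlt, hxδ n⟩
  linarith

/-- A random variable whose characteristic function `f` is such that `1 - f` is regularly varying
of index `α ∈ (0, 1]` is in the domain of attraction of an `α`-stable law. -/
theorem inDomainOfAttraction_of_regVar (μ : Measure Ω) [IsProbabilityMeasure μ] {X : Ω → ℝ}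
    (hX : Measurable X) {α : ℝ} (h0 : 0 < α) (h1 : α ≤ 1) {v : ℂ}
    (hv : RegVar (fun s => 1 - charFun (μ.map X) s) α v) (hre : 0 < v.re)
    (him : α < 1 → |v.im| ≤ v.re * Real.tan (Real.pi * α / 2)) :
    InDomainOfAttraction μ X α := by
  have := Measure.isProbabilityMeasure_map hX.aemeasurable (μ := μ)
  set f := charFun (μ.map X) with hf
  -- With ‖1 - f (x n)‖ = 1/n, regular variation gives n (1 - f (t x n)) → v t^α for t > 0, hence f
  -- (t x n)^n → exp(-v t^α); no centering is needed.
  obtain ⟨x, hx0, hx, hxn⟩ := exists_seq_norm_eq_inv (G := fun s => 1 - f s)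
    (by fun_prop) (by simp [hf]) hv.eventually_ne
  -- Matching -v t^α with the parametrisation of stable laws: for α = 1 the imaginary part of v is a
  -- location parameter and the skewness is zero; for α < 1 it is absorbed by the skewness, with β
  -- tan(πα/2) = -Im v / Re v.
  set δ : ℝ := if α = 1 then -v.im else 0 with hδ
  set k : ℝ := if α = 1 then 0 else -(v.im / v.re) with hk
  let E : ℝ → ℂ := fun t => Complex.I * ((δ * t : ℝ) : ℂ) - ((v.re * |t| ^ α : ℝ) : ℂ) *
    (1 - Complex.I * ((k * SignType.sign t : ℝ) : ℂ))
  have hEpos : ∀ t, 0 < t → E t = -(v * (t ^ α : ℝ)) := by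
    intro t ht
    apply Complex.ext <;> by_cases hα : α = 1 <;>
      simp [E, hδ, hk, hα, abs_of_pos ht, sign_pos ht]
    field_simp
  have hEneg : ∀ t, E (-t) = (starRingEnd ℂ) (E t) := by
    intro t
    simp only [E, abs_neg, Left.sign_neg]
    simp [Complex.conj_ofReal]
  have hlim : ∀ t, Tendsto (fun n : ℕ => f (t * x n) ^ n) atTop (𝓝 (Complex.exp (E t))) := by
    have hpos : ∀ t, 0 < t →
        Tendsto (fun n : ℕ => f (t * x n) ^ n) atTop (𝓝 (Complex.exp (E t))) := by
      intro t ht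
      have h2 := (hv.tendsto_div ht).comp hx
      rw [hEpos t ht]
      have h3 : Tendsto (fun n : ℕ => (n : ℂ) * (f (t * x n) - 1)) atTop
          (𝓝 (-(v * (t ^ α : ℝ)))) := by
        refine h2.neg.congr' ?_
        filter_upwards [hxn, eventually_gt_atTop 0] with n hn hn0
        have : (n : ℂ) ≠ 0 := by exact_mod_cast hn0.ne'
        simp only [Function.comp, hn]
        push_cast
        field_simp
        ring
      refine (Complex.tendsto_one_add_pow_exp_of_tendsto h3).congr fun n => ?_
      congr 1; ring
    intro t
    rcases lt_trichotomy t 0 with ht | ht | ht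
    · have h2 := (Complex.continuous_conj.tendsto _).comp (hpos (-t) (by linarith))
      rw [← Complex.exp_conj, ← hEneg, neg_neg] at h2
      refine h2.congr fun n => ?_
      simp only [Function.comp, map_pow, hf]
      rw [← charFun_neg]
      congr 2; ring
    · subst ht
      have : E 0 = 0 := by simp [E, Real.zero_rpow h0.ne']
      simp [this, hf]
    · exact hpos t ht
  have hcont : ContinuousAt (fun t => Complex.exp (E t)) 0 := by
    have hE0 : Tendsto E (𝓝 0) (𝓝 0) := by
      rw [tendsto_zero_iff_norm_tendsto_zero]
      have hb : ∀ t, ‖E t‖ ≤ |δ| * |t| + v.re * |t| ^ α * (1 + |k|) := by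
        intro t
        have hs : |((SignType.sign t : SignType) : ℝ)| ≤ 1 := by
          rcases lt_trichotomy t 0 with ht | ht | ht <;> simp [ht]
        refine (norm_sub_le _ _).trans (add_le_add ?_ ?_)
        · rw [norm_mul, Complex.norm_I, one_mul, Complex.norm_real, Real.norm_eq_abs, abs_mul]
        · rw [norm_mul, Complex.norm_real, Real.norm_of_nonneg (by positivity)]
          gcongr
          refine (norm_sub_le _ _).trans ?_
          rw [norm_mul, Complex.norm_I, one_mul, Complex.norm_real, Real.norm_eq_abs, abs_mul,
            norm_one]
          gcongr
          nlinarith [abs_nonneg k]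
      refine squeeze_zero (fun _ => norm_nonneg _) hb ?_
      have hc : Continuous fun t : ℝ => |δ| * |t| + v.re * |t| ^ α * (1 + |k|) := by
        have : Continuous fun t : ℝ => |t| ^ α :=
          (Real.continuous_rpow_const h0.le).comp continuous_abs
        fun_prop
      have := hc.tendsto 0
      simpa [Real.zero_rpow h0.ne'] using this
    have : E 0 = 0 := by simp [E, Real.zero_rpow h0.ne']
    unfold ContinuousAt
    simp only [this]
    exact (Complex.continuous_exp.tendsto 0).comp hE0
  rw [inDomainOfAttraction_iff μ hX]
  have hf' : ∀ (n : ℕ) t, f (t * x n) ^ n = f (t / (x n)⁻¹) ^ n *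
      Complex.exp (-(Complex.I * (t * ((fun _ => 0 : ℕ → ℝ) n / (x n)⁻¹) : ℝ))) := by
    intro n t; simp
  -- The stable law is not constructed separately: it is the limit of the laws of the normalised
  -- sums themselves, which exists because `exp ∘ E` is continuous at 0.
  obtain ⟨ν, hν⟩ := exists_charFun_eq_of_tendsto (f := fun t => Complex.exp (E t))
    (P := fun n => ⟨(Measure.pi fun _ : Fin n => μ).map
        (fun y => ((∑ i, X (y i)) - 0) / (x n)⁻¹), by
        have : ∀ i : Fin n, Measurable fun x : Fin n → Ω => X (x i) :=
          fun i => hX.comp (measurable_pi_apply i)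
        exact Measure.isProbabilityMeasure_map
          (((Finset.measurable_sum _ fun i _ => this i).sub_const _).div_const _).aemeasurable⟩)
    hcont (by
      intro t
      refine (hlim t).congr fun n => ?_
      simp only [ProbabilityMeasure.coe_mk]
      rw [charFun_map_normalized_sum μ hX n _ 0, hf'])
  refine ⟨ν, ⟨h0, h1.trans one_le_two, v.re, if α = 1 then 0 else
      -(v.im / v.re) / Real.tan (Real.pi * α / 2), δ, hre, ?_, ?_⟩, fun n => (x n)⁻¹, fun _ => 0,
    fun n => inv_pos.2 (hx0 n), ?_⟩
  · split_ifs with hα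
    · simp
    · have hα1 : α < 1 := lt_of_le_of_ne h1 hα
      have htan : 0 < Real.tan (Real.pi * α / 2) := by
        apply Real.tan_pos_of_pos_of_lt_pi_div_two <;> nlinarith [Real.pi_pos]
      rw [abs_div, abs_neg, abs_div, abs_of_pos hre, abs_of_pos htan, div_div,
        div_le_one (by positivity)]
      exact him hα1
  · intro t
    rw [hν]
    have hkw : k * SignType.sign t = (if α = 1 then 0 else
        -(v.im / v.re) / Real.tan (Real.pi * α / 2)) * SignType.sign t *
        (if α = 1 then -(2 / Real.pi) * Real.log |t| else Real.tan (Real.pi * α / 2)) := by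
      rw [hk]
      split_ifs with hα
      · simp
      · have hα1 : α < 1 := lt_of_le_of_ne h1 hα
        have htan : 0 < Real.tan (Real.pi * α / 2) := by
          apply Real.tan_pos_of_pos_of_lt_pi_div_two <;> nlinarith [Real.pi_pos]
        field_simp
    simp only [E, hkw]
  · intro t
    rw [hν]
    exact (hlim t).congr fun n => hf' n t

/-! ### Finite measures and multiplication by 1 - sinc -/

theorem charFun_smul_nnreal (c : NNReal) (m : Measure ℝ) (t : ℝ) :
    charFun (c • m) t = (c : ℂ) * charFun m t := by
  simp only [charFun_apply]
  rw [show c • m = (c : ENNReal) • m from rfl, integral_smul_measure]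
  simp

/-- Lévy's continuity theorem for finite measures with nonvanishing limit mass. -/
theorem exists_finiteMeasure_of_tendsto_charFun {G : ℕ → FiniteMeasure ℝ} {χ : ℝ → ℂ}
    (hχ : ContinuousAt χ 0) (h0 : 0 < (χ 0).re)
    (h : ∀ t, Tendsto (fun n => charFun (G n : Measure ℝ) t) atTop (𝓝 (χ t))) :
    ∃ Q : FiniteMeasure ℝ, (∀ t, charFun (Q : Measure ℝ) t = χ t) ∧ Tendsto G atTop (𝓝 Q) := by
  have hmass : Tendsto (fun n => ((G n).mass : ℝ)) atTop (𝓝 (χ 0).re) := by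
    refine ((Complex.continuous_re.tendsto _).comp (h 0)).congr fun n => ?_
    simp [charFun_zero]
  have hχ0 : χ 0 = ((χ 0).re : ℂ) := by
    refine tendsto_nhds_unique (h 0) ?_
    refine ((Complex.continuous_ofReal.tendsto _).comp hmass).congr fun n => ?_
    simp [charFun_zero]
  -- The limit of the total masses is χ 0. Its positivity allows passing to normalised probability
  -- measures and back.
  set M : NNReal := ⟨(χ 0).re, h0.le⟩ with hM
  have hM0 : M ≠ 0 := by
    intro h; have := congrArg NNReal.toReal h; simp [hM] at this; exact h0.ne' this
  have hmass' : Tendsto (fun n => (G n).mass) atTop (𝓝 M) := by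
    rw [← NNReal.tendsto_coe]; exact hmass
  have hev : ∀ᶠ n in atTop, (G n).mass ≠ 0 := hmass'.eventually_ne hM0
  have hG : ∀ n t, charFun (G n : Measure ℝ) t =
      ((G n).mass : ℂ) * charFun ((G n).normalize : Measure ℝ) t := by
    intro n t
    rw [← charFun_smul_nnreal]
    congr 1
    conv_lhs => rw [(G n).self_eq_mass_smul_normalize]
    rfl
  have hMC : (M : ℂ) = χ 0 := by rw [hχ0]; rfl
  have hMC0 : (M : ℂ) ≠ 0 := by exact_mod_cast hM0
  have hnorm : ∀ t, Tendsto (fun n => charFun ((G n).normalize : Measure ℝ) t) atTop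
      (𝓝 (χ t / M)) := by
    intro t
    have hm : Tendsto (fun n => ((G n).mass : ℂ)) atTop (𝓝 (M : ℂ)) :=
      (Complex.continuous_ofReal.tendsto _).comp hmass
    refine ((h t).div hm hMC0).congr' ?_
    filter_upwards [hev] with n hn
    have : ((G n).mass : ℂ) ≠ 0 := by exact_mod_cast hn
    simp only [Pi.div_apply]
    rw [hG n t]
    field_simp
  obtain ⟨Q, hQ⟩ := exists_charFun_eq_of_tendsto (f := fun t => χ t / M)
    (hχ.div_const _) hnorm
  have hQn : Tendsto (fun n => (G n).normalize) atTop (𝓝 Q) := by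
    rw [ProbabilityMeasure.tendsto_iff_tendsto_charFun]
    intro t; rw [hQ]; exact hnorm t
  have hmQ : (M • Q.toFiniteMeasure).mass = M := by
    have h1 : Q.toFiniteMeasure.mass = 1 := Q.mass_toFiniteMeasure
    rw [FiniteMeasure.mass, FiniteMeasure.coeFn_smul, Pi.smul_apply, ← FiniteMeasure.mass, h1]
    simp
  have hne : (M • Q.toFiniteMeasure) ≠ 0 := by
    rw [← FiniteMeasure.mass_nonzero_iff, hmQ]; exact hM0
  have hnQ : (M • Q.toFiniteMeasure).normalize = Q := by
    apply Subtype.ext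
    have := FiniteMeasure.toMeasure_normalize_eq_of_nonzero _ hne
    rw [hmQ] at this
    refine this.trans ?_
    ext s hs
    rw [FiniteMeasure.toMeasure_smul, smul_smul, inv_mul_cancel₀ hM0, one_smul]
    rfl
  refine ⟨M • Q.toFiniteMeasure, fun t => ?_, ?_⟩
  · rw [FiniteMeasure.toMeasure_smul, charFun_smul_nnreal]
    have := hQ t
    rw [show ((Q.toFiniteMeasure : FiniteMeasure ℝ) : Measure ℝ) = (Q : Measure ℝ) from rfl, this]
    field_simp
  · apply FiniteMeasure.tendsto_of_tendsto_normalize_testAgainstNN_of_tendsto_mass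
    · rw [hnQ]; exact hQn
    · rw [hmQ]; exact hmass'

theorem integral_withDensity_ofReal {E : Type*} [NormedAddCommGroup E] [NormedSpace ℝ E]
    {α : Type*} [MeasurableSpace α] (m : Measure α) {k : α → ℝ} (hk : Measurable k)
    (hk0 : ∀ x, 0 ≤ k x) (F : α → E) :
    ∫ x, F x ∂(m.withDensity fun x => ENNReal.ofReal (k x)) = ∫ x, k x • F x ∂m := by
  rw [integral_withDensity_eq_integral_toReal_smul (by fun_prop) (by simp)]
  simp [hk0]

theorem isFiniteMeasure_withDensity_ofReal_of_integrable {α : Type*} [MeasurableSpace α]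
    {m : Measure α} {k : α → ℝ} (hk : Integrable k m) :
    IsFiniteMeasure (m.withDensity fun x => ENNReal.ofReal (k x)) :=
  isFiniteMeasure_withDensity_ofReal hk.2

theorem integral_exp_mul_I_eq_two_mul_sinc (x : ℝ) :
    ∫ u in (-1 : ℝ)..1, Complex.exp ((u * x : ℝ) * Complex.I) = 2 * (Real.sinc x : ℂ) := by
  have := integral_charFun_Icc (μ := Measure.dirac x) one_pos
  simp only [charFun_dirac, integral_dirac] at this
  simpa [mul_comm] using this

/-- Multiplying a finite measure by `1 - sinc` subtracts from its characteristic function the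
average over a window of length two. -/
theorem integral_one_sub_sinc_smul_exp (m : Measure ℝ) [IsFiniteMeasure m] (t : ℝ) :
    ∫ x, (1 - Real.sinc x) • Complex.exp (t * x * Complex.I) ∂m =
      (1 / 2) * ∫ u in (-1 : ℝ)..1, (charFun m t - charFun m (t + u)) := by
  have hint : ∀ t : ℝ, Integrable (fun x : ℝ => Complex.exp (t * x * Complex.I)) m := by
    intro t
    refine Integrable.of_bound (by fun_prop) 1 (Eventually.of_forall fun x => ?_)
    rw [← Complex.ofReal_mul, Complex.norm_exp_ofReal_mul_I]
  have hsw : ∫ u in (-1 : ℝ)..1, charFun m (t + u) =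
      ∫ x, 2 * (Real.sinc x : ℂ) * Complex.exp (t * x * Complex.I) ∂m := by
    simp only [charFun_apply_real]
    rw [intervalIntegral_integral_swap]
    · refine integral_congr_ae (Eventually.of_forall fun x => ?_)
      beta_reduce
      rw [← integral_exp_mul_I_eq_two_mul_sinc, ← intervalIntegral.integral_mul_const]
      refine intervalIntegral.integral_congr fun u _ => ?_
      rw [← Complex.exp_add]
      congr 1
      push_cast
      ring
    · rw [Set.uIoc_of_le (by norm_num)]
      refine Integrable.of_bound (by fun_prop) 1 (Eventually.of_forall fun x => ?_)
      simp only [Function.uncurry]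
      rw [← Complex.ofReal_mul, Complex.norm_exp_ofReal_mul_I]
  rw [intervalIntegral.integral_sub (by simp) (by
    exact (Continuous.intervalIntegrable (by fun_prop) _ _)), hsw]
  simp only [intervalIntegral.integral_const, charFun_apply_real]
  rw [show ((1 : ℝ) - -1) • (∫ x : ℝ, Complex.exp (t * x * Complex.I) ∂m) =
    ∫ x : ℝ, 2 * Complex.exp (t * x * Complex.I) ∂m by
      rw [integral_const_mul, Complex.real_smul]; norm_num]
  rw [← integral_sub ((hint t).const_mul 2), ← integral_const_mul]
  · refine integral_congr_ae (Eventually.of_forall fun x => ?_)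
    simp only [Complex.real_smul]
    push_cast
    ring
  · refine (hint t).bdd_mul (c := 2) (by fun_prop) (Eventually.of_forall fun x => ?_)
    rw [norm_mul, Complex.norm_real, Real.norm_eq_abs]
    simpa using Real.abs_sinc_le_one x

/-! ### The one-sided Lévy measure and its tilt -/

/-- The density `α x^(-1-α) dx` on `(0, ∞)`. -/
noncomputable def levyMeasure (α : ℝ) : Measure ℝ :=
  (volume.restrict (Set.Ioi 0)).withDensity fun x => ENNReal.ofReal (α * x ^ (-1 - α))

instance (α : ℝ) : SFinite (levyMeasure α) := by
  unfold levyMeasure; infer_instance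

theorem ae_pos_levyMeasure (α : ℝ) : ∀ᵐ x ∂(levyMeasure α), 0 < x := by
  refine (withDensity_absolutelyContinuous _ _).ae_le ?_
  exact ae_restrict_mem measurableSet_Ioi

theorem integrable_levyMeasure_iff {E : Type*} [NormedAddCommGroup E] [NormedSpace ℝ E] {α : ℝ}
    (h0 : 0 ≤ α) {F : ℝ → E} :
    Integrable F (levyMeasure α) ↔
      IntegrableOn (fun x => (α * x ^ (-1 - α)) • F x) (Set.Ioi 0) := by
  unfold levyMeasure
  rw [integrable_withDensity_iff_integrable_smul' (by fun_prop) (by simp)]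
  refine integrable_congr ?_
  filter_upwards [ae_restrict_mem measurableSet_Ioi] with x hx
  have : 0 < x := hx
  rw [ENNReal.toReal_ofReal (by positivity)]

theorem integral_levyMeasure {E : Type*} [NormedAddCommGroup E] [NormedSpace ℝ E] {α : ℝ}
    (h0 : 0 ≤ α) (F : ℝ → E) :
    ∫ x, F x ∂(levyMeasure α) = ∫ x in Set.Ioi 0, (α * x ^ (-1 - α)) • F x := by
  unfold levyMeasure
  rw [integral_withDensity_eq_integral_toReal_smul (by fun_prop) (by simp)]
  refine integral_congr_ae ?_
  filter_upwards [ae_restrict_mem measurableSet_Ioi] with x hx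
  have : 0 < x := hx
  rw [ENNReal.toReal_ofReal (by positivity)]

/-- The tail of the density is integrable at infinity, and its singularity at 0 is compensated by
x^p when p > α. The exponents needed are p = 1 for α < 1 and p = 2 for α < 2. -/
theorem integrable_min_rpow_levyMeasure {α p : ℝ} (h0 : 0 < α) (hp : α < p) :
    Integrable (fun x => min 1 (x ^ p)) (levyMeasure α) := by
  rw [integrable_levyMeasure_iff h0.le, ← Set.Ioc_union_Ioi_eq_Ioi zero_le_one]
  refine IntegrableOn.union ?_ ?_
  · have h1 : IntegrableOn (fun x : ℝ => α * x ^ (p - 1 - α)) (Set.Ioc 0 1) := by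
      rw [← intervalIntegrable_iff_integrableOn_Ioc_of_le zero_le_one]
      exact (intervalIntegral.intervalIntegrable_rpow' (by linarith)).const_mul _
    refine h1.congr_fun (fun x hx => ?_) measurableSet_Ioc
    simp only [smul_eq_mul]
    rw [min_eq_right (Real.rpow_le_one hx.1.le hx.2 (by linarith)), mul_assoc,
      ← Real.rpow_add hx.1]
    ring_nf
  · have h1 : IntegrableOn (fun x : ℝ => α * x ^ (-1 - α)) (Set.Ioi 1) :=
      (integrableOn_Ioi_rpow_of_lt (by linarith) one_pos).const_mul _
    refine h1.congr_fun (fun x hx => ?_) measurableSet_Ioi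
    have hx : 1 < x := hx
    simp only [smul_eq_mul]
    rw [min_eq_left (Real.one_le_rpow hx.le (by linarith)), mul_one]

theorem levyMeasure_Ioi {α : ℝ} (h0 : 0 < α) {c : ℝ} (hc : 0 < c) :
    (levyMeasure α).real (Set.Ioi c) = c ^ (-α) := by
  rw [← integral_indicator_one measurableSet_Ioi, integral_levyMeasure h0.le]
  have : ∀ x, (α * x ^ (-1 - α)) • (Set.Ioi c).indicator (1 : ℝ → ℝ) x =
      (Set.Ioi c).indicator (fun x => α * x ^ (-1 - α)) x := by
    intro x
    by_cases hx : x ∈ Set.Ioi c <;> simp [hx, Set.indicator]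
  simp only [this]
  rw [setIntegral_indicator measurableSet_Ioi, Set.inter_eq_right.2 (Set.Ioi_subset_Ioi hc.le),
    integral_const_mul, integral_Ioi_rpow_of_lt (by linarith) hc]
  rw [show -1 - α + 1 = -α by ring]
  field_simp

/-- Quadratic vanishing at 0 is what makes the tilted Lévy measure finite for all α < 2. -/
theorem one_sub_sinc_le {x : ℝ} (hx : 0 < x) : 1 - Real.sinc x ≤ 2 * min 1 (x ^ (2 : ℝ)) := by
  rcases le_total x 1 with h | h
  · rw [min_eq_right (Real.rpow_le_one hx.le h (by norm_num)), Real.sinc_of_ne_zero hx.ne']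
    have := Real.sin_gt_sub_cube hx
    rw [show (2 : ℝ) = ((2 : ℕ) : ℝ) by norm_num, Real.rpow_natCast]
    have h2 : (x - x ^ 3 / 6) / x ≤ Real.sin x / x := by gcongr
    have h3 : (x - x ^ 3 / 6) / x = 1 - x ^ 2 / 6 := by field_simp
    push_cast
    nlinarith
  · rw [min_eq_left (Real.one_le_rpow h (by norm_num))]
    linarith [Real.neg_one_le_sinc x]

theorem integrable_one_sub_sinc_levyMeasure {α : ℝ} (h0 : 0 < α) (h2 : α < 2) :
    Integrable (fun x => 1 - Real.sinc x) (levyMeasure α) := by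
  refine ((integrable_min_rpow_levyMeasure h0 h2).const_mul 2).mono' (by fun_prop) ?_
  filter_upwards [ae_pos_levyMeasure α] with x hx
  rw [Real.norm_of_nonneg (by linarith [Real.sinc_le_one x])]
  exact one_sub_sinc_le hx

/-- The kernel `p (1 - e^{itx}) + q (1 - e^{-itx})`. -/
noncomputable def levyKernel (p q t x : ℝ) : ℂ :=
  p * (1 - Complex.exp (t * x * Complex.I)) + q * (1 - Complex.exp (-(t * x * Complex.I)))

theorem levyKernel_neg (p q t x : ℝ) :
    levyKernel p q (-t) x = (starRingEnd ℂ) (levyKernel p q t x) := by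
  simp [levyKernel, ← Complex.exp_conj]

theorem levyKernel_swap (p q t x : ℝ) :
    levyKernel q p t x = (starRingEnd ℂ) (levyKernel p q t x) := by
  simp [levyKernel, ← Complex.exp_conj]
  ring

/-- The density `(1 - sinc) dm`. -/
noncomputable def sincTilt (c : ℝ) (m : Measure ℝ) : Measure ℝ :=
  m.withDensity fun x => ENNReal.ofReal ((1 - Real.sinc x) / c)

theorem one_sub_sinc_nonneg (x : ℝ) : 0 ≤ 1 - Real.sinc x := by linarith [Real.sinc_le_one x]

theorem integral_sincTilt {E : Type*} [NormedAddCommGroup E] [NormedSpace ℝ E]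
    (m : Measure ℝ) {c : ℝ} (hc : 0 < c) (F : ℝ → E) :
    ∫ x, F x ∂(sincTilt c m) = ∫ x, ((1 - Real.sinc x) / c) • F x ∂m :=
  integral_withDensity_ofReal m (by fun_prop)
    (fun x => div_nonneg (one_sub_sinc_nonneg x) hc.le) F

theorem isFiniteMeasure_sincTilt (c : ℝ) {m : Measure ℝ}
    (h : Integrable (fun x => 1 - Real.sinc x) m) : IsFiniteMeasure (sincTilt c m) :=
  isFiniteMeasure_withDensity_ofReal_of_integrable (h.div_const c)

theorem integrable_one_sub_sinc (m : Measure ℝ) [IsFiniteMeasure m] :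
    Integrable (fun x => 1 - Real.sinc x) m := by
  refine Integrable.of_bound (by fun_prop) 2 (Eventually.of_forall fun x => ?_)
  rw [Real.norm_of_nonneg (one_sub_sinc_nonneg x)]
  linarith [Real.neg_one_le_sinc x]

/-- By Fubini, since averaging exp(i(t+u)x) over u in [-1, 1] multiplies exp(itx) by sinc x; the
constants in the kernel cancel in the difference. This identifies the limit in the Tauberian
theorem. The bound b is left abstract because min(1, x) serves for α < 1 and min(1, x²) for the
symmetric kernel at α = 1. -/
theorem half_integral_levyKernel_sub {α p q : ℝ} {b : ℝ → ℝ} (h0 : 0 < α) (h2 : α < 2)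
    (hb : Integrable b (levyMeasure α))
    (hKb : ∀ M : ℝ, ∃ C : ℝ, ∀ t, |t| ≤ M → ∀ x, 0 < x → ‖levyKernel p q t x‖ ≤ C * b x) (t : ℝ) :
    (1 / 2) * ∫ u in (-1 : ℝ)..1, ((∫ x, levyKernel p q (t + u) x ∂(levyMeasure α)) -
        ∫ x, levyKernel p q t x ∂(levyMeasure α)) =
      p * charFun (sincTilt 1 (levyMeasure α)) t + q * charFun (sincTilt 1 (levyMeasure α)) (-t) := by
  have hKi : ∀ t, Integrable (levyKernel p q t) (levyMeasure α) := by
    intro t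
    obtain ⟨C, hC⟩ := hKb |t|
    refine (hb.const_mul C).mono' (by unfold levyKernel; fun_prop) ?_
    filter_upwards [ae_pos_levyMeasure α] with x hx using hC t le_rfl x hx
  have h1 : ∀ u, (∫ x, levyKernel p q (t + u) x ∂(levyMeasure α)) -
        ∫ x, levyKernel p q t x ∂(levyMeasure α) =
      ∫ x, (levyKernel p q (t + u) x - levyKernel p q t x) ∂(levyMeasure α) :=
    fun u => (integral_sub (hKi _) (hKi _)).symm
  simp only [h1]
  rw [intervalIntegral_integral_swap]
  · have h3 : ∀ x, ∫ u in (-1 : ℝ)..1, (levyKernel p q (t + u) x - levyKernel p q t x) =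
        2 * (((1 - Real.sinc x) / 1) • (p * Complex.exp (t * x * Complex.I) +
          q * Complex.exp ((-t : ℝ) * x * Complex.I))) := by
      intro x
      have e1 : ∀ u : ℝ, levyKernel p q (t + u) x - levyKernel p q t x =
          (p * Complex.exp (t * x * Complex.I)) +
          (q * Complex.exp ((-t : ℝ) * x * Complex.I)) -
          (p * Complex.exp (t * x * Complex.I)) * Complex.exp ((u * x : ℝ) * Complex.I) -
          (q * Complex.exp ((-t : ℝ) * x * Complex.I)) *
            Complex.exp ((u * (-x) : ℝ) * Complex.I) := by
        intro u
        unfold levyKernel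
        rw [show ((t + u : ℝ) : ℂ) * x * Complex.I = t * x * Complex.I + (u * x : ℝ) * Complex.I by
            push_cast; ring, neg_add, Complex.exp_add, Complex.exp_add,
          show -(((u * x : ℝ) : ℂ) * Complex.I) = (u * (-x) : ℝ) * Complex.I by push_cast; ring,
          show -((t : ℂ) * x * Complex.I) = (-t : ℝ) * x * Complex.I by push_cast; ring]
        ring
      simp only [e1]
      rw [intervalIntegral.integral_sub, intervalIntegral.integral_sub,
        intervalIntegral.integral_const, intervalIntegral.integral_const_mul,
        intervalIntegral.integral_const_mul, integral_exp_mul_I_eq_two_mul_sinc,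
        integral_exp_mul_I_eq_two_mul_sinc, Real.sinc_neg]
      · simp only [Complex.real_smul]
        push_cast
        ring
      all_goals exact Continuous.intervalIntegrable (by fun_prop) _ _
    simp only [h3]
    rw [integral_const_mul, ← mul_assoc]
    norm_num only [one_mul]
    have hS : ∀ t : ℝ, Integrable (fun x : ℝ => ((1 - Real.sinc x) / 1) •
        Complex.exp (t * x * Complex.I)) (levyMeasure α) := by
      intro t
      refine (integrable_one_sub_sinc_levyMeasure h0 h2).mono (by fun_prop)
        (Eventually.of_forall fun x => ?_)
      rw [norm_smul, ← Complex.ofReal_mul, Complex.norm_exp_ofReal_mul_I]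
      simp
    simp only [charFun_apply_real, integral_sincTilt _ one_pos]
    rw [← integral_const_mul, ← integral_const_mul,
      ← integral_add ((hS t).const_mul _) ((hS (-t)).const_mul _)]
    refine integral_congr_ae (Eventually.of_forall fun x => ?_)
    simp only [Complex.real_smul]
    push_cast
    ring
  · obtain ⟨C, hC⟩ := hKb (|t| + 1)
    have hb' : Integrable (fun z : ℝ × ℝ => 2 * C * b z.2)
        ((volume.restrict (Set.uIoc (-1) 1)).prod (levyMeasure α)) := by
      rw [Set.uIoc_of_le (by norm_num)]
      exact (hb.const_mul (2 * C)).comp_snd _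
    refine hb'.mono' ?_ ?_
    · apply Continuous.aestronglyMeasurable
      simp only [Function.uncurry_def]
      unfold levyKernel
      fun_prop
    · rw [Set.uIoc_of_le (by norm_num)]
      have hp : ∀ᵐ z ∂((volume.restrict (Set.Ioc (-1 : ℝ) 1)).prod (levyMeasure α)),
          z.1 ∈ Set.Ioc (-1 : ℝ) 1 ∧ 0 < z.2 :=
        (Measure.quasiMeasurePreserving_fst.ae (ae_restrict_mem measurableSet_Ioc)).and
          (Measure.quasiMeasurePreserving_snd.ae (ae_pos_levyMeasure α))
      filter_upwards [hp] with z hz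
      simp only [Function.uncurry]
      have h4 := hC (t + z.1) (by
        refine (abs_add_le _ _).trans ?_
        have : |z.1| ≤ 1 := abs_le.2 ⟨hz.1.1.le, hz.1.2⟩
        linarith) z.2 hz.2
      have h5 := hC t (by linarith) z.2 hz.2
      refine (norm_sub_le _ _).trans ?_
      linarith

/-- The window average expresses the tilted transform through differences of `1 - charFun ρ`, the
quantity whose asymptotics at 0 are known. -/
theorem charFun_sincTilt_map (ρ : Measure ℝ) [IsFiniteMeasure ρ] {c : ℝ} (hc : 0 < c) (s t : ℝ) :
    charFun (sincTilt c (ρ.map (s * ·))) t = (1 / 2) * ∫ u in (-1 : ℝ)..1,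
      ((1 - charFun ρ ((t + u) * s)) / c - (1 - charFun ρ (t * s)) / c) := by
  rw [charFun_apply_real, integral_sincTilt _ hc]
  have h1 : ∀ x : ℝ, ((1 - Real.sinc x) / c) • Complex.exp (t * x * Complex.I) =
      (c : ℂ)⁻¹ * ((1 - Real.sinc x) • Complex.exp (t * x * Complex.I)) := by
    intro x
    simp only [Complex.real_smul]; push_cast; ring
  simp only [h1]
  rw [integral_const_mul, integral_one_sub_sinc_smul_exp]
  simp only [charFun_map_mul]
  rw [← mul_assoc, mul_comm (c : ℂ)⁻¹, mul_assoc, ← intervalIntegral.integral_const_mul]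
  congr 1
  refine intervalIntegral.integral_congr fun u _ => ?_
  rw [mul_comm s, mul_comm s]
  field_simp
  ring

/-- For t > 0 this is the hypothesis at t s combined with the ratio limit of g; negative t follow by
complex conjugation. -/
theorem tendsto_one_sub_charFun_div (ρ : Measure ℝ) [IsProbabilityMeasure ρ] {α : ℝ}
    {g : ℝ → ℝ} {w : ℂ} {ψ : ℝ → ℂ}
    (hg : ∀ᶠ s in 𝓝[>] 0, 0 < g s)
    (hF : Tendsto (fun s => (1 - charFun ρ s) / (g s : ℂ)) (𝓝[>] 0) (𝓝 w))
    (hr : ∀ t : ℝ, 0 < t → Tendsto (fun s => g (t * s) / g s) (𝓝[>] 0) (𝓝 (t ^ α)))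
    (hψ : ∀ t, 0 < t → ψ t = w * (t ^ α : ℝ)) (hψ0 : ψ 0 = 0)
    (hψn : ∀ t, ψ (-t) = (starRingEnd ℂ) (ψ t)) (t : ℝ) :
    Tendsto (fun s => (1 - charFun ρ (t * s)) / (g s : ℂ)) (𝓝[>] 0) (𝓝 (ψ t)) := by
  have hpos : ∀ t, 0 < t →
      Tendsto (fun s => (1 - charFun ρ (t * s)) / (g s : ℂ)) (𝓝[>] 0) (𝓝 (ψ t)) := by
    intro t ht
    have h1 := hF.comp (tendsto_mul_nhdsGT_zero ht)
    have h2 := (Complex.continuous_ofReal.tendsto _).comp (hr t ht)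
    rw [hψ t ht]
    refine (h1.mul h2).congr' ?_
    filter_upwards [hg, (tendsto_mul_nhdsGT_zero ht).eventually hg] with s hs hts
    have h3 : (g s : ℂ) ≠ 0 := by exact_mod_cast hs.ne'
    have h4 : (g (t * s) : ℂ) ≠ 0 := by exact_mod_cast hts.ne'
    simp only [Function.comp]
    push_cast
    field_simp
  rcases lt_trichotomy t 0 with ht | ht | ht
  · have h1 := (Complex.continuous_conj.tendsto _).comp (hpos (-t) (by linarith))
    rw [← hψn, neg_neg] at h1
    refine h1.congr fun s => ?_
    simp only [Function.comp, map_div₀, map_sub, map_one, Complex.conj_ofReal]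
    rw [← charFun_neg]
    congr 3; ring
  · subst ht; simp [hψ0]
  · exact hpos t ht

/-- Monotonicity of g near 0 bounds g (|t| s) by g (M s), which is O(g s). This domination takes the
place of the uniform convergence theorem for regularly varying functions. -/
theorem eventually_norm_one_sub_charFun_div_le (ρ : Measure ℝ) [IsProbabilityMeasure ρ] {α : ℝ}
    {g : ℝ → ℝ} {w : ℂ}
    (hg : ∀ᶠ s in 𝓝[>] 0, 0 < g s)
    (hF : Tendsto (fun s => (1 - charFun ρ s) / (g s : ℂ)) (𝓝[>] 0) (𝓝 w))
    (hr : ∀ t : ℝ, 0 < t → Tendsto (fun s => g (t * s) / g s) (𝓝[>] 0) (𝓝 (t ^ α)))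
    (hmono : ∃ δ > 0, MonotoneOn g (Set.Ioo 0 δ)) {M : ℝ} (hM : 0 < M) :
    ∃ C : ℝ, ∀ᶠ s in 𝓝[>] 0, ∀ t, |t| ≤ M → ‖(1 - charFun ρ (t * s)) / (g s : ℂ)‖ ≤ C := by
  obtain ⟨δ, hδ, hmono⟩ := hmono
  have h1 : ∀ᶠ s in 𝓝[>] (0 : ℝ), ‖(1 - charFun ρ s) / (g s : ℂ)‖ < ‖w‖ + 1 :=
    hF.norm.eventually (eventually_lt_nhds (by linarith))
  obtain ⟨δ₁, hδ₁, h2⟩ := (mem_nhdsGT_iff_exists_Ioo_subset).1 (h1.and hg)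
  have hδ₁ : 0 < δ₁ := hδ₁
  have h3 := (hr M hM).eventually (eventually_lt_nhds (b := M ^ α + 1) (by linarith))
  have hlt : ∀ ε > 0, ∀ᶠ s in 𝓝[>] (0 : ℝ), M * s < ε := fun ε hε =>
    (tendsto_nhdsWithin_iff.1 (tendsto_mul_nhdsGT_zero hM)).1.eventually (eventually_lt_nhds hε)
  refine ⟨(‖w‖ + 1) * (M ^ α + 1), ?_⟩
  filter_upwards [h3, hg, hlt δ hδ, hlt δ₁ hδ₁, self_mem_nhdsWithin] with s hs hgs hsδ hsδ₁ hs0 t ht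
  have hs0 : 0 < s := hs0
  have hC : 0 ≤ (‖w‖ + 1) * (M ^ α + 1) := by positivity
  rcases eq_or_ne t 0 with rfl | ht0
  · simpa using hC
  have habs : ‖1 - charFun ρ (t * s)‖ = ‖1 - charFun ρ (|t| * s)‖ := by
    rcases abs_cases t with h | h
    · rw [h.1]
    · rw [h.1, neg_mul, charFun_neg, ← map_one (starRingEnd ℂ), ← map_sub, Complex.norm_conj,
        map_one]
  have htp : 0 < |t| * s := by positivity
  have htM : |t| * s ≤ M * s := by gcongr
  obtain ⟨h4, h5⟩ := h2 (show |t| * s ∈ Set.Ioo 0 δ₁ from ⟨htp, htM.trans_lt hsδ₁⟩)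
  rw [norm_div, Complex.norm_real, Real.norm_of_nonneg h5.le, div_lt_iff₀ h5] at h4
  rw [norm_div, habs, Complex.norm_real, Real.norm_of_nonneg hgs.le, div_le_iff₀ hgs]
  have h6 := hmono ⟨htp, htM.trans_lt hsδ⟩ ⟨htp.trans_le htM, hsδ⟩ htM
  have h7 := (div_lt_iff₀ hgs).1 hs
  calc ‖1 - charFun ρ (|t| * s)‖ ≤ (‖w‖ + 1) * g (|t| * s) := h4.le
    _ ≤ (‖w‖ + 1) * ((M ^ α + 1) * g s) := by gcongr; linarith
    _ = _ := by ring

theorem tendsto_charFun_sincTilt (ρ : Measure ℝ) [IsProbabilityMeasure ρ] {α : ℝ}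
    {g : ℝ → ℝ} {w : ℂ} {ψ : ℝ → ℂ}
    (hg : ∀ᶠ s in 𝓝[>] 0, 0 < g s)
    (hF : Tendsto (fun s => (1 - charFun ρ s) / (g s : ℂ)) (𝓝[>] 0) (𝓝 w))
    (hr : ∀ t : ℝ, 0 < t → Tendsto (fun s => g (t * s) / g s) (𝓝[>] 0) (𝓝 (t ^ α)))
    (hmono : ∃ δ > 0, MonotoneOn g (Set.Ioo 0 δ))
    (hψ : ∀ t, 0 < t → ψ t = w * (t ^ α : ℝ)) (hψ0 : ψ 0 = 0)
    (hψn : ∀ t, ψ (-t) = (starRingEnd ℂ) (ψ t)) (t : ℝ) :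
    Tendsto (fun s => charFun (sincTilt (g s) (ρ.map (s * ·))) t) (𝓝[>] 0)
      (𝓝 ((1 / 2) * ∫ u in (-1 : ℝ)..1, (ψ (t + u) - ψ t))) := by
  obtain ⟨C, hC⟩ := eventually_norm_one_sub_charFun_div_le ρ hg hF hr hmono
    (M := |t| + 1) (by positivity)
  have hpt := tendsto_one_sub_charFun_div ρ hg hF hr hψ hψ0 hψn
  have h1 : Tendsto (fun s => (1 / 2 : ℂ) * ∫ u in (-1 : ℝ)..1,
      ((1 - charFun ρ ((t + u) * s)) / (g s : ℂ) - (1 - charFun ρ (t * s)) / (g s : ℂ))) (𝓝[>] 0)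
      (𝓝 ((1 / 2) * ∫ u in (-1 : ℝ)..1, (ψ (t + u) - ψ t))) := by
    refine Tendsto.const_mul _ ?_
    refine intervalIntegral.tendsto_integral_filter_of_dominated_convergence (fun _ => 2 * C)
      ?_ ?_ (by simp) ?_
    · refine Eventually.of_forall fun s => Continuous.aestronglyMeasurable (by fun_prop)
    · filter_upwards [hC] with s hs
      refine Eventually.of_forall fun u hu => ?_
      rw [Set.uIoc_of_le (by norm_num)] at hu
      refine (norm_sub_le _ _).trans ?_
      have : |u| ≤ 1 := abs_le.2 ⟨hu.1.le, hu.2⟩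
      have h1 := hs (t + u) ((abs_add_le _ _).trans (by linarith))
      have h2 := hs t (by linarith)
      linarith
    · exact Eventually.of_forall fun u _ => (hpt (t + u)).sub (hpt t)
  refine h1.congr' ?_
  filter_upwards [hg] with s hs
  rw [charFun_sincTilt_map ρ hs]

theorem sincTilt_levyMeasure_Ioi_pos {α : ℝ} (h0 : 0 < α) :
    0 < sincTilt 1 (levyMeasure α) (Set.Ioi 0) := by
  rw [pos_iff_ne_zero, sincTilt, withDensity_apply _ measurableSet_Ioi, Ne,
    lintegral_eq_zero_iff (by fun_prop)]
  intro h
  have h1 : ∀ᵐ x ∂(levyMeasure α), False := by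
    have h2 := (ae_restrict_iff' measurableSet_Ioi).1 h
    filter_upwards [h2, ae_pos_levyMeasure α] with x hx hx0
    have := hx hx0
    simp only [div_one, Pi.zero_apply, ENNReal.ofReal_eq_zero] at this
    rw [Real.sinc_of_ne_zero hx0.ne'] at this
    have h3 := Real.sin_lt hx0
    have : Real.sin x / x < 1 := (div_lt_one hx0).2 h3
    linarith
  have h2 : levyMeasure α = 0 := by simpa [ae_iff] using h1
  have h3 := levyMeasure_Ioi h0 one_pos
  rw [h2] at h3
  simp at h3

theorem sincTilt_levyMeasure_Iic (c α : ℝ) :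
    sincTilt c (levyMeasure α) (Set.Iic 0) = 0 := by
  refine withDensity_absolutelyContinuous _ _ ?_
  have := ae_pos_levyMeasure α
  rw [ae_iff] at this
  convert this using 2
  ext x; simp

/-- Nonnegativity of the weights of a Lévy measure, from the positivity of a measure whose
characteristic function is the corresponding combination. -/
theorem weights_nonneg {Q N : Measure ℝ} [IsFiniteMeasure Q] [IsFiniteMeasure N]
    (hN : 0 < N (Set.Ioi 0)) (hN0 : N (Set.Iic 0) = 0) {p q : ℝ}
    (h : ∀ t, charFun Q t = p * charFun N t + q * charFun N (-t)) : 0 ≤ p ∧ 0 ≤ q := by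
  have hneg : ∀ t, charFun (N.map (fun x => -x)) t = charFun N (-t) := by
    intro t
    have := charFun_map_mul (μ := N) (-1) t
    simpa using this
  -- The negative parts of p and q are moved to the left, so that two genuine measures with equal
  -- characteristic functions are compared. A negative weight is then contradicted on the half-line
  -- where only that weight is visible.
  have hm : Q + ((-p).toNNReal • N + (-q).toNNReal • N.map (fun x => -x)) =
      p.toNNReal • N + q.toNNReal • N.map (fun x => -x) := by
    have hadd : ∀ (m₁ m₂ : Measure ℝ) [IsFiniteMeasure m₁] [IsFiniteMeasure m₂] t,
        charFun (m₁ + m₂) t = charFun m₁ t + charFun m₂ t := by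
      intro m₁ m₂ _ _ t
      simp only [charFun_apply_real]
      refine integral_add_measure ?_ ?_ <;>
      · refine Integrable.of_bound (by fun_prop) 1 (Eventually.of_forall fun x => ?_)
        rw [← Complex.ofReal_mul, Complex.norm_exp_ofReal_mul_I]
    apply Measure.ext_of_charFun
    ext t
    simp only [hadd, charFun_smul_nnreal, hneg, h]
    have e : ∀ r : ℝ, (r.toNNReal : ℂ) - ((-r).toNNReal : ℂ) = r := by
      intro r
      rcases le_total 0 r with hr | hr
      · rw [Real.toNNReal_of_nonpos (by linarith : -r ≤ 0)]
        simp [hr]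
      · rw [Real.toNNReal_of_nonpos hr]
        simp [hr]
    linear_combination (-charFun N t) * e p - charFun N (-t) * e q
  have hNn1 : (N.map (fun x => -x)) (Set.Ioi 0) = 0 := by
    rw [Measure.map_apply measurable_neg measurableSet_Ioi]
    refine measure_mono_null (fun x hx => ?_) hN0
    simp only [Set.mem_preimage, Set.mem_Ioi] at hx
    simp only [Set.mem_Iic]; linarith
  have hNn2 : (N.map (fun x => -x)) (Set.Iio 0) = N (Set.Ioi 0) := by
    rw [Measure.map_apply measurable_neg measurableSet_Iio]
    congr 1; ext x; simp
  have hN2 : N (Set.Iio 0) = 0 := measure_mono_null Set.Iio_subset_Iic_self hN0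
  constructor
  · by_contra! hp
    have := congrArg (fun m : Measure ℝ => m (Set.Ioi 0)) hm
    simp only [Measure.add_apply, Measure.smul_apply, hNn1, smul_zero, add_zero,
      Real.toNNReal_of_nonpos hp.le, zero_smul, Measure.coe_zero, Pi.zero_apply, add_eq_zero] at this
    have h2 := this.2
    simp only [ENNReal.smul_def, smul_eq_mul, mul_eq_zero, hN.ne', or_false,
      ENNReal.coe_eq_zero, Real.toNNReal_eq_zero] at h2
    linarith
  · by_contra! hp
    have := congrArg (fun m : Measure ℝ => m (Set.Iio 0)) hm
    simp only [Measure.add_apply, Measure.smul_apply, hNn2, hN2, smul_zero, zero_add,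
      Real.toNNReal_of_nonpos hp.le, zero_smul, Measure.coe_zero, Pi.zero_apply, add_eq_zero] at this
    have h2 := this.2
    simp only [ENNReal.smul_def, smul_eq_mul, mul_eq_zero, hN.ne', or_false,
      ENNReal.coe_eq_zero, Real.toNNReal_eq_zero] at h2
    linarith

/-! ### The Tauberian theorem for tails -/

/-- Piecewise linear function, `0` on `(-∞, a]` and `1` on `[b, ∞)`. -/
noncomputable def ramp (a b x : ℝ) : ℝ := max 0 (min 1 ((x - a) / (b - a)))

theorem ramp_nonneg (a b x : ℝ) : 0 ≤ ramp a b x := le_max_left _ _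

theorem ramp_le_one (a b x : ℝ) : ramp a b x ≤ 1 := max_le zero_le_one (min_le_left _ _)

theorem ramp_of_le {a b x : ℝ} (hab : a < b) (h : x ≤ a) : ramp a b x = 0 := by
  unfold ramp
  refine max_eq_left ((min_le_right _ _).trans ?_)
  exact div_nonpos_of_nonpos_of_nonneg (by linarith) (by linarith)

theorem ramp_of_ge {a b x : ℝ} (hab : a < b) (h : b ≤ x) : ramp a b x = 1 := by
  unfold ramp
  rw [min_eq_left, max_eq_right zero_le_one]
  rw [le_div_iff₀ (by linarith)]; linarith

theorem continuous_ramp (a b : ℝ) : Continuous (ramp a b) := by unfold ramp; fun_prop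

/-- Needed to divide a ramp by 1 - sinc and still have a bounded continuous test function:
compactness handles bounded x, and |sinc x| ≤ 1/|x| the rest. -/
theorem exists_pos_le_one_sub_sinc {a : ℝ} (ha : 0 < a) :
    ∃ c > 0, ∀ x, a ≤ x → c ≤ 1 - Real.sinc x := by
  obtain ⟨y, hy, hym⟩ := (isCompact_Icc (a := a) (b := max a 2)).exists_isMinOn
    ⟨a, le_rfl, le_max_left _ _⟩ (f := fun x => 1 - Real.sinc x) (by fun_prop)
  have hpos : ∀ x, 0 < x → 0 < 1 - Real.sinc x := by
    intro x hx
    rw [Real.sinc_of_ne_zero hx.ne']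
    have : Real.sin x / x < 1 := (div_lt_one hx).2 (Real.sin_lt hx)
    linarith
  refine ⟨min (1 - Real.sinc y) (1 / 2), lt_min (hpos y (ha.trans_le hy.1)) (by norm_num),
    fun x hx => ?_⟩
  rcases le_total x (max a 2) with h | h
  · exact (min_le_left _ _).trans (hym ⟨hx, h⟩)
  · refine (min_le_right _ _).trans ?_
    have h2 : 2 ≤ x := (le_max_right _ _).trans h
    have h3 := Real.sinc_le_inv_abs (x := x) (by linarith)
    rw [abs_of_nonneg (by linarith)] at h3
    have : x⁻¹ ≤ 2⁻¹ := by gcongr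
    linarith

theorem integral_ramp_levyMeasure {α : ℝ} (h0 : 0 < α) {a b : ℝ} (ha : 0 < a) (hab : a < b) :
    b ^ (-α) ≤ ∫ x, ramp a b x ∂(levyMeasure α) ∧ ∫ x, ramp a b x ∂(levyMeasure α) ≤ a ^ (-α) := by
  have hfin : ∀ c, 0 < c → levyMeasure α (Set.Ioi c) ≠ ⊤ := by
    intro c hc h
    have := levyMeasure_Ioi h0 hc
    rw [measureReal_def, h] at this
    simp only [ENNReal.toReal_top] at this
    exact (Real.rpow_pos_of_pos hc _).ne this
  have hind : ∀ c, 0 < c →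
      Integrable ((Set.Ioi c).indicator (1 : ℝ → ℝ)) (levyMeasure α) := fun c hc =>
    (integrable_indicator_iff measurableSet_Ioi).2
      (integrableOn_const (hfin c hc))
  have hle : ∀ x, ramp a b x ≤ (Set.Ioi a).indicator (1 : ℝ → ℝ) x := by
    intro x
    by_cases hx : a < x
    · simp [Set.indicator, hx, ramp_le_one]
    · simp [Set.indicator, hx, ramp_of_le hab (not_lt.1 hx)]
  have hge : ∀ x, (Set.Ioi b).indicator (1 : ℝ → ℝ) x ≤ ramp a b x := by
    intro x
    by_cases hx : b < x
    · simp [Set.indicator, hx, ramp_of_ge hab hx.le]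
    · simp [Set.indicator, hx, ramp_nonneg]
  have hri : Integrable (ramp a b) (levyMeasure α) := by
    refine (hind a ha).mono' (continuous_ramp a b).aestronglyMeasurable
      (Eventually.of_forall fun x => ?_)
    rw [Real.norm_of_nonneg (ramp_nonneg _ _ _)]
    exact hle x
  rw [← levyMeasure_Ioi h0 ha, ← levyMeasure_Ioi h0 (ha.trans hab),
    ← integral_indicator_one measurableSet_Ioi, ← integral_indicator_one measurableSet_Ioi]
  exact ⟨integral_mono (hind b (ha.trans hab)) hri hge, integral_mono hri (hind a ha) hle⟩

theorem continuous_charFun_finite (m : Measure ℝ) [IsFiniteMeasure m] : Continuous (charFun m) := by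
  fun_prop

/-- Tauberian theorem: tails from the behaviour of the characteristic function at zero. -/
theorem upperTail_of_charFun (ρ : Measure ℝ) [IsProbabilityMeasure ρ] {α p q : ℝ}
    {g : ℝ → ℝ} {w : ℂ} {b : ℝ → ℝ} (h0 : 0 < α) (h2 : α < 2) (hpq : 0 < p + q)
    (hg : ∀ᶠ s in 𝓝[>] 0, 0 < g s)
    (hF : Tendsto (fun s => (1 - charFun ρ s) / (g s : ℂ)) (𝓝[>] 0) (𝓝 w))
    (hr : ∀ t : ℝ, 0 < t → Tendsto (fun s => g (t * s) / g s) (𝓝[>] 0) (𝓝 (t ^ α)))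
    (hmono : ∃ δ > 0, MonotoneOn g (Set.Ioo 0 δ))
    (hb : Integrable b (levyMeasure α))
    (hKb : ∀ M : ℝ, ∃ C : ℝ, ∀ t, |t| ≤ M → ∀ x, 0 < x → ‖levyKernel p q t x‖ ≤ C * b x)
    (hψ : ∀ t, 0 < t → ∫ x, levyKernel p q t x ∂(levyMeasure α) = w * (t ^ α : ℝ)) :
    0 ≤ p ∧ 0 ≤ q ∧ Tendsto (fun s => ρ.real (Set.Ioi s⁻¹) / g s) (𝓝[>] 0) (𝓝 p) := by
  set N := sincTilt 1 (levyMeasure α) with hN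
  have hNf : IsFiniteMeasure N :=
    isFiniteMeasure_sincTilt 1 (integrable_one_sub_sinc_levyMeasure h0 h2)
  set χ : ℝ → ℂ := fun t => p * charFun N t + q * charFun N (-t) with hχ
  have hlim : ∀ t, Tendsto (fun s => charFun (sincTilt (g s) (ρ.map (s * ·))) t) (𝓝[>] 0)
      (𝓝 (χ t)) := by
    intro t
    have := tendsto_charFun_sincTilt ρ (ψ := fun t => ∫ x, levyKernel p q t x ∂(levyMeasure α))
      hg hF hr hmono hψ (by simp [levyKernel]) (by
        intro t
        rw [← integral_conj]
        simp only [levyKernel_neg]) t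
    rw [half_integral_levyKernel_sub h0 h2 hb hKb] at this
    exact this
  have hχc : ContinuousAt χ 0 := by
    have := continuous_charFun_finite N
    fun_prop
  have hNpos := sincTilt_levyMeasure_Ioi_pos h0
  have hχ0 : 0 < (χ 0).re := by
    have : χ 0 = ((p + q) * N.real Set.univ : ℝ) := by
      simp [hχ, charFun_zero]; ring
    rw [this, Complex.ofReal_re]
    refine mul_pos hpq ?_
    rw [measureReal_def]
    exact ENNReal.toReal_pos (hNpos.trans_le (measure_mono (Set.subset_univ _))).ne'
      (measure_ne_top _ _)
  have hfin : ∀ s, IsFiniteMeasure (sincTilt (g s) (ρ.map (s * ·))) := fun s => by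
    have : IsFiniteMeasure (ρ.map (s * ·)) := inferInstance
    exact isFiniteMeasure_sincTilt _ (integrable_one_sub_sinc _)
  let T : ℝ → FiniteMeasure ℝ := fun s => ⟨_, hfin s⟩
  have hT : ∀ s, (T s : Measure ℝ) = sincTilt (g s) (ρ.map (s * ·)) := fun s => rfl
  -- The continuity theorem is about sequences, so the limit s → 0+ is tested along arbitrary
  -- sequences; the limiting transform χ does not depend on the sequence.
  have hseq : ∀ x : ℕ → ℝ, Tendsto x atTop (𝓝[>] 0) → ∃ Q : FiniteMeasure ℝ,
      (∀ t, charFun (Q : Measure ℝ) t = χ t) ∧ Tendsto (fun n => T (x n)) atTop (𝓝 Q) := fun x hx =>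
    exists_finiteMeasure_of_tendsto_charFun hχc hχ0 (fun t => (hlim t).comp hx)
  obtain ⟨x₀, hx₀⟩ := exists_seq_tendsto (𝓝[>] (0 : ℝ))
  obtain ⟨Q, hQ, -⟩ := hseq x₀ hx₀
  obtain ⟨hp, hq⟩ := weights_nonneg hNpos (sincTilt_levyMeasure_Iic 1 α) hQ
  refine ⟨hp, hq, tendsto_of_seq_tendsto fun x hx => ?_⟩
  obtain ⟨Q', hQ', hconv⟩ := hseq x hx
  -- By uniqueness of transforms the weak limit is the tilted Lévy measure with weight p on the
  -- right and its reflection with weight q on the left.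
  have hQQ : (Q' : Measure ℝ) = p.toNNReal • N + q.toNNReal • N.map (fun x => -x) := by
    apply Measure.ext_of_charFun
    ext t
    have hneg : charFun (N.map (fun x => -x)) t = charFun N (-t) := by
      have := charFun_map_mul (μ := N) (-1) t
      simpa using this
    have hadd : ∀ (m₁ m₂ : Measure ℝ) [IsFiniteMeasure m₁] [IsFiniteMeasure m₂],
        charFun (m₁ + m₂) t = charFun m₁ t + charFun m₂ t := by
      intro m₁ m₂ _ _
      simp only [charFun_apply_real]
      refine integral_add_measure ?_ ?_ <;>
      · refine Integrable.of_bound (by fun_prop) 1 (Eventually.of_forall fun x => ?_)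
        rw [← Complex.ofReal_mul, Complex.norm_exp_ofReal_mul_I]
    rw [hQ', hadd, charFun_smul_nnreal, charFun_smul_nnreal, hneg, hχ]
    simp [hp, hq]
  rw [FiniteMeasure.tendsto_iff_forall_integral_tendsto] at hconv
  -- the ramp test functions
  have hramp : ∀ a b, 0 < a → a < b → Tendsto (fun n => (∫ y, ramp a b (x n * y) ∂ρ) / g (x n))
      atTop (𝓝 (p * ∫ y, ramp a b y ∂(levyMeasure α))) := by
    intro a b ha hab
    obtain ⟨c, hc, hcs⟩ := exists_pos_le_one_sub_sinc ha
    -- Dividing by 1 - sinc undoes the tilt. The maximum with c keeps the quotient continuous and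
    -- bounded on the whole line and changes nothing where the ramp is nonzero.
    let h : BoundedContinuousFunction ℝ ℝ := BoundedContinuousFunction.ofNormedAddCommGroup
      (fun y => ramp a b y / max (1 - Real.sinc y) c)
      ((continuous_ramp a b).div (by fun_prop)
        (fun y => (hc.trans_le (le_max_right _ _)).ne')) (1 / c) (fun y => by
          rw [Real.norm_of_nonneg (div_nonneg (ramp_nonneg _ _ _) (hc.le.trans (le_max_right _ _)))]
          exact div_le_div₀ zero_le_one (ramp_le_one _ _ _) hc (le_max_right _ _))
    have hmul : ∀ y, (1 - Real.sinc y) * h y = ramp a b y := by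
      intro y
      change (1 - Real.sinc y) * (ramp a b y / max (1 - Real.sinc y) c) = ramp a b y
      rcases le_total y a with hy | hy
      · simp [ramp_of_le hab hy]
      · have := hcs y hy
        rw [max_eq_left this]
        have : 0 < 1 - Real.sinc y := hc.trans_le this
        field_simp
    have h1 := hconv h
    have h2 : ∫ y, h y ∂(Q' : Measure ℝ) = p * ∫ y, ramp a b y ∂(levyMeasure α) := by
      have hz : ∫ y, h y ∂(N.map (fun x => -x)) = 0 := by
        refine integral_eq_zero_of_ae ?_
        have : ∀ᵐ y ∂(N.map (fun x => -x)), y ≤ a := by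
          rw [ae_map_iff (by fun_prop) measurableSet_Iic]
          have h3 : ∀ᵐ y ∂N, 0 < y :=
            (withDensity_absolutelyContinuous _ _).ae_le (ae_pos_levyMeasure α)
          filter_upwards [h3] with y hy
          linarith
        filter_upwards [this] with y hy
        change ramp a b y / max (1 - Real.sinc y) c = 0
        simp [ramp_of_le hab hy]
      rw [hQQ, integral_add_measure (h.integrable _) (h.integrable _), integral_smul_nnreal_measure,
        integral_smul_nnreal_measure, hz, smul_zero, add_zero, hN, integral_sincTilt _ one_pos]
      simp only [div_one, smul_eq_mul, hmul, NNReal.smul_def, Real.coe_toNNReal _ hp]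
    rw [h2] at h1
    refine h1.congr' ?_
    filter_upwards [hx.eventually hg] with n hn
    rw [hT, integral_sincTilt _ hn]
    have h3 : ∀ y, ((1 - Real.sinc y) / g (x n)) • h y = ramp a b y / g (x n) := by
      intro y; rw [← hmul y, smul_eq_mul]; ring
    simp only [h3]
    rw [integral_div, integral_map (by fun_prop) (continuous_ramp a b).aestronglyMeasurable]
  have hri : ∀ a b s, Integrable (fun y => ramp a b (s * y)) ρ := fun a b s => by
    refine Integrable.of_bound ((continuous_ramp a b).comp (by fun_prop)).aestronglyMeasurable 1
      (Eventually.of_forall fun y => ?_)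
    rw [Real.norm_of_nonneg (ramp_nonneg _ _ _)]
    exact ramp_le_one _ _ _
  have hup : ∀ a s, a < 1 → 0 < s → ρ.real (Set.Ioi s⁻¹) ≤ ∫ y, ramp a 1 (s * y) ∂ρ := by
    intro a s ha hs
    rw [← integral_indicator_one measurableSet_Ioi]
    refine integral_mono ((integrable_const 1).indicator measurableSet_Ioi) (hri a 1 s) fun y => ?_
    by_cases hy : s⁻¹ < y
    · have : 1 ≤ s * y := by
        have := mul_le_mul_of_nonneg_left hy.le hs.le
        rwa [mul_inv_cancel₀ hs.ne'] at this
      simp [Set.indicator, hy, ramp_of_ge ha this]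
    · simp [Set.indicator, hy, ramp_nonneg]
  have hlow : ∀ b s, 1 < b → 0 < s → ∫ y, ramp 1 b (s * y) ∂ρ ≤ ρ.real (Set.Ioi s⁻¹) := by
    intro b s hb' hs
    rw [← integral_indicator_one measurableSet_Ioi]
    refine integral_mono (hri 1 b s) ((integrable_const 1).indicator measurableSet_Ioi) fun y => ?_
    by_cases hy : s⁻¹ < y
    · simp [Set.indicator, hy, ramp_le_one]
    · have : s * y ≤ 1 := by
        have := mul_le_mul_of_nonneg_left (not_lt.1 hy) hs.le
        rwa [mul_inv_cancel₀ hs.ne'] at this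
      simp [Set.indicator, hy, ramp_of_le hb' this]
  have hxpos : ∀ᶠ n in atTop, 0 < x n := hx.eventually self_mem_nhdsWithin
  have hcontp : Tendsto (fun c : ℝ => p * c ^ (-α)) (𝓝 1) (𝓝 p) := by
    have : ContinuousAt (fun c : ℝ => p * c ^ (-α)) 1 :=
      (Real.continuousAt_rpow_const 1 (-α) (Or.inl one_ne_zero)).const_mul p
    simpa [ContinuousAt] using this
  -- The indicator of (1/s, ∞) lies between the rescaled ramps on [1, c] for c > 1 and on [c, 1] for
  -- c < 1; both bounds tend to p as c → 1 because c^{-α} is continuous at 1.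
  refine tendsto_order.2 ⟨fun r hrp => ?_, fun r hrp => ?_⟩
  · have h3 := (hcontp.mono_left nhdsWithin_le_nhds : Tendsto _ (𝓝[>] (1 : ℝ)) _).eventually
      (eventually_gt_nhds hrp)
    obtain ⟨c, hc, hc1⟩ := (h3.and self_mem_nhdsWithin).exists
    have hc1 : 1 < c := hc1
    have h4 := (integral_ramp_levyMeasure h0 one_pos hc1).1
    have h5 := (hramp 1 c one_pos hc1).eventually (eventually_gt_nhds (b := r)
      (hc.trans_le (mul_le_mul_of_nonneg_left h4 hp)))
    filter_upwards [h5, hxpos, hx.eventually hg] with n h6 h7 h8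
    refine h6.trans_le ?_
    exact div_le_div_of_nonneg_right (hlow c _ hc1 h7) h8.le
  · have h3 := (hcontp.mono_left nhdsWithin_le_nhds : Tendsto _ (𝓝[<] (1 : ℝ)) _).eventually
      (eventually_lt_nhds hrp)
    obtain ⟨c, ⟨hc, hc1⟩, hc0⟩ := ((h3.and self_mem_nhdsWithin).and
      ((eventually_gt_nhds zero_lt_one).filter_mono nhdsWithin_le_nhds)).exists
    have hc1 : c < 1 := hc1
    have h4 := (integral_ramp_levyMeasure h0 hc0 hc1).2
    have h5 := (hramp c 1 hc0 hc1).eventually (eventually_lt_nhds (b := r)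
      ((mul_le_mul_of_nonneg_left h4 hp).trans_lt hc))
    filter_upwards [h5, hxpos, hx.eventually hg] with n h6 h7 h8
    refine lt_of_le_of_lt ?_ h6
    exact div_le_div_of_nonneg_right (hup c _ hc1 h7) h8.le

/-! ### Explicit integrals against the Lévy measure -/

theorem norm_one_sub_exp_neg_le {z : ℂ} (hz : 0 ≤ z.re) :
    ‖1 - Complex.exp (-z)‖ ≤ 2 * min 1 ‖z‖ := by
  have h1 : ‖Complex.exp (-z)‖ ≤ 1 := by
    rw [Complex.norm_exp]; simpa using hz
  rcases le_total ‖z‖ 1 with h | h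
  · rw [min_eq_right h]
    have := Complex.norm_exp_sub_one_le (x := -z) (by simpa using h)
    rw [← norm_neg, neg_sub]
    simpa using this
  · rw [min_eq_left h]
    refine (norm_sub_le _ _).trans ?_
    simp only [norm_one]; linarith

theorem min_one_mul_le {c x : ℝ} (hx : 0 ≤ x) (hc : 0 ≤ c) :
    min 1 (c * x) ≤ (c + 1) * min 1 x := by
  rcases le_total x 1 with h | h
  · rw [min_eq_right h]; exact (min_le_right _ _).trans (by nlinarith)
  · rw [min_eq_left h]; exact (min_le_left _ _).trans (by nlinarith)

theorem integrable_min_levyMeasure {α : ℝ} (h0 : 0 < α) (h1 : α < 1) :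
    Integrable (fun x => min 1 x) (levyMeasure α) := by
  simpa using integrable_min_rpow_levyMeasure h0 h1

/-- Integration by parts against -x^{-α} turns the integral into r ∫ x^{-α} exp(-r x) dx, a Gamma
integral. Both boundary terms vanish because 0 < α < 1. -/
theorem integral_one_sub_exp_neg_levyMeasure_real {α : ℝ} (h0 : 0 < α) (h1 : α < 1) {r₀ : ℝ}
    (hr₀ : 0 < r₀) :
    ∫ x : ℝ, (1 - Complex.exp (-(r₀ * x))) ∂(levyMeasure α) =
      Complex.Gamma (1 - α) * (r₀ : ℂ) ^ (α : ℂ) := by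
  obtain ⟨r, hrr⟩ : ∃ r : ℂ, r = r₀ := ⟨_, rfl⟩
  have hr : 0 < r.re := by simpa [hrr] using hr₀
  rw [← hrr]
  have hr0 : r ≠ 0 := by rintro rfl; simp at hr
  have hint : Integrable (fun x : ℝ => 1 - Complex.exp (-(r * x))) (levyMeasure α) := by
    refine ((integrable_min_levyMeasure h0 h1).const_mul (2 * (‖r‖ + 1))).mono'
      (by fun_prop) ?_
    filter_upwards [ae_pos_levyMeasure α] with x hx
    refine (norm_one_sub_exp_neg_le (z := r * x) (by simp; positivity)).trans ?_
    rw [norm_mul, Complex.norm_real, Real.norm_of_nonneg hx.le, mul_assoc]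
    gcongr
    exact min_one_mul_le hx.le (norm_nonneg _)
  rw [integral_levyMeasure h0.le]
  rw [integrable_levyMeasure_iff h0.le] at hint
  have hu : ∀ x ∈ Set.Ioi (0 : ℝ), HasDerivAt (fun x : ℝ => 1 - Complex.exp (-(r * x)))
      (r * Complex.exp (-(r * x))) x := by
    intro x _
    have h1 : HasDerivAt (fun x : ℝ => -(r * (x : ℂ))) (-r) x := by
      have h2 := ((Complex.ofRealCLM.hasDerivAt (x := x)).const_mul r).neg
      rw [Complex.ofRealCLM_apply, Complex.ofReal_one, mul_one] at h2
      exact h2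
    have := (h1.cexp).const_sub 1
    exact this.congr_deriv (by ring)
  have hv : ∀ x ∈ Set.Ioi (0 : ℝ), HasDerivAt (fun x : ℝ => (-(x ^ (-α)) : ℝ) : ℝ → ℂ)
      ((α * x ^ (-1 - α) : ℝ) : ℂ) x := by
    intro x hx
    have h1 := ((Real.hasDerivAt_rpow_const (x := x) (p := -α) (Or.inl (ne_of_gt hx))).neg).ofReal_comp
    refine h1.congr_deriv ?_
    rw [show -α - 1 = -1 - α by ring]; push_cast; ring
  have hnormexp : ∀ x : ℝ, ‖Complex.exp (-(r * x))‖ = Real.exp (-r.re * x) := by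
    intro x; rw [Complex.norm_exp]; simp
  have huv' : IntegrableOn ((fun x : ℝ => 1 - Complex.exp (-(r * x))) *
      fun x : ℝ => ((α * x ^ (-1 - α) : ℝ) : ℂ)) (Set.Ioi 0) := by
    refine hint.congr (Eventually.of_forall fun x => ?_)
    simp only [Complex.real_smul, Pi.mul_apply]; ring
  have hu'v : IntegrableOn ((fun x : ℝ => r * Complex.exp (-(r * x))) *
      fun x : ℝ => ((-(x ^ (-α)) : ℝ) : ℂ)) (Set.Ioi 0) := by
    have h2 := (integrableOn_rpow_mul_exp_neg_mul_rpow (s := -α) (p := 1) (b := r.re)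
      (by linarith) one_pos hr).const_mul ‖r‖
    refine h2.mono' (by fun_prop) ?_
    filter_upwards [ae_restrict_mem measurableSet_Ioi] with x hx
    have hx : 0 < x := hx
    simp only [Pi.mul_apply, norm_mul, hnormexp, Complex.norm_real, norm_neg, Real.rpow_one]
    rw [Real.norm_of_nonneg (by positivity)]
    apply le_of_eq; ring
  have hz : Tendsto ((fun x : ℝ => 1 - Complex.exp (-(r * x))) *
      fun x : ℝ => ((-(x ^ (-α)) : ℝ) : ℂ)) (𝓝[>] 0) (𝓝 0) := by
    have hlim : Tendsto (fun x : ℝ => 2 * ‖r‖ * x ^ (1 - α)) (𝓝[>] 0) (𝓝 0) := by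
      have : ContinuousAt (fun x : ℝ => 2 * ‖r‖ * x ^ (1 - α)) 0 :=
        (Real.continuousAt_rpow_const 0 (1 - α) (Or.inr (by linarith))).const_mul _
      have h3 : Tendsto _ _ _ := this
      simp only [Real.zero_rpow (show 1 - α ≠ 0 by linarith), mul_zero] at h3
      exact h3.mono_left nhdsWithin_le_nhds
    refine squeeze_zero_norm' ?_ hlim
    filter_upwards [self_mem_nhdsWithin] with x hx
    have hx : 0 < x := hx
    have h4 := norm_one_sub_exp_neg_le (z := r * x) (by simp; positivity)
    rw [norm_mul, Complex.norm_real, Real.norm_of_nonneg hx.le] at h4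
    simp only [Pi.mul_apply, norm_mul, Complex.norm_real, norm_neg]
    rw [Real.norm_of_nonneg (by positivity : 0 ≤ x ^ (-α))]
    calc _ ≤ 2 * (‖r‖ * x) * x ^ (-α) := by
          gcongr; exact h4.trans (by gcongr; exact min_le_right _ _)
      _ = 2 * ‖r‖ * x ^ (1 - α) := by
          rw [show 1 - α = 1 + -α by ring, Real.rpow_add hx, Real.rpow_one]; ring
  have hinf : Tendsto ((fun x : ℝ => 1 - Complex.exp (-(r * x))) *
      fun x : ℝ => ((-(x ^ (-α)) : ℝ) : ℂ)) atTop (𝓝 0) := by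
    have hlim : Tendsto (fun x : ℝ => 2 * x ^ (-α)) atTop (𝓝 0) := by
      simpa using (tendsto_rpow_neg_atTop h0).const_mul 2
    refine squeeze_zero_norm' ?_ hlim
    filter_upwards [eventually_gt_atTop 0] with x hx
    have h4 := norm_one_sub_exp_neg_le (z := r * x) (by simp; positivity)
    simp only [Pi.mul_apply, norm_mul, Complex.norm_real, norm_neg]
    rw [Real.norm_of_nonneg (by positivity : 0 ≤ x ^ (-α))]
    gcongr
    exact h4.trans (by linarith [min_le_left 1 ‖r * (x : ℂ)‖])
  have key := integral_Ioi_mul_deriv_eq_deriv_mul hu hv huv' hu'v hz hinf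
  have e1 : ∫ x in Set.Ioi (0 : ℝ), (α * x ^ (-1 - α)) • (1 - Complex.exp (-(r * x))) =
      ∫ x in Set.Ioi (0 : ℝ), (1 - Complex.exp (-(r * x))) * ((α * x ^ (-1 - α) : ℝ) : ℂ) := by
    refine integral_congr_ae (Eventually.of_forall fun x => ?_)
    simp only [Complex.real_smul]; ring
  rw [e1, key]
  have e2 : ∫ x in Set.Ioi (0 : ℝ), r * Complex.exp (-(r * x)) * ((-(x ^ (-α)) : ℝ) : ℂ) =
      -r * ∫ x in Set.Ioi (0 : ℝ), (x : ℂ) ^ ((1 - α : ℂ) - 1) * Complex.exp (-(r * x)) := by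
    rw [← integral_const_mul]
    refine setIntegral_congr_fun measurableSet_Ioi fun x hx => ?_
    have hx : 0 < x := hx
    rw [show (1 - (α : ℂ) - 1) = ((-α : ℝ) : ℂ) by push_cast; ring, ← Complex.ofReal_cpow hx.le]
    push_cast; ring
  rw [e2, hrr, Complex.integral_cpow_mul_exp_neg_mul_Ioi (by simp; linarith) hr₀, ← hrr]
  have hne : r.arg ≠ Real.pi := by
    intro h
    rw [Complex.arg_eq_pi_iff] at h
    linarith [h.1]
  rw [one_div, Complex.inv_cpow _ _ hne, Complex.cpow_sub _ _ hr0, Complex.cpow_one]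
  have : r ^ (α : ℂ) ≠ 0 := by simp [Complex.cpow_eq_zero_iff, hr0]
  field_simp
  ring

/-- Both sides are holomorphic in r on the right half-plane and agree for real r > 0, so the
identity theorem applies. -/
theorem integral_one_sub_exp_neg_levyMeasure {α : ℝ} (h0 : 0 < α) (h1 : α < 1) {r : ℂ}
    (hr : 0 < r.re) :
    ∫ x : ℝ, (1 - Complex.exp (-(r * x))) ∂(levyMeasure α) =
      Complex.Gamma (1 - α) * r ^ (α : ℂ) := by
  set U : Set ℂ := {z | 0 < z.re} with hU
  have hUo : IsOpen U := isOpen_lt continuous_const Complex.continuous_re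
  have hint : ∀ r ∈ U, Integrable (fun x : ℝ => 1 - Complex.exp (-(r * x))) (levyMeasure α) := by
    intro r hr
    have hr : 0 < r.re := hr
    refine ((integrable_min_levyMeasure h0 h1).const_mul (2 * (‖r‖ + 1))).mono'
      (by fun_prop) ?_
    filter_upwards [ae_pos_levyMeasure α] with x hx
    refine (norm_one_sub_exp_neg_le (z := r * x) (by simp; positivity)).trans ?_
    rw [norm_mul, Complex.norm_real, Real.norm_of_nonneg hx.le, mul_assoc]
    gcongr
    exact min_one_mul_le hx.le (norm_nonneg _)
  have hd : DifferentiableOn ℂ (fun r : ℂ => ∫ x : ℝ, (1 - Complex.exp (-(r * x)))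
      ∂(levyMeasure α)) U := by
    intro r hr
    have hr' : 0 < r.re := hr
    have hbi : Integrable (fun x : ℝ => x * Real.exp (-(r.re / 2) * x)) (levyMeasure α) := by
      rw [integrable_levyMeasure_iff h0.le]
      have h2 := (integrableOn_rpow_mul_exp_neg_mul_rpow (s := -α) (p := 1) (b := r.re / 2)
        (by linarith) one_pos (by linarith)).const_mul α
      refine IntegrableOn.congr_fun h2 (fun x hx => ?_) measurableSet_Ioi
      have hx : 0 < x := hx
      simp only [Real.rpow_one, smul_eq_mul]
      rw [show -α = (-1 - α) + 1 by ring, Real.rpow_add hx, Real.rpow_one]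
      ring
    have hs : {z : ℂ | r.re / 2 < z.re} ∈ 𝓝 r :=
      (isOpen_lt continuous_const Complex.continuous_re).mem_nhds
        (show r.re / 2 < r.re by linarith)
    have := (hasDerivAt_integral_of_dominated_loc_of_deriv_le (μ := levyMeasure α)
      (F := fun (r : ℂ) (x : ℝ) => 1 - Complex.exp (-(r * x)))
      (F' := fun (r : ℂ) (x : ℝ) => x * Complex.exp (-(r * x)))
      (x₀ := r) hs (Eventually.of_forall fun z => by fun_prop) (hint r hr) (by fun_prop)
      (bound := fun x : ℝ => x * Real.exp (-(r.re / 2) * x)) ?_ hbi ?_).2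
    · exact this.differentiableAt.differentiableWithinAt
    · filter_upwards [ae_pos_levyMeasure α] with x hx z hz
      have hz : r.re / 2 < z.re := hz
      rw [norm_mul, Complex.norm_exp, Complex.norm_real, Real.norm_of_nonneg hx.le]
      gcongr
      simp only [Complex.neg_re, Complex.mul_re, Complex.ofReal_re, Complex.ofReal_im, mul_zero,
        sub_zero]
      nlinarith
    · refine Eventually.of_forall fun x z _ => ?_
      have h3 : HasDerivAt (fun z : ℂ => -(z * (x : ℂ))) (-(x : ℂ)) z := by
        have h4 := ((hasDerivAt_id z).mul_const (x : ℂ)).neg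
        rw [one_mul] at h4
        exact h4
      exact (h3.cexp.const_sub 1).congr_deriv (by ring)
  have hd2 : DifferentiableOn ℂ (fun r : ℂ => Complex.Gamma (1 - α) * r ^ (α : ℂ)) U := by
    intro r hr
    have : r ∈ Complex.slitPlane := Or.inl hr
    exact ((differentiableAt_id.cpow_const this).const_mul _).differentiableWithinAt
  have hconn : IsPreconnected U := (convex_halfSpace_re_gt 0).isPreconnected
  have hfreq : ∃ᶠ z in 𝓝[≠] (1 : ℂ), ∫ x : ℝ, (1 - Complex.exp (-(z * x))) ∂(levyMeasure α) =
      Complex.Gamma (1 - α) * z ^ (α : ℂ) := by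
    have ht : Tendsto (fun x : ℝ => (x : ℂ)) (𝓝[≠] 1) (𝓝[≠] 1) := by
      refine tendsto_nhdsWithin_iff.2 ⟨?_, ?_⟩
      · have := Complex.continuous_ofReal.tendsto 1
        rw [Complex.ofReal_one] at this
        exact this.mono_left nhdsWithin_le_nhds
      · filter_upwards [self_mem_nhdsWithin] with x hx
        simpa using hx
    refine ht.frequently (Eventually.frequently ?_)
    filter_upwards [(eventually_gt_nhds (zero_lt_one (α := ℝ))).filter_mono nhdsWithin_le_nhds]
      with x hx using integral_one_sub_exp_neg_levyMeasure_real h0 h1 hx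
  exact (hd.analyticOnNhd hUo).eqOn_of_preconnected_of_frequently_eq (hd2.analyticOnNhd hUo) hconn
    (show (1 : ℂ) ∈ U by simp [hU]) hfreq hr

/-- Boundary value of the half-plane formula: let r = ε - i t with ε → 0+. The principal power of -i
t supplies the phase -πα/2. -/
theorem integral_one_sub_exp_mul_I_levyMeasure {α : ℝ} (h0 : 0 < α) (h1 : α < 1) {t : ℝ}
    (ht : 0 < t) :
    ∫ x : ℝ, (1 - Complex.exp (t * x * Complex.I)) ∂(levyMeasure α) =
      Real.Gamma (1 - α) * Complex.exp (-(Real.pi * α / 2 : ℝ) * Complex.I) * (t ^ α : ℝ) := by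
  have hL : Tendsto (fun ε : ℝ => ∫ x : ℝ, (1 - Complex.exp (-((ε - t * Complex.I) * x)))
      ∂(levyMeasure α)) (𝓝[>] 0)
      (𝓝 (∫ x : ℝ, (1 - Complex.exp (-(((0 : ℝ) - t * Complex.I) * x))) ∂(levyMeasure α))) := by
    refine tendsto_integral_filter_of_dominated_convergence
      (fun x => 2 * (1 + t + 1) * min 1 x) (Eventually.of_forall fun ε => by fun_prop) ?_
      ((integrable_min_levyMeasure h0 h1).const_mul _) ?_
    · filter_upwards [self_mem_nhdsWithin,
        (eventually_lt_nhds zero_lt_one).filter_mono nhdsWithin_le_nhds] with ε hε hε1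
      have hε : 0 < ε := hε
      filter_upwards [ae_pos_levyMeasure α] with x hx
      refine (norm_one_sub_exp_neg_le (by simp; positivity)).trans ?_
      rw [norm_mul, Complex.norm_real, Real.norm_of_nonneg hx.le, mul_assoc]
      gcongr
      refine (min_one_mul_le hx.le (norm_nonneg _)).trans ?_
      have hm : 0 ≤ min 1 x := le_min zero_le_one hx.le
      gcongr
      refine (norm_sub_le _ _).trans ?_
      rw [norm_mul, Complex.norm_I, Complex.norm_real, Complex.norm_real,
        Real.norm_of_nonneg hε.le, Real.norm_of_nonneg ht.le]
      linarith
    · refine Eventually.of_forall fun x => Tendsto.mono_left ?_ nhdsWithin_le_nhds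
      have : Continuous fun ε : ℝ => 1 - Complex.exp (-((ε - t * Complex.I) * x)) := by fun_prop
      exact this.tendsto 0
  have hR : Tendsto (fun ε : ℝ => Complex.Gamma (1 - α) * (ε - t * Complex.I) ^ (α : ℂ))
      (𝓝[>] 0) (𝓝 (Complex.Gamma (1 - α) * ((0 : ℝ) - t * Complex.I) ^ (α : ℂ))) := by
    refine Tendsto.const_mul _ (Tendsto.mono_left ?_ nhdsWithin_le_nhds)
    have h2 : ContinuousAt (fun ε : ℝ => ((ε : ℂ) - t * Complex.I)) 0 := by fun_prop
    exact (h2.cpow continuousAt_const (Or.inr (by simp; exact ht.ne'))).tendsto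
  have hLR := tendsto_nhds_unique (hL.congr' (by
    filter_upwards [self_mem_nhdsWithin] with ε hε
    exact integral_one_sub_exp_neg_levyMeasure h0 h1 (by simpa using hε))) hR
  have e1 : ∀ x : ℝ, -(((0 : ℝ) - t * Complex.I) * (x : ℂ)) = t * x * Complex.I := by
    intro x; push_cast; ring
  simp only [e1] at hLR
  rw [hLR]
  have e2 : ((0 : ℝ) - t * Complex.I : ℂ) = (t : ℂ) * (-Complex.I) := by push_cast; ring
  have ht0 : (t : ℂ) ≠ 0 := by exact_mod_cast ht.ne'
  rw [e2, Complex.cpow_def_of_ne_zero (by simp [ht.ne']), Complex.log_ofReal_mul ht (by simp),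
    Complex.log_neg_I, show (1 - (α : ℂ)) = ((1 - α : ℝ) : ℂ) by push_cast; rfl,
    Complex.Gamma_ofReal, add_mul, Complex.exp_add, Real.rpow_def_of_pos ht]
  push_cast
  rw [show -(Real.pi / 2 : ℂ) * Complex.I * α = -(Real.pi * α / 2 : ℂ) * Complex.I by ring]
  ring

theorem levyKernel_self (p t x : ℝ) :
    levyKernel p p t x = ((2 * p * (1 - Real.cos (t * x)) : ℝ) : ℂ) := by
  unfold levyKernel
  push_cast
  rw [Complex.cos]
  rw [neg_mul]
  ring

theorem one_sub_cos_nonneg (x : ℝ) : 0 ≤ 1 - Real.cos x := by linarith [Real.cos_le_one x]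

theorem one_sub_cos_le_min (t x : ℝ) :
    1 - Real.cos (t * x) ≤ (2 + t ^ 2) * min 1 (x ^ (2 : ℝ)) := by
  rw [Real.rpow_two]
  rcases le_total 1 (x ^ 2) with h | h
  · rw [min_eq_left h]; nlinarith [Real.neg_one_le_cos (t * x), sq_nonneg t]
  · rw [min_eq_right h]
    nlinarith [Real.one_sub_sq_div_two_le_cos (x := t * x), sq_nonneg x, sq_nonneg t,
      mul_nonneg (sq_nonneg x) (sq_nonneg t)]

theorem integrable_one_sub_cos_levyMeasure {α : ℝ} (h0 : 0 < α) (h2 : α < 2) (t : ℝ) :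
    Integrable (fun x => 1 - Real.cos (t * x)) (levyMeasure α) := by
  refine ((integrable_min_rpow_levyMeasure h0 h2).const_mul (2 + t ^ 2)).mono' (by fun_prop) ?_
  refine Eventually.of_forall fun x => ?_
  rw [Real.norm_of_nonneg (one_sub_cos_nonneg _)]
  exact one_sub_cos_le_min t x

theorem integral_one_sub_cos_levyMeasure_lt_one {α : ℝ} (h0 : 0 < α) (h1 : α < 1) {t : ℝ}
    (ht : 0 < t) :
    ∫ x, (1 - Real.cos (t * x)) ∂(levyMeasure α) =
      Real.Gamma (1 - α) * Real.cos (Real.pi * α / 2) * t ^ α := by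
  have h := congrArg Complex.re (integral_one_sub_exp_mul_I_levyMeasure h0 h1 ht)
  have e1 : ∀ x : ℝ, (1 - Complex.exp (t * x * Complex.I)).re = 1 - Real.cos (t * x) := by
    intro x
    rw [Complex.sub_re, Complex.one_re, ← Complex.ofReal_mul, Complex.exp_ofReal_mul_I_re]
  have hi : Integrable (fun x : ℝ => 1 - Complex.exp (t * x * Complex.I)) (levyMeasure α) := by
    refine ((integrable_min_levyMeasure h0 h1).const_mul (2 * (t + 1))).mono' (by fun_prop) ?_
    filter_upwards [ae_pos_levyMeasure α] with x hx
    have := norm_one_sub_exp_neg_le (z := -(t * x * Complex.I)) (by simp)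
    rw [neg_neg] at this
    refine this.trans ?_
    rw [norm_neg, norm_mul, norm_mul, Complex.norm_I, Complex.norm_real, Complex.norm_real,
      Real.norm_of_nonneg ht.le, Real.norm_of_nonneg hx.le, mul_one, mul_assoc]
    gcongr
    exact min_one_mul_le hx.le ht.le
  have h2 := integral_re hi
  simp only [RCLike.re_to_complex, e1] at h2
  rw [h2, h, ← Complex.ofReal_neg, mul_assoc, Complex.re_ofReal_mul, Complex.re_mul_ofReal,
    Complex.exp_ofReal_mul_I_re, Real.cos_neg, mul_assoc]

/-- The pole of Γ(1 - α) at α = 1 cancels the zero of the cosine: the product equals Γ(2 - α) (π/2)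
sinc(π(1 - α)/2). -/
theorem tendsto_Gamma_mul_cos :
    Tendsto (fun α : ℝ => Real.Gamma (1 - α) * Real.cos (Real.pi * α / 2)) (𝓝[<] 1)
      (𝓝 (Real.pi / 2)) := by
  have h1 : Tendsto (fun α : ℝ => Real.Gamma (1 - α + 1) *
      (Real.pi / 2 * Real.sinc (Real.pi / 2 * (1 - α)))) (𝓝[<] 1) (𝓝 (Real.pi / 2)) := by
    have h2 : ContinuousAt (fun α : ℝ => Real.Gamma (1 - α + 1) *
      (Real.pi / 2 * Real.sinc (Real.pi / 2 * (1 - α)))) 1 := by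
      refine ContinuousAt.mul ?_ (by fun_prop)
      refine ContinuousAt.comp (g := Real.Gamma) ?_ (by fun_prop)
      refine (Real.differentiableAt_Gamma fun m => ?_).continuousAt
      have : (0 : ℝ) ≤ m := m.cast_nonneg
      linarith
    have h3 := h2.tendsto
    simp only [sub_self, zero_add, Real.Gamma_one, mul_zero, Real.sinc_zero, one_mul, mul_one] at h3
    exact h3.mono_left nhdsWithin_le_nhds
  refine h1.congr' ?_
  filter_upwards [self_mem_nhdsWithin] with α hα
  have hα : α < 1 := hα
  have hne : 1 - α ≠ 0 := by linarith
  have hπ := Real.pi_pos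
  rw [Real.Gamma_add_one hne, Real.sinc_of_ne_zero (by positivity)]
  rw [show Real.pi / 2 * (1 - α) = Real.pi / 2 - Real.pi * α / 2 by ring, Real.sin_pi_div_two_sub,
    show Real.pi / 2 - Real.pi * α / 2 = Real.pi / 2 * (1 - α) by ring]
  field_simp

/-- Obtained by letting α increase to 1 in the formula for α < 1. The densities for α between 1/2
and 1 are dominated by the sum of the endpoint powers, and 1 - cos makes both integrable. -/
theorem integral_one_sub_cos_levyMeasure_one {t : ℝ} (ht : 0 < t) :
    ∫ x, (1 - Real.cos (t * x)) ∂(levyMeasure 1) = Real.pi / 2 * t := by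
  have hL : Tendsto (fun α : ℝ => ∫ x, (1 - Real.cos (t * x)) ∂(levyMeasure α)) (𝓝[<] 1)
      (𝓝 (∫ x, (1 - Real.cos (t * x)) ∂(levyMeasure 1))) := by
    have e : ∀ᶠ α : ℝ in 𝓝[<] 1, ∫ x in Set.Ioi 0, (α * x ^ (-1 - α)) • (1 - Real.cos (t * x)) =
        ∫ x, (1 - Real.cos (t * x)) ∂(levyMeasure α) := by
      filter_upwards [(eventually_gt_nhds (zero_lt_one (α := ℝ))).filter_mono nhdsWithin_le_nhds]
        with α hα using (integral_levyMeasure hα.le _).symm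
    rw [integral_levyMeasure zero_le_one]
    refine Tendsto.congr' e ?_
    have i1 := (integrable_levyMeasure_iff (by norm_num)).1
      (integrable_one_sub_cos_levyMeasure (α := 1 / 2) (by norm_num) (by norm_num) t)
    have i2 := (integrable_levyMeasure_iff (by norm_num)).1
      (integrable_one_sub_cos_levyMeasure (α := 1) (by norm_num) (by norm_num) t)
    refine tendsto_integral_filter_of_dominated_convergence _
      (Eventually.of_forall fun α => ?_) ?_ ((i1.const_mul 2).add i2) ?_
    · exact Measurable.aestronglyMeasurable (by fun_prop)
    · filter_upwards [(eventually_gt_nhds (b := (1 / 2 : ℝ)) (a := 1) (by norm_num)).filter_mono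
        nhdsWithin_le_nhds, self_mem_nhdsWithin] with α hα hα1
      have hα1 : α < 1 := hα1
      filter_upwards [ae_restrict_mem measurableSet_Ioi] with x hx
      have hx : 0 < x := hx
      have hc := one_sub_cos_nonneg (t * x)
      have hp : 0 ≤ x ^ (-1 - α) := by positivity
      rw [Real.norm_of_nonneg (smul_nonneg (by positivity) hc)]
      simp only [smul_eq_mul, Pi.add_apply]
      have h1 : α * x ^ (-1 - α) ≤ x ^ (-1 - α) := by nlinarith
      have h2 : x ^ (-1 - α) ≤ x ^ (-1 - (1 / 2) : ℝ) + x ^ (-1 - 1 : ℝ) := by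
        rcases le_total 1 x with h | h
        · exact (Real.rpow_le_rpow_of_exponent_le h (by linarith)).trans
            (le_add_of_nonneg_right (by positivity))
        · exact (Real.rpow_le_rpow_of_exponent_ge hx h (by linarith)).trans
            (le_add_of_nonneg_left (by positivity))
      calc α * x ^ (-1 - α) * (1 - Real.cos (t * x))
          ≤ (x ^ (-1 - (1 / 2) : ℝ) + x ^ (-1 - 1 : ℝ)) * (1 - Real.cos (t * x)) := by
            gcongr; exact h1.trans h2
        _ = _ := by ring
    · filter_upwards [ae_restrict_mem measurableSet_Ioi] with x hx
      have hx : 0 < x := hx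
      refine Tendsto.smul_const ?_ _
      have : ContinuousAt (fun α : ℝ => α * x ^ (-1 - α)) 1 := by
        refine continuousAt_id.mul (ContinuousAt.rpow continuousAt_const (by fun_prop) ?_)
        exact Or.inl hx.ne'
      exact this.tendsto.mono_left nhdsWithin_le_nhds
  have hR : Tendsto (fun α : ℝ => Real.Gamma (1 - α) * Real.cos (Real.pi * α / 2) * t ^ α) (𝓝[<] 1)
      (𝓝 (Real.pi / 2 * t ^ (1 : ℝ))) := by
    refine tendsto_Gamma_mul_cos.mul ?_
    exact ((Real.continuousAt_const_rpow ht.ne').tendsto).mono_left nhdsWithin_le_nhds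
  rw [Real.rpow_one] at hR
  refine tendsto_nhds_unique (hL.congr' ?_) hR
  filter_upwards [(eventually_gt_nhds (zero_lt_one (α := ℝ))).filter_mono nhdsWithin_le_nhds,
    self_mem_nhdsWithin] with α hα hα1
  exact integral_one_sub_cos_levyMeasure_lt_one hα hα1 ht

/-! ### Both tails from the Tauberian theorem -/

theorem charFun_map_neg (ρ : Measure ℝ) (s : ℝ) :
    charFun (ρ.map Neg.neg) s = (starRingEnd ℂ) (charFun ρ s) := by
  have : (Neg.neg : ℝ → ℝ) = fun x => (-1 : ℝ) * x := by ext; simp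
  rw [this, charFun_map_mul]
  simp [charFun_neg]

/-- The lower tail of X is the upper tail of -X; reflection conjugates the transform, which
exchanges the weights p and q in the kernel. -/
theorem tendsto_tails_of_charFun {Ω : Type*} [MeasurableSpace Ω] (μ : Measure Ω)
    [IsProbabilityMeasure μ] {X : Ω → ℝ} (hX : Measurable X) {α p q : ℝ}
    {g : ℝ → ℝ} {w : ℂ} {b : ℝ → ℝ} (h0 : 0 < α) (h2 : α < 2) (hpq : 0 < p + q)
    (hg : ∀ᶠ s in 𝓝[>] 0, 0 < g s)
    (hF : Tendsto (fun s => (1 - charFun (μ.map X) s) / (g s : ℂ)) (𝓝[>] 0) (𝓝 w))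
    (hr : ∀ t : ℝ, 0 < t → Tendsto (fun s => g (t * s) / g s) (𝓝[>] 0) (𝓝 (t ^ α)))
    (hmono : ∃ δ > 0, MonotoneOn g (Set.Ioo 0 δ))
    (hb : Integrable b (levyMeasure α))
    (hKb : ∀ M : ℝ, ∃ C : ℝ, ∀ t, |t| ≤ M → ∀ x, 0 < x → ‖levyKernel p q t x‖ ≤ C * b x)
    (hψ : ∀ t, 0 < t → ∫ x, levyKernel p q t x ∂(levyMeasure α) = w * (t ^ α : ℝ)) :
    0 ≤ p ∧ 0 ≤ q ∧ Tendsto (fun x => upperTail μ X x / g x⁻¹) atTop (𝓝 p) ∧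
      Tendsto (fun x => lowerTail μ X x / g x⁻¹) atTop (𝓝 q) := by
  have : IsProbabilityMeasure (μ.map X) := Measure.isProbabilityMeasure_map hX.aemeasurable
  have : IsProbabilityMeasure ((μ.map X).map Neg.neg) :=
    Measure.isProbabilityMeasure_map measurable_neg.aemeasurable
  obtain ⟨hp, hq, hup⟩ := upperTail_of_charFun (μ.map X) h0 h2 hpq hg hF hr hmono hb hKb hψ
  have hF' : Tendsto (fun s => (1 - charFun ((μ.map X).map Neg.neg) s) / (g s : ℂ)) (𝓝[>] 0)
      (𝓝 ((starRingEnd ℂ) w)) := by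
    refine ((Complex.continuous_conj.tendsto w).comp hF).congr fun s => ?_
    simp [charFun_map_neg]
  obtain ⟨-, -, hlo⟩ := upperTail_of_charFun ((μ.map X).map Neg.neg) h0 h2
    (by linarith : 0 < q + p) hg hF' hr hmono hb
    (fun M => (hKb M).imp fun C hC t ht x hx => by
      rw [levyKernel_swap p q, RCLike.norm_conj]; exact hC t ht x hx)
    (fun t ht => by
      simp_rw [levyKernel_swap p q]
      rw [integral_conj, hψ t ht, map_mul, Complex.conj_ofReal])
  refine ⟨hp, hq, ?_, ?_⟩
  · refine (hup.comp tendsto_inv_atTop_nhdsGT_zero).congr fun x => ?_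
    simp only [Function.comp_apply, inv_inv]
    rw [map_measureReal_apply hX measurableSet_Ioi]
    rfl
  · refine (hlo.comp tendsto_inv_atTop_nhdsGT_zero).congr fun x => ?_
    simp only [Function.comp_apply, inv_inv]
    rw [map_measureReal_apply measurable_neg measurableSet_Ioi,
      map_measureReal_apply hX (measurable_neg measurableSet_Ioi)]
    congr 2
    ext ω
    simp only [Set.mem_preimage, Set.mem_Ioi, Set.mem_ofPred_eq]
    exact lt_neg

theorem norm_levyKernel_le {p q M t x : ℝ} (ht : |t| ≤ M) (hx : 0 < x) :
    ‖levyKernel p q t x‖ ≤ ((|p| + |q|) * (2 * (M + 1))) * min 1 x := by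
  have hM : 0 ≤ M := (abs_nonneg t).trans ht
  have key : ∀ z : ℂ, z.re = 0 → ‖z‖ = |t| * x →
      ‖1 - Complex.exp z‖ ≤ 2 * (M + 1) * min 1 x := by
    intro z hz hn
    have := norm_one_sub_exp_neg_le (z := -z) (by simp [hz])
    rw [neg_neg, norm_neg, hn] at this
    refine this.trans ?_
    rw [mul_assoc]
    gcongr
    refine le_trans ?_ (min_one_mul_le hx.le hM)
    gcongr
  unfold levyKernel
  refine (norm_add_le _ _).trans ?_
  rw [norm_mul, norm_mul, Complex.norm_real, Complex.norm_real, Real.norm_eq_abs, Real.norm_eq_abs]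
  have h1 := key (t * x * Complex.I) (by simp) (by simp [abs_of_pos hx])
  have h2 := key (-(t * x * Complex.I)) (by simp) (by simp [abs_of_pos hx])
  nlinarith [abs_nonneg p, abs_nonneg q]

/-- Both tails, index less than one. -/
theorem tendsto_tails_of_lt_one {Ω : Type*} [MeasurableSpace Ω] (μ : Measure Ω)
    [IsProbabilityMeasure μ] {X : Ω → ℝ} (hX : Measurable X) {α p q : ℝ}
    {g : ℝ → ℝ} (h0 : 0 < α) (h1 : α < 1) (hpq : 0 < p + q)
    (hg : ∀ᶠ s in 𝓝[>] 0, 0 < g s)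
    (hF : Tendsto (fun s => (1 - charFun (μ.map X) s) / (g s : ℂ)) (𝓝[>] 0)
      (𝓝 (Real.Gamma (1 - α) * (p * Complex.exp (-(Real.pi * α / 2 : ℝ) * Complex.I) +
        q * Complex.exp ((Real.pi * α / 2 : ℝ) * Complex.I)))))
    (hr : ∀ t : ℝ, 0 < t → Tendsto (fun s => g (t * s) / g s) (𝓝[>] 0) (𝓝 (t ^ α)))
    (hmono : ∃ δ > 0, MonotoneOn g (Set.Ioo 0 δ)) :
    0 ≤ p ∧ 0 ≤ q ∧ Tendsto (fun x => upperTail μ X x / g x⁻¹) atTop (𝓝 p) ∧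
      Tendsto (fun x => lowerTail μ X x / g x⁻¹) atTop (𝓝 q) := by
  refine tendsto_tails_of_charFun μ hX h0 (by linarith) hpq hg hF hr hmono
    (integrable_min_levyMeasure h0 h1) (fun M => ⟨_, fun t ht x hx => norm_levyKernel_le ht hx⟩)
    fun t ht => ?_
  have hi : ∀ p q : ℝ, Integrable (levyKernel p q t) (levyMeasure α) := by
    intro p q
    refine ((integrable_min_levyMeasure h0 h1).const_mul
      ((|p| + |q|) * (2 * (|t| + 1)))).mono' (by unfold levyKernel; fun_prop) ?_
    filter_upwards [ae_pos_levyMeasure α] with x hx using norm_levyKernel_le le_rfl hx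
  have e : ∀ x, levyKernel p q t x = p * levyKernel 1 0 t x +
      q * (starRingEnd ℂ) (levyKernel 1 0 t x) := by
    intro x
    rw [← levyKernel_swap]
    simp [levyKernel]
  have hi2 : Integrable (fun x => (starRingEnd ℂ) (levyKernel 1 0 t x)) (levyMeasure α) := by
    simp_rw [← levyKernel_swap]
    exact hi 0 1
  simp_rw [e]
  rw [integral_add ((hi 1 0).const_mul _) (hi2.const_mul _), integral_const_mul,
    integral_const_mul, integral_conj]
  have h3 : ∫ x, levyKernel 1 0 t x ∂(levyMeasure α) = _ :=
    (integral_congr_ae (Eventually.of_forall fun x => by simp [levyKernel])).trans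
      (integral_one_sub_exp_mul_I_levyMeasure h0 h1 ht)
  rw [h3]
  simp only [map_mul, Complex.conj_ofReal, ← Complex.exp_conj, map_neg, Complex.conj_I]
  rw [neg_mul_neg]
  ring

/-- Both tails, symmetric case of index one. -/
theorem tendsto_tails_of_eq_one {Ω : Type*} [MeasurableSpace Ω] (μ : Measure Ω)
    [IsProbabilityMeasure μ] {X : Ω → ℝ} (hX : Measurable X) {p : ℝ}
    {g : ℝ → ℝ} (hp : 0 < p)
    (hg : ∀ᶠ s in 𝓝[>] 0, 0 < g s)
    (hF : Tendsto (fun s => (1 - charFun (μ.map X) s) / (g s : ℂ)) (𝓝[>] 0)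
      (𝓝 ((Real.pi * p : ℝ) : ℂ)))
    (hr : ∀ t : ℝ, 0 < t → Tendsto (fun s => g (t * s) / g s) (𝓝[>] 0) (𝓝 (t ^ (1 : ℝ))))
    (hmono : ∃ δ > 0, MonotoneOn g (Set.Ioo 0 δ)) :
    Tendsto (fun x => upperTail μ X x / g x⁻¹) atTop (𝓝 p) ∧
      Tendsto (fun x => lowerTail μ X x / g x⁻¹) atTop (𝓝 p) := by
  -- With equal weights the kernel is real, 2p (1 - cos tx), hence O(min(1, x²)) and integrable at
  -- index one; a first-order bound min(1, x) would not be.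
  refine (tendsto_tails_of_charFun μ hX (p := p) (q := p) one_pos one_lt_two (by linarith) hg hF hr
    hmono (integrable_min_rpow_levyMeasure one_pos one_lt_two)
    (fun M => ⟨2 * p * (2 + M ^ 2), fun t ht x hx => ?_⟩) fun t ht => ?_).2.2
  · rw [levyKernel_self, Complex.norm_real,
      Real.norm_of_nonneg (mul_nonneg (by positivity) (one_sub_cos_nonneg _)), mul_assoc (2 * p)]
    gcongr
    refine (one_sub_cos_le_min t x).trans ?_
    have h1 : t ^ 2 ≤ M ^ 2 := sq_le_sq' (by linarith [neg_abs_le t]) (by linarith [le_abs_self t])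
    have h2 : 0 ≤ min 1 (x ^ (2 : ℝ)) := le_min zero_le_one (by positivity)
    gcongr
  · simp_rw [levyKernel_self]
    rw [integral_complex_ofReal, integral_const_mul, integral_one_sub_cos_levyMeasure_one ht,
      Real.rpow_one, ← Complex.ofReal_mul]
    congr 1
    ring

theorem tailEquiv_of_tendsto_div {f g : ℝ → ℝ} {a : ℝ} (hg : ∀ᶠ x in atTop, g x ≠ 0)
    (h : Tendsto (fun x => f x / g x) atTop (𝓝 a)) : TailEquiv f a g := by
  refine ⟨fun ha => ?_, fun ha => ?_⟩
  · have hne : ∀ᶠ x in atTop, a * g x ≠ 0 := hg.mono fun x hx => mul_ne_zero ha hx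
    refine (isEquivalent_iff_tendsto_one hne).2 ?_
    have := h.div_const a
    rw [div_self ha] at this
    refine this.congr fun x => ?_
    simp only [Pi.div_apply]
    rw [div_div, mul_comm]
  · subst ha
    exact (isLittleO_iff_tendsto' (hg.mono fun x hx h => absurd h hx)).2 h

/-! ### Wiener–Hopf factorization of the planar walk -/

open scoped PowerSeries

/-- Functions on the dual of the plane: the ring containing the Fourier transforms. -/
abbrev DualFun : Type := StrongDual ℝ (ℝ × ℝ) → ℂ

/-- Transforms of differences of finite measures concentrated on `B`. -/
def IsTransformOn (B : Set (ℝ × ℝ)) (r : DualFun) : Prop :=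
  ∃ m n : Measure (ℝ × ℝ), IsFiniteMeasure m ∧ IsFiniteMeasure n ∧ m Bᶜ = 0 ∧ n Bᶜ = 0 ∧
    r = charFunDual m - charFunDual n

theorem charFunDual_add_measure (m n : Measure (ℝ × ℝ)) [IsFiniteMeasure m] [IsFiniteMeasure n] :
    charFunDual (m + n) = charFunDual m + charFunDual n := by
  ext L
  simp only [charFunDual_apply, Pi.add_apply]
  refine integral_add_measure ?_ ?_ <;>
  · refine Integrable.of_bound (Measurable.aestronglyMeasurable (by fun_prop)) 1
      (Eventually.of_forall fun x => ?_)
    rw [Complex.norm_exp_ofReal_mul_I]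

theorem charFunDual_zero_measure : charFunDual (0 : Measure (ℝ × ℝ)) = 0 := by
  ext L; simp [charFunDual_apply]

theorem IsTransformOn.of_measure {B : Set (ℝ × ℝ)} (m : Measure (ℝ × ℝ)) [IsFiniteMeasure m]
    (h : m Bᶜ = 0) : IsTransformOn B (charFunDual m) :=
  ⟨m, 0, inferInstance, inferInstance, h, by simp, by rw [charFunDual_zero_measure, sub_zero]⟩

theorem conv_compl_eq_zero {B : Set (ℝ × ℝ)} (hB : MeasurableSet B)
    (hadd : ∀ x ∈ B, ∀ y ∈ B, x + y ∈ B) {m n : Measure (ℝ × ℝ)} [IsFiniteMeasure m]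
    [IsFiniteMeasure n] (hm : m Bᶜ = 0) (hn : n Bᶜ = 0) : (m ∗ n) Bᶜ = 0 := by
  rw [Measure.conv, Measure.map_apply (by fun_prop) hB.compl, ← nonpos_iff_eq_zero]
  calc (m.prod n) ((fun x : (ℝ × ℝ) × (ℝ × ℝ) => x.1 + x.2) ⁻¹' Bᶜ)
      ≤ (m.prod n) (Bᶜ ×ˢ Set.univ ∪ Set.univ ×ˢ Bᶜ) := by
        refine measure_mono fun x hx => ?_
        by_contra h
        simp only [Set.mem_union, Set.mem_prod, Set.mem_compl_iff, Set.mem_univ, and_true, true_and,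
          not_or, not_not] at h
        exact hx (hadd _ h.1 _ h.2)
    _ ≤ _ := measure_union_le _ _
    _ = 0 := by rw [Measure.prod_prod, Measure.prod_prod, hm, hn]; simp

theorem charFunDual_conv_fun (m n : Measure (ℝ × ℝ)) [IsFiniteMeasure m] [IsFiniteMeasure n] :
    charFunDual (m ∗ n) = charFunDual m * charFunDual n := by
  ext L; exact charFunDual_conv L

/-- The transforms concentrated on an additively closed set form a non-unital ring. -/
def transformRing (B : Set (ℝ × ℝ)) (hB : MeasurableSet B)
    (hadd : ∀ x ∈ B, ∀ y ∈ B, x + y ∈ B) : NonUnitalSubring DualFun where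
  carrier := {r | IsTransformOn B r}
  zero_mem' := by
    simpa [charFunDual_zero_measure] using IsTransformOn.of_measure (B := B) 0 (by simp)
  add_mem' := by
    rintro _ _ ⟨m, n, _, _, hm, hn, rfl⟩ ⟨m', n', _, _, hm', hn', rfl⟩
    refine ⟨m + m', n + n', inferInstance, inferInstance, by simp [hm, hm'], by simp [hn, hn'], ?_⟩
    rw [charFunDual_add_measure, charFunDual_add_measure]
    ring
  neg_mem' := by
    rintro _ ⟨m, n, _, _, hm, hn, rfl⟩
    exact ⟨n, m, inferInstance, inferInstance, hn, hm, by ring⟩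
  mul_mem' := by
    rintro _ _ ⟨m, n, _, _, hm, hn, rfl⟩ ⟨m', n', _, _, hm', hn', rfl⟩
    refine ⟨m ∗ m' + n ∗ n', m ∗ n' + n ∗ m', inferInstance, inferInstance, ?_, ?_, ?_⟩
    · simp [conv_compl_eq_zero hB hadd hm hm', conv_compl_eq_zero hB hadd hn hn']
    · simp [conv_compl_eq_zero hB hadd hm hn', conv_compl_eq_zero hB hadd hn hm']
    · simp only [charFunDual_add_measure, charFunDual_conv_fun]
      ring

/-- The uniqueness step of Wiener–Hopf. Equal transforms give equal finite measures after moving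
negative parts across, and restriction to B kills everything concentrated on the complement. -/
theorem IsTransformOn.eq_zero_of_compl {B : Set (ℝ × ℝ)} {r : DualFun}
    (h1 : IsTransformOn B r) (h2 : IsTransformOn Bᶜ r) : r = 0 := by
  obtain ⟨m, n, _, _, hm, hn, rfl⟩ := h1
  obtain ⟨m', n', _, _, hm', hn', h⟩ := h2
  rw [compl_compl] at hm' hn'
  have h3 : m + n' = m' + n := by
    refine Measure.ext_of_charFunDual ?_
    rw [charFunDual_add_measure, charFunDual_add_measure]
    linear_combination h
  have h4 : m = n := by
    have h5 := congrArg (fun μ : Measure (ℝ × ℝ) => μ.restrict B) h3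
    simp only [Measure.restrict_add] at h5
    rw [Measure.restrict_eq_zero.2 hm', Measure.restrict_eq_zero.2 hn', add_zero, zero_add,
      Measure.restrict_eq_self_of_ae_mem, Measure.restrict_eq_self_of_ae_mem] at h5
    · exact h5
    · exact hn
    · exact hm
  rw [h4, sub_self]

/-- The half plane `x > 0`. -/
def posHalf : Set (ℝ × ℝ) := {x | 0 < x.1}

theorem measurableSet_posHalf : MeasurableSet posHalf :=
  measurableSet_lt measurable_const measurable_fst

/-- `n`-fold convolution power. -/
noncomputable def convPow (ρ : Measure (ℝ × ℝ)) : ℕ → Measure (ℝ × ℝ)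
  | 0 => Measure.dirac 0
  | n + 1 => convPow ρ n ∗ ρ

/-- Law of the walk at time `n`, restricted to the event that it has not entered `x > 0`. -/
noncomputable def stayNonpos (ρ : Measure (ℝ × ℝ)) : ℕ → Measure (ℝ × ℝ)
  | 0 => Measure.dirac 0
  | n + 1 => (stayNonpos ρ n ∗ ρ).restrict posHalfᶜ

/-- Law of the walk at time `n + 1`, restricted to the event that this is its first time in
`x > 0`. -/
noncomputable def firstPos (ρ : Measure (ℝ × ℝ)) (n : ℕ) : Measure (ℝ × ℝ) :=
  (stayNonpos ρ n ∗ ρ).restrict posHalf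

instance (ρ : Measure (ℝ × ℝ)) [IsFiniteMeasure ρ] (n : ℕ) : IsFiniteMeasure (convPow ρ n) := by
  induction n with
  | zero => unfold convPow; infer_instance
  | succ n ih => unfold convPow; infer_instance

instance (ρ : Measure (ℝ × ℝ)) [IsFiniteMeasure ρ] (n : ℕ) : IsFiniteMeasure (stayNonpos ρ n) := by
  induction n with
  | zero => unfold stayNonpos; infer_instance
  | succ n ih => unfold stayNonpos; infer_instance

instance (ρ : Measure (ℝ × ℝ)) [IsFiniteMeasure ρ] (n : ℕ) : IsFiniteMeasure (firstPos ρ n) := by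
  unfold firstPos; infer_instance

/-- Coefficients of `1 - H`, with `H` the generating function of the transforms of `firstPos`. -/
noncomputable def ladderCoeff (ρ : Measure (ℝ × ℝ)) : ℕ → DualFun
  | 0 => 1
  | n + 1 => -charFunDual (firstPos ρ n)

theorem charFunDual_dirac_zero : charFunDual (Measure.dirac (0 : ℝ × ℝ)) = 1 := by
  ext L; simp [charFunDual_dirac]

theorem charFunDual_convPow (ρ : Measure (ℝ × ℝ)) [IsFiniteMeasure ρ] (n : ℕ) :
    charFunDual (convPow ρ n) = charFunDual ρ ^ n := by
  induction n with
  | zero => rw [pow_zero]; exact charFunDual_dirac_zero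
  | succ n ih => rw [pow_succ, ← ih]; exact charFunDual_conv_fun _ _

theorem charFunDual_restrict_add_compl (m : Measure (ℝ × ℝ)) [IsFiniteMeasure m] :
    charFunDual (m.restrict posHalf) + charFunDual (m.restrict posHalfᶜ) = charFunDual m := by
  rw [← charFunDual_add_measure, Measure.restrict_add_restrict_compl measurableSet_posHalf]

/-- One more step of a walk that has stayed in x ≤ 0 either keeps it there or brings it into x > 0
for the first time. This is the coefficient form of L = G (1 - zφ). -/
theorem ladderCoeff_succ (ρ : Measure (ℝ × ℝ)) [IsFiniteMeasure ρ] (n : ℕ) :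
    ladderCoeff ρ (n + 1) =
      charFunDual (stayNonpos ρ (n + 1)) - charFunDual (stayNonpos ρ n) * charFunDual ρ := by
  rw [← charFunDual_conv_fun, ← charFunDual_restrict_add_compl (stayNonpos ρ n ∗ ρ)]
  simp only [ladderCoeff, stayNonpos, firstPos]
  ring

/-- Wiener–Hopf factorization in differentiated form. -/
theorem succ_mul_ladderCoeff (ρ : Measure (ℝ × ℝ)) [IsFiniteMeasure ρ] (n : ℕ) :
    ((n + 1 : ℕ) : DualFun) * ladderCoeff ρ (n + 1) =
      -∑ kl ∈ Finset.HasAntidiagonal.antidiagonal n,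
        charFunDual ((convPow ρ (kl.1 + 1)).restrict posHalf) * ladderCoeff ρ kl.2 := by
  set φ : DualFun := charFunDual ρ
  let L : DualFun⟦X⟧ := PowerSeries.mk (ladderCoeff ρ)
  let G : DualFun⟦X⟧ := PowerSeries.mk fun n => charFunDual (stayNonpos ρ n)
  let P : DualFun⟦X⟧ := PowerSeries.mk fun n => charFunDual ((convPow ρ (n + 1)).restrict posHalf)
  let Q : DualFun⟦X⟧ := PowerSeries.mk fun n => charFunDual ((convPow ρ (n + 1)).restrict posHalfᶜ)
  -- L plays the role of 1 - H, and G records the walk killed on entering x > 0.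
  have hL : L = G * (1 - PowerSeries.X * PowerSeries.C φ) := by
    ext1 n
    rw [mul_sub, mul_one, ← mul_assoc, map_sub, PowerSeries.coeff_mul_C]
    cases n with
    | zero =>
      rw [PowerSeries.coeff_zero_mul_X, PowerSeries.coeff_mk, PowerSeries.coeff_mk]
      simp only [ladderCoeff, stayNonpos, charFunDual_dirac_zero]
      ring
    | succ n =>
      rw [PowerSeries.coeff_succ_mul_X, PowerSeries.coeff_mk, PowerSeries.coeff_mk,
        PowerSeries.coeff_mk, ladderCoeff_succ]
  -- P + Q = φ/(1 - zφ) is minus the logarithmic derivative of 1 - zφ, split according to the sign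
  -- of the first coordinate.
  have hPQ : (P + Q) * (1 - PowerSeries.X * PowerSeries.C φ) = PowerSeries.C φ := by
    have h1 : P + Q = PowerSeries.mk fun n => φ ^ (n + 1) := by
      ext1 n
      rw [map_add, PowerSeries.coeff_mk, PowerSeries.coeff_mk, PowerSeries.coeff_mk,
        charFunDual_restrict_add_compl, charFunDual_convPow]
    rw [h1]
    ext1 n
    rw [mul_sub, mul_one, ← mul_assoc, map_sub, PowerSeries.coeff_mul_C, PowerSeries.coeff_C]
    cases n with
    | zero => simp
    | succ n =>
      rw [PowerSeries.coeff_succ_mul_X, PowerSeries.coeff_mk, PowerSeries.coeff_mk,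
        if_neg n.succ_ne_zero]
      ring
  let d : Derivation DualFun DualFun⟦X⟧ DualFun⟦X⟧ := PowerSeries.derivative DualFun
  have hd : d L = d G * (1 - PowerSeries.X * PowerSeries.C φ) - G * PowerSeries.C φ := by
    rw [hL, Derivation.leibniz, map_sub, Derivation.leibniz, Derivation.map_one_eq_zero]
    simp only [d, PowerSeries.derivative_X, PowerSeries.derivative_C, smul_eq_mul]
    ring
  -- Logarithmic differentiation of L = G (1 - zφ) gives L'/L + P = G'/G - Q. Cleared of
  -- denominators this reads E G = E' L, where E only involves measures on x > 0 and E' only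
  -- measures on x ≤ 0.
  let E := d L + P * L
  let E' := d G - Q * G
  have hEE : E * G = E' * L := by
    simp only [E, E']
    linear_combination G * hd - (d G - Q * G) * hL + (P * G) * hL + G ^ 2 * hPQ
  have hadd : ∀ x ∈ posHalf, ∀ y ∈ posHalf, x + y ∈ posHalf := fun x hx y hy =>
    add_pos (show (0 : ℝ) < x.1 from hx) hy
  have hadd' : ∀ x ∈ posHalfᶜ, ∀ y ∈ posHalfᶜ, x + y ∈ posHalfᶜ := by
    intro x hx y hy h
    have h1 : ¬ 0 < x.1 := hx
    have h2 : ¬ 0 < y.1 := hy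
    have h3 : 0 < x.1 + y.1 := h
    linarith
  let Rp := transformRing posHalf measurableSet_posHalf hadd
  let Rn := transformRing posHalfᶜ measurableSet_posHalf.compl hadd'
  have hLp : ∀ n, ladderCoeff ρ (n + 1) ∈ Rp := fun n =>
    Rp.neg_mem (IsTransformOn.of_measure _ (by
      rw [firstPos, Measure.restrict_apply measurableSet_posHalf.compl]; simp))
  have hPp : ∀ n, charFunDual ((convPow ρ n).restrict posHalf) ∈ Rp := fun n =>
    IsTransformOn.of_measure _ (by
      rw [Measure.restrict_apply measurableSet_posHalf.compl]; simp)
  have hGn : ∀ n, charFunDual (stayNonpos ρ (n + 1)) ∈ Rn := fun n =>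
    IsTransformOn.of_measure _ (by
      rw [stayNonpos, Measure.restrict_apply measurableSet_posHalf.compl.compl]; simp)
  have hQn : ∀ n, charFunDual ((convPow ρ n).restrict posHalfᶜ) ∈ Rn := fun n =>
    IsTransformOn.of_measure _ (by
      rw [Measure.restrict_apply measurableSet_posHalf.compl.compl]; simp)
  have hEp : ∀ n, PowerSeries.coeff n E ∈ Rp := by
    intro n
    rw [map_add, PowerSeries.coeff_derivative, PowerSeries.coeff_mul]
    refine Rp.add_mem ?_ (Rp.sum_mem fun kl _ => ?_)
    · rw [PowerSeries.coeff_mk, ← Nat.cast_succ, mul_comm, ← nsmul_eq_mul]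
      exact Rp.nsmul_mem (hLp n) _
    · rw [PowerSeries.coeff_mk, PowerSeries.coeff_mk]
      rcases kl.2 with _ | k
      · rw [ladderCoeff, mul_one]; exact hPp _
      · exact Rp.mul_mem (hPp _) (hLp k)
  have hEn : ∀ n, PowerSeries.coeff n E' ∈ Rn := by
    intro n
    rw [map_sub, PowerSeries.coeff_derivative, PowerSeries.coeff_mul]
    refine Rn.sub_mem ?_ (Rn.sum_mem fun kl _ => ?_)
    · rw [PowerSeries.coeff_mk, ← Nat.cast_succ, mul_comm, ← nsmul_eq_mul]
      exact Rn.nsmul_mem (hGn n) _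
    · rw [PowerSeries.coeff_mk, PowerSeries.coeff_mk]
      rcases kl.2 with _ | k
      · rw [stayNonpos, charFunDual_dirac_zero, mul_one]; exact hQn _
      · exact Rn.mul_mem (hQn _) (hGn k)
  -- G and L both have constant term 1, so once the lower coefficients vanish, E G = E' L equates
  -- the n-th coefficients of E and E'. Their common value is a transform on both half-planes, hence
  -- zero.
  have hzero : ∀ n, PowerSeries.coeff n E = 0 ∧ PowerSeries.coeff n E' = 0 := by
    intro n
    induction n using Nat.strong_induction_on with
    | _ n ih =>
      have h1 := congrArg (PowerSeries.coeff n) hEE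
      have key : ∀ A B : DualFun⟦X⟧, (∀ m < n, PowerSeries.coeff m A = 0) →
          PowerSeries.coeff n (A * B) = PowerSeries.coeff n A * PowerSeries.coeff 0 B := by
        intro A B hA
        rw [PowerSeries.coeff_mul, Finset.sum_eq_single (n, 0)]
        · rintro ⟨k, l⟩ hkl hne
          have hkl : k + l = n := by simpa using hkl
          have : k < n := by
            rcases Nat.eq_zero_or_pos l with h | h
            · subst h; exact absurd (by rw [← hkl]; rfl) hne
            · omega
          rw [hA k this, zero_mul]
        · intro h; simp at h
      rw [key _ _ fun m hm => (ih m hm).1, key _ _ fun m hm => (ih m hm).2,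
        PowerSeries.coeff_mk, PowerSeries.coeff_mk, stayNonpos, ladderCoeff,
        charFunDual_dirac_zero, mul_one, mul_one] at h1
      have h2 : PowerSeries.coeff n E = 0 :=
        IsTransformOn.eq_zero_of_compl (hEp n) (h1 ▸ hEn n)
      exact ⟨h2, h1 ▸ h2⟩
  have h1 := (hzero n).1
  rw [map_add, PowerSeries.coeff_derivative, PowerSeries.coeff_mul] at h1
  simp only [L, P, PowerSeries.coeff_mk] at h1
  rw [eq_neg_iff_add_eq_zero, ← h1]
  push_cast
  ring

/-! ### Generating functions in the unit disc and the limit z → 1 -/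

theorem summable_norm_mul_pow {a : ℕ → ℂ} (ha : ∀ n, ‖a n‖ ≤ 1) {z : ℂ} (hz : ‖z‖ < 1) :
    Summable fun n => ‖a n * z ^ n‖ := by
  refine Summable.of_nonneg_of_le (fun _ => norm_nonneg _) (fun n => ?_)
    (summable_geometric_of_lt_one (norm_nonneg z) hz)
  rw [norm_mul, norm_pow]
  exact mul_le_of_le_one_left (by positivity) (ha n)

theorem hasDerivAt_tsum_mul_pow {a : ℕ → ℂ} (ha : ∀ n, ‖a n‖ ≤ 1) {z : ℂ} (hz : ‖z‖ < 1) :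
    HasDerivAt (fun z => ∑' n, a n * z ^ n) (∑' n : ℕ, ((n + 1 : ℕ) : ℂ) * a (n + 1) * z ^ n) z := by
  obtain ⟨r, hzr, hr⟩ := exists_between hz
  have hr0 : 0 < r := (norm_nonneg z).trans_lt hzr
  have hu : Summable fun n : ℕ => (n : ℝ) * r ^ (n - 1) := by
    rw [← summable_nat_add_iff 1]
    have h1 := summable_pow_mul_geometric_of_norm_lt_one 1 (r := r)
      (by rwa [Real.norm_of_nonneg hr0.le])
    have h2 := summable_geometric_of_lt_one hr0.le hr
    refine (h1.add h2).congr fun n => ?_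
    push_cast
    simp
    ring
  have key := hasDerivAt_tsum_of_isPreconnected (g := fun n z => a n * z ^ n)
    (g' := fun n z => a n * (n * z ^ (n - 1))) hu
    (Metric.isOpen_ball (x := (0 : ℂ)) (ε := r)) (convex_ball _ _).isPreconnected
    (fun n y _ => (hasDerivAt_pow n y).const_mul (a n))
    (fun n y hy => by
      have hy : ‖y‖ < r := by simpa using hy
      rw [norm_mul, norm_mul, norm_pow, Complex.norm_natCast]
      refine (mul_le_of_le_one_left (by positivity) (ha n)).trans ?_
      gcongr)
    (y₀ := z) (by simpa using hzr) (summable_norm_mul_pow ha hz).of_norm (by simpa using hzr)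
  refine key.congr_deriv ?_
  have hs : Summable fun n : ℕ => a n * (n * z ^ (n - 1)) := by
    refine Summable.of_norm_bounded hu fun n => ?_
    rw [norm_mul, norm_mul, norm_pow, Complex.norm_natCast]
    refine (mul_le_of_le_one_left (by positivity) (ha n)).trans ?_
    gcongr
  rw [hs.tsum_eq_zero_add]
  simp only [CharP.cast_eq_zero, zero_mul, mul_zero, zero_add, Nat.add_sub_cancel]
  exact tsum_congr fun n => by ring

/-- The differential equation `F' = -P' F` for power series, solved inside the unit disc. -/
theorem tsum_mul_pow_eq_exp {L p : ℕ → ℂ} (hL : ∀ n, ‖L n‖ ≤ 1) (hp : ∀ n, ‖p n‖ ≤ 1)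
    (h0 : L 0 = 1)
    (hrec : ∀ n : ℕ, ((n + 1 : ℕ) : ℂ) * L (n + 1) =
      -∑ kl ∈ Finset.HasAntidiagonal.antidiagonal n, p kl.1 * L kl.2)
    {z : ℂ} (hz : ‖z‖ < 1) :
    ∑' n, L n * z ^ n = Complex.exp (-∑' n : ℕ, p n / ((n + 1 : ℕ) : ℂ) * z ^ (n + 1)) := by
  -- Indices are shifted so that the exponent is a plain power series; at n = 0 division by zero
  -- gives the required zero constant term.
  let a : ℕ → ℂ := fun n => p (n - 1) / n
  have ha : ∀ n, ‖a n‖ ≤ 1 := by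
    intro n
    rcases n with _ | n
    · simp [a]
    · simp only [a, norm_div, Complex.norm_natCast]
      rw [div_le_one (by positivity)]
      refine (hp _).trans ?_
      push_cast
      linarith [(n.cast_nonneg : (0 : ℝ) ≤ n)]
  have ha' : ∀ z : ℂ, ‖z‖ < 1 →
      ∑' n, a n * z ^ n = ∑' n : ℕ, p n / ((n + 1 : ℕ) : ℂ) * z ^ (n + 1) := by
    intro z hz
    rw [(summable_norm_mul_pow ha hz).of_norm.tsum_eq_zero_add]
    simp [a]
  have hda : ∀ n : ℕ, ((n + 1 : ℕ) : ℂ) * a (n + 1) = p n := by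
    intro n
    simp only [a, Nat.add_sub_cancel]
    exact mul_div_cancel₀ _ (by exact_mod_cast n.succ_ne_zero)
  -- W is the quotient of the two sides. The recursion says F' = -A' F, with F = ∑ L_n zⁿ and A = ∑
  -- a_n zⁿ, so W has derivative zero on the disc.
  let W : ℂ → ℂ := fun z => (∑' n, L n * z ^ n) * Complex.exp (∑' n, a n * z ^ n)
  have hW : ∀ z ∈ Metric.ball (0 : ℂ) 1, HasDerivAt W 0 z := by
    intro z hz
    have hz : ‖z‖ < 1 := by simpa using hz
    have h1 := hasDerivAt_tsum_mul_pow hL hz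
    have h2 := hasDerivAt_tsum_mul_pow ha hz
    refine (h1.mul h2.cexp).congr_deriv ?_
    have h3 : ∑' n : ℕ, ((n + 1 : ℕ) : ℂ) * L (n + 1) * z ^ n =
        -((∑' n, p n * z ^ n) * ∑' n, L n * z ^ n) := by
      rw [tsum_mul_tsum_eq_tsum_sum_antidiagonal_of_summable_norm (summable_norm_mul_pow hp hz)
        (summable_norm_mul_pow hL hz), ← tsum_neg]
      refine tsum_congr fun n => ?_
      rw [hrec, neg_mul, Finset.sum_mul]
      congr 1
      refine Finset.sum_congr rfl fun kl hkl => ?_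
      rw [← Finset.HasAntidiagonal.mem_antidiagonal.1 hkl, pow_add]
      ring
    simp only [hda]
    rw [h3]
    ring
  have hconst : W z = W 0 := by
    refine (convex_ball (0 : ℂ) 1).is_const_of_fderivWithin_eq_zero (𝕜 := ℂ)
      (fun y hy => (hW y hy).differentiableAt.differentiableWithinAt) (fun y hy => ?_)
      (by simpa using hz) (by simp)
    rw [fderivWithin_of_isOpen Metric.isOpen_ball hy]
    ext
    simp [(hW y hy).deriv]
  have hW0 : W 0 = 1 := by
    simp only [W]
    rw [ha' 0 (by simp), tsum_eq_single 0 (by intro n hn; simp [hn]), h0]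
    simp
  rw [hW0] at hconst
  simp only [W] at hconst
  rw [ha' z hz] at hconst
  rw [Complex.exp_neg]
  exact eq_inv_of_mul_eq_one_left hconst

theorem real_univ_conv (m n : Measure (ℝ × ℝ)) [IsFiniteMeasure m] [IsFiniteMeasure n] :
    (m ∗ n).real Set.univ = m.real Set.univ * n.real Set.univ := by
  rw [Measure.conv, map_measureReal_apply (by fun_prop) MeasurableSet.univ, Set.preimage_univ,
    ← Set.univ_prod_univ, measureReal_prod_prod]

instance (ρ : Measure (ℝ × ℝ)) [IsProbabilityMeasure ρ] (n : ℕ) :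
    IsProbabilityMeasure (convPow ρ n) := by
  induction n with
  | zero => unfold convPow; infer_instance
  | succ n ih => unfold convPow; infer_instance

theorem firstPos_real_univ (ρ : Measure (ℝ × ℝ)) [IsProbabilityMeasure ρ] (n : ℕ) :
    (firstPos ρ n).real Set.univ =
      (stayNonpos ρ n).real Set.univ - (stayNonpos ρ (n + 1)).real Set.univ := by
  rw [firstPos, stayNonpos, measureReal_restrict_apply MeasurableSet.univ,
    measureReal_restrict_apply MeasurableSet.univ, Set.univ_inter, Set.univ_inter]
  have := measureReal_add_measureReal_compl (μ := stayNonpos ρ n ∗ ρ) measurableSet_posHalf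
  rw [real_univ_conv, probReal_univ (μ := ρ), mul_one] at this
  linarith

/-- The mass entering x > 0 at a step is the loss of mass of the surviving walk, so the sum
telescopes. This gives absolute convergence of the first passage series up to z = 1. -/
theorem sum_firstPos_le_one (ρ : Measure (ℝ × ℝ)) [IsProbabilityMeasure ρ] (n : ℕ) :
    ∑ k ∈ Finset.range n, (firstPos ρ k).real Set.univ ≤ 1 := by
  simp only [firstPos_real_univ]
  rw [Finset.sum_range_sub']
  have : (stayNonpos ρ 0).real Set.univ = 1 := by simp [stayNonpos]
  rw [this]
  linarith [measureReal_nonneg (μ := stayNonpos ρ n) (s := Set.univ)]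

theorem summable_firstPos (ρ : Measure (ℝ × ℝ)) [IsProbabilityMeasure ρ] :
    Summable fun n => (firstPos ρ n).real Set.univ :=
  summable_of_sum_range_le (fun _ => measureReal_nonneg) (sum_firstPos_le_one ρ)

theorem norm_charFunDual_le_real (m : Measure (ℝ × ℝ)) [IsFiniteMeasure m]
    (L : StrongDual ℝ (ℝ × ℝ)) : ‖charFunDual m L‖ ≤ m.real Set.univ := by
  rw [charFunDual_apply]
  refine (norm_integral_le_of_norm_le_const (C := 1) (Eventually.of_forall fun x => ?_)).trans
    (by rw [one_mul])
  rw [Complex.norm_exp_ofReal_mul_I]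

/-- The generating function of the first passage transforms. -/
theorem one_sub_tsum_firstPos (ρ : Measure (ℝ × ℝ)) [IsProbabilityMeasure ρ]
    (L : StrongDual ℝ (ℝ × ℝ)) {z : ℂ} (hz : ‖z‖ < 1) :
    1 - ∑' n, charFunDual (firstPos ρ n) L * z ^ (n + 1) =
      Complex.exp (-∑' n : ℕ, charFunDual ((convPow ρ (n + 1)).restrict posHalf) L /
        ((n + 1 : ℕ) : ℂ) * z ^ (n + 1)) := by
  have hL : ∀ n, ‖ladderCoeff ρ n L‖ ≤ 1 := by
    intro n
    rcases n with _ | n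
    · simp [ladderCoeff]
    · simp only [ladderCoeff, Pi.neg_apply, norm_neg]
      refine (norm_charFunDual_le_real _ _).trans ?_
      have h1 := sum_firstPos_le_one ρ (n + 1)
      rw [Finset.sum_range_succ] at h1
      linarith [Finset.sum_nonneg (s := Finset.range n)
        (f := fun k => (firstPos ρ k).real Set.univ) fun _ _ => measureReal_nonneg]
  rw [← tsum_mul_pow_eq_exp hL (fun n => (norm_charFunDual_le_real _ _).trans
    (by
      rw [measureReal_restrict_apply MeasurableSet.univ]
      exact measureReal_le_one)) (by simp [ladderCoeff]) (fun n => ?_) hz]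
  · rw [(summable_norm_mul_pow hL hz).of_norm.tsum_eq_zero_add]
    simp [ladderCoeff, tsum_neg, sub_eq_add_neg]
  · have h := congrFun (succ_mul_ladderCoeff ρ n) L
    simpa [Finset.sum_apply] using h

/-- The functional `x ↦ s x₂`. -/
noncomputable def sndFreq (s : ℝ) : StrongDual ℝ (ℝ × ℝ) := s • ContinuousLinearMap.snd ℝ ℝ ℝ

theorem charFunDual_sndFreq (m : Measure (ℝ × ℝ)) (s : ℝ) :
    charFunDual m (sndFreq s) = ∫ x, Complex.exp ((s * x.2 : ℝ) * Complex.I) ∂m := by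
  simp [charFunDual_apply, sndFreq]

/-- The line `x = 0`. -/
def zeroLine : Set (ℝ × ℝ) := {x | x.1 = 0}

theorem measurableSet_zeroLine : MeasurableSet zeroLine :=
  measurable_fst (measurableSet_singleton 0)

theorem integrable_exp_snd (m : Measure (ℝ × ℝ)) [IsFiniteMeasure m] (s : ℝ) :
    Integrable (fun x : ℝ × ℝ => Complex.exp ((s * x.2 : ℝ) * Complex.I)) m := by
  refine Integrable.of_bound (Measurable.aestronglyMeasurable (by fun_prop)) 1
    (Eventually.of_forall fun x => ?_)
  rw [Complex.norm_exp_ofReal_mul_I]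

/-- Reflection in the first coordinate exchanges x > 0 and x < 0 and leaves the frequency s x₂
alone, so each half-plane carries half of what lies off the line x = 0. -/
theorem charFunDual_restrict_posHalf_of_symm (m : Measure (ℝ × ℝ)) [IsFiniteMeasure m]
    (hsymm : m.map (fun x => (-x.1, x.2)) = m) (s : ℝ) :
    charFunDual (m.restrict posHalf) (sndFreq s) =
      (charFunDual m (sndFreq s) - charFunDual (m.restrict zeroLine) (sndFreq s)) / 2 := by
  simp only [charFunDual_sndFreq]
  set e : ℝ × ℝ → ℂ := fun x => Complex.exp ((s * x.2 : ℝ) * Complex.I)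
  let N : Set (ℝ × ℝ) := {x | x.1 < 0}
  have hN : MeasurableSet N := measurableSet_lt measurable_fst measurable_const
  have hi := integrable_exp_snd m s
  have h1 : ∫ x in posHalf, e x ∂m = ∫ x in N, e x ∂m := by
    conv_lhs => rw [← hsymm]
    rw [setIntegral_map measurableSet_posHalf (Measurable.aestronglyMeasurable (by fun_prop))
      (Measurable.aemeasurable (by fun_prop))]
    have : (fun x : ℝ × ℝ => (-x.1, x.2)) ⁻¹' posHalf = N := by
      ext x
      simp [posHalf, N]
    rw [this]
  have h2 : posHalfᶜ = zeroLine ∪ N := by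
    ext x
    simp only [posHalf, zeroLine, N, Set.mem_compl_iff, Set.mem_ofPred_eq, Set.mem_union, not_lt]
    exact le_iff_eq_or_lt
  have h3 : ∫ x, e x ∂m = (∫ x in posHalf, e x ∂m) + ((∫ x in zeroLine, e x ∂m) +
      ∫ x in N, e x ∂m) := by
    rw [← integral_add_compl measurableSet_posHalf hi, h2,
      setIntegral_union _ hN hi.integrableOn hi.integrableOn]
    refine Set.disjoint_left.2 fun x hx hx' => ?_
    have h4 : x.1 = 0 := hx
    have h5 : x.1 < 0 := hx'
    linarith
  rw [h3, ← h1]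
  ring

theorem norm_charFunDual_restrict_le (m : Measure (ℝ × ℝ)) [IsProbabilityMeasure m]
    (B : Set (ℝ × ℝ)) (L : StrongDual ℝ (ℝ × ℝ)) :
    ‖charFunDual (m.restrict B) L‖ ≤ m.real B :=
  (norm_charFunDual_le_real _ _).trans (by
    rw [measureReal_restrict_apply MeasurableSet.univ, Set.univ_inter])

/-- Symmetry replaces the half-plane terms by half of φⁿ minus half of the terms on x = 0. The
former sum to -½ log(1 - zφ), whose exponential with the sign reversed is the square root. -/
theorem exp_neg_tsum_posHalf (ρ : Measure (ℝ × ℝ)) [IsProbabilityMeasure ρ]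
    (hsymm : ∀ n, (convPow ρ n).map (fun x => (-x.1, x.2)) = convPow ρ n) (s : ℝ) {z : ℂ}
    (hz : ‖z‖ < 1) :
    Complex.exp (-∑' n : ℕ, charFunDual ((convPow ρ (n + 1)).restrict posHalf) (sndFreq s) /
        ((n + 1 : ℕ) : ℂ) * z ^ (n + 1)) =
      Complex.exp (1 / 2 * ∑' n : ℕ, charFunDual ((convPow ρ (n + 1)).restrict zeroLine) (sndFreq s) /
        ((n + 1 : ℕ) : ℂ) * z ^ (n + 1)) *
      (1 - z * charFunDual ρ (sndFreq s)) ^ (1 / 2 : ℂ) := by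
  set φ := charFunDual ρ (sndFreq s)
  have hφ : ‖φ‖ ≤ 1 := (norm_charFunDual_le_real _ _).trans measureReal_le_one
  have hzφ : ‖z * φ‖ < 1 := by
    rw [norm_mul]
    exact (mul_le_of_le_one_right (norm_nonneg _) hφ).trans_lt hz
  have hne : 1 - z * φ ≠ 0 := by
    intro h
    rw [sub_eq_zero] at h
    rw [← h, norm_one] at hzφ
    exact lt_irrefl _ hzφ
  have hlog := Complex.hasSum_taylorSeries_neg_log hzφ
  have hlog' : HasSum (fun n : ℕ => φ ^ (n + 1) / ((n + 1 : ℕ) : ℂ) * z ^ (n + 1))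
      (-Complex.log (1 - z * φ)) := by
    have := (hasSum_nat_add_iff' 1).2 hlog
    simp only [Finset.sum_range_one, CharP.cast_eq_zero, div_zero, sub_zero] at this
    refine this.congr_fun fun n => ?_
    rw [mul_pow]
    ring
  let o : ℕ → ℂ := fun n => charFunDual ((convPow ρ (n + 1)).restrict zeroLine) (sndFreq s) /
    ((n + 1 : ℕ) : ℂ)
  have ho : Summable fun n => o n * z ^ (n + 1) := by
    have : ∀ n, ‖o n‖ ≤ 1 := by
      intro n
      simp only [o, norm_div, Complex.norm_natCast]
      rw [div_le_one (by positivity)]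
      refine ((norm_charFunDual_restrict_le _ _ _).trans measureReal_le_one).trans ?_
      push_cast
      linarith [(n.cast_nonneg : (0 : ℝ) ≤ n)]
    refine ((summable_norm_mul_pow this hz).of_norm.mul_right z).congr fun n => ?_
    rw [pow_succ]
    ring
  have hp : ∀ n : ℕ, charFunDual ((convPow ρ (n + 1)).restrict posHalf) (sndFreq s) /
      ((n + 1 : ℕ) : ℂ) * z ^ (n + 1) =
      1 / 2 * (φ ^ (n + 1) / ((n + 1 : ℕ) : ℂ) * z ^ (n + 1)) - 1 / 2 * (o n * z ^ (n + 1)) := by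
    intro n
    rw [charFunDual_restrict_posHalf_of_symm _ (hsymm _), charFunDual_convPow, Pi.pow_apply]
    simp only [o]
    ring
  simp only [hp]
  rw [((hlog'.summable.mul_left _).tsum_sub (ho.mul_left _)), tsum_mul_left, tsum_mul_left,
    hlog'.tsum_eq, Complex.cpow_def_of_ne_zero hne, ← Complex.exp_add]
  congr 1
  ring

/-- Wiener–Hopf factorization for symmetric walks, at `z = 1`. -/
theorem one_sub_tsum_firstPos_eq (ρ : Measure (ℝ × ℝ)) [IsProbabilityMeasure ρ]
    (hsymm : ∀ n, (convPow ρ n).map (fun x => (-x.1, x.2)) = convPow ρ n)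
    (hsum : Summable fun n : ℕ => (convPow ρ (n + 1)).real zeroLine / (n + 1)) (s : ℝ) :
    1 - ∑' n, charFunDual (firstPos ρ n) (sndFreq s) =
      Complex.exp (1 / 2 * ∑' n : ℕ, charFunDual ((convPow ρ (n + 1)).restrict zeroLine) (sndFreq s) /
        ((n + 1 : ℕ) : ℂ)) *
      (1 - charFunDual ρ (sndFreq s)) ^ (1 / 2 : ℂ) := by
  set φ := charFunDual ρ (sndFreq s)
  have hφ : ‖φ‖ ≤ 1 := (norm_charFunDual_le_real _ _).trans measureReal_le_one
  have hz : ∀ᶠ z : ℝ in 𝓝[<] 1, 0 ≤ z ∧ z < 1 := by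
    filter_upwards [(eventually_gt_nhds (b := (0 : ℝ)) (a := 1) one_pos).filter_mono
      nhdsWithin_le_nhds, self_mem_nhdsWithin] with z h0 h1 using ⟨le_of_lt h0, h1⟩
  have hpow : ∀ n : ℕ, Tendsto (fun z : ℝ => (z : ℂ) ^ n) (𝓝[<] 1) (𝓝 1) := by
    intro n
    have : Continuous fun z : ℝ => (z : ℂ) ^ n := by fun_prop
    have := this.tendsto 1
    simp only [Complex.ofReal_one, one_pow] at this
    exact this.mono_left nhdsWithin_le_nhds
  have hnorm : ∀ z : ℝ, 0 ≤ z → z < 1 → ∀ n : ℕ, ‖(z : ℂ) ^ n‖ ≤ 1 := by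
    intro z h0 h1 n
    rw [norm_pow, Complex.norm_real, Real.norm_of_nonneg h0]
    exact pow_le_one₀ h0 h1.le
  have hA : Tendsto (fun z : ℝ => 1 - ∑' n, charFunDual (firstPos ρ n) (sndFreq s) * (z : ℂ) ^ (n + 1))
      (𝓝[<] 1) (𝓝 (1 - ∑' n, charFunDual (firstPos ρ n) (sndFreq s))) := by
    refine Tendsto.const_sub _ (tendsto_tsum_of_dominated_convergence (summable_firstPos ρ)
      (fun n => ?_) ?_)
    · simpa using (hpow (n + 1)).const_mul (charFunDual (firstPos ρ n) (sndFreq s))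
    · filter_upwards [hz] with z hz n
      rw [norm_mul]
      exact (mul_le_of_le_one_right (norm_nonneg _) (hnorm z hz.1 hz.2 _)).trans
        (norm_charFunDual_le_real _ _)
  have hB : Tendsto (fun z : ℝ => ∑' n : ℕ,
      charFunDual ((convPow ρ (n + 1)).restrict zeroLine) (sndFreq s) / ((n + 1 : ℕ) : ℂ) *
        (z : ℂ) ^ (n + 1)) (𝓝[<] 1) (𝓝 (∑' n : ℕ,
      charFunDual ((convPow ρ (n + 1)).restrict zeroLine) (sndFreq s) / ((n + 1 : ℕ) : ℂ))) := by
    refine tendsto_tsum_of_dominated_convergence hsum (fun n => ?_) ?_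
    · simpa using (hpow (n + 1)).const_mul
        (charFunDual ((convPow ρ (n + 1)).restrict zeroLine) (sndFreq s) / ((n + 1 : ℕ) : ℂ))
    · filter_upwards [hz] with z hz n
      rw [norm_mul]
      refine (mul_le_of_le_one_right (norm_nonneg _) (hnorm z hz.1 hz.2 _)).trans ?_
      rw [norm_div, Complex.norm_natCast]
      push_cast
      gcongr
      exact norm_charFunDual_restrict_le _ _ _
  -- The principal square root is continuous on the closed right half-plane, including 0, and Re(1 -
  -- φ) ≥ 0; hence no condition on φ is needed at z = 1.
  have hC : Tendsto (fun z : ℝ => (1 - (z : ℂ) * φ) ^ (1 / 2 : ℂ)) (𝓝[<] 1)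
      (𝓝 ((1 - φ) ^ (1 / 2 : ℂ))) := by
    have h1 : Tendsto (fun z : ℝ => 1 - (z : ℂ) * φ) (𝓝[<] 1) (𝓝 (1 - φ)) := by
      have := ((hpow 1).mul_const φ).const_sub 1
      simpa using this
    refine Tendsto.comp (Complex.continuousAt_cpow_const_of_re_pos (Or.inl ?_) (by norm_num)) h1
    have := (Complex.re_le_norm φ).trans hφ
    simpa using this
  refine tendsto_nhds_unique hA (((Complex.continuous_exp.tendsto _).comp
    (hB.const_mul (1 / 2 : ℂ))).mul hC |>.congr' ?_)
  filter_upwards [hz] with z hz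
  have hz' : ‖(z : ℂ)‖ < 1 := by
    rw [Complex.norm_real, Real.norm_of_nonneg hz.1]; exact hz.2
  rw [one_sub_tsum_firstPos ρ _ hz', exp_neg_tsum_posHalf ρ hsymm s hz']
  rfl

/-! ### From convolution powers to the walk on Ω -/

theorem map_restrict_add_eq_conv {Ω α : Type*} [MeasurableSpace Ω] [MeasurableSpace α]
    {μ : Measure Ω} [IsProbabilityMeasure μ] {V : Ω → α} {Y : Ω → ℝ × ℝ} (hV : Measurable V)
    (hY : Measurable Y) (hVY : IndepFun V Y μ) {A : Set α} (hA : MeasurableSet A)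
    {z : α → ℝ × ℝ} (hz : Measurable z) :
    (μ.restrict (V ⁻¹' A)).map (fun ω => z (V ω) + Y ω) =
      ((μ.restrict (V ⁻¹' A)).map (fun ω => z (V ω))) ∗ (μ.map Y) := by
  have : IsProbabilityMeasure (μ.map V) := Measure.isProbabilityMeasure_map hV.aemeasurable
  have : IsProbabilityMeasure (μ.map Y) := Measure.isProbabilityMeasure_map hY.aemeasurable
  -- An event determined by V is independent of Y, so restricting to it leaves a product law;
  -- addition then pushes it to a convolution.
  have h1 : (μ.restrict (V ⁻¹' A)).map (fun ω => (V ω, Y ω)) =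
      ((μ.map V).restrict A).prod (μ.map Y) := by
    have h2 := (indepFun_iff_map_prod_eq_prod_map_map hV.aemeasurable hY.aemeasurable).1 hVY
    have h3 : V ⁻¹' A = (fun ω => (V ω, Y ω)) ⁻¹' (A ×ˢ Set.univ) := by ext; simp
    rw [h3, ← Measure.restrict_map (hV.prodMk hY) (hA.prod MeasurableSet.univ), h2,
      ← Measure.prod_restrict, Measure.restrict_univ]
  have h4 : (fun ω => z (V ω) + Y ω) =
      (fun x : (ℝ × ℝ) × (ℝ × ℝ) => x.1 + x.2) ∘ (Prod.map z id) ∘ fun ω => (V ω, Y ω) := rfl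
  have h5 : (μ.restrict (V ⁻¹' A)).map (fun ω => z (V ω)) = ((μ.map V).restrict A).map z := by
    rw [Measure.restrict_map hV hA, Measure.map_map hz hV]
    rfl
  rw [h4, ← Measure.map_map (by fun_prop) (by fun_prop), ← Measure.map_map (by fun_prop)
    (by fun_prop), h1, h5, Measure.conv, ← Measure.map_prod_map _ _ hz measurable_id,
    Measure.map_id]

/-- The event that the walk stays nonpositive up to time `n`. -/
def stayEvent {Ω : Type*} (ξ : ℕ → Ω → ℝ) (n : ℕ) : Set Ω := {ω | ∀ k ≤ n, partialSum ξ k ω ≤ 0}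

/-- The event that the walk is first positive at time `n + 1`. -/
def firstEvent {Ω : Type*} (ξ : ℕ → Ω → ℝ) (n : ℕ) : Set Ω :=
  {ω | 0 < partialSum ξ (n + 1) ω} ∩ stayEvent ξ n

theorem ladderTime_of_mem_firstEvent {Ω : Type*} {ξ : ℕ → Ω → ℝ} {n : ℕ} {ω : Ω} (h : ω ∈ firstEvent ξ n) :
    ladderTime ξ ω = n + 1 := by
  refine (IsLeast.csInf_eq ⟨⟨n.succ_pos, h.1⟩, fun k hk => ?_⟩)
  by_contra hlt
  exact absurd hk.2 (not_lt.2 (h.2 k (by omega)))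

theorem mem_firstEvent_ladderTime {Ω : Type*} {ξ : ℕ → Ω → ℝ} {ω : Ω} (h : ∃ n : ℕ, 0 < n ∧ 0 < partialSum ξ n ω) :
    ∃ n, ω ∈ firstEvent ξ n := by
  classical
  obtain ⟨h1, h2⟩ := Nat.find_spec h
  obtain ⟨m, hm⟩ := Nat.exists_eq_succ_of_ne_zero h1.ne'
  refine ⟨m, by rw [hm] at h2; exact h2, fun k hk => ?_⟩
  rcases Nat.eq_zero_or_pos k with h0 | h0
  · simp [h0, partialSum]
  · have := Nat.find_min h (m := k) (by omega)
    by_contra hlt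
    exact this ⟨h0, not_le.1 hlt⟩

theorem disjoint_firstEvent {Ω : Type*} {ξ : ℕ → Ω → ℝ} : Pairwise (Function.onFun Disjoint (firstEvent ξ)) := by
  intro m n hmn
  refine Set.disjoint_left.2 fun ω hm hn => hmn ?_
  have h1 := ladderTime_of_mem_firstEvent hm
  have h2 := ladderTime_of_mem_firstEvent hn
  omega

theorem charFunDual_map_pair {Ω : Type*} [MeasurableSpace Ω] {μ : Measure Ω}
    {ξ η : ℕ → Ω → ℝ} (hξ : ∀ k, Measurable (ξ k)) (hη : ∀ k, Measurable (η k)) (s : ℝ) :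
    charFunDual (μ.map fun ω => (ξ 0 ω, η 0 ω)) (sndFreq s) = charFun (μ.map (η 0)) s := by
  rw [charFunDual_sndFreq, charFun_apply_real, integral_map ((hξ 0).prodMk (hη 0)).aemeasurable
    (Measurable.aestronglyMeasurable (by fun_prop)), integral_map (hη 0).aemeasurable
    (Measurable.aestronglyMeasurable (by fun_prop))]
  push_cast
  rfl

section Walk

variable {Ω : Type*} [MeasurableSpace Ω] {μ : Measure Ω} [IsProbabilityMeasure μ]
  {ξ η : ℕ → Ω → ℝ}

theorem measurable_partialSum {X : ℕ → Ω → ℝ} (hX : ∀ k, Measurable (X k)) (n : ℕ) :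
    Measurable (partialSum X n) := by
  unfold partialSum
  exact Finset.measurable_sum _ fun k _ => hX k

/-- V is the path of the first n steps padded with zeros, so every event of the past has the form
V⁻¹ A and is independent of step n. This is the Markov property in convolution form. -/
theorem map_restrict_add_step (hξ : ∀ k, Measurable (ξ k)) (hη : ∀ k, Measurable (η k))
    (hindep : iIndepFun (fun k ω => (ξ k ω, η k ω)) μ)
    (hident : ∀ k, IdentDistrib (fun ω => (ξ k ω, η k ω)) (fun ω => (ξ 0 ω, η 0 ω)) μ μ)
    (n : ℕ) {A : Set (ℕ → ℝ × ℝ)} (hA : MeasurableSet A) :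
    let V : Ω → ℕ → ℝ × ℝ := fun ω k => if k < n then (ξ k ω, η k ω) else 0
    (μ.restrict (V ⁻¹' A)).map (fun ω => (partialSum ξ (n + 1) ω, partialSum η (n + 1) ω)) =
      ((μ.restrict (V ⁻¹' A)).map (fun ω => (partialSum ξ n ω, partialSum η n ω))) ∗
        (μ.map fun ω => (ξ 0 ω, η 0 ω)) := by
  intro V
  have hX : ∀ k, Measurable fun ω => (ξ k ω, η k ω) := fun k => (hξ k).prodMk (hη k)
  have hVm : Measurable V := by
    refine measurable_pi_lambda _ fun k => ?_
    by_cases hk : k < n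
    · simpa [V, hk] using hX k
    · simp [V, hk]
  have hi : IndepFun V (fun ω => (ξ n ω, η n ω)) μ := by
    have h1 := hindep.indepFun_finset (Finset.range n) {n} (by simp) hX
    let g : (Finset.range n → ℝ × ℝ) → ℕ → ℝ × ℝ := fun v k =>
      if h : k ∈ Finset.range n then v ⟨k, h⟩ else 0
    have hg : Measurable g := by
      refine measurable_pi_lambda _ fun k => ?_
      by_cases hk : k ∈ Finset.range n
      · simp only [g, hk, dite_true]; exact measurable_pi_apply _
      · simp only [g, hk, dite_false]; exact measurable_const
    let g' : (({n} : Finset ℕ) → ℝ × ℝ) → ℝ × ℝ := fun v => v ⟨n, by simp⟩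
    have h2 := h1.comp hg (measurable_pi_apply _ : Measurable g')
    have e : V = g ∘ fun ω (i : Finset.range n) => (ξ i ω, η i ω) := by
      funext ω k
      simp [V, g]
    rw [e]
    exact h2
  have hz : Measurable fun v : ℕ → ℝ × ℝ => ∑ k ∈ Finset.range n, v k :=
    Finset.measurable_sum _ fun k _ => measurable_pi_apply k
  have hsum : ∀ ω, ∑ k ∈ Finset.range n, V ω k = (partialSum ξ n ω, partialSum η n ω) := by
    intro ω
    rw [Finset.sum_congr rfl fun k hk => if_pos (Finset.mem_range.1 hk)]
    ext <;> simp [partialSum, Prod.fst_sum, Prod.snd_sum]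
  have key := map_restrict_add_eq_conv hVm (hX n) hi hA hz
  rw [(hident n).map_eq] at key
  simp only [hsum] at key
  rw [← key]
  congr 1
  ext ω <;> simp [partialSum, Finset.sum_range_succ]

theorem map_restrict_stayEvent_succ (hξ : ∀ k, Measurable (ξ k)) (hη : ∀ k, Measurable (η k))
    (hindep : iIndepFun (fun k ω => (ξ k ω, η k ω)) μ)
    (hident : ∀ k, IdentDistrib (fun ω => (ξ k ω, η k ω)) (fun ω => (ξ 0 ω, η 0 ω)) μ μ) (n : ℕ) :
    (μ.restrict (stayEvent ξ n)).map
        (fun ω => (partialSum ξ (n + 1) ω, partialSum η (n + 1) ω)) =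
      ((μ.restrict (stayEvent ξ n)).map (fun ω => (partialSum ξ n ω, partialSum η n ω))) ∗
        (μ.map fun ω => (ξ 0 ω, η 0 ω)) := by
  have hA : MeasurableSet {v : ℕ → ℝ × ℝ | ∀ k ≤ n, ∑ i ∈ Finset.range k, (v i).1 ≤ 0} := by
    simp only [Set.ofPred_forall]
    refine MeasurableSet.iInter fun k => MeasurableSet.iInter fun _ => ?_
    exact measurableSet_le (Finset.measurable_sum _ fun i _ =>
      measurable_fst.comp (measurable_pi_apply i)) measurable_const
  have h := map_restrict_add_step hξ hη hindep hident n hA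
  have e : stayEvent ξ n = (fun ω k => if k < n then (ξ k ω, η k ω) else 0) ⁻¹'
      {v : ℕ → ℝ × ℝ | ∀ k ≤ n, ∑ i ∈ Finset.range k, (v i).1 ≤ 0} := by
    ext ω
    simp only [stayEvent, Set.mem_ofPred_eq, Set.mem_preimage]
    refine forall₂_congr fun k hk => ?_
    rw [Finset.sum_congr rfl fun i hi =>
      show ((if i < n then (ξ i ω, η i ω) else 0 : ℝ × ℝ)).1 = ξ i ω by
        rw [if_pos ((Finset.mem_range.1 hi).trans_le hk)]]
    rfl
  rw [e]
  exact h

theorem map_partialSum_eq_convPow (hξ : ∀ k, Measurable (ξ k)) (hη : ∀ k, Measurable (η k))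
    (hindep : iIndepFun (fun k ω => (ξ k ω, η k ω)) μ)
    (hident : ∀ k, IdentDistrib (fun ω => (ξ k ω, η k ω)) (fun ω => (ξ 0 ω, η 0 ω)) μ μ) (n : ℕ) :
    μ.map (fun ω => (partialSum ξ n ω, partialSum η n ω)) =
      convPow (μ.map fun ω => (ξ 0 ω, η 0 ω)) n := by
  induction n with
  | zero => simp [partialSum, convPow, ← Prod.zero_eq_mk]
  | succ n ih =>
    have h := map_restrict_add_step hξ hη hindep hident n MeasurableSet.univ
    simp only [Set.preimage_univ, Measure.restrict_univ] at h
    rw [h, ih]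
    rfl

theorem measurable_pair (hξ : ∀ k, Measurable (ξ k)) (hη : ∀ k, Measurable (η k)) (n : ℕ) :
    Measurable fun ω => (partialSum ξ n ω, partialSum η n ω) :=
  (measurable_partialSum hξ n).prodMk (measurable_partialSum hη n)

theorem map_restrict_stayEvent (hξ : ∀ k, Measurable (ξ k)) (hη : ∀ k, Measurable (η k))
    (hindep : iIndepFun (fun k ω => (ξ k ω, η k ω)) μ)
    (hident : ∀ k, IdentDistrib (fun ω => (ξ k ω, η k ω)) (fun ω => (ξ 0 ω, η 0 ω)) μ μ) (n : ℕ) :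
    (μ.restrict (stayEvent ξ n)).map (fun ω => (partialSum ξ n ω, partialSum η n ω)) =
      stayNonpos (μ.map fun ω => (ξ 0 ω, η 0 ω)) n := by
  induction n with
  | zero => simp [partialSum, stayNonpos, stayEvent, ← Prod.zero_eq_mk]
  | succ n ih =>
    have e : stayEvent ξ (n + 1) = (fun ω => (partialSum ξ (n + 1) ω, partialSum η (n + 1) ω)) ⁻¹'
        posHalfᶜ ∩ stayEvent ξ n := by
      ext ω
      simp only [stayEvent, posHalf, Set.mem_ofPred_eq, Set.mem_inter_iff, Set.mem_preimage,
        Set.mem_compl_iff, not_lt]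
      refine ⟨fun h => ⟨h _ le_rfl, fun k hk => h k (by omega)⟩, fun h k hk => ?_⟩
      rcases Nat.le_succ_iff.1 hk with h1 | h1
      · exact h.2 k h1
      · rw [h1]; exact h.1
    have hm := measurable_pair (ξ := ξ) (η := η) hξ hη (n + 1)
    rw [e, ← Measure.restrict_restrict (hm measurableSet_posHalf.compl),
      ← Measure.restrict_map hm measurableSet_posHalf.compl,
      map_restrict_stayEvent_succ hξ hη hindep hident, ih]
    rfl

theorem measurableSet_stayEvent (hξ : ∀ k, Measurable (ξ k)) (n : ℕ) :
    MeasurableSet (stayEvent ξ n) := by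
  simp only [stayEvent, Set.ofPred_forall]
  exact MeasurableSet.iInter fun k => MeasurableSet.iInter fun _ =>
    measurableSet_le (measurable_partialSum hξ k) measurable_const

theorem measurableSet_firstEvent (hξ : ∀ k, Measurable (ξ k)) (n : ℕ) :
    MeasurableSet (firstEvent ξ n) :=
  (measurableSet_lt measurable_const (measurable_partialSum hξ (n + 1))).inter
    (measurableSet_stayEvent hξ n)

theorem map_restrict_firstEvent (hξ : ∀ k, Measurable (ξ k)) (hη : ∀ k, Measurable (η k))
    (hindep : iIndepFun (fun k ω => (ξ k ω, η k ω)) μ)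
    (hident : ∀ k, IdentDistrib (fun ω => (ξ k ω, η k ω)) (fun ω => (ξ 0 ω, η 0 ω)) μ μ) (n : ℕ) :
    (μ.restrict (firstEvent ξ n)).map
        (fun ω => (partialSum ξ (n + 1) ω, partialSum η (n + 1) ω)) =
      firstPos (μ.map fun ω => (ξ 0 ω, η 0 ω)) n := by
  have hm := measurable_pair (ξ := ξ) (η := η) hξ hη (n + 1)
  have e : firstEvent ξ n = (fun ω => (partialSum ξ (n + 1) ω, partialSum η (n + 1) ω)) ⁻¹'
      posHalf ∩ stayEvent ξ n := rfl
  rw [e, ← Measure.restrict_restrict (hm measurableSet_posHalf),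
    ← Measure.restrict_map hm measurableSet_posHalf,
    map_restrict_stayEvent_succ hξ hη hindep hident, map_restrict_stayEvent hξ hη hindep hident]
  rfl

theorem measurable_ladderTime (hξ : ∀ k, Measurable (ξ k)) : Measurable (ladderTime ξ) := by
  refine measurable_to_countable' fun n => ?_
  rcases n with _ | n
  · have e : ladderTime ξ ⁻¹' {0} = (⋃ n, firstEvent ξ n)ᶜ := by
      ext ω
      simp only [Set.mem_preimage, Set.mem_singleton_iff, Set.mem_compl_iff, Set.mem_iUnion]
      refine ⟨?_, fun h => ?_⟩
      · rintro h ⟨n, hn⟩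
        have := ladderTime_of_mem_firstEvent hn
        omega
      · have h1 : {n : ℕ | 0 < n ∧ 0 < partialSum ξ n ω} = ∅ := by
          refine Set.eq_empty_iff_forall_notMem.2 fun n hn => h (mem_firstEvent_ladderTime ⟨n, hn⟩)
        simp [ladderTime, h1]
    rw [e]
    exact (MeasurableSet.iUnion fun n => measurableSet_firstEvent hξ n).compl
  · have e : ladderTime ξ ⁻¹' {n + 1} = firstEvent ξ n := by
      ext ω
      refine ⟨fun h => ?_, fun h => ladderTime_of_mem_firstEvent h⟩
      have h : ladderTime ξ ω = n + 1 := h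
      have h1 : ∃ n : ℕ, 0 < n ∧ 0 < partialSum ξ n ω := by
        by_contra hc
        have h1 : {n : ℕ | 0 < n ∧ 0 < partialSum ξ n ω} = ∅ :=
          Set.eq_empty_iff_forall_notMem.2 fun n hn => hc ⟨n, hn⟩
        simp [ladderTime, h1] at h
      obtain ⟨m, hm⟩ := mem_firstEvent_ladderTime h1
      have := ladderTime_of_mem_firstEvent hm
      have : m = n := by omega
      exact this ▸ hm
    rw [e]
    exact measurableSet_firstEvent hξ n

theorem measurable_ladderCost (hξ : ∀ k, Measurable (ξ k)) (hη : ∀ k, Measurable (η k)) :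
    Measurable (ladderCost ξ η) := by
  have h : Measurable fun p : ℕ × Ω => partialSum η p.1 p.2 :=
    measurable_from_prod_countable_right fun n => measurable_partialSum hη n
  exact h.comp ((measurable_ladderTime hξ).prodMk measurable_id)

-- The first passage events are disjoint, with union the event that the walk ever becomes positive.
-- Integration stays restricted to that union because finiteness of the ladder time is only derived
-- from the resulting identity.
variable (μ) in
theorem tsum_charFunDual_firstPos (hξ : ∀ k, Measurable (ξ k)) (hη : ∀ k, Measurable (η k))
    (hindep : iIndepFun (fun k ω => (ξ k ω, η k ω)) μ)
    (hident : ∀ k, IdentDistrib (fun ω => (ξ k ω, η k ω)) (fun ω => (ξ 0 ω, η 0 ω)) μ μ) (s : ℝ) :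
    ∑' n, charFunDual (firstPos (μ.map fun ω => (ξ 0 ω, η 0 ω)) n) (sndFreq s) =
      ∫ ω in ⋃ n, firstEvent ξ n, Complex.exp ((s * ladderCost ξ η ω : ℝ) * Complex.I) ∂μ := by
  have hi : Integrable (fun ω => Complex.exp ((s * ladderCost ξ η ω : ℝ) * Complex.I)) μ := by
    have := measurable_ladderCost hξ hη
    refine Integrable.of_bound (Measurable.aestronglyMeasurable (by fun_prop)) 1
      (Eventually.of_forall fun x => ?_)
    rw [Complex.norm_exp_ofReal_mul_I]
  rw [integral_iUnion (measurableSet_firstEvent hξ) disjoint_firstEvent hi.integrableOn]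
  refine tsum_congr fun n => ?_
  have hm := measurable_pair (ξ := ξ) (η := η) hξ hη (n + 1)
  rw [charFunDual_sndFreq, ← map_restrict_firstEvent hξ hη hindep hident,
    integral_map hm.aemeasurable (Measurable.aestronglyMeasurable (by fun_prop))]
  refine setIntegral_congr_fun (measurableSet_firstEvent hξ n) fun ω hω => ?_
  simp only [ladderCost, ladderTime_of_mem_firstEvent hω]

theorem convPow_symm (hξ : ∀ k, Measurable (ξ k)) (hη : ∀ k, Measurable (η k))
    (hindep : iIndepFun (fun k ω => (ξ k ω, η k ω)) μ)
    (hident : ∀ k, IdentDistrib (fun ω => (ξ k ω, η k ω)) (fun ω => (ξ 0 ω, η 0 ω)) μ μ)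
    (hsymm : IsSymmetricPair μ ξ η) (n : ℕ) :
    (convPow (μ.map fun ω => (ξ 0 ω, η 0 ω)) n).map (fun x => (-x.1, x.2)) =
      convPow (μ.map fun ω => (ξ 0 ω, η 0 ω)) n := by
  rw [← map_partialSum_eq_convPow hξ hη hindep hident,
    Measure.map_map (by fun_prop) (measurable_pair hξ hη n), hsymm n]
  rfl

theorem convPow_real_zeroLine (hξ : ∀ k, Measurable (ξ k)) (hη : ∀ k, Measurable (η k))
    (hindep : iIndepFun (fun k ω => (ξ k ω, η k ω)) μ)
    (hident : ∀ k, IdentDistrib (fun ω => (ξ k ω, η k ω)) (fun ω => (ξ 0 ω, η 0 ω)) μ μ) (n : ℕ) :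
    (convPow (μ.map fun ω => (ξ 0 ω, η 0 ω)) n).real zeroLine =
      μ.real {ω | partialSum ξ n ω = 0} := by
  rw [← map_partialSum_eq_convPow hξ hη hindep hident,
    map_measureReal_apply (measurable_pair hξ hη n) measurableSet_zeroLine]
  rfl

theorem charFunDual_convPow_zeroLine (hξ : ∀ k, Measurable (ξ k)) (hη : ∀ k, Measurable (η k))
    (hindep : iIndepFun (fun k ω => (ξ k ω, η k ω)) μ)
    (hident : ∀ k, IdentDistrib (fun ω => (ξ k ω, η k ω)) (fun ω => (ξ 0 ω, η 0 ω)) μ μ) (n : ℕ)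
    (s : ℝ) :
    charFunDual ((convPow (μ.map fun ω => (ξ 0 ω, η 0 ω)) n).restrict zeroLine) (sndFreq s) =
      ∫ ω in {ω | partialSum ξ n ω = 0},
        Complex.exp (Complex.I * ((s * partialSum η n ω : ℝ) : ℂ)) ∂μ := by
  rw [charFunDual_sndFreq, ← map_partialSum_eq_convPow hξ hη hindep hident,
    setIntegral_map measurableSet_zeroLine (Measurable.aestronglyMeasurable (by fun_prop))
      (measurable_pair hξ hη n).aemeasurable]
  refine integral_congr_ae (Eventually.of_forall fun ω => ?_)
  simp only [mul_comm Complex.I]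

theorem one_sub_integral_ladderCost (hξ : ∀ k, Measurable (ξ k)) (hη : ∀ k, Measurable (η k))
    (hindep : iIndepFun (fun k ω => (ξ k ω, η k ω)) μ)
    (hident : ∀ k, IdentDistrib (fun ω => (ξ k ω, η k ω)) (fun ω => (ξ 0 ω, η 0 ω)) μ μ)
    (hsymm : IsSymmetricPair μ ξ η)
    (hsum : Summable (fun n : ℕ => μ.real {ω | partialSum ξ (n + 1) ω = 0} / (n + 1))) (s : ℝ) :
    1 - ∫ ω in ⋃ n, firstEvent ξ n, Complex.exp ((s * ladderCost ξ η ω : ℝ) * Complex.I) ∂μ =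
      Phi μ ξ η 1 s * (1 - charFun (μ.map (η 0)) s) ^ (1 / 2 : ℂ) := by
  have : IsProbabilityMeasure (μ.map fun ω => (ξ 0 ω, η 0 ω)) :=
    Measure.isProbabilityMeasure_map ((hξ 0).prodMk (hη 0)).aemeasurable
  rw [← tsum_charFunDual_firstPos μ hξ hη hindep hident, one_sub_tsum_firstPos_eq _
    (convPow_symm hξ hη hindep hident hsymm)
    (by simpa only [convPow_real_zeroLine hξ hη hindep hident] using hsum),
    charFunDual_map_pair hξ hη]
  simp only [charFunDual_convPow_zeroLine hξ hη hindep hident, Phi]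
  congr 4
  funext n
  push_cast
  rw [one_pow]
  ring

/-- At s = 0 the factor (1 - φ)^{1/2} vanishes, so the Wiener–Hopf identity leaves no mass for the
event that the walk is never positive. -/
theorem ae_exists_partialSum_pos (hξ : ∀ k, Measurable (ξ k)) (hη : ∀ k, Measurable (η k))
    (hindep : iIndepFun (fun k ω => (ξ k ω, η k ω)) μ)
    (hident : ∀ k, IdentDistrib (fun ω => (ξ k ω, η k ω)) (fun ω => (ξ 0 ω, η 0 ω)) μ μ)
    (hsymm : IsSymmetricPair μ ξ η)
    (hsum : Summable (fun n : ℕ => μ.real {ω | partialSum ξ (n + 1) ω = 0} / (n + 1))) :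
    ∀ᵐ ω ∂μ, ω ∈ ⋃ n, firstEvent ξ n := by
  have : IsProbabilityMeasure (μ.map (η 0)) := Measure.isProbabilityMeasure_map (hη 0).aemeasurable
  have h := one_sub_integral_ladderCost hξ hη hindep hident hsymm hsum 0
  simp only [zero_mul, Complex.ofReal_zero, Complex.exp_zero, charFun_zero, probReal_univ,
    Complex.ofReal_one, sub_self] at h
  rw [Complex.zero_cpow (by norm_num), mul_zero, setIntegral_const, sub_eq_zero] at h
  have h1 : μ.real (⋃ n, firstEvent ξ n) = 1 := by
    have := congrArg Complex.re h
    simpa using this.symm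
  refine (mem_ae_iff_prob_eq_one (MeasurableSet.iUnion (measurableSet_firstEvent hξ))).2 ?_
  rw [measureReal_def, ENNReal.toReal_eq_one_iff] at h1
  exact h1

/-- The central identity. As the ladder time is almost surely finite, the restricted integral is the
full characteristic function of the ladder cost. -/
theorem one_sub_charFun_ladderCost (hξ : ∀ k, Measurable (ξ k)) (hη : ∀ k, Measurable (η k))
    (hindep : iIndepFun (fun k ω => (ξ k ω, η k ω)) μ)
    (hident : ∀ k, IdentDistrib (fun ω => (ξ k ω, η k ω)) (fun ω => (ξ 0 ω, η 0 ω)) μ μ)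
    (hsymm : IsSymmetricPair μ ξ η)
    (hsum : Summable (fun n : ℕ => μ.real {ω | partialSum ξ (n + 1) ω = 0} / (n + 1))) (s : ℝ) :
    1 - charFun (μ.map (ladderCost ξ η)) s =
      Phi μ ξ η 1 s * (1 - charFun (μ.map (η 0)) s) ^ (1 / 2 : ℂ) := by
  rw [← one_sub_integral_ladderCost hξ hη hindep hident hsymm hsum,
    Measure.restrict_eq_self_of_ae_mem
      (ae_exists_partialSum_pos hξ hη hindep hident hsymm hsum), charFun_apply_real,
    integral_map (measurable_ladderCost hξ hη).aemeasurable
      (Measurable.aestronglyMeasurable (by fun_prop))]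
  push_cast
  rfl

end Walk

/-! ### Return probabilities at zero and the constant Φ(1, 0) -/

theorem integral_cos_eq_re_charFun (ν : Measure ℝ) [IsFiniteMeasure ν] (t : ℝ) :
    ∫ x, Real.cos (t * x) ∂ν = (charFun ν t).re := by
  have hi : Integrable (fun x : ℝ => Complex.exp (t * x * Complex.I)) ν := by
    refine Integrable.of_bound (Measurable.aestronglyMeasurable (by fun_prop)) 1
      (Eventually.of_forall fun x => ?_)
    rw [← Complex.ofReal_mul, Complex.norm_exp_ofReal_mul_I]
  rw [charFun_apply_real]
  have := integral_re hi
  simp only [RCLike.re_to_complex] at this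
  rw [← this]
  refine integral_congr_ae (Eventually.of_forall fun x => ?_)
  simp only
  rw [← Complex.ofReal_mul, Complex.exp_ofReal_mul_I_re]

/-- A point mass is controlled by the decay of the characteristic function near zero. -/
theorem real_singleton_zero_le (ν : Measure ℝ) [IsProbabilityMeasure ν] {δ k : ℝ} (hδ : 0 < δ)
    (hk : 0 < k) (h : ∀ t, |t| ≤ δ → ‖charFun ν t‖ ≤ Real.exp (-k * t ^ 2)) :
    ν.real {0} ≤ √(Real.pi / (k * (δ / 2) ^ 2)) := by
  -- Frequencies b (u + v) with u, v in (-1, 1] stay within [-δ, δ], where the Gaussian bound is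
  -- available.
  set b := δ / 2 with hb
  have hb0 : 0 < b := by positivity
  let m : Measure ℝ := volume.restrict (Set.Ioc (-1) 1)
  have hm : IsFiniteMeasure m := ⟨by simp [m]⟩
  have hmm : m.real Set.univ = 2 := by
    simp only [m, measureReal_restrict_apply MeasurableSet.univ, Set.univ_inter,
      Real.volume_real_Ioc]
    norm_num
  have h1 : ∀ x : ℝ, ∫ u, Complex.exp ((u * (b * x) : ℝ) * Complex.I) ∂m =
      2 * (Real.sinc (b * x) : ℂ) := by
    intro x
    rw [← integral_exp_mul_I_eq_two_mul_sinc, intervalIntegral.integral_of_le (by norm_num)]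
  -- Two independent averages produce sinc², a nonnegative function equal to 1 at the origin, hence
  -- one that dominates the indicator of {0}.
  have h2 : ∀ x : ℝ, ∫ p : ℝ × ℝ, Complex.exp ((b * (p.1 + p.2) * x : ℝ) * Complex.I)
      ∂(m.prod m) = ((4 * Real.sinc (b * x) ^ 2 : ℝ) : ℂ) := by
    intro x
    have e : ∀ p : ℝ × ℝ, Complex.exp ((b * (p.1 + p.2) * x : ℝ) * Complex.I) =
        Complex.exp ((p.1 * (b * x) : ℝ) * Complex.I) *
          Complex.exp ((p.2 * (b * x) : ℝ) * Complex.I) := by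
      intro p
      rw [← Complex.exp_add]
      congr 1
      push_cast
      ring
    simp only [e]
    rw [integral_prod_mul (fun u : ℝ => Complex.exp ((u * (b * x) : ℝ) * Complex.I))
      (fun u : ℝ => Complex.exp ((u * (b * x) : ℝ) * Complex.I)), h1]
    push_cast
    ring
  have h3 : ((∫ x, 4 * Real.sinc (b * x) ^ 2 ∂ν : ℝ) : ℂ) =
      ∫ p : ℝ × ℝ, charFun ν (b * (p.1 + p.2)) ∂(m.prod m) := by
    rw [← integral_complex_ofReal]
    simp only [← h2, charFun_apply_real]
    rw [integral_integral_swap]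
    · refine integral_congr_ae (Eventually.of_forall fun p => ?_)
      push_cast
      rfl
    · refine Integrable.of_bound (Measurable.aestronglyMeasurable
        (by unfold Function.uncurry; fun_prop)) 1 (Eventually.of_forall fun x => ?_)
      simp only [Function.uncurry]
      rw [Complex.norm_exp_ofReal_mul_I]
  have h4 : 4 * ν.real {0} ≤ ∫ x, 4 * Real.sinc (b * x) ^ 2 ∂ν := by
    have : ∫ x, ({0} : Set ℝ).indicator (fun _ => (4 : ℝ)) x ∂ν = 4 * ν.real {0} := by
      rw [integral_indicator (measurableSet_singleton 0)]
      simp [mul_comm, measureReal_def]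
    rw [← this]
    refine integral_mono_of_nonneg (Eventually.of_forall fun x => ?_) ?_
      (Eventually.of_forall fun x => ?_)
    · exact Set.indicator_nonneg (fun _ _ => by norm_num) x
    · refine Integrable.of_bound (by fun_prop) 4 (Eventually.of_forall fun x => ?_)
      rw [Real.norm_of_nonneg (by positivity)]
      have := Real.neg_one_le_sinc (b * x)
      have := Real.sinc_le_one (b * x)
      nlinarith
    · by_cases hx : x = 0
      · simp [hx]
      · simp only [Set.mem_singleton_iff, hx, not_false_eq_true, Set.indicator_of_notMem]
        positivity
  set g : ℝ → ℝ := fun y => Real.exp (-(k * b ^ 2) * y ^ 2) with hg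
  have hgi : Integrable g := integrable_exp_neg_mul_sq (by positivity)
  have hgm : Integrable (fun p : ℝ × ℝ => g (p.1 + p.2)) (m.prod m) := by
    refine Integrable.of_bound (by fun_prop) 1 (Eventually.of_forall fun x => ?_)
    rw [Real.norm_of_nonneg (Real.exp_pos _).le]
    exact Real.exp_le_one_iff.2 (by
      have : 0 ≤ k * b ^ 2 * (x.1 + x.2) ^ 2 := by positivity
      linarith)
  have h5 : ‖∫ p : ℝ × ℝ, charFun ν (b * (p.1 + p.2)) ∂(m.prod m)‖ ≤
      ∫ p : ℝ × ℝ, g (p.1 + p.2) ∂(m.prod m) := by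
    refine norm_integral_le_of_norm_le hgm ?_
    have : ∀ᵐ p : ℝ × ℝ ∂(m.prod m), p ∈ Set.Ioc (-1 : ℝ) 1 ×ˢ Set.Ioc (-1 : ℝ) 1 := by
      rw [Measure.prod_restrict]
      exact ae_restrict_mem (measurableSet_Ioc.prod measurableSet_Ioc)
    filter_upwards [this] with p hp
    have hp1 := hp.1
    have hp2 := hp.2
    refine (h _ ?_).trans_eq ?_
    · rw [abs_mul, abs_of_pos hb0]
      have : |p.1 + p.2| ≤ 2 := abs_le.2 ⟨by linarith [hp1.1, hp2.1], by linarith [hp1.2, hp2.2]⟩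
      rw [hb]
      nlinarith
    · simp only [hg]
      congr 1
      ring
  have h6 : ∫ p : ℝ × ℝ, g (p.1 + p.2) ∂(m.prod m) ≤ 2 * √(Real.pi / (k * b ^ 2)) := by
    rw [integral_prod _ hgm]
    have h7 : ∀ u : ℝ, ∫ v, g (u + v) ∂m ≤ √(Real.pi / (k * b ^ 2)) := by
      intro u
      have h8 : ∫ v, g (u + v) = √(Real.pi / (k * b ^ 2)) := by
        rw [integral_add_left_eq_self (fun v => g v) u]
        exact integral_gaussian _
      rw [← h8]
      exact setIntegral_le_integral (hgi.comp_add_left u)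
        (Eventually.of_forall fun v => (Real.exp_pos _).le)
    calc _ ≤ ∫ u, √(Real.pi / (k * b ^ 2)) ∂m :=
          integral_mono_of_nonneg
            (Eventually.of_forall fun u => integral_nonneg fun v => (Real.exp_pos _).le)
            (integrable_const _) (Eventually.of_forall h7)
      _ = _ := by rw [integral_const, hmm, smul_eq_mul]
  have h9 := h4.trans ((le_abs_self _).trans_eq (Complex.norm_real _).symm)
  rw [h3] at h9
  have := Real.sqrt_nonneg (Real.pi / (k * b ^ 2))
  linarith [h9.trans (h5.trans h6)]

/-- Symmetry makes the transform real. The inequality cos y ≤ 1 - 2y²/π² for |y| ≤ π, applied on a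
bounded window carrying positive second moment, gives quadratic decay at 0 without assuming any
moment. -/
theorem exists_norm_charFun_le_exp (ν : Measure ℝ) [IsProbabilityMeasure ν]
    (hsymm : ν.map Neg.neg = ν) (hnd : ¬ ∀ᵐ x ∂ν, x = 0) :
    ∃ δ > 0, ∃ k > 0, ∀ t, |t| ≤ δ → ‖charFun ν t‖ ≤ Real.exp (-k * t ^ 2) := by
  have him : ∀ t, (charFun ν t).im = 0 := by
    intro t
    have := charFun_map_neg ν t
    rw [hsymm] at this
    exact Complex.conj_eq_iff_im.1 this.symm
  let q : ℕ → ℝ → ℝ := fun M => (Set.Icc (-(M : ℝ)) M).indicator fun x => x ^ 2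
  have hq0 : ∀ M x, 0 ≤ q M x := fun M x => Set.indicator_nonneg (fun _ _ => sq_nonneg _) x
  have hqi : ∀ M, Integrable (q M) ν := by
    intro M
    refine Integrable.of_bound
      ((Measurable.indicator (by fun_prop) measurableSet_Icc).aestronglyMeasurable) ((M : ℝ) ^ 2)
      (Eventually.of_forall fun x => ?_)
    rw [Real.norm_of_nonneg (hq0 M x)]
    refine Set.indicator_apply_le' (fun hx => ?_) fun _ => by positivity
    exact sq_le_sq' hx.1 hx.2
  obtain ⟨M, hM⟩ : ∃ M : ℕ, 0 < ∫ x, q M x ∂ν := by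
    by_contra hcon
    push Not at hcon
    refine hnd ?_
    have h1 : ∀ M : ℕ, ∀ᵐ x ∂ν, q M x = 0 := fun M =>
      (integral_eq_zero_iff_of_nonneg (hq0 M) (hqi M)).1
        (le_antisymm (hcon M) (integral_nonneg (hq0 M)))
    filter_upwards [ae_all_iff.2 h1] with x hx
    obtain ⟨M, hM⟩ := exists_nat_ge |x|
    have h2 := hx M
    simp only [q] at h2
    rw [Set.indicator_of_mem (show x ∈ Set.Icc (-(M : ℝ)) M from abs_le.1 hM)] at h2
    exact pow_eq_zero_iff two_ne_zero |>.1 h2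
  set V := ∫ x, q M x ∂ν
  have hM0 : 0 < (M : ℝ) := by
    rcases Nat.eq_zero_or_pos M with h | h
    · exfalso
      have : ∀ x, q M x = 0 := by
        intro x
        refine Set.indicator_apply_eq_zero.2 fun hx => ?_
        rw [h] at hx
        simp only [CharP.cast_eq_zero, neg_zero, Set.Icc_self, Set.mem_singleton_iff] at hx
        simp [hx]
      simp [V, this] at hM
    · exact_mod_cast h
  have hre0 : ∀ᶠ t in 𝓝 (0 : ℝ), 0 < (charFun ν t).re := by
    have : Continuous fun t => (charFun ν t).re := Complex.continuous_re.comp (by fun_prop)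
    refine (this.tendsto 0).eventually_const_lt ?_
    simp
  obtain ⟨δ, hδ, hδ'⟩ := Metric.eventually_nhds_iff.1 hre0
  -- The bound δ/2 keeps the transform positive, so its norm is its real part; π/M keeps |t x| ≤ π
  -- on the window [-M, M]; V is the truncated second moment.
  refine ⟨min (δ / 2) (Real.pi / M), by positivity, 2 / Real.pi ^ 2 * V, by positivity,
    fun t ht => ?_⟩
  have ht1 : 0 < (charFun ν t).re := hδ' (by
    rw [dist_zero_right, Real.norm_eq_abs]
    linarith [ht.trans (min_le_left _ _)])
  have ht2 : |t| * M ≤ Real.pi := (le_div_iff₀ hM0).1 (ht.trans (min_le_right _ _))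
  have e : charFun ν t = ((charFun ν t).re : ℂ) := by
    apply Complex.ext <;> simp [him]
  rw [e, Complex.norm_real, Real.norm_of_nonneg ht1.le, ← integral_cos_eq_re_charFun]
  have h3 : ∫ x, Real.cos (t * x) ∂ν ≤ ∫ x, (1 - 2 / Real.pi ^ 2 * t ^ 2 * q M x) ∂ν := by
    refine integral_mono ?_ ((integrable_const _).sub ((hqi M).const_mul _)) fun x => ?_
    · refine Integrable.of_bound (by fun_prop) 1 (Eventually.of_forall fun x => ?_)
      exact Real.abs_cos_le_one _
    · simp only [q]
      by_cases hx : x ∈ Set.Icc (-(M : ℝ)) M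
      · rw [Set.indicator_of_mem hx]
        have h4 : |t * x| ≤ Real.pi := by
          rw [abs_mul]
          exact (mul_le_mul_of_nonneg_left (abs_le.2 hx) (abs_nonneg t)).trans ht2
        have := Real.cos_le_one_sub_mul_cos_sq h4
        linarith
      · rw [Set.indicator_of_notMem hx, mul_zero, sub_zero]
        exact Real.cos_le_one _
  rw [integral_sub (integrable_const _) ((hqi M).const_mul _), integral_const_mul, integral_const,
    probReal_univ, one_smul] at h3
  have h5 := Real.add_one_le_exp (-(2 / Real.pi ^ 2 * V) * t ^ 2)
  calc _ ≤ 1 - 2 / Real.pi ^ 2 * t ^ 2 * V := h3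
    _ = -(2 / Real.pi ^ 2 * V) * t ^ 2 + 1 := by ring
    _ ≤ _ := h5

theorem map_neg_of_isSymmetricPair {Ω : Type*} [MeasurableSpace Ω] {μ : Measure Ω}
    {ξ η : ℕ → Ω → ℝ} (hξ : ∀ k, Measurable (ξ k)) (hη : ∀ k, Measurable (η k))
    (hsymm : IsSymmetricPair μ ξ η) : (μ.map (ξ 0)).map Neg.neg = μ.map (ξ 0) := by
  have h := congrArg (fun m => m.map Prod.fst) (hsymm 1)
  have e2 : (fun ω => (partialSum ξ 1 ω, partialSum η 1 ω)) = fun ω => (ξ 0 ω, η 0 ω) := by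
    funext ω; simp [partialSum]
  have e3 : (fun ω => (-partialSum ξ 1 ω, partialSum η 1 ω)) = fun ω => (-ξ 0 ω, η 0 ω) := by
    funext ω; simp [partialSum]
  rw [e2, e3] at h
  rw [Measure.map_map measurable_fst ((hξ 0).prodMk (hη 0)),
    Measure.map_map (f := fun ω => (-ξ 0 ω, η 0 ω)) measurable_fst
      ((hξ 0).neg.prodMk (hη 0))] at h
  rw [Measure.map_map measurable_neg (hξ 0)]
  exact h.symm

section Walk

variable {Ω : Type*} [MeasurableSpace Ω] {μ : Measure Ω} [IsProbabilityMeasure μ]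
  {ξ η : ℕ → Ω → ℝ}

theorem charFun_map_partialSum (hξ : ∀ k, Measurable (ξ k)) (hη : ∀ k, Measurable (η k))
    (hindep : iIndepFun (fun k ω => (ξ k ω, η k ω)) μ)
    (hident : ∀ k, IdentDistrib (fun ω => (ξ k ω, η k ω)) (fun ω => (ξ 0 ω, η 0 ω)) μ μ)
    (n : ℕ) (t : ℝ) :
    charFun (μ.map (partialSum ξ n)) t = charFun (μ.map (ξ 0)) t ^ n := by
  let L : StrongDual ℝ (ℝ × ℝ) := t • ContinuousLinearMap.fst ℝ ℝ ℝ
  have h0 : IsProbabilityMeasure (μ.map fun ω => (ξ 0 ω, η 0 ω)) :=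
    Measure.isProbabilityMeasure_map ((hξ 0).prodMk (hη 0)).aemeasurable
  have key : ∀ X Y : Ω → ℝ, Measurable X → Measurable Y →
      charFunDual (μ.map fun ω => (X ω, Y ω)) L = charFun (μ.map X) t := by
    intro X Y hX hY
    rw [charFunDual_apply, charFun_apply_real, integral_map (hX.prodMk hY).aemeasurable
      (Measurable.aestronglyMeasurable (by fun_prop)), integral_map hX.aemeasurable
      (Measurable.aestronglyMeasurable (by fun_prop))]
    simp [L]
  have h := congrFun (charFunDual_convPow (μ.map fun ω => (ξ 0 ω, η 0 ω)) n) L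
  rw [← map_partialSum_eq_convPow hξ hη hindep hident,
    key _ _ (measurable_partialSum hξ n) (measurable_partialSum hη n), Pi.pow_apply,
    key _ _ (hξ 0) (hη 0)] at h
  exact h

/-- The transform of S_n is an n-th power, so the Gaussian rate k becomes n k, and the estimate for
the mass at 0 acquires the factor n^{-1/2}. -/
theorem exists_real_partialSum_eq_zero_le (hξ : ∀ k, Measurable (ξ k))
    (hη : ∀ k, Measurable (η k))
    (hindep : iIndepFun (fun k ω => (ξ k ω, η k ω)) μ)
    (hident : ∀ k, IdentDistrib (fun ω => (ξ k ω, η k ω)) (fun ω => (ξ 0 ω, η 0 ω)) μ μ)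
    (hsymm : IsSymmetricPair μ ξ η) (hnondeg : ¬ ∀ᵐ ω ∂μ, ξ 0 ω = 0) :
    ∃ K > 0, ∀ n : ℕ, 0 < n → μ.real {ω | partialSum ξ n ω = 0} ≤ K / √n := by
  have h0 : IsProbabilityMeasure (μ.map (ξ 0)) := Measure.isProbabilityMeasure_map (hξ 0).aemeasurable
  obtain ⟨δ, hδ, k, hk, h⟩ := exists_norm_charFun_le_exp (μ.map (ξ 0))
    (map_neg_of_isSymmetricPair hξ hη hsymm) (fun hcon => hnondeg (ae_of_ae_map (hξ 0).aemeasurable hcon))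
  have hπ := Real.pi_pos
  refine ⟨√(Real.pi / (k * (δ / 2) ^ 2)), by positivity, fun n hn => ?_⟩
  have hn : 0 < (n : ℝ) := by exact_mod_cast hn
  have hm := measurable_partialSum hξ n
  have h1 : IsProbabilityMeasure (μ.map (partialSum ξ n)) :=
    Measure.isProbabilityMeasure_map hm.aemeasurable
  have h2 := real_singleton_zero_le (μ.map (partialSum ξ n)) hδ (mul_pos hn hk) fun t ht => by
    rw [charFun_map_partialSum hξ hη hindep hident, norm_pow]
    refine (pow_le_pow_left₀ (norm_nonneg _) (h t ht) n).trans_eq ?_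
    rw [← Real.exp_nat_mul]
    congr 1
    ring
  rw [map_measureReal_apply hm (measurableSet_singleton 0)] at h2
  refine h2.trans_eq ?_
  rw [← Real.sqrt_div (by positivity)]
  congr 1
  field_simp

theorem summable_div_sqrt_div (K : ℝ) : Summable fun n : ℕ => K / √((n + 1 : ℕ) : ℝ) / (n + 1) := by
  have h := (summable_nat_add_iff 1).2
    (Real.summable_one_div_nat_rpow.2 (show (1 : ℝ) < 3 / 2 by norm_num))
  refine (h.mul_left K).congr fun n => ?_
  have hn : 0 < ((n + 1 : ℕ) : ℝ) := by positivity
  rw [show (3 / 2 : ℝ) = 1 / 2 + 1 by norm_num, Real.rpow_add hn, Real.rpow_one,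
    ← Real.sqrt_eq_rpow]
  push_cast
  field_simp

theorem summable_real_partialSum_eq_zero (hξ : ∀ k, Measurable (ξ k))
    (hη : ∀ k, Measurable (η k))
    (hindep : iIndepFun (fun k ω => (ξ k ω, η k ω)) μ)
    (hident : ∀ k, IdentDistrib (fun ω => (ξ k ω, η k ω)) (fun ω => (ξ 0 ω, η 0 ω)) μ μ)
    (hsymm : IsSymmetricPair μ ξ η) (hnondeg : ¬ ∀ᵐ ω ∂μ, ξ 0 ω = 0) :
    Summable (fun n : ℕ => μ.real {ω | partialSum ξ (n + 1) ω = 0} / (n + 1)) := by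
  obtain ⟨K, -, hK⟩ := exists_real_partialSum_eq_zero_le hξ hη hindep hident hsymm hnondeg
  refine Summable.of_nonneg_of_le (fun n => by positivity) (fun n => ?_) (summable_div_sqrt_div K)
  gcongr
  exact hK _ n.succ_pos

/-- The value of `Φ(1, 0)`. -/
noncomputable def phiOne {Ω : Type*} [MeasurableSpace Ω] (μ : Measure Ω) (ξ : ℕ → Ω → ℝ) : ℝ :=
  Real.exp (1 / 2 * ∑' n : ℕ, μ.real {ω | partialSum ξ (n + 1) ω = 0} / (n + 1))

theorem Phi_one_zero {Ω : Type*} [MeasurableSpace Ω] (μ : Measure Ω) (ξ η : ℕ → Ω → ℝ) :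
    Phi μ ξ η 1 0 = phiOne μ ξ := by
  simp only [Phi, phiOne, Complex.ofReal_exp]
  push_cast
  congr 2
  refine tsum_congr fun n => ?_
  simp only [zero_mul, mul_zero, Complex.exp_zero, one_pow]
  rw [setIntegral_const]
  simp [div_eq_inv_mul]

/-- Dominated convergence twice: in each expectation, with bound 1, and in the series, with the
summable bound P[S_n = 0]/n. -/
theorem tendsto_Phi (hη : ∀ k, Measurable (η k))
    (hsum : Summable (fun n : ℕ => μ.real {ω | partialSum ξ (n + 1) ω = 0} / (n + 1))) :
    Tendsto (fun s => Phi μ ξ η 1 s) (𝓝[>] 0) (𝓝 (phiOne μ ξ : ℂ)) := by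
  rw [← Phi_one_zero μ ξ η]
  unfold Phi
  refine (Complex.continuous_exp.tendsto _).comp (Tendsto.const_mul _ ?_)
  refine tendsto_tsum_of_dominated_convergence hsum (fun n => ?_)
    (Eventually.of_forall fun s n => ?_)
  · refine Tendsto.const_mul _ (Tendsto.mono_left ?_ nhdsWithin_le_nhds)
    refine tendsto_integral_filter_of_dominated_convergence (fun _ => 1)
      (Eventually.of_forall fun s => ?_) (Eventually.of_forall fun s =>
        Eventually.of_forall fun ω => ?_) (integrable_const _) (Eventually.of_forall fun ω => ?_)
    · have := measurable_partialSum hη (n + 1)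
      exact Measurable.aestronglyMeasurable (by fun_prop)
    · rw [mul_comm, Complex.norm_exp_ofReal_mul_I]
    · have : Continuous fun s : ℝ =>
        Complex.exp (Complex.I * ((s * partialSum η (n + 1) ω : ℝ) : ℂ)) := by fun_prop
      exact this.tendsto 0
  · rw [norm_mul, Complex.norm_real, one_pow, Real.norm_of_nonneg (by positivity), div_mul_eq_mul_div,
      one_mul]
    gcongr
    refine (norm_integral_le_of_norm_le_const (C := 1) (Eventually.of_forall fun ω => ?_)).trans ?_
    · rw [mul_comm, Complex.norm_exp_ofReal_mul_I]
    · rw [one_mul, measureReal_restrict_apply MeasurableSet.univ, Set.univ_inter]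

/-- Conditionally on the earlier steps, S_{n+1} = 0 asks the last increment to take one prescribed
value, which has probability zero. -/
theorem phiOne_eq_one_of_no_atoms (hξ : ∀ k, Measurable (ξ k)) (hη : ∀ k, Measurable (η k))
    (hindep : iIndepFun (fun k ω => (ξ k ω, η k ω)) μ)
    (hident : ∀ k, IdentDistrib (fun ω => (ξ k ω, η k ω)) (fun ω => (ξ 0 ω, η 0 ω)) μ μ)
    (hatom : ∀ x : ℝ, μ {ω | ξ 0 ω = x} = 0) : phiOne μ ξ = 1 := by
  have h : ∀ n, μ.real {ω | partialSum ξ (n + 1) ω = 0} = 0 := by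
    intro n
    have h0 : IsProbabilityMeasure (μ.map fun ω => (ξ 0 ω, η 0 ω)) :=
      Measure.isProbabilityMeasure_map ((hξ 0).prodMk (hη 0)).aemeasurable
    rw [← convPow_real_zeroLine hξ hη hindep hident, measureReal_def, convPow, Measure.conv,
      Measure.map_apply (by fun_prop) measurableSet_zeroLine]
    rw [(Measure.measure_prod_null ((by fun_prop : Measurable
      fun x : (ℝ × ℝ) × (ℝ × ℝ) => x.1 + x.2) measurableSet_zeroLine)).2, ENNReal.toReal_zero]
    refine Eventually.of_forall fun x => ?_
    have hm : MeasurableSet (Prod.mk x ⁻¹'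
        ((fun x : (ℝ × ℝ) × (ℝ × ℝ) => x.1 + x.2) ⁻¹' zeroLine)) :=
      (by fun_prop : Measurable fun y : ℝ × ℝ => x + y) measurableSet_zeroLine
    beta_reduce
    rw [Measure.map_apply ((hξ 0).prodMk (hη 0)) hm, Pi.zero_apply, ← hatom (-x.1)]
    congr 1
    ext ω
    simp only [zeroLine, Set.mem_preimage, Set.mem_ofPred_eq, Prod.fst_add]
    exact ⟨fun h => by linarith, fun h => by linarith⟩
  simp [phiOne, h]

end Walk

/-! ### The integral formula on the lattice -/

theorem ae_summable_and_integrable_tsum {α : Type*} [MeasurableSpace α] {m : Measure α}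
    {F : ℕ → α → ℂ} (hF : ∀ n, Integrable (F n) m) (hs : Summable fun n => ∫ a, ‖F n a‖ ∂m) :
    (∀ᵐ a ∂m, Summable fun n => ‖F n a‖) ∧ Integrable (fun a => ∑' n, F n a) m := by
  have h1 : ∫⁻ a, ∑' n, ‖F n a‖ₑ ∂m < ⊤ := by
    rw [lintegral_tsum fun n => (hF n).1.enorm]
    simp only [← ofReal_integral_norm_eq_lintegral_enorm (hF _)]
    rw [← ENNReal.ofReal_tsum_of_nonneg (fun n => integral_nonneg fun a => norm_nonneg _) hs]
    exact ENNReal.ofReal_lt_top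
  have h2 : ∀ᵐ a ∂m, Summable fun n => ‖F n a‖ := by
    filter_upwards [ae_lt_top' (AEMeasurable.tsum fun n => (hF n).1.enorm) h1.ne] with a ha
    exact tsum_enorm_ne_top_iff_summable_norm.1 ha.ne
  refine ⟨h2, ?_, ?_⟩
  · exact aestronglyMeasurable_of_tendsto_ae atTop
      (f := fun n a => ∑ k ∈ Finset.range n, F k a)
      (fun n => Finset.aestronglyMeasurable_fun_sum _ fun k _ => (hF k).1) (by
        filter_upwards [h2] with a ha using ha.of_norm.hasSum.tendsto_sum_nat)
  · refine (lintegral_mono fun a => ?_).trans_lt h1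
    exact enorm_tsum_le_tsum_enorm

/-- If `∑ ‖∫ fⁿ‖ / n` converges absolutely then `log (1 - f)` is integrable and can be integrated
term by term. -/
theorem integrable_log_one_sub {α : Type*} [MeasurableSpace α] {m : Measure α} {f : α → ℂ}
    (hf : ∀ a, ‖f a‖ ≤ 1) (hi : ∀ n, Integrable (fun a => f a ^ (n + 1)) m)
    (hs : Summable fun n : ℕ => (∫ a, ‖f a ^ (n + 1)‖ ∂m) / (n + 1)) :
    Integrable (fun a => Complex.log (1 - f a)) m ∧
      ∫ a, Complex.log (1 - f a) ∂m =
        -∑' n : ℕ, (∫ a, f a ^ (n + 1) ∂m) / ((n + 1 : ℕ) : ℂ) := by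
  let F : ℕ → α → ℂ := fun n a => f a ^ (n + 1) / ((n + 1 : ℕ) : ℂ)
  have hF : ∀ n, Integrable (F n) m := fun n => (hi n).div_const _
  have hn : ∀ n a, ‖F n a‖ = ‖f a ^ (n + 1)‖ / (n + 1) := by
    intro n a
    simp only [F]
    rw [norm_div, Complex.norm_natCast]
    push_cast
    rfl
  have hFs : Summable fun n => ∫ a, ‖F n a‖ ∂m := by
    refine hs.congr fun n => ?_
    simp only [hn]
    rw [integral_div]
  obtain ⟨h1, h2⟩ := ae_summable_and_integrable_tsum hF hFs
  have hlog : ∀ᵐ a ∂m, ∑' n, F n a = -Complex.log (1 - f a) := by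
    filter_upwards [h1] with a ha
    -- If |f| = 1 the norms would form the harmonic series, contradicting almost everywhere absolute
    -- summability.
    have hlt : ‖f a‖ < 1 := by
      refine lt_of_le_of_ne (hf a) fun h => ?_
      have : Summable fun n : ℕ => 1 / ((n + 1 : ℕ) : ℝ) := by
        refine ha.congr fun n => ?_
        rw [hn, norm_pow, h, one_pow]
        push_cast
        rfl
      exact Real.not_summable_one_div_natCast ((summable_nat_add_iff 1).1 this)
    have := (hasSum_nat_add_iff' 1).2 (Complex.hasSum_taylorSeries_neg_log hlt)
    simp only [Finset.sum_range_one, CharP.cast_eq_zero, div_zero, sub_zero] at this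
    exact this.tsum_eq
  have h3 := h2.congr hlog
  refine ⟨by simpa using h3.neg, ?_⟩
  have h4 := (hasSum_integral_of_summable_integral_norm hF hFs).tsum_eq
  rw [integral_congr_ae hlog, integral_neg] at h4
  rw [← neg_eq_iff_eq_neg, ← h4]
  exact tsum_congr fun n => (integral_div (((n + 1 : ℕ) : ℂ)) fun a => f a ^ (n + 1))

/-- Inversion formula on the integers. -/
theorem integral_re_charFun_eq (ν : Measure ℝ) [IsProbabilityMeasure ν]
    (hZ : ∀ᵐ x : ℝ ∂ν, ∃ k : ℤ, x = k) :
    ∫ t in Set.Ioc 0 Real.pi, (charFun ν t).re = Real.pi * ν.real {0} := by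
  simp only [← integral_cos_eq_re_charFun]
  rw [integral_integral_swap]
  · have h1 : ∀ᵐ x ∂ν, ∫ t in Set.Ioc 0 Real.pi, Real.cos (t * x) =
        ({0} : Set ℝ).indicator (fun _ => Real.pi) x := by
      filter_upwards [hZ] with x ⟨k, hk⟩
      rw [← intervalIntegral.integral_of_le Real.pi_pos.le]
      by_cases hx : x = 0
      · simp [hx]
      · rw [Set.indicator_of_notMem (by simpa using hx),
          intervalIntegral.integral_comp_mul_right (fun t => Real.cos t) hx, integral_cos]
        rw [hk, zero_mul, Real.sin_zero, mul_comm, Real.sin_int_mul_pi]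
        simp
    rw [integral_congr_ae h1, integral_indicator (measurableSet_singleton 0)]
    simp [mul_comm, measureReal_def]
  · refine Integrable.of_bound (Measurable.aestronglyMeasurable
      (by unfold Function.uncurry; fun_prop)) 1 (Eventually.of_forall fun x => ?_)
    exact Real.abs_cos_le_one _

section Walk

variable {Ω : Type*} [MeasurableSpace Ω] {μ : Measure Ω} [IsProbabilityMeasure μ]
  {ξ η : ℕ → Ω → ℝ}

/-- Expand log(1 - ψ) in powers of ψ = E exp(i t ξ) and invert on (0, π]: the integral of ψⁿ is π
P[S_n = 0]. Summability of ∫ |ψ|ⁿ / n justifies the exchange and gives integrability of the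
logarithm. -/
theorem lattice_formula (hξ : ∀ k, Measurable (ξ k)) (hη : ∀ k, Measurable (η k))
    (hindep : iIndepFun (fun k ω => (ξ k ω, η k ω)) μ)
    (hident : ∀ k, IdentDistrib (fun ω => (ξ k ω, η k ω)) (fun ω => (ξ 0 ω, η 0 ω)) μ μ)
    (hsymm : IsSymmetricPair μ ξ η) (hnondeg : ¬ ∀ᵐ ω ∂μ, ξ 0 ω = 0)
    (hZ : ∀ᵐ ω ∂μ, ∃ m : ℤ, ξ 0 ω = m) :
    IntervalIntegrable (fun t => Complex.log (1 - jointCharFun μ (ξ 0) (η 0) t 0))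
        volume 0 Real.pi ∧
      Phi μ ξ η 1 0 = latticePhi μ ξ η 1 0 := by
  have h0 : IsProbabilityMeasure (μ.map (ξ 0)) := Measure.isProbabilityMeasure_map (hξ 0).aemeasurable
  have hj : ∀ t, jointCharFun μ (ξ 0) (η 0) t 0 = charFun (μ.map (ξ 0)) t := by
    intro t
    rw [charFun_apply_real, integral_map (hξ 0).aemeasurable
      (Measurable.aestronglyMeasurable (by fun_prop)), jointCharFun]
    refine integral_congr_ae (Eventually.of_forall fun ω => ?_)
    simp only [zero_mul, add_zero]
    push_cast
    rw [mul_comm]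
  set ψ := charFun (μ.map (ξ 0)) with hψ
  have hψ1 : ∀ t, ‖ψ t‖ ≤ 1 := norm_charFun_le_one
  have hψre : ∀ t, ψ t = ((ψ t).re : ℂ) := by
    intro t
    have h1 := charFun_map_neg (μ.map (ξ 0)) t
    rw [map_neg_of_isSymmetricPair hξ hη hsymm] at h1
    exact (Complex.conj_eq_iff_re.1 h1.symm).symm
  have hψc : Continuous ψ := by fun_prop
  have hpow : ∀ n t, ψ t ^ n = (((ψ t).re ^ n : ℝ) : ℂ) := by
    intro n t
    conv_lhs => rw [hψre t]
    push_cast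
    rfl
  have hint : ∀ n, ∫ t in Set.Ioc 0 Real.pi, ψ t ^ n =
      ((Real.pi * μ.real {ω | partialSum ξ n ω = 0} : ℝ) : ℂ) := by
    intro n
    have hm := measurable_partialSum hξ n
    have h1 : IsProbabilityMeasure (μ.map (partialSum ξ n)) :=
      Measure.isProbabilityMeasure_map hm.aemeasurable
    have hZn : ∀ᵐ x : ℝ ∂(μ.map (partialSum ξ n)), ∃ k : ℤ, x = k := by
      have hmeas : MeasurableSet {x : ℝ | ∃ k : ℤ, x = k} := by
        have : {x : ℝ | ∃ k : ℤ, x = k} = Set.range ((↑) : ℤ → ℝ) := by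
          ext x; simp [eq_comm]
        rw [this]
        exact (Set.countable_range _).measurableSet
      rw [ae_map_iff hm.aemeasurable hmeas]
      have h2 : ∀ k, ∀ᵐ ω ∂μ, ∃ m : ℤ, ξ k ω = m := by
        intro k
        have h3 : IdentDistrib (ξ k) (ξ 0) μ μ := (hident k).comp measurable_fst
        have h4 : ∀ᵐ x ∂(μ.map (ξ 0)), x ∈ {x : ℝ | ∃ k : ℤ, x = k} :=
          (ae_map_iff (hξ 0).aemeasurable hmeas).2 hZ
        rw [← h3.map_eq] at h4
        exact (ae_map_iff (hξ k).aemeasurable hmeas).1 h4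
      filter_upwards [ae_all_iff.2 h2] with ω hω
      choose m hm using hω
      exact ⟨∑ k ∈ Finset.range n, m k, by simp [partialSum, hm]⟩
    have h2 := integral_re_charFun_eq _ hZn
    rw [map_measureReal_apply hm (measurableSet_singleton 0)] at h2
    have h3 : ∀ t, (charFun (μ.map (partialSum ξ n)) t).re = (ψ t).re ^ n := by
      intro t
      rw [charFun_map_partialSum hξ hη hindep hident, ← hψ, hpow, Complex.ofReal_re]
    simp only [h3] at h2
    simp only [hpow]
    rw [integral_complex_ofReal, h2]
    rfl
  have hi : ∀ n, IntegrableOn (fun t => ψ t ^ n) (Set.Ioc 0 Real.pi) := fun n =>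
    ((hψc.pow n).continuousOn.integrableOn_Icc).mono_set Set.Ioc_subset_Icc_self
  obtain ⟨K, hK0, hK⟩ := exists_real_partialSum_eq_zero_le hξ hη hindep hident hsymm hnondeg
  have hπ := Real.pi_pos
  -- ψ is real by symmetry, so even powers are their own absolute values and inversion evaluates
  -- their norms exactly; an odd power is bounded by the preceding even one.
  have heven : ∀ k : ℕ, ∫ t in Set.Ioc 0 Real.pi, ‖ψ t ^ (2 * k)‖ =
      Real.pi * μ.real {ω | partialSum ξ (2 * k) ω = 0} := by
    intro k
    have h1 := hint (2 * k)
    simp only [hpow] at h1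
    rw [integral_complex_ofReal] at h1
    have h1 := Complex.ofReal_injective h1
    rw [← h1]
    refine integral_congr_ae (Eventually.of_forall fun t => ?_)
    simp only
    rw [hpow, Complex.norm_real, Real.norm_of_nonneg]
    rw [pow_mul]
    positivity
  have hbound : ∀ n : ℕ, ∫ t in Set.Ioc 0 Real.pi, ‖ψ t ^ (n + 1)‖ ≤
      (2 * Real.pi * K + Real.pi) / √((n + 1 : ℕ) : ℝ) := by
    intro n
    have hmono : ∀ a b : ℕ, a ≤ b → ∫ t in Set.Ioc 0 Real.pi, ‖ψ t ^ b‖ ≤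
        ∫ t in Set.Ioc 0 Real.pi, ‖ψ t ^ a‖ := fun a b hab =>
      integral_mono (hi b).norm (hi a).norm fun t => by
        simp only [norm_pow]
        exact pow_le_pow_of_le_one (norm_nonneg _) (hψ1 t) hab
    -- The slack m ≤ 4·2k costs a factor 2 in √m and covers both m = 2k and m = 2k + 1. The extra π
    -- in the constant is for the power 1, which is compared with the power 0.
    have hle : ∀ k m : ℕ, 0 < k → 0 < m → m ≤ 4 * (2 * k) →
        ∫ t in Set.Ioc 0 Real.pi, ‖ψ t ^ (2 * k)‖ ≤ (2 * Real.pi * K + Real.pi) / √(m : ℝ) := by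
      intro k m hk hm hkm
      rw [heven]
      have hm0 : 0 < (m : ℝ) := by exact_mod_cast hm
      have h1 := hK (2 * k) (by omega)
      have h2 : √(m : ℝ) ≤ 2 * √((2 * k : ℕ) : ℝ) := by
        rw [show (2 : ℝ) = √4 by rw [show (4 : ℝ) = 2 ^ 2 by norm_num, Real.sqrt_sq zero_le_two],
          ← Real.sqrt_mul (by norm_num)]
        exact Real.sqrt_le_sqrt (by exact_mod_cast hkm)
      have h3 : 0 < √((2 * k : ℕ) : ℝ) := Real.sqrt_pos.2 (by exact_mod_cast (by omega : 0 < 2 * k))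
      have h4 : 0 < √(m : ℝ) := Real.sqrt_pos.2 hm0
      have h5 : K / √((2 * k : ℕ) : ℝ) ≤ 2 * K / √(m : ℝ) := by
        rw [div_le_div_iff₀ h3 h4]
        nlinarith
      calc _ ≤ Real.pi * (2 * K / √(m : ℝ)) := by gcongr; exact h1.trans h5
        _ = (2 * Real.pi * K) / √(m : ℝ) := by ring
        _ ≤ _ := by gcongr; linarith
    rcases Nat.even_or_odd' (n + 1) with ⟨k, hk | hk⟩
    · rw [hk]
      exact hle k (2 * k) (by omega) (by omega) (by omega)
    · rcases Nat.eq_zero_or_pos k with h | h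
      · have hn0 : n = 0 := by omega
        subst hn0
        refine (hmono 0 _ (Nat.zero_le _)).trans ?_
        simp only [pow_zero, norm_one, zero_add, Nat.cast_one, Real.sqrt_one, div_one]
        rw [setIntegral_const, Real.volume_real_Ioc_of_le hπ.le]
        simp only [sub_zero, smul_eq_mul, mul_one]
        have : 0 < 2 * Real.pi * K := by positivity
        linarith
      · rw [hk]
        exact (hmono _ _ (Nat.le_succ _)).trans (hle k _ h (by omega) (by omega))
  obtain ⟨h1, h2⟩ := integrable_log_one_sub (m := volume.restrict (Set.Ioc 0 Real.pi)) hψ1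
    (fun n => hi (n + 1)) (Summable.of_nonneg_of_le
      (fun n => div_nonneg (integral_nonneg fun t => norm_nonneg _) (by positivity))
      (fun n => by gcongr; exact hbound n) (summable_div_sqrt_div _))
  simp only [hj]
  refine ⟨(intervalIntegrable_iff_integrableOn_Ioc_of_le hπ.le).2 h1, ?_⟩
  rw [Phi_one_zero, latticePhi, intervalIntegral.integral_of_le hπ.le]
  simp only [hj, Complex.ofReal_one, one_mul]
  rw [h2, phiOne, Complex.ofReal_exp]
  congr 1
  simp only [hint]
  have hπc : (Real.pi : ℂ) ≠ 0 := by exact_mod_cast hπ.ne'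
  push_cast
  simp only [mul_div_assoc]
  rw [tsum_mul_left]
  field_simp

end Walk

/-! ### Square roots: tails and attraction from expansions of φ -/

theorem eventually_inv_atTop {P : ℝ → Prop} (h : ∀ᶠ s in 𝓝[>] (0 : ℝ), P s) :
    ∀ᶠ x in atTop, P x⁻¹ := tendsto_inv_atTop_nhdsGT_zero.eventually h

/-- The Tauberian theorem also yields p, q ≥ 0. Then |q - p| ≤ p + q, which is the bound on the
phase of the limit w needed for a skewness in [-1, 1]. -/
theorem attraction_and_tails_of_lt_one {Ω : Type*} [MeasurableSpace Ω] (μ : Measure Ω)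
    [IsProbabilityMeasure μ] {X : Ω → ℝ} (hX : Measurable X) {α p q : ℝ}
    {g : ℝ → ℝ} (h0 : 0 < α) (h1 : α < 1) (hpq : 0 < p + q)
    (hg : ∀ᶠ s in 𝓝[>] 0, 0 < g s)
    (hF : Tendsto (fun s => (1 - charFun (μ.map X) s) / (g s : ℂ)) (𝓝[>] 0)
      (𝓝 (Real.Gamma (1 - α) * (p * Complex.exp (-(Real.pi * α / 2 : ℝ) * Complex.I) +
        q * Complex.exp ((Real.pi * α / 2 : ℝ) * Complex.I)))))
    (hr : ∀ t : ℝ, 0 < t → Tendsto (fun s => g (t * s) / g s) (𝓝[>] 0) (𝓝 (t ^ α)))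
    (hmono : ∃ δ > 0, MonotoneOn g (Set.Ioo 0 δ)) :
    InDomainOfAttraction μ X α ∧ 0 ≤ p ∧ 0 ≤ q ∧
      TailEquiv (upperTail μ X) p (fun x => g x⁻¹) ∧
      TailEquiv (lowerTail μ X) q (fun x => g x⁻¹) := by
  obtain ⟨hp, hq, hu, hl⟩ := tendsto_tails_of_lt_one μ hX h0 h1 hpq hg hF hr hmono
  have hne : ∀ᶠ x in atTop, g x⁻¹ ≠ 0 := (eventually_inv_atTop hg).mono fun x hx => hx.ne'
  refine ⟨?_, hp, hq, tailEquiv_of_tendsto_div hne hu, tailEquiv_of_tendsto_div hne hl⟩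
  set θ := Real.pi * α / 2 with hθ
  have hθ0 : 0 < θ := by have := Real.pi_pos; positivity
  have hθ1 : θ < Real.pi / 2 := by have := Real.pi_pos; rw [hθ]; nlinarith
  have hc : 0 < Real.cos θ := Real.cos_pos_of_mem_Ioo ⟨by linarith, hθ1⟩
  have hs : 0 < Real.sin θ := Real.sin_pos_of_pos_of_lt_pi hθ0 (by linarith [Real.pi_pos])
  have hG : 0 < Real.Gamma (1 - α) := Real.Gamma_pos_of_pos (by linarith)
  set w : ℂ := Real.Gamma (1 - α) * (p * Complex.exp (-(θ : ℂ) * Complex.I) +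
        q * Complex.exp ((θ : ℂ) * Complex.I)) with hw
  have hwre : w.re = Real.Gamma (1 - α) * ((p + q) * Real.cos θ) := by
    rw [hw, Complex.re_ofReal_mul, Complex.add_re, Complex.re_ofReal_mul, Complex.re_ofReal_mul,
      ← Complex.ofReal_neg, Complex.exp_ofReal_mul_I_re, Complex.exp_ofReal_mul_I_re, Real.cos_neg]
    ring
  have hwim : w.im = Real.Gamma (1 - α) * ((q - p) * Real.sin θ) := by
    rw [hw, Complex.im_ofReal_mul, Complex.add_im, Complex.im_ofReal_mul, Complex.im_ofReal_mul,
      ← Complex.ofReal_neg, Complex.exp_ofReal_mul_I_im, Complex.exp_ofReal_mul_I_im, Real.sin_neg]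
    ring
  have hwre0 : 0 < w.re := by rw [hwre]; positivity
  have hw0 : w ≠ 0 := fun h => by rw [h] at hwre0; exact lt_irrefl _ hwre0
  have hwn : 0 < ‖w‖ := norm_pos_iff.2 hw0
  refine inDomainOfAttraction_of_regVar μ hX h0 h1.le (regVar_of_tendsto_div hw0 hg hF hr) ?_
    fun _ => ?_
  · rw [Complex.div_ofReal_re]; positivity
  · rw [Complex.div_ofReal_re, Complex.div_ofReal_im, abs_div, abs_of_pos hwn, div_mul_eq_mul_div]
    gcongr
    rw [hwre, hwim, ← hθ, Real.tan_eq_sin_div_cos, abs_mul, abs_mul, abs_of_pos hG, abs_of_pos hs]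
    have : |q - p| ≤ p + q := abs_le.2 ⟨by linarith, by linarith⟩
    calc Real.Gamma (1 - α) * (|q - p| * Real.sin θ) ≤ Real.Gamma (1 - α) * ((p + q) * Real.sin θ) := by
          gcongr
      _ = _ := by field_simp

theorem attraction_and_tails_of_eq_one {Ω : Type*} [MeasurableSpace Ω] (μ : Measure Ω)
    [IsProbabilityMeasure μ] {X : Ω → ℝ} (hX : Measurable X) {p : ℝ}
    {g : ℝ → ℝ} (hp : 0 < p)
    (hg : ∀ᶠ s in 𝓝[>] 0, 0 < g s)
    (hF : Tendsto (fun s => (1 - charFun (μ.map X) s) / (g s : ℂ)) (𝓝[>] 0)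
      (𝓝 ((Real.pi * p : ℝ) : ℂ)))
    (hr : ∀ t : ℝ, 0 < t → Tendsto (fun s => g (t * s) / g s) (𝓝[>] 0) (𝓝 (t ^ (1 : ℝ))))
    (hmono : ∃ δ > 0, MonotoneOn g (Set.Ioo 0 δ)) :
    InDomainOfAttraction μ X 1 ∧
      TailEquiv (upperTail μ X) p (fun x => g x⁻¹) ∧
      TailEquiv (lowerTail μ X) p (fun x => g x⁻¹) := by
  obtain ⟨hu, hl⟩ := tendsto_tails_of_eq_one μ hX hp hg hF hr hmono
  have hne : ∀ᶠ x in atTop, g x⁻¹ ≠ 0 := (eventually_inv_atTop hg).mono fun x hx => hx.ne'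
  refine ⟨?_, tailEquiv_of_tendsto_div hne hu, tailEquiv_of_tendsto_div hne hl⟩
  have hπp : 0 < Real.pi * p := mul_pos Real.pi_pos hp
  have hw0 : ((Real.pi * p : ℝ) : ℂ) ≠ 0 := by exact_mod_cast hπp.ne'
  refine inDomainOfAttraction_of_regVar μ hX one_pos le_rfl (regVar_of_tendsto_div hw0 hg hF hr) ?_
    fun h => absurd h (lt_irrefl _)
  rw [Complex.div_ofReal_re, Complex.ofReal_re]
  exact div_pos hπp (norm_pos_iff.2 hw0)

theorem ofReal_mul_cpow_half {a : ℝ} (ha : 0 < a) (z : ℂ) :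
    ((a : ℂ) * z) ^ (1 / 2 : ℂ) = (√a : ℂ) * z ^ (1 / 2 : ℂ) := by
  by_cases hz : z = 0
  · simp [hz]
  · have ha' : (a : ℂ) ≠ 0 := by exact_mod_cast ha.ne'
    rw [Complex.cpow_def_of_ne_zero (mul_ne_zero ha' hz), Complex.cpow_def_of_ne_zero hz,
      Complex.log_ofReal_mul ha hz, add_mul, Complex.exp_add, Real.sqrt_eq_rpow,
      Real.rpow_def_of_pos ha]
    push_cast
    rfl

theorem cpow_half_eq {z : ℂ} (hz : z ≠ 0) :
    z ^ (1 / 2 : ℂ) = (√‖z‖ : ℂ) * Complex.exp ((z.arg / 2 : ℝ) * Complex.I) := by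
  rw [Complex.cpow_def_of_ne_zero hz, Complex.log, add_mul, Complex.exp_add, Real.sqrt_eq_rpow,
    Real.rpow_def_of_pos (norm_pos_iff.2 hz)]
  push_cast
  congr 2
  ring

/-- Passing to square roots in asymptotic relations. -/
theorem tendsto_div_sqrt {f φ Φ : ℝ → ℂ} {G : ℝ → ℝ} {w : ℂ} {κ : ℂ}
    (hf : ∀ s, 1 - f s = Φ s * (1 - φ s) ^ (1 / 2 : ℂ)) (hΦ : Tendsto Φ (𝓝[>] 0) (𝓝 κ))
    (hφ : ∀ s, ‖φ s‖ ≤ 1) (hG : ∀ᶠ s in 𝓝[>] 0, 0 < G s)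
    (h : Tendsto (fun s => (1 - φ s) / (G s : ℂ)) (𝓝[>] 0) (𝓝 w)) :
    Tendsto (fun s => (1 - f s) / ((√(G s) : ℝ) : ℂ)) (𝓝[>] 0) (𝓝 (κ * w ^ (1 / 2 : ℂ))) := by
  -- This confines 1 - φ and its scaled limit w to the closed right half-plane, where the principal
  -- root is continuous.
  have hre : ∀ s, 0 ≤ (1 - φ s).re := by
    intro s
    have := (Complex.re_le_norm (φ s)).trans (hφ s)
    simpa using this
  have hw : 0 ≤ w.re := by
    refine ge_of_tendsto ((Complex.continuous_re.tendsto w).comp h) ?_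
    filter_upwards [hG] with s hs
    simp only [Function.comp_apply]
    rw [Complex.div_ofReal_re]
    exact div_nonneg (hre s) hs.le
  refine (hΦ.mul ((Complex.continuousAt_cpow_const_of_re_pos (z := w) (w := 1 / 2) (Or.inl hw)
    (by norm_num)).tendsto.comp h)).congr' ?_
  filter_upwards [hG] with s hs
  have hs' : (G s : ℂ) ≠ 0 := by exact_mod_cast hs.ne'
  have hs2 : ((√(G s) : ℝ) : ℂ) ≠ 0 := by exact_mod_cast (Real.sqrt_pos.2 hs).ne'
  simp only [Function.comp_apply]
  rw [hf, eq_div_iff hs2, mul_assoc, mul_comm (_ ^ _), ← ofReal_mul_cpow_half hs,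
    mul_div_cancel₀ _ hs']

theorem tendsto_div_of_isLittleO {φ : ℝ → ℂ} {G : ℝ → ℝ} {w : ℂ}
    (hG : ∀ᶠ s in 𝓝[>] 0, 0 < G s)
    (h : (fun s : ℝ => φ s - (1 - w * ((G s : ℝ) : ℂ))) =o[𝓝[>] 0] G) :
    Tendsto (fun s => (1 - φ s) / (G s : ℂ)) (𝓝[>] 0) (𝓝 w) := by
  have h1 : (fun s : ℝ => φ s - (1 - w * ((G s : ℝ) : ℂ))) =o[𝓝[>] 0] fun s => (G s : ℂ) :=
    Complex.isLittleO_ofReal_right.2 h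
  have h2 := (h1.tendsto_div_nhds_zero).const_sub w
  rw [sub_zero] at h2
  refine h2.congr' ?_
  filter_upwards [hG] with s hs
  have hs' : (G s : ℂ) ≠ 0 := by exact_mod_cast hs.ne'
  field_simp
  ring

theorem eventually_rpow_pos (β : ℝ) : ∀ᶠ s in 𝓝[>] (0 : ℝ), 0 < s ^ β := by
  filter_upwards [self_mem_nhdsWithin] with s hs using Real.rpow_pos_of_pos hs _

theorem tendsto_rpow_mul_div (β : ℝ) {t : ℝ} (ht : 0 < t) :
    Tendsto (fun s : ℝ => (t * s) ^ β / s ^ β) (𝓝[>] 0) (𝓝 (t ^ β)) := by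
  refine tendsto_const_nhds.congr' ?_
  filter_upwards [self_mem_nhdsWithin] with s hs
  have hs : 0 < s := hs
  rw [Real.mul_rpow ht.le hs.le, mul_div_cancel_right₀ _ (Real.rpow_pos_of_pos hs _).ne']

theorem monotoneOn_rpow_Ioo {β : ℝ} (hβ : 0 ≤ β) :
    ∃ δ > 0, MonotoneOn (fun s : ℝ => s ^ β) (Set.Ioo 0 δ) :=
  ⟨1, one_pos, fun _ hx _ _ hxy => Real.rpow_le_rpow hx.1.le hxy hβ⟩

theorem TailEquiv.congr_right {f g g' : ℝ → ℝ} {a : ℝ} (h : TailEquiv f a g) (hg : g =ᶠ[atTop] g') :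
    TailEquiv f a g' :=
  ⟨fun ha => (h.1 ha).congr_right (hg.mono fun x hx => by simp only [hx]),
    fun ha => (h.2 ha).congr' EventuallyEq.rfl hg⟩

theorem inv_rpow_eventuallyEq (β : ℝ) :
    (fun x : ℝ => x⁻¹ ^ β) =ᶠ[atTop] fun x => x ^ (-β) := by
  filter_upwards [eventually_gt_atTop 0] with x hx
  rw [Real.inv_rpow hx.le, Real.rpow_neg hx.le]

theorem sqrt_rpow {s : ℝ} (hs : 0 < s) (β : ℝ) : √(s ^ β) = s ^ (β / 2) := by
  rw [Real.sqrt_eq_rpow, ← Real.rpow_mul hs.le]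
  congr 1
  ring

theorem tendsto_div_rpow_half {f : ℝ → ℂ} {β : ℝ} {l : ℂ}
    (h : Tendsto (fun s => (1 - f s) / ((√(s ^ β) : ℝ) : ℂ)) (𝓝[>] 0) (𝓝 l)) :
    Tendsto (fun s => (1 - f s) / ((s ^ (β / 2) : ℝ) : ℂ)) (𝓝[>] 0) (𝓝 l) := by
  refine h.congr' ?_
  filter_upwards [self_mem_nhdsWithin] with s hs
  rw [sqrt_rpow hs]

theorem cpow_half_mul_neg_I {ν : ℝ} (hν : 0 < ν) :
    ((ν : ℂ) * -Complex.I) ^ (1 / 2 : ℂ) =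
      √ν * Complex.exp (-(Real.pi * (1 / 2) / 2 : ℝ) * Complex.I) := by
  rw [ofReal_mul_cpow_half hν, cpow_half_eq (by simp), Complex.arg_neg_I, norm_neg, Complex.norm_I,
    Real.sqrt_one, Complex.ofReal_one, one_mul]
  congr 3
  push_cast
  ring

theorem cpow_half_mul_I {ν : ℝ} (hν : 0 < ν) :
    ((ν : ℂ) * Complex.I) ^ (1 / 2 : ℂ) =
      √ν * Complex.exp ((Real.pi * (1 / 2) / 2 : ℝ) * Complex.I) := by
  rw [ofReal_mul_cpow_half hν, cpow_half_eq (by simp), Complex.arg_I, Complex.norm_I,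
    Real.sqrt_one, Complex.ofReal_one, one_mul]
  congr 3
  push_cast
  ring

theorem Gamma_half : Real.Gamma (1 - 1 / 2) = √Real.pi := by
  rw [show (1 - 1 / 2 : ℝ) = 1 / 2 by norm_num, Real.Gamma_one_half_eq]

section Sqrt

variable {Ω : Type*} [MeasurableSpace Ω] (μ : Measure Ω) [IsProbabilityMeasure μ] {X : Ω → ℝ}
  {φ Φ : ℝ → ℂ} {κ : ℝ}

/-- One-sided limit `-iν`. -/
theorem attraction_and_tails_of_neg_I (hX : Measurable X)
    (hf : ∀ s, 1 - charFun (μ.map X) s = Φ s * (1 - φ s) ^ (1 / 2 : ℂ))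
    (hΦ : Tendsto Φ (𝓝[>] 0) (𝓝 (κ : ℂ))) (hκ : 0 < κ) (hφ : ∀ s, ‖φ s‖ ≤ 1) {G : ℝ → ℝ} {ν : ℝ}
    (hν : 0 < ν) (hG : ∀ᶠ s in 𝓝[>] 0, 0 < G s)
    (h : Tendsto (fun s => (1 - φ s) / (G s : ℂ)) (𝓝[>] 0) (𝓝 (ν * -Complex.I)))
    (hr : ∀ t : ℝ, 0 < t → Tendsto (fun s => √(G (t * s)) / √(G s)) (𝓝[>] 0) (𝓝 (t ^ (1 / 2 : ℝ))))
    (hmono : ∃ δ > 0, MonotoneOn (fun s => √(G s)) (Set.Ioo 0 δ)) :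
    InDomainOfAttraction μ X (1 / 2) ∧
      TailEquiv (upperTail μ X) (κ * √ν / √Real.pi) (fun x => √(G x⁻¹)) ∧
      TailEquiv (lowerTail μ X) 0 (fun x => √(G x⁻¹)) := by
  have hπ : 0 < √Real.pi := Real.sqrt_pos.2 Real.pi_pos
  have hν' := Real.sqrt_pos.2 hν
  have hF := tendsto_div_sqrt hf hΦ hφ hG h
  -- The root of -iν is √ν exp(-iπ/4), the extreme phase -πα/2 for α = 1/2: the whole weight goes to
  -- the upper tail, and Γ(1/2) = √π fixes p.
  obtain ⟨h1, -, -, h2, h3⟩ := attraction_and_tails_of_lt_one μ hX (α := 1 / 2)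
    (p := κ * √ν / √Real.pi) (q := 0) (g := fun s => √(G s)) (by norm_num) (by norm_num)
    (by positivity) (hG.mono fun s hs => Real.sqrt_pos.2 hs) (by
      convert hF using 2
      rw [Gamma_half, cpow_half_mul_neg_I hν, Complex.ofReal_zero, zero_mul, add_zero, ← mul_assoc,
        ← mul_assoc, ← Complex.ofReal_mul, ← Complex.ofReal_mul, mul_div_cancel₀ _ hπ.ne']) hr hmono
  exact ⟨h1, h2, h3⟩

/-- One-sided limit `iν`. -/
theorem attraction_and_tails_of_I (hX : Measurable X)
    (hf : ∀ s, 1 - charFun (μ.map X) s = Φ s * (1 - φ s) ^ (1 / 2 : ℂ))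
    (hΦ : Tendsto Φ (𝓝[>] 0) (𝓝 (κ : ℂ))) (hκ : 0 < κ) (hφ : ∀ s, ‖φ s‖ ≤ 1) {G : ℝ → ℝ} {ν : ℝ}
    (hν : 0 < ν) (hG : ∀ᶠ s in 𝓝[>] 0, 0 < G s)
    (h : Tendsto (fun s => (1 - φ s) / (G s : ℂ)) (𝓝[>] 0) (𝓝 (ν * Complex.I)))
    (hr : ∀ t : ℝ, 0 < t → Tendsto (fun s => √(G (t * s)) / √(G s)) (𝓝[>] 0) (𝓝 (t ^ (1 / 2 : ℝ))))
    (hmono : ∃ δ > 0, MonotoneOn (fun s => √(G s)) (Set.Ioo 0 δ)) :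
    InDomainOfAttraction μ X (1 / 2) ∧
      TailEquiv (lowerTail μ X) (κ * √ν / √Real.pi) (fun x => √(G x⁻¹)) ∧
      TailEquiv (upperTail μ X) 0 (fun x => √(G x⁻¹)) := by
  have hπ : 0 < √Real.pi := Real.sqrt_pos.2 Real.pi_pos
  have hν' := Real.sqrt_pos.2 hν
  have hF := tendsto_div_sqrt hf hΦ hφ hG h
  obtain ⟨h1, -, -, h2, h3⟩ := attraction_and_tails_of_lt_one μ hX (α := 1 / 2)
    (q := κ * √ν / √Real.pi) (p := 0) (g := fun s => √(G s)) (by norm_num) (by norm_num)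
    (by positivity) (hG.mono fun s hs => Real.sqrt_pos.2 hs) (by
      convert hF using 2
      rw [Gamma_half, cpow_half_mul_I hν, Complex.ofReal_zero, zero_mul, zero_add, ← mul_assoc,
        ← mul_assoc, ← Complex.ofReal_mul, ← Complex.ofReal_mul, mul_div_cancel₀ _ hπ.ne']) hr hmono
  exact ⟨h1, h3, h2⟩

theorem halfAngle_eq {c : ℂ} (hc : 0 < c.re) : halfAngle c = c.arg / 2 := by
  have h := Complex.abs_arg_lt_pi_div_two_iff.2 (Or.inl hc)
  rw [abs_lt] at h
  rw [halfAngle, ← Complex.tan_arg, Real.arctan_tan h.1 h.2]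

/-- Regular variation with a complex constant. -/
theorem attraction_and_tails_of_rpow (hX : Measurable X)
    (hf : ∀ s, 1 - charFun (μ.map X) s = Φ s * (1 - φ s) ^ (1 / 2 : ℂ))
    (hΦ : Tendsto Φ (𝓝[>] 0) (𝓝 (κ : ℂ))) (hκ : 0 < κ) (hφ : ∀ s, ‖φ s‖ ≤ 1) {γ : ℝ} {c : ℂ}
    (hγ0 : 0 < γ) (hγ : γ < 2) (hc : 0 < c.re)
    (h : Tendsto (fun s : ℝ => (1 - φ s) / ((s ^ γ : ℝ) : ℂ)) (𝓝[>] 0) (𝓝 c)) :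
    InDomainOfAttraction μ X (γ / 2) ∧ 0 ≤ pPlus c γ ∧ pPlus c γ ≤ 1 ∧
      TailEquiv (upperTail μ X) (tailConst κ c γ * pPlus c γ / Real.Gamma (1 - γ / 2))
        (fun x => x ^ (-(γ / 2))) ∧
      TailEquiv (lowerTail μ X) (tailConst κ c γ * (1 - pPlus c γ) / Real.Gamma (1 - γ / 2))
        (fun x => x ^ (-(γ / 2))) := by
  have hF := tendsto_div_rpow_half (tendsto_div_sqrt hf hΦ hφ (eventually_rpow_pos γ) h)
  have hπ := Real.pi_pos
  have hc0 : c ≠ 0 := fun h => by rw [h] at hc; exact lt_irrefl _ hc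
  have hG : 0 < Real.Gamma (1 - γ / 2) := Real.Gamma_pos_of_pos (by linarith)
  set θ := Real.pi * γ / 4 with hθ
  have hθ0 : 0 < θ := by positivity
  have hθ1 : θ < Real.pi / 2 := by rw [hθ]; nlinarith
  have hcos : 0 < Real.cos θ := Real.cos_pos_of_mem_Ioo ⟨by linarith, hθ1⟩
  have hsin : 0 < Real.sin θ := Real.sin_pos_of_pos_of_lt_pi hθ0 (by linarith)
  have hϑ : 0 < Real.cos (halfAngle c) := by
    have h := Complex.abs_arg_lt_pi_div_two_iff.2 (Or.inl hc)
    rw [abs_lt] at h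
    rw [halfAngle_eq hc]
    exact Real.cos_pos_of_mem_Ioo ⟨by linarith, by linarith⟩
  have hnorm : (c.re ^ 2 + c.im ^ 2) ^ (1 / 4 : ℝ) = √‖c‖ := by
    rw [Real.sqrt_eq_rpow, Complex.norm_eq_sqrt_sq_add_sq, Real.sqrt_eq_rpow,
      ← Real.rpow_mul (by positivity)]
    norm_num
  have hn : 0 < √‖c‖ := Real.sqrt_pos.2 (norm_pos_iff.2 hc0)
  have hT : 0 < tailConst κ c γ := by
    rw [tailConst, hnorm]; positivity
  have hTp : tailConst κ c γ * pPlus c γ = κ * √‖c‖ / 2 *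
      (Real.cos (halfAngle c) / Real.cos θ - Real.sin (halfAngle c) / Real.sin θ) := by
    rw [tailConst, pPlus, hnorm, ← hθ, Real.tan_eq_sin_div_cos]
    field_simp
  have hTT : tailConst κ c γ = κ * √‖c‖ * (Real.cos (halfAngle c) / Real.cos θ) := by
    rw [tailConst, hnorm, ← hθ]
    field_simp
  -- With θ = πγ/4, these p and q solve the real linear system Γ(1 - γ/2) (p exp(-iθ) + q exp(iθ)) =
  -- κ c^{1/2}; the argument of the root is half the argument of c.
  obtain ⟨h1, h2, h3, h4, h5⟩ := attraction_and_tails_of_lt_one μ hX (α := γ / 2)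
    (p := tailConst κ c γ * pPlus c γ / Real.Gamma (1 - γ / 2))
    (q := tailConst κ c γ * (1 - pPlus c γ) / Real.Gamma (1 - γ / 2))
    (g := fun s => s ^ (γ / 2)) (by linarith) (by linarith) (by
      rw [← add_div, ← mul_add, add_sub_cancel, mul_one]; positivity) (eventually_rpow_pos _) (by
      convert hF using 2
      rw [cpow_half_eq hc0, ← halfAngle_eq hc, show Real.pi * (γ / 2) / 2 = θ by rw [hθ]; ring,
        mul_sub, mul_one, hTp, hTT, ← Complex.ofReal_neg]
      generalize Real.Gamma (1 - γ / 2) = Gm at hG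
      apply Complex.ext
      · simp only [Complex.re_ofReal_mul, Complex.add_re, Complex.exp_ofReal_mul_I_re,
          Real.cos_neg]
        field_simp
        ring
      · simp only [Complex.im_ofReal_mul, Complex.add_im, Complex.exp_ofReal_mul_I_im,
          Real.sin_neg]
        field_simp
        ring)
    (fun t ht => tendsto_rpow_mul_div _ ht) (monotoneOn_rpow_Ioo (by linarith))
  refine ⟨h1, ?_, ?_, h4.congr_right (inv_rpow_eventuallyEq _),
    h5.congr_right (inv_rpow_eventuallyEq _)⟩
  -- The bounds on `pPlus` are not proved by trigonometry: they are read off from p, q ≥ 0 supplied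
  -- by the Tauberian theorem.
  · by_contra hneg
    have : tailConst κ c γ * pPlus c γ / Real.Gamma (1 - γ / 2) < 0 :=
      div_neg_of_neg_of_pos (mul_neg_of_pos_of_neg hT (not_le.1 hneg)) hG
    linarith
  · by_contra hneg
    have : tailConst κ c γ * (1 - pPlus c γ) / Real.Gamma (1 - γ / 2) < 0 :=
      div_neg_of_neg_of_pos (mul_neg_of_pos_of_neg hT (by linarith)) hG
    linarith

end Sqrt

theorem tendsto_sqrt_div_sqrt {G : ℝ → ℝ} {β t : ℝ} (ht : 0 < t) (hG : ∀ᶠ s in 𝓝[>] 0, 0 < G s)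
    (h : Tendsto (fun s => G (t * s) / G s) (𝓝[>] 0) (𝓝 (t ^ β))) :
    Tendsto (fun s => √(G (t * s)) / √(G s)) (𝓝[>] 0) (𝓝 (t ^ (β / 2))) := by
  rw [← sqrt_rpow ht]
  refine ((Real.continuous_sqrt.tendsto _).comp h).congr' ?_
  filter_upwards [hG] with s hs
  simp only [Function.comp_apply]
  rw [Real.sqrt_div' _ hs.le]

/-- Case (C) uses the gauge √(s log(1/s)), which the Tauberian theorem requires to be monotone near
0. -/
theorem monotoneOn_negMulLog : MonotoneOn Real.negMulLog (Set.Ioo 0 (Real.exp (-1))) := by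
  refine monotoneOn_of_deriv_nonneg (convex_Ioo _ _) (by fun_prop)
    (fun x hx => ?_) fun x hx => ?_ <;> rw [interior_Ioo] at hx
  · exact (Real.differentiableAt_negMulLog hx.1.ne').differentiableWithinAt
  · rw [Real.deriv_negMulLog hx.1.ne']
    have := (Real.log_le_log hx.1 hx.2.le)
    rw [Real.log_exp] at this
    linarith

theorem negMulLog_eq_mul_log (s : ℝ) : s * Real.log (1 / s) = Real.negMulLog s := by
  rw [one_div, Real.log_inv, Real.negMulLog]; ring

theorem eventually_negMulLog_pos : ∀ᶠ s in 𝓝[>] (0 : ℝ), 0 < Real.negMulLog s := by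
  filter_upwards [self_mem_nhdsWithin,
    (eventually_lt_nhds (b := (1 : ℝ)) (a := 0) one_pos).filter_mono nhdsWithin_le_nhds] with s h0 h1
  have h0 : 0 < s := h0
  have := Real.log_neg h0 h1
  rw [Real.negMulLog]
  nlinarith

theorem tendsto_negMulLog_div {t : ℝ} (ht : 0 < t) :
    Tendsto (fun s => Real.negMulLog (t * s) / Real.negMulLog s) (𝓝[>] 0) (𝓝 (t ^ (1 : ℝ))) := by
  have h1 : Tendsto (fun s : ℝ => t + -(t * Real.log t) * (-Real.log s)⁻¹) (𝓝[>] 0)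
      (𝓝 (t + -(t * Real.log t) * 0)) :=
    (((tendsto_neg_atBot_atTop.comp Real.tendsto_log_nhdsGT_zero).inv_tendsto_atTop).const_mul
      _).const_add _
  rw [mul_zero, add_zero] at h1
  rw [Real.rpow_one]
  refine h1.congr' ?_
  filter_upwards [eventually_negMulLog_pos, self_mem_nhdsWithin] with s hs h0
  have h0 : s ≠ 0 := (show 0 < s from h0).ne'
  have hl : Real.log s ≠ 0 := by
    intro h
    rw [Real.negMulLog, h, mul_zero] at hs
    exact lt_irrefl _ hs
  rw [Real.negMulLog_mul, Real.negMulLog, Real.negMulLog]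
  field_simp
  ring

theorem sqrt_inv_eventuallyEq : (fun x : ℝ => √x⁻¹) =ᶠ[atTop] fun x => x ^ (-(1 / 2) : ℝ) := by
  filter_upwards [eventually_gt_atTop 0] with x hx
  rw [Real.sqrt_inv, Real.rpow_neg hx.le, Real.sqrt_eq_rpow]

section Cases

variable {Ω : Type*} [MeasurableSpace Ω] (μ : Measure Ω) [IsProbabilityMeasure μ] {X : Ω → ℝ}
  {φ Φ : ℝ → ℂ} {κ : ℝ}

theorem attraction_and_tails_linear (hX : Measurable X)
    (hf : ∀ s, 1 - charFun (μ.map X) s = Φ s * (1 - φ s) ^ (1 / 2 : ℂ))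
    (hΦ : Tendsto Φ (𝓝[>] 0) (𝓝 (κ : ℂ))) (hκ : 0 < κ) (hφ : ∀ s, ‖φ s‖ ≤ 1) (ν : ℝ)
    (h : (fun s : ℝ => φ s - (1 + Complex.I * ν * s)) =o[𝓝[>] 0] (fun s : ℝ => s)) :
    (0 < ν → InDomainOfAttraction μ X (1 / 2) ∧
        upperTail μ X ~[atTop] (fun x => √(ν / Real.pi) * κ * x ^ (-(1 / 2) : ℝ)) ∧
        lowerTail μ X =o[atTop] (fun x : ℝ => x ^ (-(1 / 2) : ℝ))) ∧
      (ν < 0 → InDomainOfAttraction μ X (1 / 2) ∧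
        lowerTail μ X ~[atTop] (fun x => √(-ν / Real.pi) * κ * x ^ (-(1 / 2) : ℝ)) ∧
        upperTail μ X =o[atTop] (fun x : ℝ => x ^ (-(1 / 2) : ℝ))) := by
  have hG : ∀ᶠ s in 𝓝[>] (0 : ℝ), 0 < s := self_mem_nhdsWithin
  have hr : ∀ t : ℝ, 0 < t → Tendsto (fun s => √(t * s) / √s) (𝓝[>] 0) (𝓝 (t ^ (1 / 2 : ℝ))) := by
    intro t ht
    refine tendsto_sqrt_div_sqrt (G := fun s => s) ht hG ?_
    simpa using tendsto_rpow_mul_div 1 ht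
  have hmono : ∃ δ > 0, MonotoneOn (fun s => √s) (Set.Ioo 0 δ) :=
    ⟨1, one_pos, fun _ _ _ _ hxy => Real.sqrt_le_sqrt hxy⟩
  have hπ := Real.sqrt_pos.2 Real.pi_pos
  constructor
  · intro hν
    have h' : (fun s : ℝ => φ s - (1 - (ν * -Complex.I) * ((s : ℝ) : ℂ))) =o[𝓝[>] 0]
        (fun s : ℝ => s) := h.congr_left fun s => by ring
    obtain ⟨h1, h2, h3⟩ := attraction_and_tails_of_neg_I μ hX hf hΦ hκ hφ hν hG
      (tendsto_div_of_isLittleO hG h') hr hmono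
    have hν' := Real.sqrt_pos.2 hν
    refine ⟨h1, ?_, (h3.congr_right sqrt_inv_eventuallyEq).2 rfl⟩
    refine ((h2.congr_right sqrt_inv_eventuallyEq).1 (by positivity)).congr_right
      (Eventually.of_forall fun x => ?_)
    simp only
    rw [Real.sqrt_div hν.le]
    ring
  · intro hν
    have hν2 : 0 < -ν := by linarith
    have h' : (fun s : ℝ => φ s - (1 - (((-ν : ℝ) : ℂ) * Complex.I) * ((s : ℝ) : ℂ))) =o[𝓝[>] 0]
        (fun s : ℝ => s) := h.congr_left fun s => by push_cast; ring
    obtain ⟨h1, h2, h3⟩ := attraction_and_tails_of_I μ hX hf hΦ hκ hφ hν2 hG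
      (tendsto_div_of_isLittleO hG h') hr hmono
    have hν' := Real.sqrt_pos.2 hν2
    refine ⟨h1, ?_, (h3.congr_right sqrt_inv_eventuallyEq).2 rfl⟩
    refine ((h2.congr_right sqrt_inv_eventuallyEq).1 (by positivity)).congr_right
      (Eventually.of_forall fun x => ?_)
    simp only
    rw [Real.sqrt_div hν2.le]
    ring

theorem sqrt_negMulLog_inv_eventuallyEq :
    (fun x : ℝ => √(Real.negMulLog x⁻¹)) =ᶠ[atTop] fun x => √(Real.log x) / x ^ (1 / 2 : ℝ) := by
  filter_upwards [eventually_gt_atTop 0] with x hx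
  rw [Real.negMulLog, Real.log_inv, ← Real.sqrt_eq_rpow, ← Real.sqrt_div' _ hx.le]
  congr 1
  ring

theorem attraction_and_tails_log (hX : Measurable X)
    (hf : ∀ s, 1 - charFun (μ.map X) s = Φ s * (1 - φ s) ^ (1 / 2 : ℂ))
    (hΦ : Tendsto Φ (𝓝[>] 0) (𝓝 (κ : ℂ))) (hκ : 0 < κ) (hφ : ∀ s, ‖φ s‖ ≤ 1) (c₂ : ℝ)
    (h : (fun s : ℝ => φ s - (1 + Complex.I * c₂ * ((s * Real.log (1 / s) : ℝ) : ℂ))) =o[𝓝[>] 0]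
      (fun s : ℝ => s * Real.log (1 / s))) :
    (0 < c₂ → InDomainOfAttraction μ X (1 / 2) ∧
        upperTail μ X ~[atTop]
          (fun x => √(c₂ * Real.log x / Real.pi) * κ * x ^ (-(1 / 2) : ℝ)) ∧
        lowerTail μ X =o[atTop] (fun x : ℝ => √(Real.log x) / x ^ (1 / 2 : ℝ))) ∧
      (c₂ < 0 → InDomainOfAttraction μ X (1 / 2) ∧
        lowerTail μ X ~[atTop]
          (fun x => √(-c₂ * Real.log x / Real.pi) * κ * x ^ (-(1 / 2) : ℝ)) ∧
        upperTail μ X =o[atTop] (fun x : ℝ => √(Real.log x) / x ^ (1 / 2 : ℝ))) := by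
  simp only [negMulLog_eq_mul_log] at h
  have hr : ∀ t : ℝ, 0 < t → Tendsto (fun s => √(Real.negMulLog (t * s)) / √(Real.negMulLog s))
      (𝓝[>] 0) (𝓝 (t ^ (1 / 2 : ℝ))) := fun t ht =>
    tendsto_sqrt_div_sqrt ht eventually_negMulLog_pos (tendsto_negMulLog_div ht)
  have hmono : ∃ δ > 0, MonotoneOn (fun s => √(Real.negMulLog s)) (Set.Ioo 0 δ) :=
    ⟨_, Real.exp_pos _, fun _ hx _ hy hxy => Real.sqrt_le_sqrt (monotoneOn_negMulLog hx hy hxy)⟩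
  have hπ := Real.sqrt_pos.2 Real.pi_pos
  have hfin : ∀ c : ℝ, 0 < c → (fun x => κ * √c / √Real.pi * (√(Real.log x) / x ^ (1 / 2 : ℝ)))
      =ᶠ[atTop] fun x => √(c * Real.log x / Real.pi) * κ * x ^ (-(1 / 2) : ℝ) := by
    intro c hc
    filter_upwards [eventually_gt_atTop 0] with x hx
    rw [Real.sqrt_div' _ Real.pi_pos.le, Real.sqrt_mul hc.le, Real.rpow_neg hx.le]
    ring
  constructor
  · intro hc
    have h' : (fun s : ℝ => φ s - (1 - (c₂ * -Complex.I) * ((Real.negMulLog s : ℝ) : ℂ)))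
        =o[𝓝[>] 0] Real.negMulLog := h.congr_left fun s => by ring
    obtain ⟨h1, h2, h3⟩ := attraction_and_tails_of_neg_I μ hX hf hΦ hκ hφ hc
      eventually_negMulLog_pos (tendsto_div_of_isLittleO eventually_negMulLog_pos h') hr hmono
    have hc' := Real.sqrt_pos.2 hc
    refine ⟨h1, ?_, (h3.congr_right sqrt_negMulLog_inv_eventuallyEq).2 rfl⟩
    exact ((h2.congr_right sqrt_negMulLog_inv_eventuallyEq).1 (by positivity)).congr_right
      (hfin _ hc)
  · intro hc
    have hc2 : 0 < -c₂ := by linarith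
    have h' : (fun s : ℝ => φ s - (1 - (((-c₂ : ℝ) : ℂ) * Complex.I) *
        ((Real.negMulLog s : ℝ) : ℂ))) =o[𝓝[>] 0] Real.negMulLog :=
      h.congr_left fun s => by push_cast; ring
    obtain ⟨h1, h2, h3⟩ := attraction_and_tails_of_I μ hX hf hΦ hκ hφ hc2
      eventually_negMulLog_pos (tendsto_div_of_isLittleO eventually_negMulLog_pos h') hr hmono
    have hc' := Real.sqrt_pos.2 hc2
    refine ⟨h1, ?_, (h3.congr_right sqrt_negMulLog_inv_eventuallyEq).2 rfl⟩
    exact ((h2.congr_right sqrt_negMulLog_inv_eventuallyEq).1 (by positivity)).congr_right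
      (hfin _ hc2)

theorem attraction_and_tails_real (hX : Measurable X)
    (hf : ∀ s, 1 - charFun (μ.map X) s = Φ s * (1 - φ s) ^ (1 / 2 : ℂ))
    (hΦ : Tendsto Φ (𝓝[>] 0) (𝓝 (κ : ℂ))) (hκ : 0 < κ) (hφ : ∀ s, ‖φ s‖ ≤ 1) {γ c₃ : ℝ}
    (hγ0 : 0 < γ) (hγ : γ ≤ 2) (hc : 0 < c₃)
    (h : (fun s : ℝ => φ s - (1 - c₃ * ((s ^ γ : ℝ) : ℂ))) =o[𝓝[>] 0] (fun s : ℝ => s ^ γ)) :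
    InDomainOfAttraction μ X (γ / 2) ∧
      (γ < 2 →
        upperTail μ X ~[atTop]
          (fun x => κ * √c₃ / Real.cos (Real.pi * γ / 4) / (2 * Real.Gamma (1 - γ / 2))
            * x ^ (-(γ / 2))) ∧
        lowerTail μ X ~[atTop]
          (fun x => κ * √c₃ / Real.cos (Real.pi * γ / 4) / (2 * Real.Gamma (1 - γ / 2))
            * x ^ (-(γ / 2)))) ∧
      (γ = 2 →
        upperTail μ X ~[atTop] (fun x => κ * √c₃ / Real.pi * x ^ (-1 : ℝ)) ∧
        lowerTail μ X ~[atTop] (fun x => κ * √c₃ / Real.pi * x ^ (-1 : ℝ))) := by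
  have h' := tendsto_div_of_isLittleO (eventually_rpow_pos γ) h
  have hc' := Real.sqrt_pos.2 hc
  have hπ := Real.pi_pos
  -- For γ < 2 a real constant has angle zero, so the tails balance. For γ = 2 the ladder cost has
  -- index one, and the symmetric index-one theorem applies with πp = κ√c₃.
  rcases hγ.lt_or_eq with hlt | heq
  · obtain ⟨h1, -, -, h2, h3⟩ := attraction_and_tails_of_rpow μ hX hf hΦ hκ hφ hγ0 hlt
      (c := c₃) (by simpa using hc) h'
    refine ⟨h1, fun _ => ?_, fun h => absurd h hlt.ne⟩
    have hp : pPlus c₃ γ = 1 / 2 := by simp [pPlus, halfAngle]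
    have hcos : 0 < Real.cos (Real.pi * γ / 4) :=
      Real.cos_pos_of_mem_Ioo ⟨by nlinarith, by nlinarith⟩
    have hG : 0 < Real.Gamma (1 - γ / 2) := Real.Gamma_pos_of_pos (by linarith)
    have hT : tailConst κ c₃ γ = κ * √c₃ / Real.cos (Real.pi * γ / 4) := by
      simp only [tailConst, halfAngle, Complex.ofReal_re, Complex.ofReal_im]
      rw [Real.sqrt_eq_rpow, zero_div, Real.arctan_zero, zero_div, Real.cos_zero,
        zero_pow two_ne_zero, add_zero, ← Real.rpow_natCast, ← Real.rpow_mul hc.le]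
      norm_num
      ring
    have e : κ * √c₃ / Real.cos (Real.pi * γ / 4) * (1 / 2) / Real.Gamma (1 - γ / 2) =
        κ * √c₃ / Real.cos (Real.pi * γ / 4) / (2 * Real.Gamma (1 - γ / 2)) := by
      rw [mul_one_div, div_div]
    rw [show (1 : ℝ) - pPlus c₃ γ = 1 / 2 by rw [hp]; norm_num, hT, e] at h3
    rw [hp, hT, e] at h2
    exact ⟨h2.1 (by positivity), h3.1 (by positivity)⟩
  · subst heq
    have hF := tendsto_div_rpow_half (tendsto_div_sqrt hf hΦ hφ (eventually_rpow_pos 2) h')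
    rw [show (2 / 2 : ℝ) = 1 by norm_num] at hF ⊢
    obtain ⟨h1, h2, h3⟩ := attraction_and_tails_of_eq_one μ hX (p := κ * √c₃ / Real.pi)
      (g := fun s => s ^ (1 : ℝ)) (by positivity) (eventually_rpow_pos 1) (by
        convert hF using 2
        have := ofReal_mul_cpow_half hc 1
        rw [mul_one, Complex.one_cpow, mul_one] at this
        rw [this, mul_div_cancel₀ _ hπ.ne']
        push_cast
        rfl) (fun t ht => tendsto_rpow_mul_div 1 ht) (monotoneOn_rpow_Ioo zero_le_one)
    refine ⟨h1, fun h => absurd h (lt_irrefl _), fun _ => ⟨?_, ?_⟩⟩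
    · exact (h2.congr_right (inv_rpow_eventuallyEq 1)).1 (by positivity)
    · exact (h3.congr_right (inv_rpow_eventuallyEq 1)).1 (by positivity)

/-- Regular variation is inherited by the square root. -/
theorem inDomainOfAttraction_of_regVar_sqrt (hX : Measurable X)
    (hf : ∀ s, 1 - charFun (μ.map X) s = Φ s * (1 - φ s) ^ (1 / 2 : ℂ))
    (hΦ : Tendsto Φ (𝓝[>] 0) (𝓝 (κ : ℂ))) (hκ : 0 < κ) (hφ : ∀ s, ‖φ s‖ ≤ 1) {γ : ℝ} {u : ℂ}
    (hγ0 : 0 < γ) (hγ : γ ≤ 2) (h : RegVar (fun s => 1 - φ s) γ u)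
    (hu : γ < 1 → |u.arg| ≤ Real.pi * γ / 2) :
    InDomainOfAttraction μ X (γ / 2) := by
  have hπ := Real.pi_pos
  have hG : ∀ᶠ s in 𝓝[>] 0, 0 < ‖1 - φ s‖ := h.eventually_ne.mono fun s hs => norm_pos_iff.2 hs
  have hu1 : ‖u‖ = 1 := h.norm_eq_one
  have hu0 : u ≠ 0 := by rw [← norm_pos_iff, hu1]; exact one_pos
  have hure : 0 ≤ u.re := by
    refine ge_of_tendsto ((Complex.continuous_re.tendsto u).comp h.1) (Eventually.of_forall fun s => ?_)
    simp only [Function.comp_apply]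
    rw [Complex.div_ofReal_re]
    refine div_nonneg ?_ (norm_nonneg _)
    have := (Complex.re_le_norm (φ s)).trans (hφ s)
    simpa using this
  have harg : |u.arg| ≤ Real.pi / 2 := Complex.abs_arg_le_pi_div_two_iff.2 hure
  have hF := tendsto_div_sqrt hf hΦ hφ hG h.1
  rw [cpow_half_eq hu0, hu1, Real.sqrt_one, Complex.ofReal_one, one_mul] at hF
  set θ := u.arg / 2 with hθ
  -- Halving a phase from the closed right half-plane lands strictly inside the open one, so the
  -- scale of the limit law is positive. This bound also suffices for the skewness when γ ≥ 1; for γ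
  -- < 1 the sharper hypothesis on arg u is used.
  have hθ4 : |θ| ≤ Real.pi / 4 := by rw [hθ, abs_div, abs_two]; linarith
  set w : ℂ := κ * Complex.exp (θ * Complex.I) with hw
  have hwn : ‖w‖ = κ := by
    rw [hw, norm_mul, Complex.norm_exp_ofReal_mul_I, Complex.norm_real,
      Real.norm_of_nonneg hκ.le, mul_one]
  have hw0 : w ≠ 0 := by rw [← norm_pos_iff, hwn]; exact hκ
  have hθ' := abs_le.1 hθ4
  have hcos : 0 < Real.cos θ := Real.cos_pos_of_mem_Ioo ⟨by linarith, by linarith⟩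
  have hv : w / (‖w‖ : ℂ) = Complex.exp (θ * Complex.I) := by
    have : (κ : ℂ) ≠ 0 := by exact_mod_cast hκ.ne'
    rw [hwn, hw, mul_div_cancel_left₀ _ this]
  refine inDomainOfAttraction_of_regVar μ hX (by linarith) (by linarith)
    (regVar_of_tendsto_div (g := fun s => √‖1 - φ s‖) hw0
      (hG.mono fun s hs => Real.sqrt_pos.2 hs) hF
      fun t ht => tendsto_sqrt_div_sqrt (G := fun s => ‖1 - φ s‖) ht hG (h.2 t ht)) ?_ fun hlt => ?_
  · rw [hv, Complex.exp_ofReal_mul_I_re]; exact hcos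
  · rw [hv, Complex.exp_ofReal_mul_I_re, Complex.exp_ofReal_mul_I_im]
    have hθγ : |θ| ≤ Real.pi * γ / 4 := by
      rcases lt_or_ge γ 1 with h1 | h1
      · rw [hθ, abs_div, abs_two]; linarith [hu h1]
      · nlinarith
    have hmax : Real.pi * γ / 4 < Real.pi / 2 := by nlinarith
    rw [show Real.pi * (γ / 2) / 2 = Real.pi * γ / 4 by ring]
    have h1 : |Real.sin θ| = Real.cos θ * Real.tan |θ| := by
      rw [Real.abs_sin_eq_sin_abs_of_abs_le_pi (by linarith), Real.tan_eq_sin_div_cos,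
        Real.cos_abs, mul_div_cancel₀ _ hcos.ne']
    rw [h1]
    gcongr
    refine Real.strictMonoOn_tan.monotoneOn ⟨?_, ?_⟩ ⟨?_, hmax⟩ hθγ
    · linarith [abs_nonneg θ]
    · linarith
    · nlinarith

end Cases

/-! ### Locally uniform convergence and continuous logarithms -/

/-- `F j → f` uniformly on every `[0, M]`. -/
def UnifTo (F : ℕ → ℝ → ℂ) (f : ℝ → ℂ) : Prop :=
  ∀ M : ℝ, Tendsto (fun p : ℕ × ℝ => F p.1 p.2 - f p.2) (atTop ×ˢ 𝓟 (Set.Icc 0 M)) (𝓝 0)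

theorem UnifTo.comp {F : ℕ → ℝ → ℂ} {f : ℝ → ℂ} (h : UnifTo F f) {ι : Type*} {l : Filter ι}
    {j : ι → ℕ} {t : ι → ℝ} {M : ℝ} (hj : Tendsto j l atTop) (ht : ∀ᶠ i in l, t i ∈ Set.Icc 0 M) :
    Tendsto (fun i => F (j i) (t i) - f (t i)) l (𝓝 0) :=
  (h M).comp (hj.prodMk (tendsto_principal.2 ht))

theorem UnifTo.tendsto {F : ℕ → ℝ → ℂ} {f : ℝ → ℂ} (h : UnifTo F f) {t : ℝ} (ht : 0 ≤ t) :
    Tendsto (fun j => F j t) atTop (𝓝 (f t)) := by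
  have := (h.comp (t := fun _ => t) tendsto_id (Eventually.of_forall fun _ => ⟨ht, le_rfl⟩)).add_const (f t)
  simpa using this

/-- Splitting at |x| = R bounds the oscillation by a Lipschitz term plus a tail; for a tight family
this is uniform equicontinuity of the transforms. -/
theorem norm_charFun_sub_le (P : Measure ℝ) [IsProbabilityMeasure P] (s t : ℝ) {R : ℝ} (hR : 0 ≤ R) :
    ‖charFun P s - charFun P t‖ ≤ |s - t| * R + 2 * P.real {x | R < ‖x‖} := by
  have hi : ∀ s : ℝ, Integrable (fun x : ℝ => Complex.exp (s * x * Complex.I)) P := fun s => by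
    refine Integrable.of_bound (Measurable.aestronglyMeasurable (by fun_prop)) 1
      (Eventually.of_forall fun x => ?_)
    rw [← Complex.ofReal_mul, Complex.norm_exp_ofReal_mul_I]
  have hm : MeasurableSet {x : ℝ | R < ‖x‖} := measurableSet_lt measurable_const measurable_norm
  rw [charFun_apply_real, charFun_apply_real, ← integral_sub (hi s) (hi t)]
  have hb : Integrable (fun x => |s - t| * R + ({x : ℝ | R < ‖x‖}).indicator (fun _ => (2 : ℝ)) x) P :=
    (integrable_const _).add ((integrable_const _).indicator hm)
  have key : ∀ x : ℝ, ‖Complex.exp (s * x * Complex.I) - Complex.exp (t * x * Complex.I)‖ ≤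
      |s - t| * R + ({x : ℝ | R < ‖x‖}).indicator (fun _ => (2 : ℝ)) x := by
    intro x
    by_cases hx : R < ‖x‖
    · rw [Set.indicator_of_mem (show x ∈ {x : ℝ | R < ‖x‖} from hx)]
      have h1 : 0 ≤ |s - t| * R := by positivity
      refine (norm_sub_le _ _).trans ?_
      rw [← Complex.ofReal_mul, ← Complex.ofReal_mul, Complex.norm_exp_ofReal_mul_I,
        Complex.norm_exp_ofReal_mul_I]
      linarith
    · rw [Set.indicator_of_notMem (show x ∉ {x : ℝ | R < ‖x‖} from hx), add_zero]
      have e : Complex.exp (s * x * Complex.I) - Complex.exp (t * x * Complex.I) =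
          Complex.exp (t * x * Complex.I) *
            (Complex.exp (Complex.I * (((s - t) * x : ℝ) : ℂ)) - 1) := by
        rw [mul_sub, ← Complex.exp_add, mul_one]
        congr 2
        push_cast
        ring
      rw [e, norm_mul, ← Complex.ofReal_mul, Complex.norm_exp_ofReal_mul_I, one_mul]
      refine Real.norm_exp_I_mul_ofReal_sub_one_le.trans ?_
      rw [norm_mul, Real.norm_eq_abs (s - t)]
      gcongr
      exact not_lt.1 hx
  refine (norm_integral_le_of_norm_le hb (Eventually.of_forall key)).trans_eq ?_
  rw [integral_add (integrable_const _) ((integrable_const _).indicator hm),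
    integral_indicator hm]
  simp [mul_comm]

/-- Convergent transforms come from a tight family, and equicontinuity upgrades pointwise
convergence to uniform convergence on compact sets. -/
theorem unifTo_charFun {P : ℕ → Measure ℝ} [∀ n, IsProbabilityMeasure (P n)] {f : ℝ → ℂ}
    (hf : Continuous f) (h : ∀ t, Tendsto (fun n => charFun (P n) t) atTop (𝓝 (f t))) :
    UnifTo (fun n t => charFun (P n) t) f := by
  have htight := tendsto_measure_norm_gt_of_isTightMeasureSet
    (isTightMeasureSet_of_tendsto_charFun hf.continuousAt h)
  have hloc : ∀ t, Tendsto (fun y : ℕ × ℝ => charFun (P y.1) y.2 - f y.2) (atTop ×ˢ 𝓝 t) (𝓝 0) := by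
    intro t
    rw [Metric.tendsto_nhds]
    intro ε hε
    obtain ⟨R, hR0, hR⟩ : ∃ R : ℝ, 0 < R ∧ ∀ n, (P n).real {x | R < ‖x‖} ≤ ε / 12 := by
      have h1 := (htight.eventually_lt_const
        (ENNReal.ofReal_pos.2 (show 0 < ε / 12 by positivity))).and (eventually_gt_atTop 0)
      obtain ⟨R, hR, hR0⟩ := h1.exists
      refine ⟨R, hR0, fun n => ?_⟩
      refine ENNReal.toReal_le_of_le_ofReal (by positivity) ?_
      exact (le_iSup₂ (f := fun (m : Measure ℝ) (_ : m ∈ Set.range P) => m {x | R < ‖x‖})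
        (P n) ⟨n, rfl⟩).trans hR.le
    have e1 : ∀ᶠ y : ℕ × ℝ in atTop ×ˢ 𝓝 t, |y.2 - t| * R < ε / 6 := by
      have h2 : Tendsto (fun y : ℕ × ℝ => |y.2 - t| * R) (atTop ×ˢ 𝓝 t) (𝓝 0) := by
        have : Continuous fun y : ℝ => |y - t| * R := by fun_prop
        have h3 := this.tendsto t
        simp only [sub_self, abs_zero, zero_mul] at h3
        exact h3.comp tendsto_snd
      exact h2.eventually_lt_const (by positivity)
    have e2 : ∀ᶠ y : ℕ × ℝ in atTop ×ˢ 𝓝 t, ‖charFun (P y.1) t - f t‖ < ε / 3 := by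
      have h3 := (tendsto_iff_norm_sub_tendsto_zero.1 (h t)).eventually_lt_const
        (show 0 < ε / 3 by positivity)
      exact tendsto_fst.eventually h3
    have e3 : ∀ᶠ y : ℕ × ℝ in atTop ×ˢ 𝓝 t, ‖f y.2 - f t‖ < ε / 3 := by
      have h3 := (tendsto_iff_norm_sub_tendsto_zero.1 (hf.tendsto t)).eventually_lt_const
        (show 0 < ε / 3 by positivity)
      exact tendsto_snd.eventually h3
    filter_upwards [e1, e2, e3] with y h1 h2 h3
    rw [dist_zero_right]
    have e : charFun (P y.1) y.2 - f y.2 = (charFun (P y.1) y.2 - charFun (P y.1) t) +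
      (charFun (P y.1) t - f t) - (f y.2 - f t) := by ring
    rw [e]
    refine (norm_sub_le _ _).trans_lt ?_
    have h4 := norm_add_le (charFun (P y.1) y.2 - charFun (P y.1) t) (charFun (P y.1) t - f t)
    have h5 := norm_charFun_sub_le (P y.1) y.2 t hR0.le
    have h6 := hR y.1
    linarith
  have hlu : TendstoLocallyUniformly (fun n t => charFun (P n) t - f t) (fun _ => 0) atTop := by
    rw [tendstoLocallyUniformly_iff_forall_tendsto]
    intro t
    rw [tendsto_uniformity_iff_dist_tendsto_zero]
    refine (hloc t).norm.congr' (Eventually.of_forall fun y => ?_) |>.trans (by simp)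
    rw [dist_zero_left]
  intro M
  have h2 := tendstoUniformlyOn_iff_tendsto.1
    (tendstoLocallyUniformly_iff_forall_isCompact.1 hlu _ (isCompact_Icc (a := 0) (b := M)))
  rw [tendsto_uniformity_iff_dist_tendsto_zero] at h2
  rw [tendsto_zero_iff_norm_tendsto_zero]
  refine h2.congr fun y => ?_
  rw [dist_zero_left]

/-- Continuous logarithms: a continuous `G` with `G 0 = 0` and `e^{-G}` near `1` is given by the
principal branch. -/
theorem eq_neg_log_exp_neg {G : ℝ → ℂ} {M : ℝ} (hG : ContinuousOn G (Set.Icc 0 M)) (h0 : G 0 = 0)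
    (h : ∀ t ∈ Set.Icc 0 M, ‖Complex.exp (-G t) - 1‖ < 1) :
    ∀ t ∈ Set.Icc 0 M, G t = -Complex.log (Complex.exp (-G t)) := by
  intro t ht
  -- Staying within distance 1 of 1 forces a positive real part, so |Im G| never equals π/2.
  -- Starting from G 0 = 0, continuity keeps it below π/2.
  have him : ∀ x ∈ Set.Icc 0 M, |(G x).im| ≠ Real.pi / 2 := by
    intro x hx habs
    have h1 := h x hx
    have h2 : (Complex.exp (-G x)).re = 0 := by
      rw [Complex.exp_re, Complex.neg_im, Real.cos_neg, ← Real.cos_abs, habs, Real.cos_pi_div_two,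
        mul_zero]
    have h3 := Complex.abs_re_le_norm (Complex.exp (-G x) - 1)
    rw [Complex.sub_re, h2, Complex.one_re] at h3
    norm_num at h3
    linarith
  have hlt : |(G t).im| < Real.pi / 2 := by
    by_contra hcon
    have hc : ContinuousOn (fun x => |(G x).im|) (Set.Icc 0 t) :=
      (continuous_abs.comp Complex.continuous_im).comp_continuousOn
        (hG.mono (Set.Icc_subset_Icc_right ht.2))
    obtain ⟨x, hx, hxe⟩ := intermediate_value_Icc ht.1 hc
      (show Real.pi / 2 ∈ Set.Icc |(G 0).im| |(G t).im| from
        ⟨by rw [h0]; simp; positivity, not_lt.1 hcon⟩)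
    exact him x ⟨hx.1, hx.2.trans ht.2⟩ hxe
  rw [abs_lt] at hlt
  have hπ := Real.pi_pos
  rw [Complex.log_exp (by rw [Complex.neg_im]; linarith) (by rw [Complex.neg_im]; linarith), neg_neg]

/-- Transfers convergence from exponentials back to exponents. Vanishing at 0 and continuity exclude
jumps by multiples of 2πi, so the principal logarithm of a quantity near 1 applies. -/
theorem unifTo_of_exp_neg {F : ℕ → ℝ → ℂ} {f : ℝ → ℂ} (hf : ContinuousOn f (Set.Ici 0))
    (hF : ∀ M, ∀ᶠ j in atTop, ContinuousOn (F j) (Set.Icc 0 M)) (h0 : f 0 = 0) (hF0 : ∀ j, F j 0 = 0)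
    (h : UnifTo (fun j t => Complex.exp (-(F j t - f t))) (fun _ => 1)) : UnifTo F f := by
  intro M
  have h1 : Tendsto (fun p : ℕ × ℝ => Complex.exp (-(F p.1 p.2 - f p.2)))
      (atTop ×ˢ 𝓟 (Set.Icc 0 M)) (𝓝 1) := by
    have := (h M).add_const 1
    simpa using this
  have h2 : Tendsto (fun p : ℕ × ℝ => -Complex.log (Complex.exp (-(F p.1 p.2 - f p.2))))
      (atTop ×ˢ 𝓟 (Set.Icc 0 M)) (𝓝 0) := by
    have h3 := ((continuousAt_clog (x := 1) (by simp)).tendsto.comp h1).neg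
    simpa using h3
  refine h2.congr' ?_
  have h4 : ∀ᶠ p : ℕ × ℝ in atTop ×ˢ 𝓟 (Set.Icc 0 M),
      ‖Complex.exp (-(F p.1 p.2 - f p.2)) - 1‖ < 1 := by
    have := (h M).norm
    rw [norm_zero] at this
    exact this.eventually_lt_const one_pos
  rw [eventually_prod_principal_iff] at h4
  have h5 : ∀ᶠ p : ℕ × ℝ in atTop ×ˢ 𝓟 (Set.Icc 0 M), p.2 ∈ Set.Icc 0 M →
      F p.1 p.2 - f p.2 = -Complex.log (Complex.exp (-(F p.1 p.2 - f p.2))) := by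
    rw [eventually_prod_principal_iff]
    filter_upwards [h4, hF M] with j hj hFj t ht ht'
    exact eq_neg_log_exp_neg (G := fun t => F j t - f t)
      (hFj.sub (hf.mono Set.Icc_subset_Ici_self)) (by simp [h0, hF0]) hj t ht
  have h6 : ∀ᶠ p : ℕ × ℝ in atTop ×ˢ 𝓟 (Set.Icc 0 M), p.2 ∈ Set.Icc 0 M := by
    rw [eventually_prod_principal_iff]
    exact Eventually.of_forall fun _ _ h => h
  filter_upwards [h5, h6] with p hp hp' using (hp hp').symm

/-! ### Transfer of regular variation -/

theorem RegVar.of_norm_div {F G : ℝ → ℂ} {ρ : ℝ} {u v : ℂ} (hG : RegVar G ρ v)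
    (hF : Tendsto (fun s => F s / (‖F s‖ : ℂ)) (𝓝[>] 0) (𝓝 u)) {w : ℝ} (hw : w ≠ 0)
    (h : Tendsto (fun s => ‖F s‖ / ‖G s‖) (𝓝[>] 0) (𝓝 w)) : RegVar F ρ u := by
  refine ⟨hF, fun t ht => ?_⟩
  have h1 := ((h.comp (tendsto_mul_nhdsGT_zero ht)).div h hw).mul (hG.2 t ht)
  rw [div_self hw, one_mul] at h1
  refine h1.congr' ?_
  filter_upwards [(tendsto_mul_nhdsGT_zero ht).eventually hG.eventually_ne, hG.eventually_ne]
    with s hs hs'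
  have h2 : ‖G (t * s)‖ ≠ 0 := norm_ne_zero_iff.2 hs
  have h3 : ‖G s‖ ≠ 0 := norm_ne_zero_iff.2 hs'
  simp only [Function.comp_apply, Pi.div_apply]
  by_cases h4 : ‖F s‖ = 0
  · simp [h4]
  · field_simp

theorem tendsto_normalize_of_div {F G : ℝ → ℂ} {u : ℂ}
    (hG : Tendsto (fun s => G s / (‖G s‖ : ℂ)) (𝓝[>] 0) (𝓝 u)) (hG0 : ∀ᶠ s in 𝓝[>] 0, G s ≠ 0)
    (h : Tendsto (fun s => F s / G s) (𝓝[>] 0) (𝓝 1)) :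
    Tendsto (fun s => F s / (‖F s‖ : ℂ)) (𝓝[>] 0) (𝓝 u) := by
  have h1 : Tendsto (fun s => ((‖F s / G s‖ : ℝ) : ℂ)) (𝓝[>] 0) (𝓝 1) := by
    have : Tendsto (fun s => ((‖F s / G s‖ : ℝ) : ℂ)) (𝓝[>] 0) (𝓝 ((‖(1 : ℂ)‖ : ℝ) : ℂ)) :=
      (Complex.continuous_ofReal.tendsto _).comp h.norm
    rwa [norm_one, Complex.ofReal_one] at this
  have h2 := (hG.mul h).div h1 one_ne_zero
  rw [mul_one, div_one] at h2
  refine h2.congr' ?_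
  filter_upwards [hG0] with s hs
  have h3 : (‖G s‖ : ℂ) ≠ 0 := by simpa using hs
  simp only [Pi.div_apply, norm_div, Complex.ofReal_div]
  by_cases h4 : F s = 0
  · simp [h4]
  · have h5 : (‖F s‖ : ℂ) ≠ 0 := by simpa using h4
    field_simp

theorem RegVar.of_div {F G : ℝ → ℂ} {ρ : ℝ} {u : ℂ} (hG : RegVar G ρ u)
    (h : Tendsto (fun s => F s / G s) (𝓝[>] 0) (𝓝 1)) : RegVar F ρ u := by
  refine hG.of_norm_div (tendsto_normalize_of_div hG.1 hG.eventually_ne h) (w := 1) one_ne_zero ?_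
  simpa using h.norm

/-- Regular variation at `0+` from convergence along a sequence of scales whose consecutive
ratios are bounded. -/
theorem regVar_of_unifTo {L : ℝ → ℂ} {m α : ℕ → ℝ} {K : ℂ} {ρ B : ℝ} (hm : ∀ j, 0 < m j)
    (hα0 : ∀ j, 0 < α j) (hα : Tendsto α atTop atTop) (hB : ∀ᶠ j in atTop, α (j + 1) ≤ B * α j)
    (hK : K ≠ 0) (hρ : 0 < ρ)
    (h : UnifTo (fun j t => m j * L (t / α j)) (fun t => K * ((t ^ ρ : ℝ) : ℂ))) :
    RegVar L ρ (K / (‖K‖ : ℂ)) := by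
  have hex : ∀ s : ℝ, ∃ j, s⁻¹ ≤ α j := fun s => (hα.eventually_ge_atTop s⁻¹).exists
  classical
  -- The first scale above 1/s: then s α_{j(s)} lies in [1, B], and the uniform limit can be read at
  -- this bounded argument instead of at s.
  let j : ℝ → ℕ := fun s => Nat.find (hex s)
  have hj1 : ∀ s, s⁻¹ ≤ α (j s) := fun s => Nat.find_spec (hex s)
  have hinv : Tendsto (fun s : ℝ => s⁻¹) (𝓝[>] 0) atTop := tendsto_inv_nhdsGT_zero
  have hj : Tendsto j (𝓝[>] 0) atTop := by
    rw [tendsto_atTop]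
    intro N
    have : ∀ᶠ s : ℝ in 𝓝[>] 0, ∀ i ∈ Finset.range N, α i < s⁻¹ :=
      (Finset.eventually_all _).2 fun i _ => hinv.eventually_gt_atTop (α i)
    filter_upwards [this] with s hs
    by_contra hcon
    exact absurd (hs _ (Finset.mem_range.2 (not_le.1 hcon))) (not_lt.2 (hj1 s))
  have hpos : ∀ᶠ s : ℝ in 𝓝[>] 0, 0 < s := eventually_mem_nhdsWithin
  have ht1 : ∀ᶠ s : ℝ in 𝓝[>] 0, 1 ≤ s * α (j s) := by
    filter_upwards [hpos] with s hs
    have := mul_le_mul_of_nonneg_left (hj1 s) hs.le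
    rwa [mul_inv_cancel₀ hs.ne'] at this
  have ht2 : ∀ᶠ s : ℝ in 𝓝[>] 0, s * α (j s) ≤ B := by
    obtain ⟨N, hN⟩ := eventually_atTop.1 hB
    have hB0 : 0 ≤ B := by
      have := (hα0 (N + 1)).trans_le (hN N le_rfl)
      exact (pos_of_mul_pos_left this (hα0 N).le).le
    filter_upwards [hj.eventually_ge_atTop (N + 1), hpos] with s hs hs0
    have h1 : j s = (j s - 1) + 1 := by omega
    have h2 := hN (j s - 1) (by omega)
    rw [← h1] at h2
    have h3 : α (j s - 1) < s⁻¹ := not_le.1 (Nat.find_min (hex s) (m := j s - 1) (by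
      change j s - 1 < j s; omega))
    calc s * α (j s) ≤ s * (B * α (j s - 1)) := by gcongr
      _ ≤ s * (B * s⁻¹) := by gcongr
      _ = B := by field_simp
  -- Dividing by (s α_j)^ρ removes the oscillating argument from the power function; the divisor is
  -- at least 1, so the error does not grow.
  have key : ∀ τ : ℝ, 0 < τ → Tendsto (fun s => (m (j s) / (s * α (j s)) ^ ρ : ℝ) * L (τ * s))
      (𝓝[>] 0) (𝓝 (K * ((τ ^ ρ : ℝ) : ℂ))) := by
    intro τ hτ
    have h1 := h.comp (t := fun s => τ * (s * α (j s))) (M := τ * B) hj (by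
      filter_upwards [ht1, ht2] with s h1 h2
      exact ⟨by positivity, by gcongr⟩)
    have h2 : Tendsto (fun s => (m (j s) / (s * α (j s)) ^ ρ : ℝ) * L (τ * s)
        - K * ((τ ^ ρ : ℝ) : ℂ)) (𝓝[>] 0) (𝓝 0) := by
      refine squeeze_zero_norm' ?_ (tendsto_zero_iff_norm_tendsto_zero.1 h1)
      filter_upwards [ht1] with s hs
      have h3 : 1 ≤ (s * α (j s)) ^ ρ := Real.one_le_rpow hs hρ.le
      have h4 : τ * (s * α (j s)) / α (j s) = τ * s := by
        have := (hα0 (j s)).ne'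
        field_simp
      have h5 : ((τ * (s * α (j s))) ^ ρ : ℝ) = τ ^ ρ * (s * α (j s)) ^ ρ :=
        Real.mul_rpow hτ.le (by linarith)
      have h6 : (((s * α (j s)) ^ ρ : ℝ) : ℂ) ≠ 0 := by
        exact_mod_cast (show (s * α (j s)) ^ ρ ≠ 0 by linarith)
      rw [h4, h5]
      have e : (m (j s) * L (τ * s) - K * ((τ ^ ρ * (s * α (j s)) ^ ρ : ℝ) : ℂ)) =
          (((s * α (j s)) ^ ρ : ℝ) : ℂ) * ((m (j s) / (s * α (j s)) ^ ρ : ℝ) * L (τ * s)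
            - K * ((τ ^ ρ : ℝ) : ℂ)) := by
        rw [Complex.ofReal_div, Complex.ofReal_mul]
        field_simp
      rw [e, norm_mul, Complex.norm_real, Real.norm_of_nonneg (by linarith)]
      exact le_mul_of_one_le_left (norm_nonneg _) h3
    simpa using h2.add_const (K * ((τ ^ ρ : ℝ) : ℂ))
  have hc : ∀ᶠ s : ℝ in 𝓝[>] 0, 0 < m (j s) / (s * α (j s)) ^ ρ := by
    filter_upwards [ht1] with s hs
    exact div_pos (hm _) (Real.rpow_pos_of_pos (by linarith) _)
  have key1 := key 1 one_pos
  simp only [Real.one_rpow, Complex.ofReal_one, mul_one, one_mul] at key1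
  have hKn : (‖K‖ : ℂ) ≠ 0 := by simpa using hK
  have hn1 : ∀ τ : ℝ, 0 < τ → Tendsto (fun s => (m (j s) / (s * α (j s)) ^ ρ : ℝ) * ‖L (τ * s)‖)
      (𝓝[>] 0) (𝓝 (‖K‖ * τ ^ ρ)) := by
    intro τ hτ
    have h1 := (key τ hτ).norm
    rw [norm_mul, Complex.norm_real, Real.norm_of_nonneg (by positivity)] at h1
    refine h1.congr' ?_
    filter_upwards [hc] with s hs
    rw [norm_mul, Complex.norm_real, Real.norm_of_nonneg hs.le]
  have hn2 := hn1 1 one_pos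
  simp only [Real.one_rpow, mul_one, one_mul] at hn2
  constructor
  · have h1 := key1.div ((Complex.continuous_ofReal.tendsto _).comp hn2) hKn
    refine h1.congr' ?_
    filter_upwards [hc] with s hs
    have h3 : ((m (j s) / (s * α (j s)) ^ ρ : ℝ) : ℂ) ≠ 0 := by exact_mod_cast hs.ne'
    simp only [Pi.div_apply, Function.comp_apply]
    rw [Complex.ofReal_mul, mul_div_mul_left _ _ h3]
  · intro τ hτ
    have h1 := (hn1 τ hτ).div hn2 (by simpa using hK)
    rw [mul_div_cancel_left₀ _ (by simpa using hK)] at h1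
    refine h1.congr' ?_
    filter_upwards [hc] with s hs
    simp only [Pi.div_apply]
    rw [mul_div_mul_left _ _ hs.ne']

/-! ### Symmetrization -/

theorem charFun_conv_neg (ρ : Measure ℝ) [IsProbabilityMeasure ρ] (s : ℝ) :
    charFun (ρ ∗ ρ.map Neg.neg) s = ((‖charFun ρ s‖ ^ 2 : ℝ) : ℂ) := by
  have := Measure.isProbabilityMeasure_map (μ := ρ) (measurable_neg (G := ℝ)).aemeasurable
  rw [charFun_conv, charFun_map_neg, Complex.mul_conj, Complex.normSq_eq_norm_sq]

/-- Integrate 1 - cos 2y ≤ 4 (1 - cos y), which is (cos y - 1)² ≥ 0 in disguise. -/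
theorem one_sub_re_charFun_two_mul_le (P : Measure ℝ) [IsProbabilityMeasure P] (s : ℝ) :
    1 - (charFun P (2 * s)).re ≤ 4 * (1 - (charFun P s).re) := by
  have hi : ∀ t : ℝ, Integrable (fun x => Real.cos (t * x)) P := fun t =>
    Integrable.of_bound (by fun_prop) 1 (Eventually.of_forall fun x => Real.abs_cos_le_one _)
  rw [← integral_cos_eq_re_charFun, ← integral_cos_eq_re_charFun]
  have e : ∀ t : ℝ, 1 - ∫ x, Real.cos (t * x) ∂P = ∫ x, (1 - Real.cos (t * x)) ∂P := fun t => by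
    rw [integral_sub (integrable_const _) (hi t)]; simp
  rw [e, e, ← integral_const_mul]
  refine integral_mono ((integrable_const _).sub (hi _))
    (((integrable_const _).sub (hi _)).const_mul 4) fun x => ?_
  have h1 : Real.cos (2 * s * x) = 2 * Real.cos (s * x) ^ 2 - 1 := by
    rw [mul_assoc, Real.cos_two_mul]
  simp only [h1]
  nlinarith [sq_nonneg (Real.cos (s * x) - 1)]

/-- The doubling inequality applied to the symmetrized law, whose transform is |charFun ρ|². -/
theorem norm_charFun_two_mul_eq_one (ρ : Measure ℝ) [IsProbabilityMeasure ρ] {s : ℝ}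
    (h : ‖charFun ρ s‖ = 1) : ‖charFun ρ (2 * s)‖ = 1 := by
  have := Measure.isProbabilityMeasure_map (μ := ρ) (measurable_neg (G := ℝ)).aemeasurable
  have h1 := one_sub_re_charFun_two_mul_le (ρ ∗ ρ.map Neg.neg) s
  rw [charFun_conv_neg, charFun_conv_neg, Complex.ofReal_re, Complex.ofReal_re, h] at h1
  have h2 := norm_charFun_le_one (μ := ρ) (2 * s)
  have h3 := norm_nonneg (charFun ρ (2 * s))
  nlinarith

theorem norm_charFun_eq_one_of_near (ρ : Measure ℝ) [IsProbabilityMeasure ρ] {r : ℝ} (hr : 0 < r)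
    (h : ∀ s ∈ Set.Icc 0 r, ‖charFun ρ s‖ = 1) {s : ℝ} (hs : 0 ≤ s) : ‖charFun ρ s‖ = 1 := by
  have h1 : ∀ (n : ℕ) (t : ℝ), ‖charFun ρ t‖ = 1 → ‖charFun ρ (2 ^ n * t)‖ = 1 := by
    intro n
    induction n with
    | zero => intro t ht; simpa using ht
    | succ n ih =>
      intro t ht
      have := norm_charFun_two_mul_eq_one ρ (ih t ht)
      rwa [← mul_assoc, ← pow_succ'] at this
  obtain ⟨n, hn⟩ := pow_unbounded_of_one_lt (s / r) one_lt_two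
  have h2 : s / 2 ^ n ≤ r := by
    rw [div_lt_iff₀ hr] at hn
    rw [div_le_iff₀ (by positivity)]
    linarith
  have h3 := h1 n _ (h (s / 2 ^ n) ⟨by positivity, h2⟩)
  rwa [mul_div_cancel₀ _ (by positivity)] at h3

/-! ### Scaling limits of the logarithm of a characteristic function -/

/-- The exponent `K t^γ + i e t log t` of a stable law on the half-line `t ≥ 0`. -/
noncomputable def stableExp (K : ℂ) (e γ t : ℝ) : ℂ :=
  K * ((t ^ γ : ℝ) : ℂ) + Complex.I * ((e * (t * Real.log t) : ℝ) : ℂ)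

theorem stableExp_zero (K : ℂ) (e : ℝ) {γ : ℝ} (hγ : 0 < γ) : stableExp K e γ 0 = 0 := by
  simp [stableExp, Real.zero_rpow hγ.ne']

theorem stableExp_one (K : ℂ) (e γ : ℝ) : stableExp K e γ 1 = K := by
  simp [stableExp]

theorem stableExp_re (K : ℂ) (e γ t : ℝ) : (stableExp K e γ t).re = K.re * t ^ γ := by
  simp [stableExp]

theorem continuous_stableExp (K : ℂ) (e : ℝ) {γ : ℝ} (hγ : 0 < γ) : Continuous (stableExp K e γ) := by
  have h1 : Continuous fun t : ℝ => t ^ γ := Real.continuous_rpow_const hγ.le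
  have h2 := Real.continuous_mul_log
  unfold stableExp
  fun_prop

theorem IsStable.exists_stableExp {γ : ℝ} {ν : Measure ℝ} (h : IsStable γ ν) :
    ∃ (K : ℂ) (e δ : ℝ), 0 < K.re ∧
      (γ ≠ 1 → e = 0 ∧ |K.im| ≤ K.re * |Real.tan (Real.pi * γ / 2)|) ∧
      ∀ t, 0 ≤ t → charFun ν t = Complex.exp (Complex.I * ((δ * t : ℝ) : ℂ) - stableExp K e γ t) := by
  obtain ⟨hγ, -, c, β, δ, hc, hβ, hν⟩ := h
  by_cases h1 : γ = 1
  · refine ⟨c, c * β * (2 / Real.pi), δ, by simpa using hc, fun h => absurd h1 h, fun t ht => ?_⟩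
    rw [hν t, abs_of_nonneg ht, if_pos h1]
    congr 2
    rcases ht.eq_or_lt with rfl | ht
    · simp [stableExp, Real.zero_rpow hγ.ne']
    · rw [stableExp, sign_pos ht, h1]
      simp only [Real.rpow_one, SignType.coe_one]
      push_cast
      ring
  · refine ⟨c * (1 - Complex.I * ((β * Real.tan (Real.pi * γ / 2) : ℝ) : ℂ)), 0, δ, ?_,
      fun _ => ⟨rfl, ?_⟩, fun t ht => ?_⟩
    · simpa only [Complex.mul_re, Complex.ofReal_re, Complex.ofReal_im, Complex.sub_re,
        Complex.one_re, Complex.I_re, Complex.I_im, zero_mul, mul_zero, sub_zero, mul_one]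
    · simp only [Complex.mul_im, Complex.mul_re, Complex.ofReal_re, Complex.ofReal_im,
        Complex.sub_re, Complex.sub_im, Complex.one_re, Complex.one_im, Complex.I_re, Complex.I_im]
      ring_nf
      rw [abs_neg, abs_mul, abs_mul, abs_of_pos hc]
      have : |β| * |Real.tan (Real.pi * γ * (1 / 2))| ≤ 1 * |Real.tan (Real.pi * γ * (1 / 2))| := by gcongr
      nlinarith
    · rw [hν t, abs_of_nonneg ht, if_neg h1]
      congr 2
      rcases ht.eq_or_lt with rfl | ht
      · simp [stableExp, Real.zero_rpow hγ.ne']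
      · rw [stableExp, sign_pos ht]
        simp only [SignType.coe_one]
        push_cast
        ring

/-- Along the scales `α j → ∞`, the functions `-2^j log φ(t / α_j) + i t D_j` converge to a
stable exponent, uniformly on bounded intervals of `[0, ∞)`. -/
structure IsScaling (φ : ℝ → ℂ) (γ : ℝ) (K : ℂ) (e : ℝ) (α D : ℕ → ℝ) : Prop where
  index_pos : 0 < γ
  re_pos : 0 < K.re
  scale_pos : ∀ j, 0 < α j
  scale_tendsto : Tendsto α atTop atTop
  lim : UnifTo (fun j t => 2 ^ j * -Complex.log (φ (t / α j)) + Complex.I * ((t * D j : ℝ) : ℂ))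
    (stableExp K e γ)

/-- If infinitely many α_j were at most R, then for s ≤ 1/R the powers |φ(s)|^{2^j} could not tend
to 0 along them, forcing |φ(s)| = 1 there. By doubling |φ| = 1 everywhere, against the limit exp(-c)
< 1 at t = 1. -/
theorem scale_tendsto_atTop (ρ : Measure ℝ) [IsProbabilityMeasure ρ] {γ c : ℝ} (hγ : 0 < γ)
    (hc : 0 < c) {α : ℕ → ℝ} (hα : ∀ j, 0 < α j)
    (h : ∀ M : ℝ, Tendsto (fun p : ℕ × ℝ => ‖charFun ρ (p.2 / α p.1)‖ ^ 2 ^ p.1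
      - Real.exp (-(c * p.2 ^ γ))) (atTop ×ˢ 𝓟 (Set.Icc 0 M)) (𝓝 0)) :
    Tendsto α atTop atTop := by
  by_contra hcon
  obtain ⟨R, hR0, hR⟩ : ∃ R, 0 < R ∧ ∃ᶠ j in atTop, α j ≤ R := by
    by_contra! hno
    refine hcon (tendsto_atTop.2 fun b => ?_)
    have := hno (max b 1) (by positivity)
    filter_upwards [this] with j hj
    exact (le_max_left _ _).trans hj.le
  have hnear : ∀ s ∈ Set.Icc 0 R⁻¹, ‖charFun ρ s‖ = 1 := by
    intro s hs
    by_contra hne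
    have hlt : ‖charFun ρ s‖ < 1 := lt_of_le_of_ne (norm_charFun_le_one _) hne
    have h1 : Tendsto (fun j : ℕ => ‖charFun ρ s‖ ^ 2 ^ j) atTop (𝓝 0) :=
      (tendsto_pow_atTop_nhds_zero_of_lt_one (norm_nonneg _) hlt).comp
        (tendsto_pow_atTop_atTop_of_one_lt one_lt_two)
    have h2 : Tendsto (fun j => ‖charFun ρ (min (s * α j) 1 / α j)‖ ^ 2 ^ j
        - Real.exp (-(c * (min (s * α j) 1) ^ γ))) atTop (𝓝 0) :=
      Tendsto.comp (f := fun j => (j, min (s * α j) 1)) (h 1) (tendsto_id.prodMk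
        (tendsto_principal.2 (Eventually.of_forall fun j => ⟨le_min (mul_nonneg hs.1 (hα j).le) zero_le_one,
          min_le_right _ _⟩)))
    have e1 := h1.eventually_lt_const (show 0 < Real.exp (-c) / 2 by positivity)
    have e2 := h2.eventually_const_lt (show -(Real.exp (-c) / 2) < 0 by
      have := Real.exp_pos (-c); linarith)
    obtain ⟨j, hj, h3, h4⟩ := (hR.and_eventually (e1.and e2)).exists
    have h5 : s * α j ≤ 1 := by
      calc s * α j ≤ R⁻¹ * R := mul_le_mul hs.2 hj (hα j).le (by positivity)
        _ = 1 := inv_mul_cancel₀ hR0.ne'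
    have h6 : (s * α j) ^ γ ≤ 1 := Real.rpow_le_one (mul_nonneg hs.1 (hα j).le) h5 hγ.le
    rw [min_eq_left h5, mul_div_cancel_right₀ _ (hα j).ne'] at h4
    have h7 : Real.exp (-c) ≤ Real.exp (-(c * (s * α j) ^ γ)) := by
      rw [Real.exp_le_exp]; nlinarith
    linarith
  have hall := fun s hs => norm_charFun_eq_one_of_near ρ (inv_pos.2 hR0) hnear (s := s) hs
  have h1 : Tendsto (fun j => ‖charFun ρ (1 / α j)‖ ^ 2 ^ j - Real.exp (-(c * 1 ^ γ))) atTop (𝓝 0) :=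
    Tendsto.comp (f := fun j => (j, (1 : ℝ))) (h 1) (tendsto_id.prodMk
      (tendsto_principal.2 (Eventually.of_forall fun j => ⟨zero_le_one, le_rfl⟩)))
  have h2 : ∀ j, ‖charFun ρ (1 / α j)‖ ^ 2 ^ j - Real.exp (-(c * 1 ^ γ)) = 1 - Real.exp (-c) := by
    intro j
    rw [hall _ (by have := hα j; positivity)]
    simp
  simp only [h2] at h1
  have h3 := tendsto_nhds_unique h1 tendsto_const_nhds
  have h4 : Real.exp (-c) < 1 := by simpa using hc
  linarith

/-- Restrict the attraction hypothesis to n = 2^j and take logarithms. At fixed t, φ(t/α_j) is near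
1 for large j, so principal logarithms are continuous; `unifTo_of_exp_neg` removes the exponentials.
-/
theorem exists_isScaling {Ω : Type*} [MeasurableSpace Ω] (μ : Measure Ω) [IsProbabilityMeasure μ]
    {X : Ω → ℝ} (hX : Measurable X) {γ : ℝ} (h : InDomainOfAttraction μ X γ) :
    ∃ (K : ℂ) (e : ℝ) (α D : ℕ → ℝ), IsScaling (charFun (μ.map X)) γ K e α D ∧
      (γ ≠ 1 → e = 0 ∧ |K.im| ≤ K.re * |Real.tan (Real.pi * γ / 2)|) := by
  have := Measure.isProbabilityMeasure_map hX.aemeasurable (μ := μ)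
  obtain ⟨ν, hν, a, b, ha, hab⟩ := (inDomainOfAttraction_iff μ hX γ).1 h
  obtain ⟨K, e, δ, hK, hKe, hνe⟩ := hν.exists_stableExp
  have hγ := hν.1
  set φ := charFun (μ.map X) with hφ
  have hφ0 : φ 0 = 1 := by simp [hφ]
  have hφc : Continuous φ := continuous_charFun
  have hpow : Tendsto (fun j : ℕ => 2 ^ j) atTop atTop :=
    tendsto_pow_atTop_atTop_of_one_lt (one_lt_two (α := ℕ))
  let P : ℕ → Measure ℝ := fun j =>
    (Measure.pi fun _ : Fin (2 ^ j) => μ).map (fun x => ((∑ i, X (x i)) - b (2 ^ j)) / a (2 ^ j))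
  have hPp : ∀ j, IsProbabilityMeasure (P j) := fun j =>
    Measure.isProbabilityMeasure_map (Measurable.aemeasurable (by fun_prop))
  let α : ℕ → ℝ := fun j => a (2 ^ j)
  let d : ℕ → ℝ := fun j => b (2 ^ j) / a (2 ^ j)
  have hPc : ∀ j t, charFun (P j) t = φ (t / α j) ^ 2 ^ j *
      Complex.exp (-(Complex.I * (t * d j : ℝ))) := fun j t =>
    charFun_map_normalized_sum μ hX _ _ _ t
  have hα0 : ∀ j, 0 < α j := fun j => ha _
  have hU : UnifTo (fun j t => charFun (P j) t) (charFun (ν : Measure ℝ)) := by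
    refine unifTo_charFun continuous_charFun fun t => ?_
    simp only [hPc]
    exact (hab t).comp hpow
  have hnorm : ∀ j t, ‖charFun (P j) t‖ = ‖φ (t / α j)‖ ^ 2 ^ j := by
    intro j t
    rw [hPc, norm_mul, norm_pow, Complex.norm_exp]
    simp
  have hνn : ∀ t, 0 ≤ t → ‖charFun (ν : Measure ℝ) t‖ = Real.exp (-(K.re * t ^ γ)) := by
    intro t ht
    rw [hνe t ht, Complex.norm_exp, Complex.sub_re, stableExp_re]
    simp
  have hα : Tendsto α atTop atTop := by
    refine scale_tendsto_atTop (μ.map X) hγ hK hα0 fun M => ?_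
    refine squeeze_zero_norm' ?_ (tendsto_zero_iff_norm_tendsto_zero.1 (hU M))
    rw [eventually_prod_principal_iff]
    refine Eventually.of_forall fun j t ht => ?_
    rw [← hνn t ht.1, ← hnorm]
    exact abs_norm_sub_norm_le _ _
  obtain ⟨r, hr0, hr⟩ : ∃ r, 0 < r ∧ ∀ s ∈ Set.Icc 0 r, φ s ∈ Complex.slitPlane := by
    have h1 : ∀ᶠ s in 𝓝 (0 : ℝ), φ s ∈ Complex.slitPlane :=
      hφc.continuousAt.eventually (by
        rw [hφ0]; exact Complex.isOpen_slitPlane.mem_nhds Complex.one_mem_slitPlane)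
    obtain ⟨r, hr, h2⟩ := Metric.eventually_nhds_iff.1 h1
    refine ⟨r / 2, by positivity, fun s hs => h2 ?_⟩
    rw [Real.dist_eq, sub_zero, abs_of_nonneg hs.1]
    linarith [hs.2]
  have hsmall : ∀ M, ∀ᶠ j in atTop, ∀ t ∈ Set.Icc 0 M, φ (t / α j) ∈ Complex.slitPlane := by
    intro M
    filter_upwards [hα.eventually_ge_atTop (M / r)] with j hj t ht
    refine hr _ ⟨div_nonneg ht.1 (hα0 j).le, ?_⟩
    rw [div_le_iff₀ hr0] at hj
    rw [div_le_iff₀ (hα0 j)]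
    linarith [ht.2]
  refine ⟨K, e, α, fun j => d j + δ, ⟨hγ, hK, hα0, hα, ?_⟩, hKe⟩
  refine unifTo_of_exp_neg (continuous_stableExp K e hγ).continuousOn ?_ (stableExp_zero K e hγ) ?_ ?_
  · intro M
    filter_upwards [hsmall M] with j hj
    refine ContinuousOn.add (continuousOn_const.mul (ContinuousOn.neg ?_)) (by fun_prop)
    exact ContinuousOn.clog (by fun_prop) hj
  · intro j
    simp [hφ0]
  · intro M
    have hbd : ∀ t ∈ Set.Icc 0 M, ‖Complex.exp (stableExp K e γ t - Complex.I * ((δ * t : ℝ) : ℂ))‖ ≤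
        Real.exp (K.re * M ^ γ) := by
      intro t ht
      rw [Complex.norm_exp, Complex.sub_re, stableExp_re]
      simp only [Complex.mul_re, Complex.I_re, Complex.I_im, Complex.ofReal_im, zero_mul, mul_zero,
        sub_zero]
      gcongr
      · exact ht.1
      · exact ht.2
    have h1 := (tendsto_zero_iff_norm_tendsto_zero.1 (hU M)).mul_const (Real.exp (K.re * M ^ γ))
    rw [zero_mul] at h1
    refine squeeze_zero_norm' ?_ h1
    rw [eventually_prod_principal_iff]
    filter_upwards [hsmall M] with j hj t ht
    have hne := Complex.slitPlane_ne_zero (hj t ht)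
    have e1 : Complex.exp (-(2 ^ j * -Complex.log (φ (t / α j)) +
        Complex.I * ((t * (d j + δ) : ℝ) : ℂ) - stableExp K e γ t)) - 1 =
        (charFun (P j) t - charFun (ν : Measure ℝ) t) *
          Complex.exp (stableExp K e γ t - Complex.I * ((δ * t : ℝ) : ℂ)) := by
      rw [sub_mul, hνe t ht.1, ← Complex.exp_add, hPc, mul_assoc, ← Complex.exp_add]
      nth_rewrite 2 [← Complex.exp_log hne]
      rw [← Complex.exp_nat_mul, ← Complex.exp_add]
      congr 1
      · congr 1
        push_cast
        ring
      · rw [← Complex.exp_zero]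
        congr 1
        ring
    rw [e1, norm_mul]
    exact mul_le_mul_of_nonneg_left (hbd t ht) (norm_nonneg _)

/-- A stable linear recursion with vanishing forcing forgets its initial value: once |x j| ≤ p < 1,
the excess of |D| over ε/2 decays geometrically. -/
theorem eq_zero_tendsto_of_contraction {D x e : ℕ → ℝ} {q : ℝ} (hq : |q| < 1)
    (hx : Tendsto x atTop (𝓝 q)) (he : Tendsto e atTop (𝓝 0))
    (hD : ∀ j, D (j + 1) = x j * D j + e j) : Tendsto D atTop (𝓝 0) := by
  obtain ⟨p, hqp, hp1⟩ := exists_between hq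
  have hp0 : 0 < p := (abs_nonneg q).trans_lt hqp
  rw [Metric.tendsto_atTop]
  intro ε hε
  have h1 := hx.abs.eventually_le_const hqp
  have he' := he.abs
  rw [abs_zero] at he'
  have h2 := he'.eventually_le_const (show 0 < (1 - p) * (ε / 2) by
    have : 0 < 1 - p := by linarith
    positivity)
  obtain ⟨N, hN⟩ := eventually_atTop.1 (h1.and h2)
  have h3 : ∀ n, |D (N + n)| - ε / 2 ≤ p ^ n * |D N| := by
    intro n
    induction n with
    | zero => simp; positivity
    | succ n ih =>
      obtain ⟨ha, hb⟩ := hN (N + n) (by omega)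
      rw [← add_assoc, hD]
      have h4 := abs_add_le (x (N + n) * D (N + n)) (e (N + n))
      rw [abs_mul] at h4
      have h5 : |x (N + n)| * |D (N + n)| ≤ p * |D (N + n)| := by gcongr
      have h6 := mul_le_mul_of_nonneg_left ih hp0.le
      rw [pow_succ']
      nlinarith
  have h4 : Tendsto (fun n => p ^ n * |D N|) atTop (𝓝 0) := by
    simpa using (tendsto_pow_atTop_nhds_zero_of_lt_one hp0.le hp1).mul_const |D N|
  obtain ⟨n₀, hn₀⟩ := eventually_atTop.1 (h4.eventually_lt_const (show 0 < ε / 2 by positivity))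
  refine ⟨N + n₀, fun n hn => ?_⟩
  obtain ⟨k, rfl⟩ := Nat.exists_eq_add_of_le hn
  have h5 := h3 (n₀ + k)
  have h6 := hn₀ (n₀ + k) (by omega)
  rw [← add_assoc] at h5
  rw [Real.dist_eq, sub_zero]
  linarith

/-- An expanding recursion has D → 0 only for an exceptional initial value, selected here by D y →
0. If |D n| exceeded ε/2 for a large n, the product (|D| - ε/2) y would be nondecreasing from a
positive value, yet it tends to 0. -/
theorem eq_zero_tendsto_of_expansion {D x e y : ℕ → ℝ} {q : ℝ} (hq : 1 < q)
    (hx : Tendsto x atTop (𝓝 q)) (he : Tendsto e atTop (𝓝 0))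
    (hD : ∀ j, D (j + 1) = x j * D j + e j) (hy : ∀ j, 0 < y j) (hyx : ∀ j, y (j + 1) * x j = y j)
    (hy0 : Tendsto y atTop (𝓝 0)) (hDy : Tendsto (fun j => D j * y j) atTop (𝓝 0)) :
    Tendsto D atTop (𝓝 0) := by
  obtain ⟨p, hp1, hpq⟩ := exists_between hq
  rw [Metric.tendsto_atTop]
  intro ε hε
  have h1 := hx.eventually_const_le hpq
  have he' := he.abs
  rw [abs_zero] at he'
  have h2 := he'.eventually_le_const (show 0 < (p - 1) * (ε / 2) by
    have : 0 < p - 1 := by linarith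
    positivity)
  obtain ⟨N, hN⟩ := eventually_atTop.1 (h1.and h2)
  have hmono : ∀ j, N ≤ j → (|D j| - ε / 2) * y j ≤ (|D (j + 1)| - ε / 2) * y (j + 1) := by
    intro j hj
    obtain ⟨ha, hb⟩ := hN j hj
    have h3 : x j * |D j| - |e j| ≤ |D (j + 1)| := by
      have h4 := abs_sub_abs_le_abs_sub (x j * D j) (-e j)
      rw [abs_mul, abs_neg, abs_of_pos (by linarith : 0 < x j), sub_neg_eq_add, ← hD] at h4
      exact h4
    rw [← hyx j]
    have h5 : x j * (|D j| - ε / 2) ≤ |D (j + 1)| - ε / 2 := by nlinarith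
    calc _ = x j * (|D j| - ε / 2) * y (j + 1) := by ring
      _ ≤ _ := mul_le_mul_of_nonneg_right h5 (hy _).le
  have hlim : Tendsto (fun j => (|D j| - ε / 2) * y j) atTop (𝓝 0) := by
    have h3 := hDy.abs.sub (hy0.const_mul (ε / 2))
    rw [abs_zero, mul_zero, sub_zero] at h3
    refine h3.congr fun j => ?_
    rw [abs_mul, abs_of_pos (hy j)]
    ring
  refine ⟨N, fun n hn => ?_⟩
  have hle : (|D n| - ε / 2) * y n ≤ 0 := by
    refine ge_of_tendsto hlim ?_
    filter_upwards [eventually_ge_atTop n] with m hm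
    induction m, hm using Nat.le_induction with
    | base => rfl
    | succ m hm ih => exact ih.trans (hmono m (hn.trans hm))
  have h4 := nonpos_of_mul_nonpos_left hle (hy n)
  rw [Real.dist_eq, sub_zero]
  linarith

/-! ### Comparing consecutive scales -/

namespace IsScaling

variable {φ : ℝ → ℂ} {γ e : ℝ} {K : ℂ} {α D : ℕ → ℝ} (h : IsScaling φ γ K e α D)
include h

theorem unifTo_re : UnifTo (fun j t => ((2 ^ j : ℝ) : ℂ) * (((-Complex.log (φ (t / α j))).re : ℝ) : ℂ))
    (fun t => (K.re : ℂ) * ((t ^ γ : ℝ) : ℂ)) := by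
  intro M
  refine squeeze_zero_norm (fun p => ?_) (tendsto_zero_iff_norm_tendsto_zero.1 (h.lim M))
  refine le_trans (le_of_eq ?_) (Complex.abs_re_le_norm _)
  beta_reduce
  rw [← Complex.ofReal_mul, ← Complex.ofReal_mul, ← Complex.ofReal_sub, Complex.norm_real,
    Real.norm_eq_abs, Complex.sub_re, stableExp_re, Complex.add_re]
  have : ((2 : ℂ) ^ p.1) = ((2 ^ p.1 : ℝ) : ℂ) := by push_cast; rfl
  rw [this, Complex.re_ofReal_mul]
  simp

theorem tendsto_re {ι : Type*} {l : Filter ι} {j : ι → ℕ} {t : ι → ℝ} {M : ℝ}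
    (hj : Tendsto j l atTop) (ht : ∀ᶠ i in l, t i ∈ Set.Icc 0 M) :
    Tendsto (fun i => 2 ^ j i * (-Complex.log (φ (t i / α (j i)))).re - K.re * t i ^ γ) l (𝓝 0) := by
  have h1 := (Complex.continuous_re.tendsto _).comp (h.unifTo_re.comp hj ht)
  rw [Complex.zero_re] at h1
  refine h1.congr fun i => ?_
  simp only [Function.comp_apply, ← Complex.ofReal_mul, ← Complex.ofReal_sub, Complex.ofReal_re]

/-- The point 1/α_{j+1} is seen at level j+1 with t = 1 and at level j with t = α_j/α_{j+1}.
Comparing real parts, where the drift is invisible, shows that the γ-th power of the ratio tends to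
1/2. -/
theorem tendsto_ratio : Tendsto (fun j => α j / α (j + 1)) atTop (𝓝 ((1 / 2) ^ (1 / γ) : ℝ)) := by
  have hK := h.re_pos
  have hr0 : ∀ j, 0 < α j / α (j + 1) := fun j => div_pos (h.scale_pos _) (h.scale_pos _)
  have h1 := h.tendsto_re (t := fun _ => 1) (M := 1) tendsto_id (Eventually.of_forall fun _ => by simp)
  have h1' := h1.comp (tendsto_add_atTop_nat 1)
  -- The minimum with 1 keeps the argument in a fixed compact set before the ratio is known to be
  -- below 1. It first shows that α_{j+1} ≤ α_j fails eventually, since otherwise 1/α_j would give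
  -- both Re K and at most Re K/2.
  have h2 := h.tendsto_re (t := fun j => min 1 (α (j + 1) / α j)) (M := 1) (tendsto_add_atTop_nat 1)
    (Eventually.of_forall fun j =>
      ⟨le_min zero_le_one (div_pos (h.scale_pos _) (h.scale_pos _)).le, min_le_left _ _⟩)
  have hlt : ∀ᶠ j in atTop, α j / α (j + 1) < 1 := by
    filter_upwards [h1.eventually_const_lt (show -(K.re / 8) < 0 by linarith),
      h2.eventually_lt_const (show 0 < K.re / 8 by linarith)] with j ha hb
    by_contra hcon
    have hle : α (j + 1) / α j ≤ 1 := by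
      have := (one_le_div (h.scale_pos (j + 1))).1 (not_lt.1 hcon)
      exact (div_le_one (h.scale_pos j)).2 this
    rw [min_eq_right hle] at hb
    have e1 : α (j + 1) / α j / α (j + 1) = 1 / α j := by
      have := (h.scale_pos j).ne'
      have := (h.scale_pos (j + 1)).ne'
      field_simp
    have e2 : (α (j + 1) / α j) ^ γ ≤ 1 :=
      Real.rpow_le_one (div_pos (h.scale_pos _) (h.scale_pos _)).le hle h.index_pos.le
    rw [e1, pow_succ] at hb
    simp only [id, Real.one_rpow, mul_one] at ha
    nlinarith
  have h3 := h.tendsto_re (t := fun j => α j / α (j + 1)) (M := 1) tendsto_id (by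
    filter_upwards [hlt] with j hj using ⟨(hr0 j).le, hj.le⟩)
  have h4 : Tendsto (fun j => (α j / α (j + 1)) ^ γ) atTop (𝓝 (1 / 2)) := by
    have h5 := ((h1'.div_const 2).sub h3).div_const K.re
    have h6 := h5.add_const (1 / 2)
    rw [zero_div, sub_zero, zero_div, zero_add] at h6
    refine h6.congr fun j => ?_
    have e1 : α j / α (j + 1) / α j = 1 / α (j + 1) := by
      have := (h.scale_pos j).ne'
      have := (h.scale_pos (j + 1)).ne'
      field_simp
    simp only [Function.comp_apply, id, e1, Real.one_rpow, pow_succ]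
    have := hK.ne'
    field_simp
    ring
  have h7 := h4.rpow_const (p := 1 / γ) (Or.inl (by norm_num))
  refine h7.congr fun j => ?_
  rw [← Real.rpow_mul (hr0 j).le, mul_one_div_cancel h.index_pos.ne', Real.rpow_one]

theorem exists_scale_le : ∃ B, ∀ᶠ j in atTop, α (j + 1) ≤ B * α j := by
  have hq : 0 < (1 / 2 : ℝ) ^ (1 / γ) := by positivity
  refine ⟨2 / (1 / 2 : ℝ) ^ (1 / γ), ?_⟩
  filter_upwards [h.tendsto_ratio.eventually_const_lt (half_lt_self hq)] with j hj
  rw [lt_div_iff₀ (h.scale_pos _)] at hj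
  rw [div_mul_eq_mul_div, le_div_iff₀ hq]
  linarith

/-- The same comparison of two levels at 1/α_{j+1}, now in imaginary parts: the logarithms cancel
and only the drifts remain. With e = 0 the stable exponents cancel in the limit too. -/
theorem tendsto_drift (he : e = 0) :
    Tendsto (fun j => D (j + 1) - 2 * (α j / α (j + 1)) * D j) atTop (𝓝 0) := by
  have hq : (1 / 2 : ℝ) ^ (1 / γ) < 1 :=
    Real.rpow_lt_one (by norm_num) (by norm_num) (one_div_pos.2 h.index_pos)
  have h1 := (h.lim.tendsto (t := 1) zero_le_one).comp (tendsto_add_atTop_nat 1)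
  have h2 := h.lim.comp (t := fun j => α j / α (j + 1)) (M := 1) tendsto_id (by
    filter_upwards [h.tendsto_ratio.eventually_lt_const hq] with j hj
    exact ⟨(div_pos (h.scale_pos _) (h.scale_pos _)).le, hj.le⟩)
  have h3 : Tendsto (fun j => stableExp K e γ (α j / α (j + 1))) atTop (𝓝 (K * (1 / 2))) := by
    have := ((continuous_stableExp K e h.index_pos).tendsto _).comp h.tendsto_ratio
    have e1 : stableExp K e γ ((1 / 2) ^ (1 / γ)) = K * (1 / 2) := by
      rw [stableExp, he, ← Real.rpow_mul (by norm_num), one_div_mul_cancel h.index_pos.ne']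
      simp
    rwa [e1] at this
  have h4 := (h1.sub ((h2.add h3).const_mul 2))
  have h5 := (Complex.continuous_im.tendsto _).comp h4
  have e0 : (stableExp K e γ 1 - 2 * (0 + K * (1 / 2))).im = 0 := by
    rw [stableExp_one]; ring_nf; simp
  rw [e0] at h5
  refine h5.congr fun j => ?_
  have e1 : α j / α (j + 1) / α j = 1 / α (j + 1) := by
    have := (h.scale_pos j).ne'
    have := (h.scale_pos (j + 1)).ne'
    field_simp
  have e2 : ∀ L : ℂ, 2 ^ (j + 1) * L + Complex.I * ((1 * D (j + 1) : ℝ) : ℂ) -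
      2 * (2 ^ j * L + Complex.I * ((α j / α (j + 1) * D j : ℝ) : ℂ)) =
      Complex.I * ((D (j + 1) - 2 * (α j / α (j + 1)) * D j : ℝ) : ℂ) := by
    intro L
    push_cast
    ring
  simp only [Function.comp_apply, id, e1, sub_add_cancel, e2]
  simp

/-- Once the drift vanishes, `-log φ` varies regularly. -/
theorem regVar_log (he : e = 0) (hD : Tendsto D atTop (𝓝 0)) :
    RegVar (fun s => -Complex.log (φ s)) γ (K / (‖K‖ : ℂ)) := by
  obtain ⟨B, hB⟩ := h.exists_scale_le
  have hK : K ≠ 0 := fun h0 => by have := h.re_pos; simp [h0] at this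
  refine regVar_of_unifTo (m := fun j => 2 ^ j) (fun j => by positivity) h.scale_pos h.scale_tendsto
    hB hK h.index_pos fun M => ?_
  have h1 : Tendsto (fun p : ℕ × ℝ => Complex.I * ((p.2 * D p.1 : ℝ) : ℂ))
      (atTop ×ˢ 𝓟 (Set.Icc 0 M)) (𝓝 0) := by
    have h2 := ((hD.comp tendsto_fst).abs (l := atTop ×ˢ 𝓟 (Set.Icc 0 M))).const_mul M
    rw [abs_zero, mul_zero] at h2
    refine squeeze_zero_norm' ?_ h2
    rw [eventually_prod_principal_iff]
    refine Eventually.of_forall fun j t ht => ?_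
    rw [norm_mul, Complex.norm_I, one_mul, Complex.norm_real, Real.norm_eq_abs, abs_mul,
      abs_of_nonneg ht.1]
    exact mul_le_mul_of_nonneg_right ht.2 (abs_nonneg _)
  have h2 := (h.lim M).sub h1
  rw [sub_zero] at h2
  refine h2.congr fun p => ?_
  rw [stableExp, he]
  push_cast
  ring

/-- The drift is purely imaginary, so the real part varies regularly whatever the drift does. -/
theorem regVar_re : RegVar (fun s => (((-Complex.log (φ s)).re : ℝ) : ℂ)) γ 1 := by
  obtain ⟨B, hB⟩ := h.exists_scale_le
  have hK : (K.re : ℂ) ≠ 0 := by exact_mod_cast h.re_pos.ne'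
  have h1 := regVar_of_unifTo (L := fun s => (((-Complex.log (φ s)).re : ℝ) : ℂ))
    (m := fun j => 2 ^ j) (fun j => by positivity) h.scale_pos h.scale_tendsto
    hB hK h.index_pos h.unifTo_re
  rwa [Complex.norm_real, Real.norm_of_nonneg h.re_pos.le, div_self hK] at h1

end IsScaling

/-! ### Regular variation of `1 - φ` from a domain of attraction -/

theorem tendsto_one_sub_div_neg_log {φ : ℝ → ℂ} (hφ : Tendsto φ (𝓝[>] 0) (𝓝 1))
    (h0 : ∀ᶠ s in 𝓝[>] 0, -Complex.log (φ s) ≠ 0) :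
    Tendsto (fun s => (1 - φ s) / -Complex.log (φ s)) (𝓝[>] 0) (𝓝 1) := by
  have hne : ∀ᶠ s in 𝓝[>] 0, φ s ≠ 1 := by
    filter_upwards [h0] with s hs h1
    exact hs (by simp [h1])
  have h1 : HasDerivAt Complex.log 1 1 := by
    simpa using Complex.hasDerivAt_log Complex.one_mem_slitPlane
  have h2 := (hasDerivAt_iff_tendsto_slope.1 h1).comp (tendsto_nhdsWithin_iff.2 ⟨hφ, hne⟩)
  have h3 := h2.inv₀ one_ne_zero
  rw [inv_one] at h3
  refine h3.congr' ?_
  filter_upwards [hne, h0] with s hs hs'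
  have h4 : φ s - 1 ≠ 0 := sub_ne_zero.2 hs
  have h5 : Complex.log (φ s) ≠ 0 := by simpa using hs'
  simp only [Function.comp_apply, slope_def_field, Complex.log_one, sub_zero, inv_div]
  rw [div_neg, ← neg_div, neg_sub]

theorem tendsto_charFun_one (ρ : Measure ℝ) [IsProbabilityMeasure ρ] :
    Tendsto (charFun ρ) (𝓝[>] 0) (𝓝 1) := by
  have := (continuous_charFun (μ := ρ)).tendsto 0
  rw [charFun_zero, probReal_univ, Complex.ofReal_one] at this
  exact this.mono_left nhdsWithin_le_nhds

/-- Turns the bound on skewness into a bound on the phase, by monotonicity of the arctangent. -/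
theorem abs_arg_normalize_le {K : ℂ} (hK : 0 < K.re) {θ : ℝ} (h0 : 0 < θ) (h1 : θ < Real.pi / 2)
    (h : |K.im| ≤ K.re * |Real.tan θ|) : |(K / (‖K‖ : ℂ)).arg| ≤ θ := by
  have hK0 : K ≠ 0 := fun h => by simp [h] at hK
  have hn : 0 < ‖K‖⁻¹ := inv_pos.2 (norm_pos_iff.2 hK0)
  have e : (K / (‖K‖ : ℂ)) = ((‖K‖⁻¹ : ℝ) : ℂ) * K := by
    rw [Complex.ofReal_inv, div_eq_inv_mul]
  have ht := Real.tan_pos_of_pos_of_lt_pi_div_two h0 h1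
  have harg := abs_lt.1 (Complex.abs_arg_lt_pi_div_two_iff.2 (Or.inl hK))
  rw [e, Complex.arg_real_mul _ hn, ← Real.arctan_tan harg.1 harg.2, Complex.tan_arg]
  rw [abs_of_pos ht, abs_le] at h
  have h2 : K.im / K.re ≤ Real.tan θ := by rw [div_le_iff₀ hK]; linarith [h.2]
  have h3 : -Real.tan θ ≤ K.im / K.re := by rw [le_div_iff₀ hK]; linarith [h.1]
  have h4 := Real.arctan_tan (x := θ) (by linarith) h1
  rw [abs_le]
  constructor
  · have := Real.arctan_mono h3
    rwa [Real.arctan_neg, h4] at this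
  · have := Real.arctan_mono h2
    rwa [h4] at this

namespace IsScaling

variable {ρ : Measure ℝ} [IsProbabilityMeasure ρ] {γ e : ℝ} {K : ℂ} {α D : ℕ → ℝ}

theorem regVar_one_sub (h : IsScaling (charFun ρ) γ K e α D) (he : e = 0)
    (hD : Tendsto D atTop (𝓝 0)) : RegVar (fun s => 1 - charFun ρ s) γ (K / (‖K‖ : ℂ)) := by
  have h1 := h.regVar_log he hD
  exact h1.of_div (tendsto_one_sub_div_neg_log (tendsto_charFun_one ρ) h1.eventually_ne)

/-- For γ < 1 the limiting multiplier 2·2^{-1/γ} is below 1, so the drift recursion contracts and no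
centering survives. -/
theorem regVar_one_sub_of_lt_one (h : IsScaling (charFun ρ) γ K e α D) (he : e = 0) (hγ : γ < 1) :
    RegVar (fun s => 1 - charFun ρ s) γ (K / (‖K‖ : ℂ)) := by
  have hγ0 := h.index_pos
  refine h.regVar_one_sub he (eq_zero_tendsto_of_contraction
    (x := fun j => 2 * (α j / α (j + 1))) ?_ (h.tendsto_ratio.const_mul 2) (h.tendsto_drift he)
    fun j => by ring)
  have h1 : 1 < 1 / γ := (one_lt_div hγ0).2 hγ
  have h2 : (1 / 2 : ℝ) ^ (1 / γ) < (1 / 2 : ℝ) ^ (1 : ℝ) :=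
    Real.rpow_lt_rpow_of_exponent_gt (by norm_num) (by norm_num) h1
  rw [Real.rpow_one] at h2
  have h3 : 0 < (1 / 2 : ℝ) ^ (1 / γ) := by positivity
  rw [abs_of_pos (by positivity)]
  linarith

/-- Here the limiting multiplier of the drift is 1 and the recursion is useless; the phase u
decides. If Re u ≠ 0, the norm of L is comparable to Re L, which varies regularly. If Re u = 0, then
Re L is negligible, |D_j| → ∞, and L divided by the drift converges to the linear function u t. -/
theorem regVar_one_sub_of_eq_one (h : IsScaling (charFun ρ) 1 K e α D) {u : ℂ}
    (hu : Tendsto (fun s => (1 - charFun ρ s) / (‖1 - charFun ρ s‖ : ℂ)) (𝓝[>] 0) (𝓝 u)) :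
    RegVar (fun s => 1 - charFun ρ s) 1 u := by
  set φ := charFun ρ with hφ
  set L : ℝ → ℂ := fun s => -Complex.log (φ s) with hLdef
  have hre := h.regVar_re
  have hL0 : ∀ᶠ s in 𝓝[>] 0, L s ≠ 0 := by
    filter_upwards [hre.eventually_ne] with s hs h0
    exact hs (by rw [hLdef] at h0; simp only at h0; rw [h0]; simp)
  have hlam := tendsto_one_sub_div_neg_log (tendsto_charFun_one ρ) hL0
  have hLu : Tendsto (fun s => L s / (‖L s‖ : ℂ)) (𝓝[>] 0) (𝓝 u) := by
    have h1 := hlam.inv₀ one_ne_zero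
    rw [inv_one] at h1
    refine tendsto_normalize_of_div hu ?_ (h1.congr fun s => inv_div _ _)
    filter_upwards [hlam.eventually_ne one_ne_zero] with s hs h0
    exact hs (by rw [h0, zero_div])
  refine RegVar.of_div (G := L) ?_ hlam
  have hreu : Tendsto (fun s => (L s).re / ‖L s‖) (𝓝[>] 0) (𝓝 u.re) := by
    refine ((Complex.continuous_re.tendsto _).comp hLu).congr fun s => ?_
    simp only [Function.comp_apply, Complex.div_ofReal_re]
  by_cases hu0 : u.re = 0
  · -- the drift dominates
    obtain ⟨B, hB⟩ := h.exists_scale_le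
    have hs : Tendsto (fun j => 1 / α j) atTop (𝓝[>] 0) := by
      simp only [one_div]
      exact tendsto_inv_atTop_nhdsGT_zero.comp h.scale_tendsto
    let Z : ℕ → ℂ := fun j => 2 ^ j * L (1 / α j)
    have hZn : ∀ j, ‖Z j‖ = 2 ^ j * ‖L (1 / α j)‖ := fun j => by simp [Z]
    have hZre : Tendsto (fun j => 2 ^ j * (L (1 / α j)).re) atTop (𝓝 K.re) := by
      have h1 := (h.tendsto_re (t := fun _ => 1) (M := 1) tendsto_id
        (Eventually.of_forall fun _ => by simp)).add_const K.re
      rw [zero_add] at h1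
      refine h1.congr fun j => ?_
      simp [hLdef]
    have hZinf : Tendsto (fun j => ‖Z j‖) atTop atTop := by
      have h1 := (hreu.comp hs).div hZre h.re_pos.ne'
      rw [hu0, zero_div] at h1
      have h2 : Tendsto (fun j => ‖Z j‖⁻¹) atTop (𝓝[>] 0) := by
        refine tendsto_nhdsWithin_iff.2 ⟨h1.congr' ?_, ?_⟩
        · filter_upwards [hZre.eventually_const_lt h.re_pos] with j hj
          have h3 : (L (1 / α j)).re ≠ 0 := fun h0 => by rw [h0] at hj; simp at hj
          simp only [Pi.div_apply, Function.comp_apply, hZn]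
          have h4 : ‖L (1 / α j)‖ ≠ 0 := fun h0 => h3 (by rw [norm_eq_zero.1 h0]; rfl)
          field_simp
        · filter_upwards [hs.eventually hL0] with j hj
          rw [Set.mem_Ioi, inv_pos, hZn]
          have := norm_pos_iff.2 hj
          positivity
      simpa [Function.comp_def] using tendsto_inv_nhdsGT_zero.comp h2
    have hFK : Tendsto (fun j => Z j + Complex.I * (D j : ℂ)) atTop (𝓝 K) := by
      have := h.lim.tendsto (t := 1) zero_le_one
      rw [stableExp_one] at this
      simpa [Z, hLdef] using this
    have hDinf : Tendsto (fun j => |D j|) atTop atTop := by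
      refine tendsto_atTop_mono' _ ?_ (tendsto_atTop_add_const_right _ (-(‖K‖ + 1)) hZinf)
      filter_upwards [hFK.norm.eventually_le_const (lt_add_one _)] with j hj
      have h1 := norm_sub_le (Z j + Complex.I * (D j : ℂ)) (Complex.I * (D j : ℂ))
      rw [add_sub_cancel_right, norm_mul Complex.I, Complex.norm_I, one_mul, Complex.norm_real,
        Real.norm_eq_abs] at h1
      linarith
    have hDinv : Tendsto (fun j => ((|D j|⁻¹ : ℝ) : ℂ)) atTop (𝓝 0) := by
      have := (Complex.continuous_ofReal.tendsto _).comp (tendsto_inv_atTop_zero.comp hDinf)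
      rwa [Complex.ofReal_zero] at this
    have hDne : ∀ᶠ j in atTop, D j ≠ 0 := by
      filter_upwards [hDinf.eventually_gt_atTop 0] with j hj using abs_pos.1 hj
    have hn1 : ‖u‖ = 1 := by
      refine tendsto_nhds_unique hLu.norm (Tendsto.congr' ?_ tendsto_const_nhds)
      filter_upwards [hL0] with s hs
      simp [hs]
    -- Z_j + i D_j stays bounded while |D_j| → ∞, so -i sign(D_j) has the same limiting phase as
    -- Z_j, which is u.
    have hw : Tendsto (fun j => -(Complex.I * ((D j / |D j| : ℝ) : ℂ))) atTop (𝓝 u) := by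
      have h1 : Tendsto (fun j => (Z j + Complex.I * (D j : ℂ)) * ((|D j|⁻¹ : ℝ) : ℂ)) atTop (𝓝 0) := by
        simpa using hFK.mul hDinv
      have h2 : Tendsto (fun j => ‖Z j * ((|D j|⁻¹ : ℝ) : ℂ)‖) atTop (𝓝 1) := by
        rw [tendsto_iff_norm_sub_tendsto_zero]
        refine squeeze_zero_norm' ?_ (tendsto_zero_iff_norm_tendsto_zero.1 h1)
        filter_upwards [hDne] with j hj
        have h3 : ‖Complex.I * ((D j / |D j| : ℝ) : ℂ)‖ = 1 := by
          have := abs_pos.2 hj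
          rw [norm_mul, Complex.norm_I, one_mul, Complex.norm_real, Real.norm_eq_abs, abs_div,
            abs_abs, div_self this.ne']
        rw [norm_norm, Real.norm_eq_abs, ← h3, ← norm_neg (Complex.I * _)]
        refine (abs_norm_sub_norm_le _ _).trans_eq ?_
        congr 1
        push_cast
        ring
      have h3 : Tendsto (fun j => Z j / (‖Z j‖ : ℂ)) atTop (𝓝 u) := by
        refine (hLu.comp hs).congr fun j => ?_
        simp only [Function.comp_apply, hZn, Z]
        push_cast
        rw [mul_div_mul_left _ _ (pow_ne_zero j two_ne_zero)]
      have h4 := (h3.mul ((Complex.continuous_ofReal.tendsto _).comp h2)).sub h1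
      rw [Complex.ofReal_one, mul_one, sub_zero] at h4
      refine h4.congr' ?_
      filter_upwards [hZinf.eventually_gt_atTop 0] with j hj
      have h5 : (‖Z j‖ : ℂ) ≠ 0 := by exact_mod_cast hj.ne'
      simp only [Function.comp_apply, norm_mul, Complex.norm_real, norm_inv, norm_abs_eq_norm, Complex.ofReal_mul]
      rw [Real.norm_eq_abs]
      push_cast
      field_simp
      ring
    -- The weight 1 at indices with D j = 0 only keeps the weights positive; such indices are finite
    -- in number.
    have hR := regVar_of_unifTo (L := L) (m := fun j => if D j = 0 then 1 else 2 ^ j / |D j|)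
      (K := u) (ρ := 1) (B := B) (fun j => by
        split_ifs with hj
        · exact one_pos
        · have := abs_pos.2 hj
          positivity) h.scale_pos h.scale_tendsto hB (fun h0 => by simp [h0] at hn1) one_pos (by
      intro M
      have h1 : Tendsto (fun p : ℕ × ℝ => (2 ^ p.1 * L (p.2 / α p.1) +
          Complex.I * ((p.2 * D p.1 : ℝ) : ℂ)) * ((|D p.1|⁻¹ : ℝ) : ℂ))
          (atTop ×ˢ 𝓟 (Set.Icc 0 M)) (𝓝 0) := by
        obtain ⟨C, hC⟩ := (isCompact_Icc (a := (0 : ℝ)) (b := M)).exists_bound_of_continuousOn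
          (continuous_stableExp K e one_pos).continuousOn
        have h2 := (hDinv.norm.comp (tendsto_fst (f := atTop) (g := 𝓟 (Set.Icc 0 M)))).const_mul (1 + C)
        rw [norm_zero, mul_zero] at h2
        have h3 := (h.lim M).norm
        rw [norm_zero] at h3
        have h4 := h3.eventually_le_const one_pos
        rw [eventually_prod_principal_iff] at h4
        refine squeeze_zero_norm' ?_ h2
        rw [eventually_prod_principal_iff]
        filter_upwards [h4] with j hj t ht
        rw [norm_mul]
        refine mul_le_mul_of_nonneg_right ?_ (norm_nonneg _)
        have h5 := norm_add_le (2 ^ j * L (t / α j) + Complex.I * ((t * D j : ℝ) : ℂ)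
          - stableExp K e 1 t) (stableExp K e 1 t)
        rw [sub_add_cancel] at h5
        exact h5.trans (add_le_add (hj t ht) (hC t ht))
      have h2 : Tendsto (fun p : ℕ × ℝ => (p.2 : ℂ) * (-(Complex.I * ((D p.1 / |D p.1| : ℝ) : ℂ)) - u))
          (atTop ×ˢ 𝓟 (Set.Icc 0 M)) (𝓝 0) := by
        have h3 := ((tendsto_iff_norm_sub_tendsto_zero.1 hw).comp
          (tendsto_fst (f := atTop) (g := 𝓟 (Set.Icc 0 M)))).const_mul M
        rw [mul_zero] at h3
        refine squeeze_zero_norm' ?_ h3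
        rw [eventually_prod_principal_iff]
        refine Eventually.of_forall fun j t ht => ?_
        rw [norm_mul, Complex.norm_real, Real.norm_of_nonneg ht.1]
        exact mul_le_mul_of_nonneg_right ht.2 (norm_nonneg _)
      have h3 := h1.add h2
      rw [zero_add] at h3
      refine h3.congr' ?_
      filter_upwards [tendsto_fst.eventually hDne] with p hp
      have h4 : ((|D p.1| : ℝ) : ℂ) ≠ 0 := by simpa using hp
      rw [if_neg hp, Real.rpow_one]
      push_cast
      field_simp
      ring)
    rwa [hn1, Complex.ofReal_one, div_one] at hR
  · refine hre.of_norm_div hLu (w := |u.re|⁻¹) (inv_ne_zero (abs_ne_zero.2 hu0)) ?_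
    have h1 := (hreu.abs).inv₀ (abs_ne_zero.2 hu0)
    refine h1.congr fun s => ?_
    rw [abs_div, inv_div, abs_norm, Complex.norm_real, Real.norm_eq_abs]

end IsScaling

/-! ### Indices above one: integrability and centering -/

theorem integrable_of_integrable_conv_neg (ρ : Measure ℝ) [IsProbabilityMeasure ρ]
    (h : Integrable id (ρ ∗ ρ.map Neg.neg)) : Integrable id ρ := by
  have := Measure.isProbabilityMeasure_map (μ := ρ) (measurable_neg (G := ℝ)).aemeasurable
  rw [Measure.conv, integrable_map_measure (by fun_prop) (by fun_prop)] at h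
  -- By Fubini x - y is integrable in x for some fixed y, and a constant shift does not affect
  -- integrability.
  obtain ⟨y, hy⟩ := h.prod_left_ae.exists
  refine (hy.sub (integrable_const y)).congr (Eventually.of_forall fun x => ?_)
  simp

/-- Layer-cake bound along the scales: |x| is at most α_N plus the sum of α_{j+1} over those j ≥ N
with α_j < |x|; the tail bound makes the expectation a convergent series. -/
theorem integrable_of_scale_tail {P : Measure ℝ} [IsProbabilityMeasure P] {α : ℕ → ℝ} {C : ℝ}
    (hα0 : ∀ j, 0 < α j) (hα : Tendsto α atTop atTop)
    (hs : Summable fun j => α j * (1 / 2) ^ j)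
    (hP : ∀ᶠ j in atTop, P.real {x | α j < |x|} ≤ C * (1 / 2) ^ j) : Integrable id P := by
  obtain ⟨N, hN⟩ := eventually_atTop.1 hP
  have hm : ∀ r : ℝ, MeasurableSet {x : ℝ | r < |x|} := fun r =>
    measurableSet_lt measurable_const (by fun_prop)
  refine ⟨by fun_prop, ?_⟩
  rw [hasFiniteIntegral_iff_enorm]
  have hle : ∀ x : ℝ, ‖id x‖ₑ ≤ ENNReal.ofReal (α N) + ∑' j : ℕ,
      ({x : ℝ | α (N + j) < |x|}).indicator (fun _ => ENNReal.ofReal (α (N + j + 1))) x := by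
    intro x
    rw [id, Real.enorm_eq_ofReal_abs]
    have hex : ∃ m, |x| ≤ α (N + m) := by
      obtain ⟨m, hm⟩ := ((hα.comp (tendsto_add_atTop_nat N)).eventually_ge_atTop |x|).exists
      exact ⟨m, by rw [add_comm]; exact hm⟩
    classical
    rcases Nat.eq_zero_or_pos (Nat.find hex) with h0 | h0
    · have := Nat.find_spec hex
      rw [h0] at this
      exact (ENNReal.ofReal_le_ofReal this).trans le_self_add
    · obtain ⟨k, hk⟩ := Nat.exists_eq_succ_of_ne_zero h0.ne'
      have h1 := Nat.find_spec hex
      rw [hk] at h1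
      have h2 : α (N + k) < |x| := not_le.1 (Nat.find_min hex (m := k) (by omega))
      refine le_trans ?_ le_add_self
      refine le_trans ?_ (ENNReal.le_tsum k)
      rw [Set.indicator_of_mem (show x ∈ {x : ℝ | α (N + k) < |x|} from h2)]
      exact ENNReal.ofReal_le_ofReal h1
  refine (lintegral_mono hle).trans_lt ?_
  rw [lintegral_add_left measurable_const, lintegral_const, measure_univ, mul_one,
    lintegral_tsum fun j => (measurable_const.indicator (hm _)).aemeasurable]
  refine ENNReal.add_lt_top.2 ⟨ENNReal.ofReal_lt_top, ?_⟩
  have hs' : Summable fun j => 2 * C * (α (N + j + 1) * (1 / 2) ^ (N + j + 1)) := by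
    refine Summable.mul_left _ ?_
    have := (summable_nat_add_iff (N + 1)).2 hs
    refine this.congr fun j => ?_
    rw [show j + (N + 1) = N + j + 1 by ring]
  refine lt_of_le_of_lt ?_ hs'.tsum_ofReal_lt_top
  refine ENNReal.tsum_le_tsum fun j => ?_
  rw [lintegral_indicator_const (hm _), ← ofReal_measureReal,
    ← ENNReal.ofReal_mul (hα0 _).le]
  refine ENNReal.ofReal_le_ofReal ?_
  calc α (N + j + 1) * P.real {x | α (N + j) < |x|}
      ≤ α (N + j + 1) * (C * (1 / 2) ^ (N + j)) :=
        mul_le_mul_of_nonneg_left (hN _ (by omega)) (hα0 _).le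
    _ = _ := by rw [pow_succ]; ring

theorem hasDerivAt_charFun_zero (ρ : Measure ℝ) [IsProbabilityMeasure ρ] (h : Integrable id ρ) :
    HasDerivAt (charFun ρ) (Complex.I * ((∫ x, x ∂ρ : ℝ) : ℂ)) 0 := by
  have hm : MemLp id ((1 : ℕ) : ENNReal) ρ := by simpa using memLp_one_iff_integrable.2 h
  have h1 := (contDiff_charFun hm).differentiable (by simp) 0
  have h2 := iteratedDeriv_charFun_zero hm
  rw [iteratedDeriv_one] at h2
  have h3 := h1.hasDerivAt
  rw [h2] at h3
  simpa using h3

namespace IsScaling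

variable {ρ : Measure ℝ} [IsProbabilityMeasure ρ] {γ e : ℝ} {K : ℂ} {α D : ℕ → ℝ}

theorem summable_scale {φ : ℝ → ℂ} (h : IsScaling φ γ K e α D) (hγ : 1 < γ) :
    Summable fun j => α j * (1 / 2) ^ j := by
  have hq : (1 / 2 : ℝ) < (1 / 2 : ℝ) ^ (1 / γ) := by
    have h1 : 1 / γ < 1 := (div_lt_one h.index_pos).2 hγ
    have := Real.rpow_lt_rpow_of_exponent_gt (x := 1 / 2) (by norm_num) (by norm_num) h1
    rwa [Real.rpow_one] at this
  have hq0 : (0 : ℝ) < (1 / 2 : ℝ) ^ (1 / γ) := by positivity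
  refine summable_of_ratio_test_tendsto_lt_one (l := 1 / 2 / (1 / 2 : ℝ) ^ (1 / γ))
    ((div_lt_one hq0).2 hq) (Eventually.of_forall fun j => ?_) ?_
  · have := h.scale_pos j
    positivity
  · refine (tendsto_const_nhds.div h.tendsto_ratio hq0.ne').congr fun j => ?_
    have h1 := h.scale_pos j
    have h2 := h.scale_pos (j + 1)
    simp only [Pi.div_apply, norm_mul, norm_pow, Real.norm_of_nonneg h1.le, Real.norm_of_nonneg h2.le, pow_succ]
    rw [Real.norm_of_nonneg (by norm_num : (0 : ℝ) ≤ 1 / 2)]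
    field_simp

/-- Symmetrization removes the uncontrolled drift: -log |φ| = O(2^{-j}) on |s| ≤ 2/α_j, and the
truncation inequality gives P[|X - X'| > α_j] = O(2^{-j}). This is summable against α_j because γ >
1. -/
theorem integrable_id (h : IsScaling (charFun ρ) γ K e α D) (hγ : 1 < γ) : Integrable id ρ := by
  have := Measure.isProbabilityMeasure_map (μ := ρ) (measurable_neg (G := ℝ)).aemeasurable
  apply integrable_of_integrable_conv_neg
  set C := K.re * 2 ^ γ + 1 with hCdef
  have hC : 0 ≤ C := by have := h.re_pos; positivity
  refine integrable_of_scale_tail (C := 4 * C) h.scale_pos h.scale_tendsto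
    (h.summable_scale hγ) ?_
  obtain ⟨r, hr0, hr⟩ : ∃ r, 0 < r ∧ ∀ s, |s| < r → charFun ρ s ≠ 0 := by
    have h1 : ∀ᶠ s in 𝓝 (0 : ℝ), charFun ρ s ≠ 0 :=
      (continuous_charFun (μ := ρ)).continuousAt.eventually_ne (by simp)
    obtain ⟨r, hr, h2⟩ := Metric.eventually_nhds_iff.1 h1
    exact ⟨r, hr, fun s hs => h2 (by rwa [Real.dist_eq, sub_zero])⟩
  have h1 := (h.unifTo_re 2).norm
  rw [norm_zero] at h1
  have h2 := h1.eventually_le_const one_pos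
  rw [eventually_prod_principal_iff] at h2
  filter_upwards [h2, h.scale_tendsto.eventually_gt_atTop (2 / r)] with j hj hjr
  have hαj := h.scale_pos j
  have hnear : ∀ s, 0 ≤ s → s ≤ 2 * (α j)⁻¹ → 1 - ‖charFun ρ s‖ ^ 2 ≤ 2 * C * (1 / 2) ^ j := by
    intro s hs0 hs
    have hsα : s * α j ≤ 2 := by
      calc s * α j ≤ 2 * (α j)⁻¹ * α j := by gcongr
        _ = 2 := by field_simp
    have hsr : |s| < r := by
      rw [abs_of_nonneg hs0]
      refine hs.trans_lt ?_
      rw [← div_eq_mul_inv, div_lt_iff₀ hαj]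
      rw [div_lt_iff₀ hr0] at hjr
      linarith
    have hpos : 0 < ‖charFun ρ s‖ := norm_pos_iff.2 (hr s hsr)
    have h3 := hj (s * α j) ⟨by positivity, hsα⟩
    rw [mul_div_cancel_right₀ _ hαj.ne', ← Complex.ofReal_mul, ← Complex.ofReal_mul,
      ← Complex.ofReal_sub, Complex.norm_real, Real.norm_eq_abs, Complex.neg_re,
      Complex.log_re] at h3
    have h4 := (abs_le.1 h3).2
    have h5 : (s * α j) ^ γ ≤ 2 ^ γ := Real.rpow_le_rpow (by positivity) hsα h.index_pos.le
    have h6 : 2 ^ j * -Real.log ‖charFun ρ s‖ ≤ C := by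
      have := mul_le_mul_of_nonneg_left h5 h.re_pos.le
      linarith
    have h7 : -Real.log ‖charFun ρ s‖ ≤ C * (1 / 2) ^ j := by
      rw [one_div, inv_pow, ← div_eq_mul_inv, le_div_iff₀ (by positivity)]
      linarith
    have h8 := Real.log_le_sub_one_of_pos (x := ‖charFun ρ s‖ ^ 2) (by positivity)
    have h9 := Real.one_sub_inv_le_log_of_pos (x := ‖charFun ρ s‖ ^ 2) (by positivity)
    have h10 := Real.add_one_le_exp (Real.log (‖charFun ρ s‖ ^ 2))
    rw [Real.exp_log (by positivity), Real.log_pow] at h10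
    push_cast at h10
    linarith
  have h3 := measureReal_abs_gt_le_integral_charFun (μ := ρ ∗ ρ.map Neg.neg) hαj
  refine h3.trans ?_
  have h4 : ‖∫ t in (-2 * (α j)⁻¹)..(2 * (α j)⁻¹), 1 - charFun (ρ ∗ ρ.map Neg.neg) t‖ ≤
      2 * C * (1 / 2) ^ j * |2 * (α j)⁻¹ - -2 * (α j)⁻¹| := by
    refine intervalIntegral.norm_integral_le_of_norm_le_const fun t ht => ?_
    have hle : -2 * (α j)⁻¹ ≤ 2 * (α j)⁻¹ := by
      have := inv_pos.2 hαj
      linarith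
    rw [Set.uIoc_of_le hle] at ht
    have hn : ‖charFun ρ t‖ = ‖charFun ρ |t|‖ := by
      rcases abs_cases t with ⟨h5, -⟩ | ⟨h5, -⟩
      · rw [h5]
      · rw [h5, charFun_neg, RCLike.norm_conj]
    rw [charFun_conv_neg, ← Complex.ofReal_one, ← Complex.ofReal_sub, Complex.norm_real, hn,
      Real.norm_of_nonneg]
    · exact hnear _ (abs_nonneg _) (abs_le.2 ⟨by linarith [ht.1], ht.2⟩)
    · have h6 := norm_charFun_le_one (μ := ρ) |t|
      have h7 := norm_nonneg (charFun ρ |t|)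
      nlinarith
  have h5 : |2 * (α j)⁻¹ - -2 * (α j)⁻¹| = 4 * (α j)⁻¹ := by
    rw [abs_of_nonneg (by have := inv_pos.2 hαj; linarith)]; ring
  rw [h5] at h4
  calc _ ≤ 2⁻¹ * α j * (2 * C * (1 / 2) ^ j * (4 * (α j)⁻¹)) :=
        mul_le_mul_of_nonneg_left h4 (by positivity)
    _ = _ := by field_simp

/-- Mean zero makes log φ(s) = o(s), so D_j α_j 2^{-j} → 0. The recursion now expands, with
multiplier tending to 2·2^{-1/γ} > 1, and this decay singles out the solution tending to 0. -/
theorem drift_tendsto_zero_of_mean_zero (h : IsScaling (charFun ρ) γ K e α D) (he : e = 0)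
    (hγ : 1 < γ) (hm : ∫ x, x ∂ρ = 0) : Tendsto D atTop (𝓝 0) := by
  have hq : (1 / 2 : ℝ) < (1 / 2 : ℝ) ^ (1 / γ) := by
    have h1 : 1 / γ < 1 := (div_lt_one h.index_pos).2 hγ
    have := Real.rpow_lt_rpow_of_exponent_gt (x := 1 / 2) (by norm_num) (by norm_num) h1
    rwa [Real.rpow_one] at this
  have hy0 : Tendsto (fun j => α j * (1 / 2) ^ j) atTop (𝓝 0) :=
    (h.summable_scale hγ).tendsto_atTop_zero
  have hlog : Tendsto (fun j => (α j : ℂ) * -Complex.log (charFun ρ (1 / α j))) atTop (𝓝 0) := by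
    have h1 := hasDerivAt_charFun_zero ρ (h.integrable_id hγ)
    rw [hm, Complex.ofReal_zero, mul_zero] at h1
    have h2 := h1.clog_real (by simp)
    rw [zero_div] at h2
    have h3 := hasDerivAt_iff_tendsto_slope_zero.1 h2
    have hs : Tendsto (fun j => 1 / α j) atTop (𝓝[≠] 0) := by
      simp only [one_div]
      exact (tendsto_inv_atTop_nhdsGT_zero.comp h.scale_tendsto).mono_right
        (nhdsWithin_mono _ fun x hx => ne_of_gt hx)
    have h4 := (h3.comp hs).neg
    rw [neg_zero] at h4
    refine h4.congr fun j => ?_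
    simp
  refine eq_zero_tendsto_of_expansion (q := 2 * (1 / 2) ^ (1 / γ)) (y := fun j => α j * (1 / 2) ^ j)
    (x := fun j => 2 * (α j / α (j + 1))) (by linarith) (h.tendsto_ratio.const_mul 2)
    (h.tendsto_drift he) (fun j => by ring) (fun j => ?_) (fun j => ?_) hy0 ?_
  · have := h.scale_pos j
    positivity
  · have := (h.scale_pos (j + 1)).ne'
    rw [pow_succ]
    field_simp
  · have h1 := h.lim.tendsto (t := 1) zero_le_one
    have h2 := (h1.mul ((Complex.continuous_ofReal.tendsto _).comp hy0)).sub hlog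
    rw [Complex.ofReal_zero, mul_zero, sub_zero] at h2
    have h3 := (Complex.continuous_im.tendsto _).comp h2
    rw [Complex.zero_im] at h3
    refine h3.congr fun j => ?_
    have e1 : (2 ^ j * -Complex.log (charFun ρ (1 / α j)) + Complex.I * ((1 * D j : ℝ) : ℂ)) *
        ((α j * (1 / 2) ^ j : ℝ) : ℂ) - α j * -Complex.log (charFun ρ (1 / α j)) =
        Complex.I * ((D j * (α j * (1 / 2) ^ j) : ℝ) : ℂ) := by
      have e2 : (2 : ℂ) ^ j * (1 / 2) ^ j = 1 := by rw [← mul_pow]; norm_num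
      push_cast
      linear_combination (α j * -Complex.log (charFun ρ (1 / α j)) : ℂ) * e2
    simp only [Function.comp_apply, e1, Complex.I_mul_im, Complex.ofReal_re]

end IsScaling

/-- A nonzero mean m dominates: 1 - φ(s) ~ -i m s, whatever the index of attraction. -/
theorem regVar_one_sub_of_mean_ne_zero (ρ : Measure ℝ) [IsProbabilityMeasure ρ]
    (hi : Integrable id ρ) (hm : ∫ x, x ∂ρ ≠ 0) : ∃ u, RegVar (fun s => 1 - charFun ρ s) 1 u := by
  set m := ∫ x, x ∂ρ with hmdef
  refine ⟨_, regVar_of_tendsto_div (g := fun s => s) (w := -(Complex.I * (m : ℂ))) (by simpa using hm)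
    eventually_mem_nhdsWithin ?_ fun t ht => ?_⟩
  · have h1 := (hasDerivAt_iff_tendsto_slope_zero.1 (hasDerivAt_charFun_zero ρ hi)).neg
    refine (h1.mono_left (nhdsWithin_mono _ fun x hx => ne_of_gt hx)).congr fun s => ?_
    rw [zero_add, charFun_zero, probReal_univ, Complex.ofReal_one, ← smul_neg, neg_sub,
      Complex.real_smul, Complex.ofReal_inv, div_eq_inv_mul]
  · rw [Real.rpow_one]
    refine tendsto_const_nhds.congr' ?_
    filter_upwards [eventually_mem_nhdsWithin] with s hs
    rw [mul_div_cancel_right₀ _ (ne_of_gt hs)]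

theorem integrable_of_inDomainOfAttraction {Ω : Type*} [MeasurableSpace Ω] (μ : Measure Ω)
    [IsProbabilityMeasure μ] {X : Ω → ℝ} (hX : Measurable X) {γ : ℝ} (hγ : 1 < γ)
    (h : InDomainOfAttraction μ X γ) : Integrable X μ := by
  have := Measure.isProbabilityMeasure_map hX.aemeasurable (μ := μ)
  obtain ⟨K, e, α, D, hs, -⟩ := exists_isScaling μ hX h
  exact (integrable_map_measure (by fun_prop) hX.aemeasurable).1 (hs.integrable_id hγ)

/-- In the domain of attraction of a stable law of index `γ ≠ 1`, centered if `γ > 1`, the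
function `1 - φ` varies regularly. -/
theorem exists_regVar_of_inDomainOfAttraction {Ω : Type*} [MeasurableSpace Ω] (μ : Measure Ω)
    [IsProbabilityMeasure μ] {X : Ω → ℝ} (hX : Measurable X) {γ : ℝ} (hγ : γ ≠ 1)
    (h : InDomainOfAttraction μ X γ) (hm : 1 < γ → ∫ ω, X ω ∂μ = 0) :
    ∃ u, RegVar (fun s => 1 - charFun (μ.map X) s) γ u ∧ (γ < 1 → |u.arg| ≤ Real.pi * γ / 2) := by
  have := Measure.isProbabilityMeasure_map hX.aemeasurable (μ := μ)
  obtain ⟨K, e, α, D, hs, hKe⟩ := exists_isScaling μ hX h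
  obtain ⟨he, hK⟩ := hKe hγ
  have hγ0 := hs.index_pos
  refine ⟨K / (‖K‖ : ℂ), ?_, fun h1 => ?_⟩
  · rcases lt_or_gt_of_ne hγ with h1 | h1
    · exact hs.regVar_one_sub_of_lt_one he h1
    · refine hs.regVar_one_sub he (hs.drift_tendsto_zero_of_mean_zero he h1 ?_)
      rw [integral_map hX.aemeasurable (by fun_prop)]
      exact hm h1
  · have hπ := Real.pi_pos
    exact abs_arg_normalize_le hs.re_pos (by positivity) (by nlinarith) hK

end LadderCost

/-! ### Assembly of the theorem -/

open LadderCost in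
theorem mainTheorem8 {Ω : Type*} [MeasurableSpace Ω] (μ : Measure Ω) [IsProbabilityMeasure μ]
    (ξ η : ℕ → Ω → ℝ)
    (hξ : ∀ k, Measurable (ξ k)) (hη : ∀ k, Measurable (η k))
    (hindep : iIndepFun (fun k ω => (ξ k ω, η k ω)) μ)
    (hident : ∀ k, IdentDistrib (fun ω => (ξ k ω, η k ω)) (fun ω => (ξ 0 ω, η 0 ω)) μ μ)
    (hsymm : IsSymmetricPair μ ξ η)
    (hnondeg : ¬ ∀ᵐ ω ∂μ, ξ 0 ω = 0) :
    -- the first-ladder time is almost surely finite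
    (∀ᵐ ω ∂μ, ∃ n : ℕ, 0 < n ∧ 0 < partialSum ξ n ω) ∧
    -- the series defining `Φ(1, 0)` converges; `Φ(1, 0) = κ` is a positive real number
    Summable (fun n : ℕ => μ.real {ω | partialSum ξ (n + 1) ω = 0} / (n + 1)) ∧
    ∃ κ : ℝ, 0 < κ ∧ Phi μ ξ η 1 0 = κ ∧
    -- integral formula for walks on `ℤ`, and the value for continuous increments
    ((∀ᵐ ω ∂μ, ∃ m : ℤ, ξ 0 ω = m) →
      IntervalIntegrable (fun t => Complex.log (1 - jointCharFun μ (ξ 0) (η 0) t 0))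
        volume 0 Real.pi ∧
      Phi μ ξ η 1 0 = latticePhi μ ξ η 1 0) ∧
    ((∀ x : ℝ, μ {ω | ξ 0 ω = x} = 0) → κ = 1) ∧
    -- domain of attraction of the first-ladder cost
    (∀ γ : ℝ, 0 < γ → γ < 1 → InDomainOfAttraction μ (η 0) γ →
      InDomainOfAttraction μ (ladderCost ξ η) (γ / 2)) ∧
    (InDomainOfAttraction μ (η 0) 1 →
      (∃ u : ℂ, Tendsto
        (fun s : ℝ => (1 - charFun (μ.map (η 0)) s) / (‖1 - charFun (μ.map (η 0)) s‖ : ℂ))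
        (𝓝[>] 0) (𝓝 u)) →
      InDomainOfAttraction μ (ladderCost ξ η) (1 / 2)) ∧
    (∀ γ : ℝ, 1 < γ → γ ≤ 2 → InDomainOfAttraction μ (η 0) γ →
      Integrable (η 0) μ ∧
      (∫ ω, η 0 ω ∂μ ≠ 0 → InDomainOfAttraction μ (ladderCost ξ η) (1 / 2)) ∧
      (∫ ω, η 0 ω ∂μ = 0 → InDomainOfAttraction μ (ladderCost ξ η) (γ / 2))) ∧
    -- (A)
    (∀ ν : ℝ,
      (fun s : ℝ => charFun (μ.map (η 0)) s - (1 + Complex.I * ν * s)) =o[𝓝[>] 0]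
        (fun s : ℝ => s) →
      (0 < ν →
        InDomainOfAttraction μ (ladderCost ξ η) (1 / 2) ∧
        upperTail μ (ladderCost ξ η) ~[atTop]
          (fun x => √(ν / Real.pi) * κ * x ^ (-(1 / 2) : ℝ)) ∧
        lowerTail μ (ladderCost ξ η) =o[atTop] (fun x : ℝ => x ^ (-(1 / 2) : ℝ))) ∧
      (ν < 0 →
        InDomainOfAttraction μ (ladderCost ξ η) (1 / 2) ∧
        lowerTail μ (ladderCost ξ η) ~[atTop]
          (fun x => √(-ν / Real.pi) * κ * x ^ (-(1 / 2) : ℝ)) ∧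
        upperTail μ (ladderCost ξ η) =o[atTop] (fun x : ℝ => x ^ (-(1 / 2) : ℝ)))) ∧
    -- (B)
    (∀ (γ : ℝ) (c₁ : ℂ), 0 < γ → γ ≤ 1 → 0 < c₁.re →
      (fun s : ℝ => charFun (μ.map (η 0)) s - (1 - c₁ * ((s ^ γ : ℝ) : ℂ))) =o[𝓝[>] 0]
        (fun s : ℝ => s ^ γ) →
      InDomainOfAttraction μ (ladderCost ξ η) (γ / 2) ∧
      0 ≤ pPlus c₁ γ ∧ pPlus c₁ γ ≤ 1 ∧
      TailEquiv (upperTail μ (ladderCost ξ η))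
        (tailConst κ c₁ γ * pPlus c₁ γ / Real.Gamma (1 - γ / 2))
        (fun x => x ^ (-(γ / 2))) ∧
      TailEquiv (lowerTail μ (ladderCost ξ η))
        (tailConst κ c₁ γ * (1 - pPlus c₁ γ) / Real.Gamma (1 - γ / 2))
        (fun x => x ^ (-(γ / 2)))) ∧
    -- (C)
    (∀ c₂ : ℝ,
      (fun s : ℝ => charFun (μ.map (η 0)) s
          - (1 + Complex.I * c₂ * ((s * Real.log (1 / s) : ℝ) : ℂ))) =o[𝓝[>] 0]
        (fun s : ℝ => s * Real.log (1 / s)) →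
      (0 < c₂ →
        InDomainOfAttraction μ (ladderCost ξ η) (1 / 2) ∧
        upperTail μ (ladderCost ξ η) ~[atTop]
          (fun x => √(c₂ * Real.log x / Real.pi) * κ * x ^ (-(1 / 2) : ℝ)) ∧
        lowerTail μ (ladderCost ξ η) =o[atTop]
          (fun x : ℝ => √(Real.log x) / x ^ (1 / 2 : ℝ))) ∧
      (c₂ < 0 →
        InDomainOfAttraction μ (ladderCost ξ η) (1 / 2) ∧
        lowerTail μ (ladderCost ξ η) ~[atTop]
          (fun x => √(-c₂ * Real.log x / Real.pi) * κ * x ^ (-(1 / 2) : ℝ)) ∧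
        upperTail μ (ladderCost ξ η) =o[atTop]
          (fun x : ℝ => √(Real.log x) / x ^ (1 / 2 : ℝ)))) ∧
    -- (D)
    (∀ γ c₃ : ℝ, 1 < γ → γ ≤ 2 → 0 < c₃ →
      (fun s : ℝ => charFun (μ.map (η 0)) s - (1 - c₃ * ((s ^ γ : ℝ) : ℂ))) =o[𝓝[>] 0]
        (fun s : ℝ => s ^ γ) →
      InDomainOfAttraction μ (ladderCost ξ η) (γ / 2) ∧
      (γ < 2 →
        upperTail μ (ladderCost ξ η) ~[atTop]
          (fun x => κ * √c₃ / Real.cos (Real.pi * γ / 4) / (2 * Real.Gamma (1 - γ / 2))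
            * x ^ (-(γ / 2))) ∧
        lowerTail μ (ladderCost ξ η) ~[atTop]
          (fun x => κ * √c₃ / Real.cos (Real.pi * γ / 4) / (2 * Real.Gamma (1 - γ / 2))
            * x ^ (-(γ / 2)))) ∧
      (γ = 2 →
        upperTail μ (ladderCost ξ η) ~[atTop] (fun x => κ * √c₃ / Real.pi * x ^ (-1 : ℝ)) ∧
        lowerTail μ (ladderCost ξ η) ~[atTop] (fun x => κ * √c₃ / Real.pi * x ^ (-1 : ℝ)))) := by
  have hsum := summable_real_partialSum_eq_zero hξ hη hindep hident hsymm hnondeg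
  have hX := measurable_ladderCost hξ hη
  have hf := one_sub_charFun_ladderCost hξ hη hindep hident hsymm hsum
  have hΦ := tendsto_Phi hη hsum
  have hκ : 0 < phiOne μ ξ := Real.exp_pos _
  have hP := Measure.isProbabilityMeasure_map (μ := μ) (hη 0).aemeasurable
  have hφ : ∀ s, ‖charFun (μ.map (η 0)) s‖ ≤ 1 := fun s => norm_charFun_le_one s
  refine ⟨?_, hsum, phiOne μ ξ, hκ, Phi_one_zero μ ξ η,
    lattice_formula hξ hη hindep hident hsymm hnondeg,
    phiOne_eq_one_of_no_atoms hξ hη hindep hident, ?_, ?_, ?_,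
    attraction_and_tails_linear μ hX hf hΦ hκ hφ, ?_, attraction_and_tails_log μ hX hf hΦ hκ hφ, ?_⟩
  · filter_upwards [ae_exists_partialSum_pos hξ hη hindep hident hsymm hsum] with ω hω
    obtain ⟨n, hn⟩ := Set.mem_iUnion.1 hω
    exact ⟨n + 1, n.succ_pos, hn.1⟩
  · intro γ hγ0 hγ h
    obtain ⟨u, hu, harg⟩ := exists_regVar_of_inDomainOfAttraction μ (hη 0) hγ.ne h
      fun h1 => absurd h1 hγ.not_gt
    exact inDomainOfAttraction_of_regVar_sqrt μ hX hf hΦ hκ hφ hγ0 (by linarith) hu harg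
  · rintro h ⟨u, hu⟩
    obtain ⟨K, e, α, D, hs, -⟩ := exists_isScaling μ (hη 0) h
    exact inDomainOfAttraction_of_regVar_sqrt μ hX hf hΦ hκ hφ one_pos one_le_two
      (hs.regVar_one_sub_of_eq_one hu) fun h1 => absurd h1 (lt_irrefl _)
  · intro γ hγ1 hγ2 h
    have hint := integrable_of_inDomainOfAttraction μ (hη 0) hγ1 h
    refine ⟨hint, fun hm => ?_, fun hm => ?_⟩
    -- With nonzero mean, 1 - φ has index 1 instead of γ, which halves to 1/2.
    · obtain ⟨u, hu⟩ := regVar_one_sub_of_mean_ne_zero (μ.map (η 0))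
        ((integrable_map_measure (by fun_prop) (hη 0).aemeasurable).2 hint)
        (by rwa [integral_map (hη 0).aemeasurable (by fun_prop)])
      exact inDomainOfAttraction_of_regVar_sqrt μ hX hf hΦ hκ hφ one_pos one_le_two hu
        fun h1 => absurd h1 (lt_irrefl _)
    · obtain ⟨u, hu, harg⟩ := exists_regVar_of_inDomainOfAttraction μ (hη 0) hγ1.ne' h
        fun _ => hm
      exact inDomainOfAttraction_of_regVar_sqrt μ hX hf hΦ hκ hφ (by linarith) hγ2 hu harg
  · intro γ c₁ hγ0 hγ hc h
    exact attraction_and_tails_of_rpow μ hX hf hΦ hκ hφ hγ0 (by linarith) hc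
      (tendsto_div_of_isLittleO (eventually_rpow_pos γ) h)
  · intro γ c₃ hγ1 hγ2 hc h
    exact attraction_and_tails_real μ hX hf hΦ hκ hφ (by linarith) hγ2 hc h
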